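/- **Spectral data.** Unital complex $*$-algebras $\mathcal A$ act on Hilbert spaces by bounded operators; commutator and (anti)commutation relations with unbounded operators are understood with domains preserved. A set of *$N=1$ spectral data* $(\mathcal A,\mathcal H,D,\gamma)$ is a unital $*$-algebra represented faithfully on a separable Hilbert space $\mathcal H$, a self-adjoint operator $D$ with $[D,a]$ bounded for all $a\in\mathcal A$ and $e^{-\varepsilon D^2}$ trace class for all $\varepsilon>0$, and a grading $\gamma=\gamma^*=\gamma^{-1}$ with $[\gamma,a]=0$, $\{\gamma,D\}=0$. A *real structure* of even $KO$-dimension $n\in\{0,2,4,6\}$ (mod $8$) is an antiunitary $J$ with $J^2=\varepsilon$, $JD=DJ$, $J\gamma=\varepsilon''\gamma J$, where $\varepsilon=+,-,-,+$ and $\varepsilon''=+,-,+,-$ for $n=0,2,4,6$, such that $[JaJ^*,b]=[JaJ^*,[D,b]]=0$ for all $a,b\in\mathcal A$. Put $da=[D,a]$ and $\Omega^1_D(\mathcal A)=\{\sum_j a_j[D,b_j]\}$. A set of *$N=(1,1)$ spectral data* $(\mathcal A,\mathcal H,\mathfrak D,\overline{\mathfrak D},\gamma,\star)$ consists of a unital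 $*$-algebra represented faithfully on a separable Hilbert space, self-adjoint operators $\mathfrak D,\overline{\mathfrak D}$ with $\mathfrak D^2=\overline{\mathfrak D}^2$ and $\mathfrak D\overline{\mathfrak D}=-\overline{\mathfrak D}\mathfrak D$, having bounded commutators with $\mathcal A$ and $e^{-\varepsilon\mathfrak D^2}$ trace class for all $\varepsilon>0$, a grading $\gamma$ commuting with $\mathcal A$ and anticommuting with $\mathfrak D,\overline{\mathfrak D}$, and a self-adjoint unitary $\star$ commuting with $\mathcal A$, $\gamma$ and $\overline{\mathfrak D}$ and anticommuting with $\mathfrak D$. **The extension procedure $\Phi$.** Its input is: $N=1$ spectral data with a real structure $J$ of even $KO$-dimension; a dense subspace $\mathcal E\subseteq\mathcal H$, stable under $\mathcal A$, $J$, $\gamma$ and all $[D,a]$, which is a finitely generated projective left $\mathcal A$-module; a Hermitian structure $\langle\cdot,\cdot\rangle_{\mathcal A}$ on $\mathcal E$ ($\mathcal A$-linear in the first variable, $\langle\xi,\eta\rangle_{\mathcal A}^*=\langle\eta,\xi\rangle_{\mathcal A}$, $\langle\xi,\xi\rangle_{\mathcal A}$ a positive operator, and every $\mathcal A$-linear $\mathcal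 E\to\mathcal A$ equal to $\langle\cdot,\eta\rangle_{\mathcal A}$ for a unique $\eta$); and a connection $\nabla:\mathcal E\to\Omega^1_D(\mathcal A)\otimes_{\mathcal A}\mathcal E$, i.e. a $\mathbb C$-linear map with $\nabla(a\xi)=a\nabla\xi+da\otimes\xi$, which is compatible, $\langle\nabla\xi,\eta\rangle-\langle\xi,\nabla\eta\rangle=d\langle\xi,\eta\rangle_{\mathcal A}$ (where $\langle\omega\otimes\zeta,\eta\rangle=\omega\langle\zeta,\eta\rangle_{\mathcal A}$ and $\langle\xi,\omega\otimes\zeta\rangle=\langle\xi,\zeta\rangle_{\mathcal A}\omega^*$), and satisfies $\nabla\gamma=(1\otimes\gamma)\nabla$. Set $\xi\cdot a=Ja^*J^*\xi$ and $\xi\cdot\omega=J\omega^*J^*\xi$. Let $\widetilde{\mathcal H}$ be the completion of $\mathcal E\otimes_{\mathcal A}\mathcal E$ for $\langle\xi\otimes\eta,\xi'\otimes\eta'\rangle=\langle\eta,(\xi,\xi')_{\mathcal A}\,\eta'\rangle$, where $(\xi,\xi')_{\mathcal A}=\langle J\xi,J\xi'\rangle_{\mathcal A}$ is the Hermitian structure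 of $\mathcal E$ as a right module. Put $\Psi(\omega\otimes\xi)=J\xi\otimes\omega^*$, $\overline\nabla\xi=-\Psi(\nabla J^*\xi)$, $\widetilde\nabla(\xi_1\otimes\xi_2)=\overline\nabla\xi_1\otimes\xi_2+\xi_1\otimes\nabla\xi_2$, $c(\xi_1\otimes\omega\otimes\xi_2)=\xi_1\otimes\omega\xi_2$, $\overline c(\xi_1\otimes\omega\otimes\xi_2)=\xi_1\cdot\omega\otimes\gamma\xi_2$. Then $\Phi$ of the input is $(\mathcal A,\widetilde{\mathcal H},\mathfrak D,\overline{\mathfrak D},\gamma\otimes\gamma,1\otimes\gamma)$, where $\mathcal A$ acts on the first tensor factor and $\mathfrak D,\overline{\mathfrak D}$ are the closures of $c\circ\widetilde\nabla$ and $\overline c\circ\widetilde\nabla$ on $\mathcal E\otimes_{\mathcal A}\mathcal E$. It may or may not be a set of $N=(1,1)$ spectral data. **Products.** The *Kasparov product* of two inputs $X_1,X_2$ is the input over $\mathcal A=\mathcal A_1\otimes\mathcal A_2$ (algebraic tensor product) and $\mathcal H=\mathcal H_1\otimes\mathcal H_2$ with $D=D_1\otimes1+\gamma_1\otimes D_2$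 (closed), $\gamma=\gamma_1\otimes\gamma_2$, $KO$-dimension $n_1+n_2$, $J=J_1\otimes J_2$ if $J_1\gamma_1=\gamma_1J_1$ and $J=J_1\otimes J_2\gamma_2$ if $J_1\gamma_1=-\gamma_1J_1$, $\mathcal E=\mathcal E_1\otimes\mathcal E_2$ (algebraic), $\langle e_1\otimes e_2,f_1\otimes f_2\rangle_{\mathcal A}=\langle e_1,f_1\rangle_{\mathcal A_1}\otimes\langle e_2,f_2\rangle_{\mathcal A_2}$, and $\nabla(e_1\otimes e_2)=\nabla_1e_1\otimes e_2+e_1\otimes\nabla_2e_2$, where one-forms $\omega_1,\omega_2$ of the factors are viewed as $\omega_1\otimes1$, $\gamma_1\otimes\omega_2$ in $\Omega^1_D(\mathcal A)$. The *product* of two sets of $N=(1,1)$ spectral data is $(\mathcal A_1\otimes\mathcal A_2,\mathcal H_1\otimes\mathcal H_2,\mathfrak D,\overline{\mathfrak D},\gamma_1\otimes\gamma_2,\star_1\otimes\star_2)$ with (operators being closed) $$(0)\quad \mathfrak D=\mathfrak D_1\otimes1+\star_1\otimes\mathfrak D_2,\qquad \overline{\mathfrak D}=\overline{\mathfrak D}_1\otimes\star_2+\gamma_1\otimes\overline{\mathfrak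 D}_2 .$$ Five further product rules have the same $\gamma$ and $\star$ and: (1) $\mathfrak D=\mathfrak D_1\otimes1+\star_1\otimes\mathfrak D_2$, $\overline{\mathfrak D}=\overline{\mathfrak D}_1\otimes\gamma_2+\star_1\otimes\overline{\mathfrak D}_2$; (2) $\mathfrak D=\mathfrak D_1\otimes\star_2+1\otimes\mathfrak D_2$, $\overline{\mathfrak D}=\overline{\mathfrak D}_1\otimes\gamma_2+\star_1\otimes\overline{\mathfrak D}_2$; (3) $\mathfrak D=\mathfrak D_1\otimes\star_2+1\otimes\mathfrak D_2$, $\overline{\mathfrak D}=\overline{\mathfrak D}_1\otimes\star_2+\gamma_1\otimes\overline{\mathfrak D}_2$; (4) $\mathfrak D=\mathfrak D_1\otimes1+\gamma_1\otimes\mathfrak D_2$, $\overline{\mathfrak D}=\overline{\mathfrak D}_1\otimes1+\gamma_1\otimes\overline{\mathfrak D}_2$; (5) $\mathfrak D=\mathfrak D_1\otimes\gamma_2+1\otimes\mathfrak D_2$, $\overline{\mathfrak D}=\overline{\mathfrak D}_1\otimes\gamma_2+1\otimes\overline{\mathfrak D}_2$. $\Phi$ of the Kasparov product $X$ is said to *equal*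 a product of $\Phi(X_1)$ and $\Phi(X_2)$ if $(\xi_1\otimes\xi_2)\otimes(\eta_1\otimes\eta_2)\mapsto(\xi_1\otimes\eta_1)\otimes(\xi_2\otimes\eta_2)$ extends to a unitary $\widetilde{\mathcal H}\to\widetilde{\mathcal H}_1\otimes\widetilde{\mathcal H}_2$ which carries one sextuple to the other. $\Phi$ is *multiplicative* for a product rule if, for all inputs $X_1,X_2$ such that $\Phi(X_1),\Phi(X_2)$ are $N=(1,1)$ spectral data, $\Phi$ of their Kasparov product equals the product of $\Phi(X_1)$ and $\Phi(X_2)$ under that rule. **Theorem.** Let $X_1,X_2$ be inputs such that $\Phi(X_1)$ and $\Phi(X_2)$ are $N=(1,1)$ spectral data. Then their Kasparov product $X$ exists, $\Phi(X)$ is again a set of $N=(1,1)$ spectral data, and $\Phi(X)$ equals the product (0) of $\Phi(X_1)$ and $\Phi(X_2)$. If moreover $\mathfrak D_1\neq0$ and $\mathfrak D_2\neq0$, then $\Phi(X)$ does not equal the product of $\Phi(X_1)$ and $\Phi(X_2)$ under any of the rules (1)–(5). Consequently $\Phi$ is multiplicative for exactly one of the six product rules, namely (0). -/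

import Mathlib

open scoped TensorProduct InnerProductSpace
open UniformSpace

universe u

noncomputable section

namespace SpectralData

/-! ### Unbounded operators on a Hilbert space -/

section Operators

variable {H : Type*} [NormedAddCommGroup H] [InnerProductSpace ℂ H]

/-- `[D, B] = T` as an everywhere defined bounded operator: `B` preserves the domain of `D`
and `D B x - B D x = T x` on it. -/
def IsCommutator (D : H →ₗ.[ℂ] H) (B T : H →L[ℂ] H) : Prop :=
  ∀ x y, (x, y) ∈ D.graph → (B x, B y + T x) ∈ D.graph

/-- `B D = D B`, for bounded `B` (used with `B² = 1`). -/
def Commutes (B : H →L[ℂ] H) (D : H →ₗ.[ℂ] H) : Prop :=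
  ∀ x y, (x, y) ∈ D.graph → (B x, B y) ∈ D.graph

/-- `B D = - D B`, for bounded `B` (used with `B² = 1`). -/
def AntiCommutes (B : H →L[ℂ] H) (D : H →ₗ.[ℂ] H) : Prop :=
  ∀ x y, (x, y) ∈ D.graph → (B x, -B y) ∈ D.graph

/-- `x` lies in the natural domain of the composition `S T`, and `S T x = z`. -/
def CompGraph (S T : H →ₗ.[ℂ] H) (x z : H) : Prop :=
  ∃ y, (x, y) ∈ T.graph ∧ (y, z) ∈ S.graph

/-- A `ℤ₂`-grading operator: a self-adjoint unitary. -/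
structure IsGrading [CompleteSpace H] (γ : H →L[ℂ] H) : Prop where
  selfAdjoint : IsSelfAdjoint γ
  sq_eq_one : γ * γ = 1

/-- `T t = exp (-t D²)` for `t > 0`: for every `x`, the curve `t ↦ T t x` is the solution of the
heat equation `u' = - D² u`, `u(0+) = x`. -/
structure IsHeatSemigroup (D : H →ₗ.[ℂ] H) (T : ℝ → H →L[ℂ] H) : Prop where
  initial : ∀ x, Filter.Tendsto (fun t => T t x) (nhdsWithin 0 (Set.Ioi 0)) (nhds x)
  heat : ∀ x, ∀ t > 0, ∃ z, CompGraph D D (T t x) z ∧ HasDerivAt (fun s => T s x) (-z) t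

/-- `T` is of trace class: `Tr |T| < ∞`, computed in a Hilbert basis. -/
def IsTraceClass [CompleteSpace H] (T : H →L[ℂ] H) : Prop :=
  ∃ (w : Set H) (b : HilbertBasis w ℂ H),
    Summable fun i => (⟪b i, CFC.abs T (b i)⟫_ℂ).re

/-- `exp (-ε D²)` is of trace class for all `ε > 0`. -/
def HeatTraceClass [CompleteSpace H] (D : H →ₗ.[ℂ] H) : Prop :=
  ∃ T : ℝ → H →L[ℂ] H, IsHeatSemigroup D T ∧ ∀ ε > 0, IsTraceClass (T ε)

end Operators

/-! ### Tensor products of Hilbert spaces and operators -/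

section HilbertTensor

/-- The Hilbert space tensor product. -/
abbrev HTensor (H₁ H₂ : Type*) [NormedAddCommGroup H₁] [InnerProductSpace ℂ H₁]
    [NormedAddCommGroup H₂] [InnerProductSpace ℂ H₂] : Type _ :=
  Completion (H₁ ⊗[ℂ] H₂)

variable {H₁ H₂ : Type*} [NormedAddCommGroup H₁] [InnerProductSpace ℂ H₁]
  [NormedAddCommGroup H₂] [InnerProductSpace ℂ H₂]

/-- The elementary tensor `x ⊗ y` in the Hilbert space tensor product. -/
def htmul (x : H₁) (y : H₂) : HTensor H₁ H₂ := ((x ⊗ₜ[ℂ] y : H₁ ⊗[ℂ] H₂) : HTensor H₁ H₂)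

/-- The bounded operator `S ⊗ T`. -/
def hmap (S : H₁ →L[ℂ] H₁) (T : H₂ →L[ℂ] H₂) : HTensor H₁ H₂ →L[ℂ] HTensor H₁ H₂ :=
  (TensorProduct.mapL S T).completion

theorem hmap_htmul (S : H₁ →L[ℂ] H₁) (T : H₂ →L[ℂ] H₂) (x : H₁) (y : H₂) :
    hmap S T (htmul x y) = htmul (S x) (T y) := by
  simp [hmap, htmul]

theorem hmap_ext {S T : HTensor H₁ H₂ →L[ℂ] HTensor H₁ H₂}
    (h : ∀ x y, S (htmul x y) = T (htmul x y)) : S = T := by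
  ext z
  induction z using Completion.induction_on with
  | hp => exact isClosed_eq S.continuous T.continuous
  | ih z =>
    induction z using TensorProduct.induction_on with
    | zero => exact (map_zero S).trans (map_zero T).symm
    | tmul x y => exact h x y
    | add a b ha hb =>
      have e : ((a + b : H₁ ⊗[ℂ] H₂) : HTensor H₁ H₂) = a + b := Completion.coe_add _ _
      rw [e, map_add, map_add, ha, hb]

theorem htmul_add_left (x x' : H₁) (y : H₂) : htmul (x + x') y = htmul x y + htmul x' y := by
  rw [htmul, TensorProduct.add_tmul]
  exact Completion.coe_add _ _

theorem htmul_add_right (x : H₁) (y y' : H₂) : htmul x (y + y') = htmul x y + htmul x y' := by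
  rw [htmul, TensorProduct.tmul_add]
  exact Completion.coe_add _ _

theorem htmul_smul_left (c : ℂ) (x : H₁) (y : H₂) : htmul (c • x) y = c • htmul x y := by
  rw [htmul, ← TensorProduct.smul_tmul']
  exact Completion.coe_smul _ _

theorem htmul_smul_right (c : ℂ) (x : H₁) (y : H₂) : htmul x (c • y) = c • htmul x y := by
  rw [htmul, TensorProduct.tmul_smul]
  exact Completion.coe_smul _ _

/-- `(S, T) ↦ S ⊗ T` as a bilinear map. -/
def hmapBilin : (H₁ →L[ℂ] H₁) →ₗ[ℂ] (H₂ →L[ℂ] H₂) →ₗ[ℂ] (HTensor H₁ H₂ →L[ℂ] HTensor H₁ H₂) :=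
  LinearMap.mk₂ ℂ hmap
    (fun S S' T => hmap_ext fun x y => by simp [hmap_htmul, htmul_add_left])
    (fun c S T => hmap_ext fun x y => by simp [hmap_htmul, htmul_smul_left])
    (fun S T T' => hmap_ext fun x y => by simp [hmap_htmul, htmul_add_right])
    (fun c S T => hmap_ext fun x y => by simp [hmap_htmul, htmul_smul_right])

/-- The unbounded operator `D₁ ⊗ B₂ + B₁ ⊗ D₂`: the closure of the operator defined by this
formula on the algebraic tensor product of the domains of `D₁` and `D₂`. -/
def tensorSum (D₁ : H₁ →ₗ.[ℂ] H₁) (B₂ : H₂ →L[ℂ] H₂) (B₁ : H₁ →L[ℂ] H₁) (D₂ : H₂ →ₗ.[ℂ] H₂) :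
    HTensor H₁ H₂ →ₗ.[ℂ] HTensor H₁ H₂ :=
  (Submodule.span ℂ {p : HTensor H₁ H₂ × HTensor H₁ H₂ |
    ∃ x x' y y', (x, x') ∈ D₁.graph ∧ (y, y') ∈ D₂.graph ∧
      p = (htmul x y, htmul x' (B₂ y) + htmul (B₁ x) y')}).toLinearPMap.closure

end HilbertTensor

/-! ### Tensor products over a noncommutative algebra -/

section NCTensor

variable {A M N : Type*} [AddCommGroup M] [Module ℂ M] [AddCommGroup N] [Module ℂ N]

/-- The subspace spanned by the `(m a) ⊗ n - m ⊗ (a n)`. -/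
def balanced (r : A → M →ₗ[ℂ] M) (l : A → N →ₗ[ℂ] N) : Submodule ℂ (M ⊗[ℂ] N) :=
  Submodule.span ℂ {t | ∃ a m n, t = r a m ⊗ₜ[ℂ] n - m ⊗ₜ[ℂ] l a n}

/-- `M ⊗_A N`, where the right action of `a` on `M` is `r a` and the left action on `N` is `l a`. -/
def NCTensor (r : A → M →ₗ[ℂ] M) (l : A → N →ₗ[ℂ] N) : Type _ :=
  (M ⊗[ℂ] N) ⧸ balanced r l

instance (r : A → M →ₗ[ℂ] M) (l : A → N →ₗ[ℂ] N) : AddCommGroup (NCTensor r l) :=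
  inferInstanceAs (AddCommGroup ((M ⊗[ℂ] N) ⧸ balanced r l))

instance (r : A → M →ₗ[ℂ] M) (l : A → N →ₗ[ℂ] N) : Module ℂ (NCTensor r l) :=
  inferInstanceAs (Module ℂ ((M ⊗[ℂ] N) ⧸ balanced r l))

/-- The quotient map `M ⊗ N → M ⊗_A N`. -/
def ncq (r : A → M →ₗ[ℂ] M) (l : A → N →ₗ[ℂ] N) : M ⊗[ℂ] N →ₗ[ℂ] NCTensor r l :=
  (balanced r l).mkQ

variable {r : A → M →ₗ[ℂ] M} {l : A → N →ₗ[ℂ] N}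

variable (r l) in
/-- The elementary tensor `m ⊗ n` in `M ⊗_A N`. -/
def nctmul (m : M) (n : N) : NCTensor r l := ncq r l (m ⊗ₜ[ℂ] n)

theorem nctmul_balanced (a : A) (m : M) (n : N) :
    nctmul r l (r a m) n = nctmul r l m (l a n) := by
  rw [← sub_eq_zero, nctmul, nctmul, ← map_sub]
  refine (Submodule.Quotient.mk_eq_zero (balanced r l)).mpr ?_
  exact Submodule.subset_span ⟨a, m, n, rfl⟩

theorem nctmul_add_left (m m' : M) (n : N) :
    nctmul r l (m + m') n = nctmul r l m n + nctmul r l m' n := by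
  simp only [nctmul, TensorProduct.add_tmul, map_add]

theorem nctmul_add_right (m : M) (n n' : N) :
    nctmul r l m (n + n') = nctmul r l m n + nctmul r l m n' := by
  simp only [nctmul, TensorProduct.tmul_add, map_add]

theorem nctmul_smul_left (c : ℂ) (m : M) (n : N) :
    nctmul r l (c • m) n = c • nctmul r l m n := by
  simp only [nctmul, ← TensorProduct.smul_tmul', map_smul]

theorem nctmul_smul_right (c : ℂ) (m : M) (n : N) :
    nctmul r l m (c • n) = c • nctmul r l m n := by
  simp only [nctmul, TensorProduct.tmul_smul, map_smul]

/-- `(m, n) ↦ m ⊗ n` as a bilinear map. -/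
def ncmk (r : A → M →ₗ[ℂ] M) (l : A → N →ₗ[ℂ] N) : M →ₗ[ℂ] N →ₗ[ℂ] NCTensor r l :=
  LinearMap.mk₂ ℂ (nctmul r l) nctmul_add_left nctmul_smul_left nctmul_add_right
    nctmul_smul_right

/-- The (semi)linear map on `M ⊗_A N` induced by a balanced (semi)bilinear map. -/
def nclift {σ : ℂ →+* ℂ} {P : Type*} [AddCommGroup P] [Module ℂ P]
    (f : M →ₛₗ[σ] N →ₛₗ[σ] P) (h : ∀ a m n, f (r a m) n = f m (l a n)) :
    NCTensor r l →ₛₗ[σ] P :=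
  (balanced r l).liftQ (TensorProduct.lift f) (by
    rw [balanced, Submodule.span_le]
    rintro _ ⟨a, m, n, rfl⟩
    simp [h])

@[simp]
theorem nclift_nctmul {σ : ℂ →+* ℂ} {P : Type*} [AddCommGroup P] [Module ℂ P]
    (f : M →ₛₗ[σ] N →ₛₗ[σ] P) (h : ∀ a m n, f (r a m) n = f m (l a n)) (m : M) (n : N) :
    nclift f h (nctmul r l m n) = f m n := rfl

theorem ncq_surjective : Function.Surjective (ncq r l) := (balanced r l).mkQ_surjective

theorem nctensor_induction {p : NCTensor r l → Prop} (z : NCTensor r l)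
    (tmul : ∀ m n, p (nctmul r l m n)) (add : ∀ x y, p x → p y → p (x + y)) : p z := by
  obtain ⟨t, rfl⟩ := ncq_surjective z
  induction t using TensorProduct.induction_on with
  | zero =>
    have := tmul 0 0
    rwa [nctmul, TensorProduct.zero_tmul] at this
  | tmul m n => exact tmul m n
  | add a b ha hb => rw [map_add]; exact add _ _ ha hb

/-- `f ⊗ g : M ⊗_A N → M' ⊗_A N'` for compatible linear maps. -/
def ncmap {M' N' : Type*} [AddCommGroup M'] [Module ℂ M'] [AddCommGroup N'] [Module ℂ N']
    {r' : A → M' →ₗ[ℂ] M'} {l' : A → N' →ₗ[ℂ] N'} (f : M →ₗ[ℂ] M') (g : N →ₗ[ℂ] N')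
    (hf : ∀ a m, f (r a m) = r' a (f m)) (hg : ∀ a n, g (l a n) = l' a (g n)) :
    NCTensor r l →ₗ[ℂ] NCTensor r' l' :=
  nclift (LinearMap.mk₂ ℂ (fun m n => nctmul r' l' (f m) (g n))
    (fun m m' n => by simp only [map_add, nctmul_add_left])
    (fun c m n => by simp only [map_smul, nctmul_smul_left])
    (fun m n n' => by simp only [map_add, nctmul_add_right])
    (fun c m n => by simp only [map_smul, nctmul_smul_right]))
    (fun a m n => by simp only [LinearMap.mk₂_apply, hf, hg, nctmul_balanced])

@[simp]
theorem ncmap_nctmul {M' N' : Type*} [AddCommGroup M'] [Module ℂ M'] [AddCommGroup N']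
    [Module ℂ N'] {r' : A → M' →ₗ[ℂ] M'} {l' : A → N' →ₗ[ℂ] N'} (f : M →ₗ[ℂ] M')
    (g : N →ₗ[ℂ] N') (hf : ∀ a m, f (r a m) = r' a (f m)) (hg : ∀ a n, g (l a n) = l' a (g n))
    (m : M) (n : N) :
    ncmap f g hf hg (nctmul r l m n) = nctmul r' l' (f m) (g n) := rfl

end NCTensor

/-! ### Positivity of operator matrices -/

section Positivity

/-- A self-adjoint operator `T` is positive if `⟪P y, T P y⟫ ≥ 0` for all polynomials `P` in `T`
and all `y` in a total set. -/
theorem nonneg_of_adjoin {K : Type*} [NormedAddCommGroup K] [InnerProductSpace ℂ K]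
    [CompleteSpace K] (T : K →L[ℂ] K) (hsa : IsSelfAdjoint T) (S : Set K)
    (hS : Submodule.span ℂ S = ⊤)
    (hpos : ∀ P ∈ Algebra.adjoin ℂ {T}, ∀ y ∈ S, 0 ≤ (⟪P y, T (P y)⟫_ℂ).re) (x : K) :
    0 ≤ (⟪x, T x⟫_ℂ).re := by
  have hpos' : ∀ P ∈ StarAlgebra.elemental ℂ T, ∀ y ∈ S, 0 ≤ (⟪P y, T (P y)⟫_ℂ).re := by
    intro P hP y hy
    have hcl : IsClosed {P : K →L[ℂ] K | 0 ≤ (⟪P y, T (P y)⟫_ℂ).re} :=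
      isClosed_le continuous_const (by fun_prop)
    refine hcl.closure_subset_iff.mpr ?_ hP
    intro P hP
    refine hpos P ?_ y hy
    have : P ∈ (StarAlgebra.adjoin ℂ {T}).toSubalgebra := hP
    rw [StarAlgebra.adjoin_toSubalgebra, Set.star_singleton, hsa.star_eq, Set.union_self] at this
    exact this
  have hneg : T⁻ ∈ StarAlgebra.elemental ℂ T := by
    rw [CFC.negPart_def, cfcₙ_eq_cfc, cfc_real_eq_complex _]
    exact cfc_mem_elemental _ T
  have hT0 : 0 ≤ T⁻ := CFC.negPart_nonneg T
  have hker : ∀ y ∈ S, T⁻ y = 0 := by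
    intro y hy
    have h1 := hpos' _ hneg y hy
    have h2 : T * T⁻ = -(T⁻ * T⁻) := by
      have h3 := CFC.posPart_sub_negPart T hsa
      calc T * T⁻ = (T⁺ - T⁻) * T⁻ := by rw [h3]
        _ = -(T⁻ * T⁻) := by rw [sub_mul, CFC.posPart_mul_negPart, zero_sub]
    have h4 : T (T⁻ y) = -(T⁻ (T⁻ y)) := congrArg (fun R : K →L[ℂ] K => R y) h2
    have h5 : CFC.sqrt T⁻ * CFC.sqrt T⁻ = T⁻ := CFC.sqrt_mul_sqrt_self _ hT0
    have h6 : ∀ z, T⁻ z = CFC.sqrt T⁻ (CFC.sqrt T⁻ z) := fun z =>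
      (congrArg (fun R : K →L[ℂ] K => R z) h5).symm
    have h7 : ∀ z w, ⟪z, CFC.sqrt T⁻ w⟫_ℂ = ⟪CFC.sqrt T⁻ z, w⟫_ℂ := fun z w =>
      ((ContinuousLinearMap.isSelfAdjoint_iff_isSymmetric.mp
        (IsSelfAdjoint.of_nonneg (CFC.sqrt_nonneg T⁻))) z w).symm
    have h8 : ∀ z w, ⟪z, T⁻ w⟫_ℂ = ⟪T⁻ z, w⟫_ℂ := fun z w =>
      ((ContinuousLinearMap.isSelfAdjoint_iff_isSymmetric.mp
        (IsSelfAdjoint.of_nonneg hT0)) z w).symm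
    have h9 : CFC.sqrt T⁻ (T⁻ y) = 0 := by
      rw [h4, inner_neg_right, h6 (T⁻ y), h7, Complex.neg_re] at h1
      have h10 := inner_self_eq_norm_sq (𝕜 := ℂ) (CFC.sqrt T⁻ (T⁻ y))
      have h11 : RCLike.re ⟪CFC.sqrt T⁻ (T⁻ y), CFC.sqrt T⁻ (T⁻ y)⟫_ℂ
        = (⟪CFC.sqrt T⁻ (T⁻ y), CFC.sqrt T⁻ (T⁻ y)⟫_ℂ).re := rfl
      have h12 : ‖CFC.sqrt T⁻ (T⁻ y)‖ ^ 2 ≤ 0 := by rw [← h10, h11]; linarith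
      exact norm_eq_zero.mp (pow_eq_zero_iff two_ne_zero |>.mp (le_antisymm h12 (sq_nonneg _)))
    have h13 : ⟪T⁻ y, T⁻ y⟫_ℂ = 0 := by
      rw [← h8, h6 (T⁻ y), h9, map_zero, inner_zero_right]
    exact inner_self_eq_zero.mp h13
  have hzero : T⁻ = 0 := by
    ext1 y
    have hy : y ∈ Submodule.span ℂ S := hS ▸ Submodule.mem_top
    induction hy using Submodule.span_induction with
    | mem y hy => exact hker y hy
    | zero => simp
    | add a b _ _ ha hb => rw [map_add, ha, hb]; simp
    | smul c a _ ha => rw [map_smul, ha]; simp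
  have hfin : 0 ≤ T := by
    rw [← CFC.posPart_sub_negPart T hsa, hzero, sub_zero]
    exact CFC.posPart_nonneg T
  exact ((ContinuousLinearMap.nonneg_iff_isPositive T).mp hfin).re_inner_nonneg_right x

variable {A H : Type*} [Ring A] [StarRing A] [Algebra ℂ A]
  [NormedAddCommGroup H] [InnerProductSpace ℂ H] [CompleteSpace H]

/-- A Hermitian matrix over a `*`-algebra of operators is positive as soon as all the elements
`∑ aᵢ Gᵢⱼ aⱼ*` of the algebra are positive. -/
theorem matrix_nonneg {ι : Type*} [Fintype ι] (rep : A →⋆ₐ[ℂ] (H →L[ℂ] H)) (G : ι → ι → A)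
    (hG : ∀ i j, star (G i j) = G j i)
    (hpos : ∀ a : ι → A, (rep (∑ i, ∑ j, a i * G i j * star (a j))).IsPositive) (x : ι → H) :
    0 ≤ (∑ i, ∑ j, ⟪x i, rep (G i j) (x j)⟫_ℂ).re := by
  classical
  let e := PiLp.continuousLinearEquiv 2 ℂ (fun _ : ι => H)
  let T : PiLp 2 (fun _ : ι => H) →L[ℂ] PiLp 2 (fun _ : ι => H) :=
    e.symm.toContinuousLinearMap ∘L
    (ContinuousLinearMap.pi fun i => ∑ j, rep (G i j) ∘L ContinuousLinearMap.proj j) ∘L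
      e.toContinuousLinearMap
  have hT : ∀ (y : PiLp 2 (fun _ : ι => H)) i, (T y) i = ∑ j, rep (G i j) (y j) := by
    intro y i
    change (∑ j, rep (G i j) ∘L ContinuousLinearMap.proj j) (e y) = _
    simp only [_root_.sum_apply, ContinuousLinearMap.comp_apply]
    rfl
  have inner_T : ∀ y z : PiLp 2 (fun _ : ι => H),
      ⟪y, T z⟫_ℂ = ∑ i, ∑ j, ⟪y i, rep (G i j) (z j)⟫_ℂ := by
    intro y z
    rw [PiLp.inner_apply]
    simp only [hT, inner_sum]
  have adj : ∀ i j (v w : H), ⟪rep (G i j) v, w⟫_ℂ = ⟪v, rep (G j i) w⟫_ℂ := by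
    intro i j v w
    rw [← hG i j, map_star, ContinuousLinearMap.star_eq_adjoint,
      ContinuousLinearMap.adjoint_inner_right]
  have hsa : IsSelfAdjoint T := by
    rw [ContinuousLinearMap.isSelfAdjoint_iff_isSymmetric]
    intro y z
    change ⟪T y, z⟫_ℂ = ⟪y, T z⟫_ℂ
    rw [inner_T, PiLp.inner_apply]
    simp only [hT, sum_inner, adj]
    exact Finset.sum_comm
  have single_apply : ∀ (r : ι) (v : H) (i : ι),
      (PiLp.single 2 r v : PiLp 2 (fun _ : ι => H)) i = if i = r then v else 0 := by
    intro r v i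
    by_cases h : i = r
    · subst h; simp
    · simp [h]
  have sum_single : ∀ y : PiLp 2 (fun _ : ι => H), y = ∑ i, PiLp.single 2 i (y i) := by
    intro y
    ext i
    simp [WithLp.ofLp_sum, Finset.sum_apply]
  have hQ : ∀ P ∈ Algebra.adjoin ℂ {T}, ∀ r, ∃ a : ι → A, ∀ v i,
      (P (PiLp.single 2 r v)) i = rep (a i) v := by
    intro P hP
    induction hP using Algebra.adjoin_induction with
    | mem P h =>
      rw [Set.mem_singleton_iff] at h
      subst h
      refine fun r => ⟨fun i => G i r, fun v i => ?_⟩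
      rw [hT, Finset.sum_eq_single r]
      · simp
      · intro j _ hj
        simp [hj]
      · simp
    | algebraMap c =>
      refine fun r => ⟨fun i => algebraMap ℂ A (if i = r then c else 0), fun v i => ?_⟩
      have : rep (algebraMap ℂ A (if i = r then c else 0))
        = algebraMap ℂ _ (if i = r then c else 0) := AlgHomClass.commutes rep _
      rw [this]
      by_cases h : i = r
      · subst h; simp [Algebra.algebraMap_eq_smul_one]
      · simp [Algebra.algebraMap_eq_smul_one, h]
    | add P P' hP hP' h h' =>
      intro r
      obtain ⟨a, ha⟩ := h r
      obtain ⟨b, hb⟩ := h' r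
      exact ⟨fun i => a i + b i, fun v i => by simp [ha, hb]⟩
    | mul P P' hP hP' h h' =>
      intro r
      obtain ⟨b, hb⟩ := h' r
      choose a ha using h
      refine ⟨fun i => ∑ k, a k i * b k, fun v i => ?_⟩
      change (P (P' (PiLp.single 2 r v))) i = _
      rw [sum_single (P' (PiLp.single 2 r v)), map_sum]
      simp only [WithLp.ofLp_sum, Finset.sum_apply, ha, hb, map_sum, map_mul,
        _root_.sum_apply]
      rfl
  have key := nonneg_of_adjoin T hsa
    {y | ∃ r v, y = PiLp.single 2 r v} (by
      rw [eq_top_iff]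
      intro y _
      rw [sum_single y]
      exact Submodule.sum_mem _ fun i _ => Submodule.subset_span ⟨i, y i, rfl⟩) (by
      rintro P hP _ ⟨r, v, rfl⟩
      obtain ⟨a, ha⟩ := hQ P hP r
      have h1 := (hpos fun i => star (a i)).re_inner_nonneg_right v
      rw [inner_T]
      have h2 : ∀ i j, ⟪v, rep (star (a i) * G i j * star (star (a j))) v⟫_ℂ
          = ⟪rep (a i) v, rep (G i j) (rep (a j) v)⟫_ℂ := by
        intro i j
        rw [star_star, map_mul, map_mul, map_star, ContinuousLinearMap.star_eq_adjoint]
        exact ContinuousLinearMap.adjoint_inner_right _ _ _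
      simp only [map_sum, _root_.sum_apply, inner_sum, h2] at h1
      simp only [ha, Complex.re_sum]
      exact h1) (WithLp.toLp 2 x)
  rw [inner_T] at key
  exact key

end Positivity

/-! ### `N = 1` spectral data with real structure -/

/-- `N = 1` spectral data `(A, H, D, γ)`. -/
structure N1Data (A H : Type u) [Ring A] [StarRing A] [Algebra ℂ A] [StarModule ℂ A]
    [NormedAddCommGroup H] [InnerProductSpace ℂ H] [CompleteSpace H] where
  /-- The representation of `A` on `H`. -/
  rep : A →⋆ₐ[ℂ] (H →L[ℂ] H)
  /-- The Dirac operator. -/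
  D : H →ₗ.[ℂ] H
  /-- The grading operator. -/
  γ : H →L[ℂ] H
  separable : TopologicalSpace.SeparableSpace H
  faithful : Function.Injective rep
  selfAdjoint : IsSelfAdjoint D
  bounded_commutator : ∀ a, ∃ T, IsCommutator D (rep a) T
  theta_summable : HeatTraceClass D
  grading : IsGrading γ
  γ_rep : ∀ a, γ * rep a = rep a * γ
  γ_D : AntiCommutes γ D

/-- The sign in `J² = ε`, for `KO`-dimension `2 k` modulo `8`. -/
def eps : Fin 4 → ℤ := ![1, -1, -1, 1]

/-- The sign in `J γ = ε'' γ J`, for `KO`-dimension `2 k` modulo `8`. -/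
def epsGamma : Fin 4 → ℤ := ![1, -1, 1, -1]

section Defs

variable {A H : Type u} [Ring A] [StarRing A] [Algebra ℂ A] [StarModule ℂ A]
  [NormedAddCommGroup H] [InnerProductSpace ℂ H] [CompleteSpace H]

namespace N1Data

variable (X : N1Data A H)

/-- `d a = [D, a]`, as a bounded operator. -/
def d (a : A) : H →L[ℂ] H := Classical.choose (X.bounded_commutator a)

theorem d_spec (a : A) : IsCommutator X.D (X.rep a) (X.d a) :=
  Classical.choose_spec (X.bounded_commutator a)

theorem commutator_unique {B S T : H →L[ℂ] H} (hS : IsCommutator X.D B S)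
    (hT : IsCommutator X.D B T) : S = T := by
  refine ContinuousLinearMap.coeFn_injective (Continuous.ext_on X.selfAdjoint.dense_domain
    S.continuous T.continuous fun x hx => ?_)
  obtain ⟨y, hy⟩ := LinearPMap.mem_domain_iff.mp hx
  have h := X.D.graph.sub_mem (hS x y hy) (hT x y hy)
  rw [Prod.mk_sub_mk, sub_self, add_sub_add_left_eq_sub] at h
  exact sub_eq_zero.mp (LinearPMap.graph_fst_eq_zero_snd X.D h rfl)

theorem d_mul (a b : A) : X.d (a * b) = X.d a * X.rep b + X.rep a * X.d b := by
  refine X.commutator_unique (X.d_spec (a * b)) fun x y h => ?_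
  have e : X.rep (a * b) y + (X.d a * X.rep b + X.rep a * X.d b) x =
      X.rep a (X.rep b y + X.d b x) + X.d a (X.rep b x) := by
    rw [map_mul, map_add]
    change X.rep a (X.rep b y) + (X.d a (X.rep b x) + X.rep a (X.d b x)) = _
    abel
  rw [e, map_mul]
  exact X.d_spec a _ _ (X.d_spec b x y h)

theorem D_symmetric {x y z w : H} (h : (x, y) ∈ X.D.graph) (h' : (z, w) ∈ X.D.graph) :
    ⟪y, z⟫_ℂ = ⟪x, w⟫_ℂ := by
  have hs := LinearPMap.adjoint_isFormalAdjoint (T := X.D) X.selfAdjoint.dense_domain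
  rw [LinearPMap.isSelfAdjoint_def.mp X.selfAdjoint] at hs
  rw [LinearPMap.mem_graph_iff] at h h'
  obtain ⟨x', rfl, rfl⟩ := h
  obtain ⟨z', rfl, rfl⟩ := h'
  exact hs x' z'

theorem star_d (a : A) : star (X.d a) = -X.d (star a) := by
  rw [ContinuousLinearMap.star_eq_adjoint, eq_comm, ContinuousLinearMap.eq_adjoint_iff]
  have hd : Dense (X.D.domain : Set H) := X.selfAdjoint.dense_domain
  intro x y
  refine congrFun (Continuous.ext_on hd (f := fun x => ⟪(-X.d (star a)) x, y⟫_ℂ)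
    (g := fun x => ⟪x, X.d a y⟫_ℂ) (by fun_prop) (by fun_prop) fun x hx => ?_) x
  refine congrFun (Continuous.ext_on hd (f := fun y => ⟪(-X.d (star a)) x, y⟫_ℂ)
    (g := fun y => ⟪x, X.d a y⟫_ℂ) (by fun_prop) (by fun_prop) fun y hy => ?_) y
  obtain ⟨x', hx'⟩ := LinearPMap.mem_domain_iff.mp hx
  obtain ⟨y', hy'⟩ := LinearPMap.mem_domain_iff.mp hy
  have adj : ∀ u v : H, ⟪X.rep (star a) u, v⟫_ℂ = ⟪u, X.rep a v⟫_ℂ := fun u v => by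
    rw [map_star, ContinuousLinearMap.star_eq_adjoint, ContinuousLinearMap.adjoint_inner_left]
  have h1 := X.D_symmetric (X.d_spec (star a) x x' hx') hy'
  have h2 := X.D_symmetric hx' (X.d_spec a y y' hy')
  rw [inner_add_left, adj, adj] at h1
  rw [inner_add_right] at h2
  simp only [_root_.neg_apply, inner_neg_left]
  linear_combination h2 - h1

/-- The space `Ω¹_D(A)` of noncommutative one-forms `∑ aⱼ [D, bⱼ]`. -/
def Omega : Submodule ℂ (H →L[ℂ] H) :=
  Submodule.span ℂ {ω | ∃ a b, ω = X.rep a * X.d b}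

theorem d_mem (a : A) : X.d a ∈ X.Omega :=
  Submodule.subset_span ⟨1, a, by rw [map_one, one_mul]⟩

theorem rep_mul_mem (a : A) {ω : H →L[ℂ] H} (hω : ω ∈ X.Omega) : X.rep a * ω ∈ X.Omega := by
  induction hω using Submodule.span_induction with
  | mem ω h =>
    obtain ⟨b, c, rfl⟩ := h
    exact Submodule.subset_span ⟨a * b, c, by rw [map_mul, mul_assoc]⟩
  | zero => rw [mul_zero]; exact zero_mem _
  | add x y _ _ hx hy => rw [mul_add]; exact add_mem hx hy
  | smul c x _ hx => rw [mul_smul_comm]; exact Submodule.smul_mem _ _ hx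

theorem mul_rep_mem (a : A) {ω : H →L[ℂ] H} (hω : ω ∈ X.Omega) : ω * X.rep a ∈ X.Omega := by
  induction hω using Submodule.span_induction with
  | mem ω h =>
    obtain ⟨b, c, rfl⟩ := h
    have : X.rep b * X.d c * X.rep a = X.rep b * X.d (c * a) - X.rep (b * c) * X.d a := by
      rw [d_mul, map_mul]
      noncomm_ring
    rw [this]
    exact sub_mem (Submodule.subset_span ⟨_, _, rfl⟩) (Submodule.subset_span ⟨_, _, rfl⟩)
  | zero => rw [zero_mul]; exact zero_mem _
  | add x y _ _ hx hy => rw [add_mul]; exact add_mem hx hy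
  | smul c x _ hx => rw [smul_mul_assoc]; exact Submodule.smul_mem _ _ hx

theorem star_mem {ω : H →L[ℂ] H} (hω : ω ∈ X.Omega) : star ω ∈ X.Omega := by
  induction hω using Submodule.span_induction with
  | mem ω h =>
    obtain ⟨b, c, rfl⟩ := h
    rw [star_mul, star_d, neg_mul, ← map_star]
    exact neg_mem (X.mul_rep_mem _ (X.d_mem _))
  | zero => rw [star_zero]; exact zero_mem _
  | add x y _ _ hx hy => rw [star_add]; exact add_mem hx hy
  | smul c x _ hx => rw [star_smul]; exact Submodule.smul_mem _ _ hx

/-- The left action of `A` on one-forms. -/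
def omegaLeft (a : A) : X.Omega →ₗ[ℂ] X.Omega where
  toFun ω := ⟨X.rep a * ω, X.rep_mul_mem a ω.2⟩
  map_add' _ _ := Subtype.ext (mul_add _ _ _)
  map_smul' _ _ := Subtype.ext (mul_smul_comm _ _ _)

/-- The right action of `A` on one-forms. -/
def omegaRight (a : A) : X.Omega →ₗ[ℂ] X.Omega where
  toFun ω := ⟨ω * X.rep a, X.mul_rep_mem a ω.2⟩
  map_add' _ _ := Subtype.ext (add_mul _ _ _)
  map_smul' _ _ := Subtype.ext (smul_mul_assoc _ _ _)

/-- The involution on one-forms. -/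
def omegaStar (ω : X.Omega) : X.Omega := ⟨star (ω : H →L[ℂ] H), X.star_mem ω.2⟩

end N1Data

end Defs

/-- `N = 1` spectral data with a real structure `J` of even `KO`-dimension `2 ko` modulo `8`
(where `J D = ε' D J` with `ε' = 1`). -/
structure RealN1Data (A H : Type u) [Ring A] [StarRing A] [Algebra ℂ A] [StarModule ℂ A]
    [NormedAddCommGroup H] [InnerProductSpace ℂ H] [CompleteSpace H] extends N1Data A H where
  /-- The real structure. -/
  J : H ≃ₗᵢ⋆[ℂ] H
  /-- Half of the `KO`-dimension. -/
  ko : Fin 4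
  J_J : ∀ x, J (J x) = eps ko • x
  J_D : ∀ x y, (x, y) ∈ D.graph → (J x, J y) ∈ D.graph
  J_γ : ∀ x, J (γ x) = epsGamma ko • γ (J x)
  order_zero : ∀ a b x, J (rep a (J.symm (rep b x))) = rep b (J (rep a (J.symm x)))
  order_one : ∀ a b x,
    J (rep a (J.symm (toN1Data.d b x))) = toN1Data.d b (J (rep a (J.symm x)))

/-- The left `A`-module structure of a subspace that is stable under the representation. -/
@[reducible]
def repModule {A H : Type u} [Ring A] [StarRing A] [Algebra ℂ A]
    [NormedAddCommGroup H] [InnerProductSpace ℂ H] [CompleteSpace H]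
    (rep : A →⋆ₐ[ℂ] (H →L[ℂ] H)) (E : Submodule ℂ H) (h : ∀ a, ∀ x ∈ E, rep a x ∈ E) :
    Module A E where
  smul a x := ⟨rep a x, h a x x.2⟩
  one_smul x := Subtype.ext (by change rep 1 (x : H) = x; rw [map_one]; rfl)
  mul_smul a b x := Subtype.ext (by
    change rep (a * b) (x : H) = rep a (rep b x); rw [map_mul]; rfl)
  smul_zero a := Subtype.ext (map_zero (rep a))
  smul_add a x y := Subtype.ext (map_add (rep a) (x : H) y)
  add_smul a b x := Subtype.ext (by
    change rep (a + b) (x : H) = rep a x + rep b x; rw [map_add]; rfl)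
  zero_smul x := Subtype.ext (by change rep 0 (x : H) = 0; rw [map_zero]; rfl)

/-- Real `N = 1` spectral data together with a dense subspace `E` of `H` which is stable under
`A`, `J`, `γ` and the one-forms, and is a finitely generated projective left `A`-module. -/
structure ModuleData (A H : Type u) [Ring A] [StarRing A] [Algebra ℂ A] [StarModule ℂ A]
    [NormedAddCommGroup H] [InnerProductSpace ℂ H] [CompleteSpace H] extends RealN1Data A H where
  /-- The dense module. -/
  E : Submodule ℂ H
  dense_E : Dense (E : Set H)
  rep_mem : ∀ a, ∀ x ∈ E, rep a x ∈ E
  J_mem : ∀ x ∈ E, J x ∈ E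
  γ_mem : ∀ x ∈ E, γ x ∈ E
  d_mem_E : ∀ a, ∀ x ∈ E, toN1Data.d a x ∈ E
  finite_projective :
    letI : Module A E := repModule toN1Data.rep E rep_mem
    Module.Finite A E ∧ Module.Projective A E

section Defs

variable {A H : Type u} [Ring A] [StarRing A] [Algebra ℂ A] [StarModule ℂ A]
  [NormedAddCommGroup H] [InnerProductSpace ℂ H] [CompleteSpace H]

namespace ModuleData

variable (X : ModuleData A H)

theorem eps_mul_self (k : Fin 4) : eps k * eps k = 1 := by
  fin_cases k <;> rfl

theorem J_symm_eq (x : H) : X.J.symm x = eps X.ko • X.J x := by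
  rw [LinearIsometryEquiv.symm_apply_eq, map_zsmul, X.J_J, smul_smul, eps_mul_self, one_smul]

theorem J_symm_mem {x : H} (hx : x ∈ X.E) : X.J.symm x ∈ X.E := by
  rw [J_symm_eq]
  exact X.E.toAddSubgroup.zsmul_mem (X.J_mem x hx) _

theorem omega_mem {ω : H →L[ℂ] H} (hω : ω ∈ X.Omega) {x : H} (hx : x ∈ X.E) : ω x ∈ X.E := by
  induction hω using Submodule.span_induction with
  | mem ω h =>
    obtain ⟨a, b, rfl⟩ := h
    exact X.rep_mem a _ (X.d_mem_E b x hx)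
  | zero => exact zero_mem _
  | add S T _ _ hS hT => exact add_mem hS hT
  | smul c S _ hS => exact Submodule.smul_mem _ _ hS

/-- The left action of `A` on `E`. -/
def left (a : A) : X.E →ₗ[ℂ] X.E where
  toFun x := ⟨X.rep a x, X.rep_mem a x x.2⟩
  map_add' x y := Subtype.ext (map_add (X.rep a) (x : H) y)
  map_smul' c x := Subtype.ext (map_smul (X.rep a) c (x : H))

/-- The right action of `A` on `E`: `ξ · a = J a* J* ξ`. -/
def right (a : A) : X.E →ₗ[ℂ] X.E where
  toFun x := ⟨X.J (X.rep (star a) (X.J.symm x)),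
    X.J_mem _ (X.rep_mem _ _ (X.J_symm_mem x.2))⟩
  map_add' x y := Subtype.ext (by simp)
  map_smul' c x := Subtype.ext (by
    change X.J (X.rep (star a) (X.J.symm (c • (x : H)))) =
      c • X.J (X.rep (star a) (X.J.symm (x : H)))
    rw [X.J.symm.map_smulₛₗ, map_smul, X.J.map_smulₛₗ]
    exact congrArg (· • _) (Complex.conj_conj c))

/-- The real structure on `E`. -/
def JE : X.E →ₗ⋆[ℂ] X.E where
  toFun x := ⟨X.J x, X.J_mem x x.2⟩
  map_add' x y := Subtype.ext (map_add X.J (x : H) y)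
  map_smul' c x := Subtype.ext (X.J.map_smulₛₗ c (x : H))

/-- The inverse (that is, adjoint) of the real structure on `E`. -/
def JEsymm : X.E →ₗ⋆[ℂ] X.E where
  toFun x := ⟨X.J.symm x, X.J_symm_mem x.2⟩
  map_add' x y := Subtype.ext (map_add X.J.symm (x : H) y)
  map_smul' c x := Subtype.ext (X.J.symm.map_smulₛₗ c (x : H))

/-- The grading on `E`. -/
def γE : X.E →ₗ[ℂ] X.E where
  toFun x := ⟨X.γ x, X.γ_mem x x.2⟩
  map_add' x y := Subtype.ext (map_add X.γ (x : H) y)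
  map_smul' c x := Subtype.ext (map_smul X.γ c (x : H))

/-- The left action `ω · ξ` of one-forms on `E`. -/
def omegaAct : X.Omega →ₗ[ℂ] X.E →ₗ[ℂ] X.E :=
  LinearMap.mk₂ ℂ (fun ω x => ⟨(ω : H →L[ℂ] H) x, X.omega_mem ω.2 x.2⟩)
    (fun _ _ _ => rfl) (fun _ _ _ => rfl)
    (fun ω x y => Subtype.ext (map_add (ω : H →L[ℂ] H) (x : H) y))
    (fun c ω x => Subtype.ext (map_smul (ω : H →L[ℂ] H) c (x : H)))

/-- The right action `ξ · ω = J ω* J* ξ` of one-forms on `E`. -/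
def omegaActRight : X.E →ₗ[ℂ] X.Omega →ₗ[ℂ] X.E :=
  LinearMap.mk₂ ℂ (fun x ω => X.JE (X.omegaAct (X.omegaStar ω) (X.JEsymm x)))
    (fun x y ω => by simp only [map_add])
    (fun c x ω => by simp only [LinearMap.map_smulₛₗ, RingHomCompTriple.comp_apply,
      RingHom.id_apply])
    (fun x ω η => by
      have : X.omegaStar (ω + η) = X.omegaStar ω + X.omegaStar η := Subtype.ext (star_add _ _)
      simp only [this, map_add, LinearMap.add_apply])
    (fun c x ω => by
      have : X.omegaStar (c • ω) = star c • X.omegaStar ω := Subtype.ext (star_smul _ _)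
      simp only [this, LinearMap.map_smulₛₗ, LinearMap.smul_apply, RingHom.id_apply]
      simp)

/-- `E ⊗_A E`. -/
abbrev EE : Type u := NCTensor X.right X.left

/-- `Ω¹_D(A) ⊗_A E`. -/
abbrev OmegaE : Type u := NCTensor X.omegaRight X.left

/-- `E ⊗_A Ω¹_D(A)`. -/
abbrev EOmega : Type u := NCTensor X.right X.omegaLeft

end ModuleData

end Defs

/-- Real `N = 1` spectral data with a dense Hermitian f.g.p. module: `herm` is the `A`-valued
Hermitian structure on the left `A`-module `E`. -/
structure HermitianData (A H : Type u) [Ring A] [StarRing A] [Algebra ℂ A] [StarModule ℂ A]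
    [NormedAddCommGroup H] [InnerProductSpace ℂ H] [CompleteSpace H] extends ModuleData A H where
  /-- The Hermitian structure, linear in the first and antilinear in the second variable. -/
  herm : E →ₗ[ℂ] E →ₗ⋆[ℂ] A
  herm_left : ∀ a ξ η, herm (toModuleData.left a ξ) η = a * herm ξ η
  herm_symm : ∀ ξ η, star (herm ξ η) = herm η ξ
  herm_nonneg : ∀ ξ, (rep (herm ξ ξ)).IsPositive
  /-- Self-duality: every `A`-linear functional is `⟨·, η⟩` for a unique `η`. -/
  herm_dual : ∀ φ : E →ₗ[ℂ] A, (∀ a ξ, φ (toModuleData.left a ξ) = a * φ ξ) →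
    ∃! η, ∀ ξ, φ ξ = herm ξ η

section Defs

variable {A H : Type u} [Ring A] [StarRing A] [Algebra ℂ A] [StarModule ℂ A]
  [NormedAddCommGroup H] [InnerProductSpace ℂ H] [CompleteSpace H]

namespace HermitianData

variable (X : HermitianData A H)

theorem herm_right (a : A) (ξ η : X.E) : X.herm ξ (X.left a η) = X.herm ξ η * star a := by
  rw [← X.herm_symm, X.herm_left, star_mul, X.herm_symm]

theorem JE_right (a : A) (ξ : X.E) : X.JE (X.right a ξ) = X.left (star a) (X.JE ξ) := by
  apply Subtype.ext
  change X.J (X.J (X.rep (star a) (X.J.symm ξ))) = X.rep (star a) (X.J ξ)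
  rw [X.J_J, X.J_symm_eq, map_zsmul, smul_smul, ModuleData.eps_mul_self, one_smul]

/-- The inner product of elementary tensors of `E ⊗_A E`,
`⟨ξ ⊗ η, ξ' ⊗ η'⟩ = ⟨η, ⟨ξ, ξ'⟩_A η'⟩`. In the first tensor factor `E` is a right module, with the
right Hermitian structure corresponding to `herm` under `J`, i.e. `⟨ξ, ξ'⟩_A = herm (J ξ) (J ξ')`,
which satisfies `⟨ξ · a, ξ' · b⟩_A = a* ⟨ξ, ξ'⟩_A b`. -/
def formAux (ξ η ξ' η' : X.E) : ℂ :=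
  ⟪(η : H), X.rep (X.herm (X.JE ξ) (X.JE ξ')) (η' : H)⟫_ℂ

/-- The inner product of `E ⊗_A E` with first variable an elementary tensor. -/
def formRight (ξ η : X.E) : X.EE →ₗ[ℂ] ℂ :=
  nclift (LinearMap.mk₂ ℂ (X.formAux ξ η)
    (fun a b c => by
      simp only [formAux, map_add, _root_.add_apply, inner_add_right])
    (fun k a b => by
      simp only [formAux, LinearMap.map_smulₛₗ, map_smul, RingHomCompTriple.comp_apply,
        RingHom.id_apply, _root_.smul_apply, inner_smul_right, smul_eq_mul])
    (fun a b c => by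
      simp only [formAux, Submodule.coe_add, map_add, inner_add_right])
    (fun k a b => by
      simp only [formAux, Submodule.coe_smul, map_smul, inner_smul_right, smul_eq_mul]))
    (fun a ξ' η' => by
      change ⟪(η : H), X.rep (X.herm (X.JE ξ) (X.JE (X.right a ξ'))) (η' : H)⟫_ℂ =
        ⟪(η : H), X.rep (X.herm (X.JE ξ) (X.JE ξ')) (X.rep a (η' : H))⟫_ℂ
      rw [JE_right, herm_right, star_star, map_mul, mul_apply_eq_comp])

theorem formRight_nctmul (ξ η ξ' η' : X.E) :
    X.formRight ξ η (nctmul X.right X.left ξ' η') =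
      ⟪(η : H), X.rep (X.herm (X.JE ξ) (X.JE ξ')) (η' : H)⟫_ℂ := rfl

theorem ee_ext {f g : X.EE →ₗ[ℂ] ℂ}
    (h : ∀ ξ η, f (nctmul X.right X.left ξ η) = g (nctmul X.right X.left ξ η)) : f = g :=
  LinearMap.ext fun z => by
    induction z using nctensor_induction with
    | tmul ξ η => exact h ξ η
    | add x y hx hy => rw [map_add f, map_add g, hx, hy]

theorem formRight_add_left (a b c : X.E) :
    X.formRight (a + b) c = X.formRight a c + X.formRight b c :=
  X.ee_ext fun ξ η => by
    simp only [formRight_nctmul, LinearMap.add_apply, map_add, _root_.add_apply, inner_add_right]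

theorem formRight_smul_left (k : ℂ) (a c : X.E) :
    X.formRight (k • a) c = starRingEnd ℂ k • X.formRight a c :=
  X.ee_ext fun ξ η => by
    simp only [formRight_nctmul, LinearMap.smul_apply, LinearMap.map_smulₛₗ, map_smul,
      _root_.smul_apply, inner_smul_right, smul_eq_mul]

theorem formRight_add_right (a b c : X.E) :
    X.formRight a (b + c) = X.formRight a b + X.formRight a c :=
  X.ee_ext fun ξ η => by
    simp only [formRight_nctmul, LinearMap.add_apply, Submodule.coe_add, inner_add_left]

theorem formRight_smul_right (k : ℂ) (a c : X.E) :
    X.formRight a (k • c) = starRingEnd ℂ k • X.formRight a c :=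
  X.ee_ext fun ξ η => by
    simp only [formRight_nctmul, LinearMap.smul_apply, Submodule.coe_smul, inner_smul_left,
      smul_eq_mul]

theorem formRight_balanced (a : A) (ξ η : X.E) :
    X.formRight (X.right a ξ) η = X.formRight ξ (X.left a η) :=
  X.ee_ext fun ξ' η' => by
    rw [formRight_nctmul, formRight_nctmul, JE_right, X.herm_left, map_mul, map_star,
      ContinuousLinearMap.star_eq_adjoint, mul_apply_eq_comp,
      ContinuousLinearMap.adjoint_inner_right]
    rfl

/-- `(ξ, η) ↦ ⟨ξ ⊗ η, ·⟩` as a sesquilinear map. -/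
def formPre : X.E →ₗ⋆[ℂ] X.E →ₗ⋆[ℂ] (X.EE →ₗ[ℂ] ℂ) :=
  LinearMap.mk₂'ₛₗ (starRingEnd ℂ) (starRingEnd ℂ) X.formRight
    X.formRight_add_left X.formRight_smul_left X.formRight_add_right X.formRight_smul_right

/-- The inner product of `E ⊗_A E`. -/
def form : X.EE →ₗ⋆[ℂ] X.EE →ₗ[ℂ] ℂ :=
  nclift X.formPre X.formRight_balanced

theorem form_nctmul (ξ η ξ' η' : X.E) :
    X.form (nctmul X.right X.left ξ η) (nctmul X.right X.left ξ' η') =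
      ⟪(η : H), X.rep (X.herm (X.JE ξ) (X.JE ξ')) (η' : H)⟫_ℂ := rfl

theorem form_add_left (x y z : X.EE) : X.form (x + y) z = X.form x z + X.form y z := by
  rw [LinearMap.map_add X.form, LinearMap.add_apply]

theorem form_symm (x y : X.EE) : starRingEnd ℂ (X.form y x) = X.form x y := by
  induction x using nctensor_induction with
  | tmul ξ η =>
    induction y using nctensor_induction with
    | tmul ξ' η' =>
      rw [form_nctmul, form_nctmul, inner_conj_symm, ← X.herm_symm, map_star,
        ContinuousLinearMap.star_eq_adjoint, ContinuousLinearMap.adjoint_inner_left]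
    | add x y hx hy =>
      rw [LinearMap.map_add (X.form _), form_add_left, map_add, hx, hy]
  | add x y hx hy => rw [LinearMap.map_add (X.form _), form_add_left, map_add, hx, hy]

theorem form_nonneg (x : X.EE) : 0 ≤ (X.form x x).re := by
  obtain ⟨t, rfl⟩ := ncq_surjective x
  obtain ⟨n, ξ, η, rfl⟩ := TensorProduct.exists_sum_tmul_eq t
  have h := matrix_nonneg X.rep (fun i j : Fin n => X.herm (X.JE (ξ i)) (X.JE (ξ j)))
    (fun i j => X.herm_symm _ _) (fun a => by
      have : ∑ i, ∑ j, a i * X.herm (X.JE (ξ i)) (X.JE (ξ j)) * star (a j) =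
          X.herm (∑ i, X.left (a i) (X.JE (ξ i))) (∑ i, X.left (a i) (X.JE (ξ i))) := by
        simp only [map_sum, LinearMap.sum_apply, X.herm_left, X.herm_right, mul_assoc]
        exact Finset.sum_comm
      rw [this]
      exact X.herm_nonneg _) (fun i => (η i : H))
  convert h using 2
  simp only [map_sum, LinearMap.sum_apply]
  rw [Finset.sum_comm]
  rfl

/-- The pre-Hilbert space `E ⊗_A E`. -/
def Pre : Type u := X.EE

instance : AddCommGroup X.Pre := inferInstanceAs (AddCommGroup X.EE)

instance : Module ℂ X.Pre := inferInstanceAs (Module ℂ X.EE)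

/-- The semi-inner product on `E ⊗_A E`. -/
@[reducible]
def core : PreInnerProductSpace.Core ℂ X.Pre where
  inner x y := X.form x y
  conj_inner_symm := X.form_symm
  re_inner_nonneg := X.form_nonneg
  add_left x y z := X.form_add_left x y z
  smul_left x y r := LinearMap.congr_fun (LinearMap.map_smulₛₗ X.form r x) y

instance : SeminormedAddCommGroup X.Pre :=
  @InnerProductSpace.Core.toSeminormedAddCommGroup ℂ X.Pre _ _ _ X.core

instance : InnerProductSpace ℂ X.Pre := InnerProductSpace.ofCore X.core

/-- The Hilbert space completion of `E ⊗_A E`. -/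
abbrev HTilde : Type u := Completion X.Pre

/-- The canonical map from `E ⊗_A E` to its completion. -/
def incl : X.EE →ₗ[ℂ] X.HTilde where
  toFun x := ((show X.Pre from x : X.Pre) : X.HTilde)
  map_add' x y := Completion.coe_add (α := X.Pre) x y
  map_smul' c x := Completion.coe_smul (X := X.Pre) c x

end HermitianData

end Defs

section Defs

variable {A H : Type u} [Ring A] [StarRing A] [Algebra ℂ A] [StarModule ℂ A]
  [NormedAddCommGroup H] [InnerProductSpace ℂ H] [CompleteSpace H]

namespace HermitianData

variable (X : HermitianData A H)

theorem left_omega (a : A) (ω : X.Omega) (ξ : X.E) :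
    X.omegaAct (X.omegaLeft a ω) ξ = X.left a (X.omegaAct ω ξ) := rfl

theorem omega_left (a : A) (ω : X.Omega) (ξ : X.E) :
    X.omegaAct (X.omegaRight a ω) ξ = X.omegaAct ω (X.left a ξ) := rfl

theorem JEsymm_JE (ξ : X.E) : X.JEsymm (X.JE ξ) = ξ := Subtype.ext (X.J.symm_apply_apply _)

theorem JE_JEsymm (ξ : X.E) : X.JE (X.JEsymm ξ) = ξ := Subtype.ext (X.J.apply_symm_apply _)

theorem right_eq (a : A) (ξ : X.E) : X.right a ξ = X.JE (X.left (star a) (X.JEsymm ξ)) := rfl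

theorem JE_left (a : A) (ξ : X.E) : X.JE (X.left a ξ) = X.right (star a) (X.JE ξ) := by
  rw [right_eq, star_star, JEsymm_JE]

theorem JEsymm_right (a : A) (ξ : X.E) : X.JEsymm (X.right a ξ) = X.left (star a) (X.JEsymm ξ) := by
  rw [right_eq, JEsymm_JE]

theorem right_omega (a : A) (ω : X.Omega) (ξ : X.E) :
    X.omegaActRight (X.right a ξ) ω = X.omegaActRight ξ (X.omegaLeft a ω) := by
  change X.JE (X.omegaAct (X.omegaStar ω) (X.JEsymm (X.right a ξ))) =
    X.JE (X.omegaAct (X.omegaStar (X.omegaLeft a ω)) (X.JEsymm ξ))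
  have : X.omegaStar (X.omegaLeft a ω) = X.omegaRight (star a) (X.omegaStar ω) :=
    Subtype.ext (by
      change star (X.rep a * (ω : H →L[ℂ] H)) = star (ω : H →L[ℂ] H) * X.rep (star a)
      rw [star_mul, map_star])
  rw [JEsymm_right, this, omega_left]

theorem omega_right (a : A) (ω : X.Omega) (ξ : X.E) :
    X.omegaActRight ξ (X.omegaRight a ω) = X.right a (X.omegaActRight ξ ω) := by
  change X.JE (X.omegaAct (X.omegaStar (X.omegaRight a ω)) (X.JEsymm ξ)) =
    X.right a (X.JE (X.omegaAct (X.omegaStar ω) (X.JEsymm ξ)))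
  have : X.omegaStar (X.omegaRight a ω) = X.omegaLeft (star a) (X.omegaStar ω) :=
    Subtype.ext (by
      change star ((ω : H →L[ℂ] H) * X.rep a) = X.rep (star a) * star (ω : H →L[ℂ] H)
      rw [star_mul, map_star])
  rw [this, left_omega, JE_left, star_star]

theorem γE_left (a : A) (ξ : X.E) : X.γE (X.left a ξ) = X.left a (X.γE ξ) :=
  Subtype.ext (congrArg (fun T : H →L[ℂ] H => T ξ) (X.γ_rep a))

/-- The left action of `A` on `Ω¹_D(A) ⊗_A E`. -/
def oeLeft (a : A) : X.OmegaE →ₗ[ℂ] X.OmegaE :=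
  ncmap (X.omegaLeft a) LinearMap.id
    (fun _ _ => Subtype.ext (mul_assoc _ _ _).symm) (fun _ _ => rfl)

/-- The operator `1 ⊗ γ` on `Ω¹_D(A) ⊗_A E`. -/
def oeγ : X.OmegaE →ₗ[ℂ] X.OmegaE :=
  ncmap LinearMap.id X.γE (fun _ _ => rfl) X.γE_left

/-- The right action of `A` on `E ⊗_A Ω¹_D(A)`. -/
def eoRight (a : A) : X.EOmega →ₗ[ℂ] X.EOmega :=
  ncmap LinearMap.id (X.omegaRight a) (fun _ _ => rfl)
    (fun _ _ => Subtype.ext (mul_assoc _ _ _))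

/-- The pairing `⟨ω ⊗ ζ, η⟩ = ω ⟨ζ, η⟩`. -/
def pairing (η : X.E) : X.OmegaE →ₗ[ℂ] (H →L[ℂ] H) :=
  nclift (LinearMap.mk₂ ℂ
    (fun (ω : X.Omega) (ζ : X.E) => (ω : H →L[ℂ] H) * X.rep (X.herm ζ η))
    (fun _ _ _ => add_mul _ _ _) (fun _ _ _ => smul_mul_assoc _ _ _)
    (fun ω ζ ζ' => by rw [map_add, LinearMap.add_apply, map_add, mul_add])
    (fun c ω ζ => by rw [map_smul, LinearMap.smul_apply, map_smul, mul_smul_comm]))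
    (fun a ω ζ => by
      rw [LinearMap.mk₂_apply, LinearMap.mk₂_apply, X.herm_left, map_mul, ← mul_assoc]
      rfl)

/-- The antilinear flip `Ψ (ω ⊗ ξ) = J ξ ⊗ ω*`. -/
def flip : X.OmegaE →ₗ⋆[ℂ] X.EOmega :=
  nclift (LinearMap.mk₂'ₛₗ (starRingEnd ℂ) (starRingEnd ℂ)
    (fun (ω : X.Omega) (ξ : X.E) => nctmul X.right X.omegaLeft (X.JE ξ) (X.omegaStar ω))
    (fun ω ω' ξ => by
      have : X.omegaStar (ω + ω') = X.omegaStar ω + X.omegaStar ω' := Subtype.ext (star_add _ _)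
      rw [this, nctmul_add_right])
    (fun c ω ξ => by
      have : X.omegaStar (c • ω) = star c • X.omegaStar ω := Subtype.ext (star_smul _ _)
      rw [this, nctmul_smul_right]
      rfl)
    (fun ω ξ ξ' => by rw [map_add, nctmul_add_left])
    (fun c ω ξ => by rw [LinearMap.map_smulₛₗ, nctmul_smul_left]))
    (fun a ω ξ => by
      have : X.omegaStar (X.omegaRight a ω) = X.omegaLeft (star a) (X.omegaStar ω) :=
        Subtype.ext (by
          change star ((ω : H →L[ℂ] H) * X.rep a) = X.rep (star a) * star (ω : H →L[ℂ] H)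
          rw [star_mul, map_star])
      rw [LinearMap.mk₂'ₛₗ_apply, LinearMap.mk₂'ₛₗ_apply, this, JE_left, nctmul_balanced])

theorem flip_nctmul (ω : X.Omega) (ξ : X.E) : X.flip (nctmul X.omegaRight X.left ω ξ) =
    nctmul X.right X.omegaLeft (X.JE ξ) (X.omegaStar ω) := rfl

theorem flip_left (a : A) (s : X.OmegaE) :
    X.flip (X.oeLeft a s) = X.eoRight (star a) (X.flip s) := by
  induction s using nctensor_induction with
  | tmul ω ξ =>
    have : X.omegaStar (X.omegaLeft a ω) = X.omegaRight (star a) (X.omegaStar ω) :=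
      Subtype.ext (by
        change star (X.rep a * (ω : H →L[ℂ] H)) = star (ω : H →L[ℂ] H) * X.rep (star a)
        rw [star_mul, map_star])
    rw [oeLeft, ncmap_nctmul, flip_nctmul, flip_nctmul, this, eoRight, ncmap_nctmul]
    rfl
  | add x y hx hy => simp only [map_add, hx, hy]

/-- `E ⊗_A Ω¹_D(A) ⊗_A E`. -/
abbrev EOmegaE : Type u := NCTensor X.eoRight X.left

/-- `ω ⊗ η ↦ ξ ⊗ ω ⊗ η`. -/
def insert (ξ : X.E) : X.OmegaE →ₗ[ℂ] X.EOmegaE :=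
  ncmap (ncmk X.right X.omegaLeft ξ) LinearMap.id (fun _ _ => rfl) (fun _ _ => rfl)

theorem insert_nctmul (ξ : X.E) (ω : X.Omega) (η : X.E) :
    X.insert ξ (nctmul X.omegaRight X.left ω η) =
      nctmul X.eoRight X.left (nctmul X.right X.omegaLeft ξ ω) η := rfl

theorem insert_add (ξ ξ' : X.E) (s : X.OmegaE) :
    X.insert (ξ + ξ') s = X.insert ξ s + X.insert ξ' s := by
  induction s using nctensor_induction with
  | tmul ω η => simp only [insert_nctmul, nctmul_add_left]
  | add x y hx hy => simp only [map_add, hx, hy]; abel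

theorem insert_smul (c : ℂ) (ξ : X.E) (s : X.OmegaE) :
    X.insert (c • ξ) s = c • X.insert ξ s := by
  induction s using nctensor_induction with
  | tmul ω η => simp only [insert_nctmul, nctmul_smul_left]
  | add x y hx hy => simp only [map_add, hx, hy, smul_add]

theorem insert_right (a : A) (ξ : X.E) (s : X.OmegaE) :
    X.insert (X.right a ξ) s = X.insert ξ (X.oeLeft a s) := by
  induction s using nctensor_induction with
  | tmul ω η =>
    rw [insert_nctmul, nctmul_balanced, oeLeft, ncmap_nctmul, insert_nctmul]
    rfl
  | add x y hx hy => simp only [map_add, hx, hy]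

/-- `ξ₁ ⊗ ω ↦ (ξ₂ ↦ ξ₁ ⊗ ω · ξ₂)`. -/
def cAux : X.EOmega →ₗ[ℂ] X.E →ₗ[ℂ] X.EE :=
  nclift (LinearMap.mk₂ ℂ
    (fun (ξ : X.E) (ω : X.Omega) => (ncmk X.right X.left ξ).comp (X.omegaAct ω))
    (fun _ _ _ => by rw [map_add, LinearMap.add_comp])
    (fun _ _ _ => by rw [map_smul, LinearMap.smul_comp])
    (fun _ _ _ => by rw [map_add, LinearMap.comp_add])
    (fun _ _ _ => by rw [map_smul, LinearMap.comp_smul]))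
    (fun a ξ ω => LinearMap.ext fun η => nctmul_balanced a ξ (X.omegaAct ω η))

/-- `c (ξ₁ ⊗ ω ⊗ ξ₂) = ξ₁ ⊗ ω · ξ₂`. -/
def c : X.EOmegaE →ₗ[ℂ] X.EE :=
  nclift X.cAux fun a z η => by
    induction z using nctensor_induction with
    | tmul ξ ω => rfl
    | add x y hx hy => simp only [map_add, LinearMap.add_apply, hx, hy]

/-- `ξ₁ ⊗ ω ↦ (ξ₂ ↦ ξ₁ · ω ⊗ γ ξ₂)`. -/
def cBarAux : X.EOmega →ₗ[ℂ] X.E →ₗ[ℂ] X.EE :=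
  nclift (LinearMap.mk₂ ℂ
    (fun (ξ : X.E) (ω : X.Omega) => (ncmk X.right X.left (X.omegaActRight ξ ω)).comp X.γE)
    (fun _ _ _ => by rw [map_add, LinearMap.add_apply, map_add, LinearMap.add_comp])
    (fun _ _ _ => by rw [map_smul, LinearMap.smul_apply, map_smul, LinearMap.smul_comp])
    (fun _ _ _ => by rw [map_add, map_add, LinearMap.add_comp])
    (fun _ _ _ => by rw [map_smul, map_smul, LinearMap.smul_comp]))
    (fun a ξ ω => by rw [LinearMap.mk₂_apply, LinearMap.mk₂_apply, right_omega])

/-- `c̄ (ξ₁ ⊗ ω ⊗ ξ₂) = ξ₁ · ω ⊗ γ ξ₂`. -/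
def cBar : X.EOmegaE →ₗ[ℂ] X.EE :=
  nclift X.cBarAux fun a z η => by
    induction z using nctensor_induction with
    | tmul ξ ω =>
      change nctmul X.right X.left (X.omegaActRight ξ (X.omegaRight a ω)) (X.γE η) =
        nctmul X.right X.left (X.omegaActRight ξ ω) (X.γE (X.left a η))
      rw [omega_right, nctmul_balanced, γE_left]
    | add x y hx hy => simp only [map_add, LinearMap.add_apply, hx, hy]

end HermitianData

end Defs

/-- Input of the extension procedure: real `N = 1` spectral data with a dense Hermitian f.g.p.
module `E` and a compatible connection `∇` on `E` which commutes with the grading. -/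
structure ExtInput (A H : Type u) [Ring A] [StarRing A] [Algebra ℂ A] [StarModule ℂ A]
    [NormedAddCommGroup H] [InnerProductSpace ℂ H] [CompleteSpace H] extends
    HermitianData A H where
  /-- The connection. -/
  nabla : E →ₗ[ℂ] toHermitianData.OmegaE
  leibniz : ∀ a ξ, nabla (toHermitianData.left a ξ) =
    toHermitianData.oeLeft a (nabla ξ) +
      nctmul _ _ (⟨toHermitianData.d a, toHermitianData.d_mem a⟩ : toHermitianData.Omega) ξ
  /-- `⟨∇ξ, η⟩ - ⟨ξ, ∇η⟩ = d ⟨ξ, η⟩`, where `⟨ξ, ω ⊗ ζ⟩ = ⟨ω ⊗ ζ, ξ⟩* = ⟨ξ, ζ⟩ ω*`. -/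
  compatible : ∀ ξ η, toHermitianData.pairing η (nabla ξ) -
    star (toHermitianData.pairing ξ (nabla η)) = toHermitianData.d (herm ξ η)
  nabla_γ : ∀ ξ, nabla (toHermitianData.γE ξ) = toHermitianData.oeγ (nabla ξ)

section Defs

variable {A H : Type u} [Ring A] [StarRing A] [Algebra ℂ A] [StarModule ℂ A]
  [NormedAddCommGroup H] [InnerProductSpace ℂ H] [CompleteSpace H]

namespace ExtInput

variable (X : ExtInput A H)

/-- The associated right connection `∇̄ ξ = - Ψ (∇ J* ξ)`. -/
def nablaBar : X.E →ₗ[ℂ] X.EOmega := -(X.flip.comp (X.nabla.comp X.JEsymm))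

theorem nablaBar_right (a : A) (ξ : X.E) : X.nablaBar (X.right a ξ) =
    X.eoRight a (X.nablaBar ξ) +
      nctmul X.right X.omegaLeft ξ (⟨X.d a, X.d_mem a⟩ : X.Omega) := by
  change -X.flip (X.nabla (X.JEsymm (X.right a ξ))) =
    X.eoRight a (-X.flip (X.nabla (X.JEsymm ξ))) + _
  have : X.omegaStar ⟨X.d (star a), X.d_mem (star a)⟩ = (-1 : ℂ) • ⟨X.d a, X.d_mem a⟩ :=
    Subtype.ext (by
      change star (X.d (star a)) = (-1 : ℂ) • X.d a
      rw [X.star_d, star_star, neg_one_smul])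
  rw [HermitianData.JEsymm_right, X.leibniz, map_add, HermitianData.flip_left, star_star,
    HermitianData.flip_nctmul, HermitianData.JE_JEsymm, this, nctmul_smul_right, map_neg,
    neg_one_smul, neg_add, neg_neg]

/-- The tensored connection `ξ₁ ⊗ ξ₂ ↦ ∇̄ ξ₁ ⊗ ξ₂ + ξ₁ ⊗ ∇ ξ₂`. -/
def nablaTilde : X.EE →ₗ[ℂ] X.EOmegaE :=
  nclift (LinearMap.mk₂ ℂ
    (fun ξ η => nctmul X.eoRight X.left (X.nablaBar ξ) η + X.insert ξ (X.nabla η))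
    (fun ξ ξ' η => by
      rw [map_add, nctmul_add_left, HermitianData.insert_add]; abel)
    (fun c ξ η => by
      rw [map_smul, nctmul_smul_left, HermitianData.insert_smul, smul_add])
    (fun ξ η η' => by
      rw [map_add, map_add, nctmul_add_right]; abel)
    (fun c ξ η => by
      rw [map_smul, map_smul, nctmul_smul_right, smul_add]))
    (fun a ξ η => by
      rw [LinearMap.mk₂_apply, LinearMap.mk₂_apply, nablaBar_right, nctmul_add_left,
        nctmul_balanced, HermitianData.insert_right, X.leibniz, map_add,
        HermitianData.insert_nctmul]
      abel)

/-- The operator `𝔇 = c ∘ ∇̃` on `E ⊗_A E`. -/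
def dirac : X.EE →ₗ[ℂ] X.EE := X.c ∘ₗ X.nablaTilde

/-- The operator `𝔇̄ = c̄ ∘ ∇̃` on `E ⊗_A E`. -/
def diracBar : X.EE →ₗ[ℂ] X.EE := X.cBar ∘ₗ X.nablaTilde

end ExtInput

end Defs

/-! ### `N = (1,1)` spectral data and the extension procedure -/

/-- The type of sextuples `(A, H, 𝔇, 𝔇̄, γ, ⋆)`, not yet subject to any relations. -/
structure Sextuple (A H : Type u) [Ring A] [Algebra ℂ A]
    [NormedAddCommGroup H] [InnerProductSpace ℂ H] where
  /-- The action of `A` on `H`. -/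
  rep : A →ₗ[ℂ] (H →L[ℂ] H)
  /-- The operator `𝔇`. -/
  D : H →ₗ.[ℂ] H
  /-- The operator `𝔇̄`. -/
  Dbar : H →ₗ.[ℂ] H
  /-- The grading operator. -/
  γ : H →L[ℂ] H
  /-- The Hodge operator. -/
  hodge : H →L[ℂ] H

/-- The sextuple is a set of `N = (1,1)` spectral data. -/
structure Sextuple.IsN11 {A H : Type u} [Ring A] [StarRing A] [Algebra ℂ A]
    [NormedAddCommGroup H] [InnerProductSpace ℂ H] [CompleteSpace H]
    (S : Sextuple A H) : Prop where
  separable : TopologicalSpace.SeparableSpace H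
  representation : ∃ ρ : A →⋆ₐ[ℂ] (H →L[ℂ] H), (∀ a, ρ a = S.rep a) ∧ Function.Injective ρ
  selfAdjoint : IsSelfAdjoint S.D
  selfAdjoint_bar : IsSelfAdjoint S.Dbar
  /-- `𝔇² = 𝔇̄²`. -/
  sq_eq : ∀ x z, CompGraph S.D S.D x z ↔ CompGraph S.Dbar S.Dbar x z
  /-- `𝔇 𝔇̄ = - 𝔇̄ 𝔇`. -/
  anticomm : ∀ x z, CompGraph S.D S.Dbar x z ↔ CompGraph S.Dbar S.D x (-z)
  bounded_commutator : ∀ a, ∃ T, IsCommutator S.D (S.rep a) T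
  bounded_commutator_bar : ∀ a, ∃ T, IsCommutator S.Dbar (S.rep a) T
  trace_class : HeatTraceClass S.D
  grading : IsGrading S.γ
  γ_rep : ∀ a, S.γ * S.rep a = S.rep a * S.γ
  γ_D : AntiCommutes S.γ S.D
  γ_Dbar : AntiCommutes S.γ S.Dbar
  hodge_grading : IsGrading S.hodge
  hodge_γ : S.hodge * S.γ = S.γ * S.hodge
  hodge_rep : ∀ a, S.hodge * S.rep a = S.rep a * S.hodge
  hodge_D : AntiCommutes S.hodge S.D
  hodge_Dbar : Commutes S.hodge S.Dbar

section Defs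

variable {A H : Type u} [Ring A] [StarRing A] [Algebra ℂ A] [StarModule ℂ A]
  [NormedAddCommGroup H] [InnerProductSpace ℂ H] [CompleteSpace H]

namespace HermitianData

variable (X : HermitianData A H)

/-- The left action of `A` on `E ⊗_A E`. -/
def eeLeft (a : A) : X.EE →ₗ[ℂ] X.EE :=
  ncmap (X.left a) LinearMap.id (fun b ξ => Subtype.ext (X.order_zero (star b) a ξ).symm)
    (fun _ _ => rfl)

theorem γ_γ (x : H) : X.γ (X.γ x) = x :=
  congrArg (fun T : H →L[ℂ] H => T x) X.grading.sq_eq_one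

theorem γE_JE (ξ : X.E) : X.γE (X.JE ξ) = epsGamma X.ko • X.JE (X.γE ξ) := by
  apply Subtype.ext
  change X.γ (X.J ξ) = epsGamma X.ko • X.J (X.γ ξ)
  rw [X.J_γ, smul_smul]
  have : ∀ k : Fin 4, epsGamma k * epsGamma k = 1 := by intro k; fin_cases k <;> rfl
  rw [this, one_smul]

theorem γE_right (a : A) (ξ : X.E) : X.γE (X.right a ξ) = X.right a (X.γE ξ) := by
  obtain ⟨η, rfl⟩ : ∃ η, X.JE η = ξ := ⟨X.JEsymm ξ, X.JE_JEsymm ξ⟩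
  rw [right_eq, JEsymm_JE, γE_JE, γE_JE, γE_left, map_zsmul, right_eq, JEsymm_JE]

/-- The grading `γ ⊗ γ` on `E ⊗_A E`. -/
def eeγ : X.EE →ₗ[ℂ] X.EE := ncmap X.γE X.γE X.γE_right X.γE_left

/-- The Hodge operator `1 ⊗ γ` on `E ⊗_A E`. -/
def eeHodge : X.EE →ₗ[ℂ] X.EE := ncmap LinearMap.id X.γE (fun _ _ => rfl) X.γE_left

open Classical in
/-- The extension of `T` to a bounded operator on the completion of `E ⊗_A E`, or `0` if `T` is
not bounded. -/
def boundedExtension (T : X.EE →ₗ[ℂ] X.EE) : X.HTilde →L[ℂ] X.HTilde :=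
  if h : ∃ S : X.HTilde →L[ℂ] X.HTilde, ∀ x, S (X.incl x) = X.incl (T x) then h.choose else 0

open Classical in
/-- The action of `A` on the completion of `E ⊗_A E` extending the left action of `A` on
`E ⊗_A E`, or `0` if `A` does not act by bounded operators. -/
def repTilde : A →ₗ[ℂ] (X.HTilde →L[ℂ] X.HTilde) :=
  if h : ∃ ρ : A →ₗ[ℂ] (X.HTilde →L[ℂ] X.HTilde), ∀ a x, ρ a (X.incl x) = X.incl (X.eeLeft a x)
    then h.choose else 0

/-- The closure of the operator `T`, with domain `E ⊗_A E`, on the completion of `E ⊗_A E`. -/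
def closureOp (T : X.EE →ₗ[ℂ] X.EE) : X.HTilde →ₗ.[ℂ] X.HTilde :=
  (LinearMap.range (X.incl.prod (X.incl ∘ₗ T))).toLinearPMap.closure

end HermitianData

/-- The extension procedure `Φ`: the candidate sextuple `(A, H̃, 𝔇, 𝔇̄, γ ⊗ γ, 1 ⊗ γ)`. -/
def Phi (X : ExtInput A H) : Sextuple A X.HTilde where
  rep := X.repTilde
  D := X.closureOp X.dirac
  Dbar := X.closureOp X.diracBar
  γ := X.boundedExtension X.eeγ
  hodge := X.boundedExtension X.eeHodge

end Defs

/-! ### Products -/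

/-- The product of `N = (1,1)` spectral data, and five other rules. -/
inductive ProductRule
  /-- `𝔇 = 𝔇₁ ⊗ 1 + ⋆₁ ⊗ 𝔇₂` and `𝔇̄ = 𝔇̄₁ ⊗ ⋆₂ + γ₁ ⊗ 𝔇̄₂`. -/
  | standard
  /-- `𝔇 = 𝔇₁ ⊗ 1 + ⋆₁ ⊗ 𝔇₂` and `𝔇̄ = 𝔇̄₁ ⊗ γ₂ + ⋆₁ ⊗ 𝔇̄₂`. -/
  | rule1
  /-- `𝔇 = 𝔇₁ ⊗ ⋆₂ + 1 ⊗ 𝔇₂` and `𝔇̄ = 𝔇̄₁ ⊗ γ₂ + ⋆₁ ⊗ 𝔇̄₂`. -/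
  | rule2
  /-- `𝔇 = 𝔇₁ ⊗ ⋆₂ + 1 ⊗ 𝔇₂` and `𝔇̄ = 𝔇̄₁ ⊗ ⋆₂ + γ₁ ⊗ 𝔇̄₂`. -/
  | rule3
  /-- `𝔇 = 𝔇₁ ⊗ 1 + γ₁ ⊗ 𝔇₂` and `𝔇̄ = 𝔇̄₁ ⊗ 1 + γ₁ ⊗ 𝔇̄₂`. -/
  | rule4
  /-- `𝔇 = 𝔇₁ ⊗ γ₂ + 1 ⊗ 𝔇₂` and `𝔇̄ = 𝔇̄₁ ⊗ γ₂ + 1 ⊗ 𝔇̄₂`. -/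
  | rule5

section Products

variable {A₁ A₂ K₁ K₂ : Type u} [Ring A₁] [Algebra ℂ A₁] [Ring A₂] [Algebra ℂ A₂]
  [NormedAddCommGroup K₁] [InnerProductSpace ℂ K₁]
  [NormedAddCommGroup K₂] [InnerProductSpace ℂ K₂]

/-- The operator `𝔇` of the product of two sextuples. -/
def Sextuple.prodD (S₁ : Sextuple A₁ K₁) (S₂ : Sextuple A₂ K₂) :
    ProductRule → HTensor K₁ K₂ →ₗ.[ℂ] HTensor K₁ K₂
  | .standard => tensorSum S₁.D 1 S₁.hodge S₂.D
  | .rule1 => tensorSum S₁.D 1 S₁.hodge S₂.D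
  | .rule2 => tensorSum S₁.D S₂.hodge 1 S₂.D
  | .rule3 => tensorSum S₁.D S₂.hodge 1 S₂.D
  | .rule4 => tensorSum S₁.D 1 S₁.γ S₂.D
  | .rule5 => tensorSum S₁.D S₂.γ 1 S₂.D

/-- The operator `𝔇̄` of the product of two sextuples. -/
def Sextuple.prodDbar (S₁ : Sextuple A₁ K₁) (S₂ : Sextuple A₂ K₂) :
    ProductRule → HTensor K₁ K₂ →ₗ.[ℂ] HTensor K₁ K₂
  | .standard => tensorSum S₁.Dbar S₂.hodge S₁.γ S₂.Dbar
  | .rule1 => tensorSum S₁.Dbar S₂.γ S₁.hodge S₂.Dbar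
  | .rule2 => tensorSum S₁.Dbar S₂.γ S₁.hodge S₂.Dbar
  | .rule3 => tensorSum S₁.Dbar S₂.hodge S₁.γ S₂.Dbar
  | .rule4 => tensorSum S₁.Dbar 1 S₁.γ S₂.Dbar
  | .rule5 => tensorSum S₁.Dbar S₂.γ 1 S₂.Dbar

/-- The product of two sextuples, according to one of the six rules. -/
def Sextuple.prod (k : ProductRule) (S₁ : Sextuple A₁ K₁) (S₂ : Sextuple A₂ K₂) :
    Sextuple (A₁ ⊗[ℂ] A₂) (HTensor K₁ K₂) where
  rep := TensorProduct.lift (hmapBilin.compl₁₂ S₁.rep S₂.rep)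
  D := S₁.prodD S₂ k
  Dbar := S₁.prodDbar S₂ k
  γ := hmap S₁.γ S₂.γ
  hodge := hmap S₁.hodge S₂.hodge

/-- The unitary `U` carries the sextuple `S` to the sextuple `T`. -/
structure Sextuple.Transports {A K L : Type u} [Ring A] [Algebra ℂ A]
    [NormedAddCommGroup K] [InnerProductSpace ℂ K] [NormedAddCommGroup L] [InnerProductSpace ℂ L]
    (U : K ≃ₗᵢ[ℂ] L) (S : Sextuple A K) (T : Sextuple A L) : Prop where
  rep : ∀ a x, U (S.rep a x) = T.rep a (U x)
  D : ∀ x y, (x, y) ∈ S.D.graph ↔ (U x, U y) ∈ T.D.graph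
  Dbar : ∀ x y, (x, y) ∈ S.Dbar.graph ↔ (U x, U y) ∈ T.Dbar.graph
  γ : ∀ x, U (S.γ x) = T.γ (U x)
  hodge : ∀ x, U (S.hodge x) = T.hodge (U x)

end Products

section Kasparov

variable {A₁ A₂ H₁ H₂ : Type u}
  [Ring A₁] [StarRing A₁] [Algebra ℂ A₁] [StarModule ℂ A₁]
  [NormedAddCommGroup H₁] [InnerProductSpace ℂ H₁] [CompleteSpace H₁]
  [Ring A₂] [StarRing A₂] [Algebra ℂ A₂] [StarModule ℂ A₂]
  [NormedAddCommGroup H₂] [InnerProductSpace ℂ H₂] [CompleteSpace H₂]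

/-- `X` is the Kasparov product of `X₁` and `X₂`, with `E = E₁ ⊗ E₂`, the product Hermitian
structure, and the connection `∇ (e₁ ⊗ e₂) = ∇₁ e₁ ⊗ e₂ + e₁ ⊗ ∇₂ e₂`, where one-forms `ω₁` and
`ω₂` of the factors are regarded as the one-forms `ω₁ ⊗ 1` and `γ₁ ⊗ ω₂` of the product. -/
structure IsProduct (X₁ : ExtInput A₁ H₁) (X₂ : ExtInput A₂ H₂)
    (X : ExtInput (A₁ ⊗[ℂ] A₂) (HTensor H₁ H₂)) : Prop where
  rep : ∀ a₁ a₂, X.rep (a₁ ⊗ₜ[ℂ] a₂) = hmap (X₁.rep a₁) (X₂.rep a₂)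
  D : X.D = tensorSum X₁.D 1 X₁.γ X₂.D
  γ : X.γ = hmap X₁.γ X₂.γ
  ko : X.ko = X₁.ko + X₂.ko
  /-- The real structure `J₁ ⊗ J₂` or `J₁ ⊗ J₂ γ₂`, according to the sign in
  `J₁ γ₁ = ± γ₁ J₁`. -/
  J : ∀ x y, X.J (htmul x y) =
    htmul (X₁.J x) (X₂.J (if epsGamma X₁.ko = 1 then y else X₂.γ y))
  E : X.E = Submodule.span ℂ {z | ∃ x ∈ X₁.E, ∃ y ∈ X₂.E, z = htmul x y}
  herm : ∀ (x x' : X₁.E) (y y' : X₂.E) (e e' : X.E), (e : HTensor H₁ H₂) = htmul (x : H₁) (y : H₂) →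
    (e' : HTensor H₁ H₂) = htmul (x' : H₁) (y' : H₂) → X.herm e e' = X₁.herm x x' ⊗ₜ[ℂ] X₂.herm y y'
  nabla : ∀ (x : X₁.E) (y : X₂.E) (e : X.E), (e : HTensor H₁ H₂) = htmul (x : H₁) (y : H₂) →
    ∀ (m n : ℕ) (ω : Fin m → X₁.Omega) (ξ : Fin m → X₁.E) (ω' : Fin n → X₂.Omega)
      (η : Fin n → X₂.E),
      X₁.nabla x = ∑ i, nctmul _ _ (ω i) (ξ i) → X₂.nabla y = ∑ j, nctmul _ _ (ω' j) (η j) →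
      ∃ (w : Fin m → X.Omega) (w' : Fin n → X.Omega) (u : Fin m → X.E) (v : Fin n → X.E),
        (∀ i, (w i : HTensor H₁ H₂ →L[ℂ] HTensor H₁ H₂) = hmap (ω i) 1 ∧
          (u i : HTensor H₁ H₂) = htmul (ξ i : H₁) (y : H₂)) ∧
        (∀ j, (w' j : HTensor H₁ H₂ →L[ℂ] HTensor H₁ H₂) = hmap X₁.γ (ω' j) ∧
          (v j : HTensor H₁ H₂) = htmul (x : H₁) (η j : H₂)) ∧
        X.nabla e = ∑ i, nctmul _ _ (w i) (u i) + ∑ j, nctmul _ _ (w' j) (v j)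

/-- The unitary identifying the completion of `E ⊗_A E`, for `A = A₁ ⊗ A₂` and `E = E₁ ⊗ E₂`, with
the tensor product of the completions of `E₁ ⊗_{A₁} E₁` and `E₂ ⊗_{A₂} E₂`:
`(ξ₁ ⊗ ξ₂) ⊗ (η₁ ⊗ η₂) ↦ (ξ₁ ⊗ η₁) ⊗ (ξ₂ ⊗ η₂)`. -/
def IsCanonical (X₁ : ExtInput A₁ H₁) (X₂ : ExtInput A₂ H₂)
    (X : ExtInput (A₁ ⊗[ℂ] A₂) (HTensor H₁ H₂))
    (U : X.HTilde ≃ₗᵢ[ℂ] HTensor X₁.HTilde X₂.HTilde) : Prop :=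
  ∀ (ξ₁ η₁ : X₁.E) (ξ₂ η₂ : X₂.E) (ξ η : X.E), (ξ : HTensor H₁ H₂) = htmul (ξ₁ : H₁) (ξ₂ : H₂) →
    (η : HTensor H₁ H₂) = htmul (η₁ : H₁) (η₂ : H₂) →
    U (X.incl (nctmul _ _ ξ η)) =
      htmul (X₁.incl (nctmul _ _ ξ₁ η₁)) (X₂.incl (nctmul _ _ ξ₂ η₂))

/-- `Φ` of the Kasparov product `X` of `X₁` and `X₂` equals the product of `Φ X₁` and `Φ X₂`
according to the given rule, under the canonical identification of the Hilbert spaces. -/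
def PhiEqProd (k : ProductRule) (X₁ : ExtInput A₁ H₁) (X₂ : ExtInput A₂ H₂)
    (X : ExtInput (A₁ ⊗[ℂ] A₂) (HTensor H₁ H₂)) : Prop :=
  ∃ U : X.HTilde ≃ₗᵢ[ℂ] HTensor X₁.HTilde X₂.HTilde, IsCanonical X₁ X₂ X U ∧
    Sextuple.Transports U (Phi X) (Sextuple.prod k (Phi X₁) (Phi X₂))

end Kasparov

/-- `Φ` is multiplicative with respect to the given product of `N = (1,1)` spectral data. -/
def Multiplicative (k : ProductRule) : Prop :=
  ∀ (A₁ H₁ A₂ H₂ : Type u)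
    [Ring A₁] [StarRing A₁] [Algebra ℂ A₁] [StarModule ℂ A₁]
    [NormedAddCommGroup H₁] [InnerProductSpace ℂ H₁] [CompleteSpace H₁]
    [Ring A₂] [StarRing A₂] [Algebra ℂ A₂] [StarModule ℂ A₂]
    [NormedAddCommGroup H₂] [InnerProductSpace ℂ H₂] [CompleteSpace H₂]
    (X₁ : ExtInput A₁ H₁) (X₂ : ExtInput A₂ H₂),
    (Phi X₁).IsN11 → (Phi X₂).IsN11 →
    ∀ X : ExtInput (A₁ ⊗[ℂ] A₂) (HTensor H₁ H₂), IsProduct X₁ X₂ X → PhiEqProd k X₁ X₂ X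

end SpectralData

end

-- Algebraic part. For `E = E₁ ⊗ E₂`, elements of `E ⊗_A E` regroup as `(ξ₁ ⊗ η₁) ⊗ (ξ₂ ⊗ η₂)`, and
-- rule (0) is what the formulas for `𝔇` and `𝔇̄` become after regrouping. The one-forms entering
-- the product connection are `ω₁ ⊗ 1` and `γ₁ ⊗ ω₂`. In `𝔇` they act from the left on the second
-- leg `η₁ ⊗ η₂`: the first kind produces `𝔇₁ ⊗ 1`, the second leaves a `γ₁` on the second leg of
-- the first factor, which is `⋆₁`. In `𝔇̄` they act from the right on the first leg, while `γ₁ ⊗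
-- γ₂` is applied to the second leg: the first kind leaves a spare `γ₂` on `η₂`, which is `⋆₂`, and
-- the second leaves `γ₁` on both legs of the first factor, which is the grading. The possible extra
-- `γ₂` in `J` only produces signs, and these cancel. This is `swap_dirac` and `swap_diracBar`.
-- Regrouping is isometric because the grading of `Φ(X₂)` is unitary, which forces `γ₂` to preserve
-- the Hermitian structure (`herm_γE`).
--
-- Analytic part. Everything about unbounded operators is reduced to eigenbases of the square. A
-- self-adjoint `D` with trace class heat semigroup has a Hilbert basis with `D² bᵢ = κᵢ bᵢ` and `∑
-- exp(-t κᵢ) < ∞` (`exists_squareDiagonal`). Conversely, a closed symmetric operator with such a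
-- basis is self-adjoint, its domain and its square are determined by `b` and `κ`, and its heat
-- semigroup is trace class. This form is stable under `D₁ ⊗ B₂ + B₁ ⊗ D₂`: if the involutions
-- satisfy `B₁ D₁ = -D₁ B₁` and `B₂ D₂ = D₂ B₂`, the cross terms in the square cancel and `b₁ ⊗ b₂`
-- is an eigenbasis with values `κ₁ + κ₂`. Since `𝔇` and `𝔇̄` share one eigenbasis with the same
-- values, the product (0) is again `N = (1,1)` data (`Sextuple.IsN11.prod`), and `Φ(X)` inherits
-- this along the unitary. The same criterion makes the Kasparov product of the `N = 1` data exist;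
-- its module is handled through products of dual bases, and positivity of its Hermitian structure
-- comes from positivity of a tensor product of two inner products.
--
-- Closures do not interfere: `Eᵢ ⊗ Eᵢ` is a core for the operators of `Φ(Xᵢ)`, and the closure of a
-- tensor sum can be computed on cores (`closure_span_sumGens`).
--
-- Exclusion of the other rules. The operator `F₁ ⊗ B₂ + B₁ ⊗ F₂` determines `B₂` if `F₁ ≠ 0` and
-- `B₁` if `F₂ ≠ 0` (`eq_of_tensorSum_eq`). Each of the rules (1)–(5) would therefore identify two
-- involutions of which one commutes and the other anticommutes with the same nonzero operator. For
-- the uniqueness statement a single input with `𝔇 ≠ 0` suffices; the inner derivation `[M, ·]` on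
-- two copies of a matrix algebra, with the flat connection, provides it.

universe v

noncomputable section

namespace SpectralData

/-! ### Symmetric and self-adjoint operators through their graphs -/

section Graphs

variable {H : Type*} [NormedAddCommGroup H] [InnerProductSpace ℂ H]

/-- A linear relation is symmetric if it satisfies the symmetry identity of an operator. -/
def IsSymmGraph (g : Submodule ℂ (H × H)) : Prop :=
  ∀ p ∈ g, ∀ q ∈ g, ⟪p.2, q.1⟫_ℂ = ⟪p.1, q.2⟫_ℂ

theorem IsSymmGraph.topologicalClosure {g : Submodule ℂ (H × H)} (hg : IsSymmGraph g) :
    IsSymmGraph g.topologicalClosure := by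
  have h1 : ∀ q ∈ g, ∀ p ∈ g.topologicalClosure, ⟪p.2, q.1⟫_ℂ = ⟪p.1, q.2⟫_ℂ := fun q hq => by
    have hcl : IsClosed {p : H × H | ⟪p.2, q.1⟫_ℂ = ⟪p.1, q.2⟫_ℂ} :=
      isClosed_eq (by fun_prop) (by fun_prop)
    exact fun p hp => hcl.closure_subset_iff.mpr (fun p hp => hg p hp q hq) hp
  intro p hp
  have hcl : IsClosed {q : H × H | ⟪p.2, q.1⟫_ℂ = ⟪p.1, q.2⟫_ℂ} :=
    isClosed_eq (by fun_prop) (by fun_prop)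
  exact fun q hq => hcl.closure_subset_iff.mpr (fun q hq => h1 q hq p hp) hq

/-- Symmetry makes `p.2` orthogonal to every first coordinate, and these are dense. Hence a densely
defined symmetric relation is automatically single-valued. -/
theorem IsSymmGraph.eq_zero {g : Submodule ℂ (H × H)} (hg : IsSymmGraph g)
    (hd : Dense (Prod.fst '' (g : Set (H × H)))) {p : H × H} (hp : p ∈ g) (h : p.1 = 0) :
    p.2 = 0 := by
  refine hd.eq_zero_of_inner_left ℂ ?_
  rintro _ ⟨q, hq, rfl⟩
  rw [hg p hp q hq, h, inner_zero_left]

theorem isSymmGraph_span {s : Set (H × H)}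
    (hs : ∀ p ∈ s, ∀ q ∈ s, ⟪p.2, q.1⟫_ℂ = ⟪p.1, q.2⟫_ℂ) :
    IsSymmGraph (Submodule.span ℂ s) := by
  intro p hp q hq
  induction hp using Submodule.span_induction with
  | mem p hp =>
    induction hq using Submodule.span_induction with
    | mem q hq => exact hs p hp q hq
    | zero => simp
    | add a b _ _ ha hb => simp only [Prod.fst_add, Prod.snd_add, inner_add_right, ha, hb]
    | smul c a _ ha => simp only [Prod.smul_fst, Prod.smul_snd, inner_smul_right, ha]
  | zero => simp
  | add a b _ _ ha hb => simp only [Prod.fst_add, Prod.snd_add, inner_add_left, ha, hb]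
  | smul c a _ ha => simp only [Prod.smul_fst, Prod.smul_snd, inner_smul_left, ha]

theorem IsSymmGraph.toLinearPMap_graph {g : Submodule ℂ (H × H)} (hg : IsSymmGraph g)
    (hd : Dense (Prod.fst '' (g : Set (H × H)))) : g.toLinearPMap.graph = g :=
  g.toLinearPMap_graph_eq fun _ hp h => hg.eq_zero hd hp h

/-- The closed relation is again symmetric and densely defined, hence a graph, so the operator is
closable. This is needed because the closure of a non-closable operator is by default the operator
itself. -/
theorem IsSymmGraph.closure_graph {g : Submodule ℂ (H × H)} (hg : IsSymmGraph g)
    (hd : Dense (Prod.fst '' (g : Set (H × H)))) :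
    g.toLinearPMap.closure.graph = g.topologicalClosure := by
  have h1 := hg.toLinearPMap_graph hd
  have hcl : g.toLinearPMap.IsClosable := by
    refine ⟨g.topologicalClosure.toLinearPMap, ?_⟩
    rw [h1, hg.topologicalClosure.toLinearPMap_graph
      (hd.mono (Set.image_mono g.le_topologicalClosure))]
  rw [← hcl.graph_closure_eq_closure_graph, h1]

/-- Induction over the closed span of a set of pairs: a continuous additive map is controlled by
its values on the set. -/
theorem mem_closure_span_of_forall {σ : ℂ →+* ℂ} {K : Type*} [NormedAddCommGroup K]
    [InnerProductSpace ℂ K] {s : Set (H × H)} {C : Submodule ℂ (K × K)}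
    (L : (H × H) →SL[σ] (K × K)) (hs : ∀ p ∈ s, L p ∈ C.topologicalClosure)
    {p : H × H} (hp : p ∈ (Submodule.span ℂ s).topologicalClosure) :
    L p ∈ C.topologicalClosure := by
  have hcl : IsClosed {p : H × H | L p ∈ C.topologicalClosure} :=
    C.isClosed_topologicalClosure.preimage L.continuous
  refine hcl.closure_subset_iff.mpr (fun p hp => ?_) hp
  change L p ∈ C.topologicalClosure
  have hp' : p ∈ Submodule.span ℂ s := hp
  clear hp
  induction hp' using Submodule.span_induction with
  | mem p hp => exact hs p hp
  | zero => rw [map_zero]; exact zero_mem _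
  | add a b _ _ ha hb => rw [map_add]; exact add_mem ha hb
  | smul c a _ ha => rw [L.map_smulₛₗ]; exact Submodule.smul_mem _ _ ha

theorem fst_image_graph (D : H →ₗ.[ℂ] H) :
    Prod.fst '' (D.graph : Set (H × H)) = D.domain := by
  ext x
  constructor
  · rintro ⟨⟨x, y⟩, h, rfl⟩
    exact LinearPMap.mem_domain_iff.mpr ⟨y, h⟩
  · intro h
    obtain ⟨y, hy⟩ := LinearPMap.mem_domain_iff.mp h
    exact ⟨(x, y), hy, rfl⟩

variable [CompleteSpace H]

theorem mem_adjoint_graph_iff {D : H →ₗ.[ℂ] H} (hd : Dense (D.domain : Set H)) {p : H × H} :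
    p ∈ D.adjoint.graph ↔ ∀ u v, (u, v) ∈ D.graph → ⟪v, p.1⟫_ℂ = ⟪u, p.2⟫_ℂ := by
  rw [LinearPMap.adjoint_graph_eq_graph_adjoint hd, Submodule.mem_adjoint_iff]
  simp only [sub_eq_zero]

/-- A densely defined operator is self-adjoint iff its graph is its own adjoint relation. -/
theorem isSelfAdjoint_iff_graph {D : H →ₗ.[ℂ] H} :
    IsSelfAdjoint D ↔ Dense (D.domain : Set H) ∧
      ∀ x y, (x, y) ∈ D.graph ↔ ∀ u v, (u, v) ∈ D.graph → ⟪v, x⟫_ℂ = ⟪u, y⟫_ℂ := by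
  constructor
  · intro h
    refine ⟨h.dense_domain, fun x y => ?_⟩
    conv_lhs => rw [← LinearPMap.isSelfAdjoint_def.mp h]
    exact mem_adjoint_graph_iff h.dense_domain
  · rintro ⟨hd, h⟩
    rw [LinearPMap.isSelfAdjoint_def]
    refine LinearPMap.eq_of_eq_graph (Submodule.ext fun p => ?_)
    rw [mem_adjoint_graph_iff hd, ← h]

theorem isSymmGraph_of_isSelfAdjoint {D : H →ₗ.[ℂ] H} (hD : IsSelfAdjoint D) :
    IsSymmGraph D.graph := fun p hp q hq =>
  ((isSelfAdjoint_iff_graph.mp hD).2 q.1 q.2).mp hq p.1 p.2 hp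

theorem isClosed_graph_of_isSelfAdjoint {D : H →ₗ.[ℂ] H} (hD : IsSelfAdjoint D) :
    IsClosed (D.graph : Set (H × H)) := hD.isClosed

end Graphs

/-! ### Operators with an eigenbasis of the square -/

section Eigenbasis

variable {H : Type*} [NormedAddCommGroup H] [InnerProductSpace ℂ H]

/-- `D² bᵢ = κᵢ bᵢ` for a Hilbert basis `b`. -/
def SquareDiagonal {ι : Type*} (D : H →ₗ.[ℂ] H) (b : HilbertBasis ι ℂ H) (κ : ι → ℝ) : Prop :=
  ∀ i, CompGraph D D (b i) ((κ i : ℂ) • b i)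

variable {ι : Type*} {D : H →ₗ.[ℂ] H} {b : HilbertBasis ι ℂ H} {κ : ι → ℝ}

theorem inner_self_ofReal (x : H) : ⟪x, x⟫_ℂ = ((‖x‖ ^ 2 : ℝ) : ℂ) := by
  rw [inner_self_eq_norm_sq_to_K]
  norm_cast

theorem summable_orthogonal_iff [CompleteSpace H] {c : ι → H}
    (hc : Pairwise fun i j => ⟪c i, c j⟫_ℂ = 0) :
    Summable c ↔ Summable fun i => ‖c i‖ ^ 2 := by
  have hV : OrthogonalFamily ℂ (fun i => (ℂ ∙ c i : Submodule ℂ H))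
      fun i => (ℂ ∙ c i : Submodule ℂ H).subtypeₗᵢ := by
    intro i j hij x y
    obtain ⟨a, ha⟩ := Submodule.mem_span_singleton.mp x.2
    obtain ⟨d, hd⟩ := Submodule.mem_span_singleton.mp y.2
    simp only [Submodule.coe_subtypeₗᵢ, Submodule.subtype_apply, ← ha, ← hd, inner_smul_left,
      inner_smul_right, hc hij, mul_zero]
  exact hV.summable_iff_norm_sq_summable fun i => ⟨c i, Submodule.mem_span_singleton_self _⟩

variable (hsym : IsSymmGraph D.graph)
include hsym

/-- Moving `D` across turns `⟪D bᵢ, D bⱼ⟫` into `⟪bᵢ, D² bⱼ⟫`. The vectors `c i = D bᵢ` are thus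
orthogonal with squared norms `κ i`, which is the source of all estimates below. -/
theorem inner_mid {c : ι → H}
    (hc : ∀ i, (b i, c i) ∈ D.graph ∧ (c i, (κ i : ℂ) • b i) ∈ D.graph) [DecidableEq ι] (i j : ι) :
    ⟪c i, c j⟫_ℂ = if i = j then (κ i : ℂ) else 0 := by
  rw [hsym _ (hc i).1 _ (hc j).2]
  change ⟪b i, (κ j : ℂ) • b j⟫_ℂ = _
  rw [inner_smul_right, orthonormal_iff_ite.mp b.orthonormal]
  split_ifs with h
  · rw [h, mul_one]
  · rw [mul_zero]

theorem SquareDiagonal.nonneg (hb : SquareDiagonal D b κ) (i : ι) : 0 ≤ κ i := by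
  classical
  choose c hc using hb
  have h := inner_mid hsym hc i i
  rw [if_pos rfl] at h
  have h2 := inner_self_ofReal (c i)
  rw [h] at h2
  have h3 : κ i = ‖c i‖ ^ 2 := by exact_mod_cast h2
  rw [h3]; positivity

variable [CompleteSpace H] (hcl : IsClosed (D.graph : Set (H × H)))

-- The series `∑ ⟪bᵢ, x⟫ D bᵢ` is orthogonal with squared norms `κᵢ |⟪bᵢ, x⟫|²`, so it converges;
-- closedness of the graph identifies its sum with `D x`.
include hcl in
theorem exists_mem_graph_of_summable {c : ι → H}
    (hc : ∀ i, (b i, c i) ∈ D.graph ∧ (c i, (κ i : ℂ) • b i) ∈ D.graph) {x : H}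
    (hx : Summable fun i => κ i * ‖⟪b i, x⟫_ℂ‖ ^ 2) :
    ∃ y, (x, y) ∈ D.graph ∧ HasSum (fun i => ⟪b i, x⟫_ℂ • c i) y := by
  classical
  have hin := inner_mid hsym hc
  have hs : Summable fun i => ⟪b i, x⟫_ℂ • c i := by
    refine (summable_orthogonal_iff ?_).mpr ?_
    · intro i j hij
      simp only [inner_smul_left, inner_smul_right, hin, if_neg hij, mul_zero]
    · convert! hx using 2 with i
      have h2 := inner_self_ofReal (c i)
      rw [hin, if_pos rfl] at h2
      have h3 : κ i = ‖c i‖ ^ 2 := by exact_mod_cast h2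
      rw [norm_smul, mul_pow, h3, mul_comm]
  obtain ⟨y, hy⟩ := hs
  refine ⟨y, ?_, hy⟩
  have h1 : HasSum (fun i => ⟪b i, x⟫_ℂ • b i) x := by
    simpa only [b.repr_apply_apply] using b.hasSum_repr x
  refine hcl.mem_of_tendsto (h1.prodMk_nhds hy) (Filter.Eventually.of_forall fun F => ?_)
  have : (∑ i ∈ F, ⟪b i, x⟫_ℂ • b i, ∑ i ∈ F, ⟪b i, x⟫_ℂ • c i) =
      ∑ i ∈ F, ⟪b i, x⟫_ℂ • (b i, c i) := by
    simp only [Prod.smul_mk, Prod.ext_iff, Prod.fst_sum, Prod.snd_sum, and_self]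
  change (∑ i ∈ F, ⟪b i, x⟫_ℂ • b i, ∑ i ∈ F, ⟪b i, x⟫_ℂ • c i) ∈ D.graph
  rw [this]
  exact Submodule.sum_mem _ fun i _ => Submodule.smul_mem _ _ (hc i).1

omit [CompleteSpace H] in
/-- Bessel's inequality for the orthogonal family `D bᵢ`. -/
theorem SquareDiagonal.summable_of_adjoint (hb : SquareDiagonal D b κ) {x y : H}
    (h : ∀ u v, (u, v) ∈ D.graph → ⟪v, x⟫_ℂ = ⟪u, y⟫_ℂ) :
    Summable fun i => κ i * ‖⟪b i, x⟫_ℂ‖ ^ 2 := by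
  classical
  have hnn := SquareDiagonal.nonneg hsym hb
  choose c hc using hb
  have hin := inner_mid hsym hc
  refine summable_of_sum_le (c := ‖y‖ ^ 2) (fun i => mul_nonneg (hnn i) (sq_nonneg _)) fun F => ?_
  have h1 : ∀ i, ⟪c i, y⟫_ℂ = κ i * ⟪b i, x⟫_ℂ := fun i => by
    rw [← h _ _ (hc i).2, inner_smul_left, Complex.conj_ofReal]
  have h2 : ⟪∑ i ∈ F, ⟪b i, x⟫_ℂ • c i, y⟫_ℂ = ((∑ i ∈ F, κ i * ‖⟪b i, x⟫_ℂ‖ ^ 2 : ℝ) : ℂ) := by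
    rw [sum_inner, Complex.ofReal_sum]
    refine Finset.sum_congr rfl fun i _ => ?_
    rw [inner_smul_left, h1]
    have := Complex.conj_mul' ⟪b i, x⟫_ℂ
    push_cast
    linear_combination (κ i : ℂ) * this
  have h3 : ⟪∑ i ∈ F, ⟪b i, x⟫_ℂ • c i, ∑ i ∈ F, ⟪b i, x⟫_ℂ • c i⟫_ℂ =
      ((∑ i ∈ F, κ i * ‖⟪b i, x⟫_ℂ‖ ^ 2 : ℝ) : ℂ) := by
    rw [sum_inner, Complex.ofReal_sum]
    refine Finset.sum_congr rfl fun i hi => ?_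
    rw [inner_sum, Finset.sum_eq_single i]
    · rw [inner_smul_left, inner_smul_right, hin, if_pos rfl]
      have := Complex.conj_mul' ⟪b i, x⟫_ℂ
      push_cast
      linear_combination (κ i : ℂ) * this
    · intro j _ hj
      rw [inner_smul_left, inner_smul_right, hin, if_neg hj.symm, mul_zero, mul_zero]
    · exact fun h => absurd hi h
  set S := ∑ i ∈ F, κ i * ‖⟪b i, x⟫_ℂ‖ ^ 2
  set w := ∑ i ∈ F, ⟪b i, x⟫_ℂ • c i
  have h4 : S = ‖w‖ ^ 2 := by
    have := inner_self_ofReal w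
    rw [h3] at this
    exact_mod_cast this
  have h5 : S ≤ ‖w‖ * ‖y‖ := by
    have := norm_inner_le_norm (𝕜 := ℂ) w y
    rw [h2, Complex.norm_real, Real.norm_eq_abs] at this
    exact (le_abs_self _).trans this
  -- From `S = ‖w‖²` and `S ≤ ‖w‖ ‖y‖ ≤ (S + ‖y‖²) / 2` one gets `S ≤ ‖y‖²`.
  nlinarith [sq_nonneg (‖w‖ - ‖y‖)]

-- A vector in the domain of the adjoint has summable coefficients by Bessel's inequality, hence
-- lies in the domain of the closed operator; the two values agree when paired with the dense
-- domain.
include hcl in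
theorem SquareDiagonal.isSelfAdjoint (hb : SquareDiagonal D b κ) : IsSelfAdjoint D := by
  have hb' := hb
  choose c hc using hb
  have hdom : Dense (D.domain : Set H) := by
    have h1 := b.dense_span
    rw [← Submodule.dense_iff_topologicalClosure_eq_top] at h1
    refine h1.mono ?_
    refine SetLike.coe_subset_coe.mpr (Submodule.span_le.mpr ?_)
    rintro _ ⟨i, rfl⟩
    exact LinearPMap.mem_domain_iff.mpr ⟨_, (hc i).1⟩
  refine isSelfAdjoint_iff_graph.mpr ⟨hdom, fun x y => ⟨fun h u v huv => hsym _ huv _ h, fun h => ?_⟩⟩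
  obtain ⟨z, hz, -⟩ := exists_mem_graph_of_summable hsym hcl hc
    (SquareDiagonal.summable_of_adjoint hsym hb' h)
  have : y - z = 0 := by
    refine hdom.eq_zero_of_inner_left ℂ fun u hu => ?_
    obtain ⟨v, hv⟩ := LinearPMap.mem_domain_iff.mp hu
    have h1 : ⟪v, x⟫_ℂ = ⟪u, z⟫_ℂ := hsym _ hv _ hz
    rw [inner_sub_left, ← inner_conj_symm y, ← inner_conj_symm z, ← h _ _ hv, h1, sub_self]
  rwa [sub_eq_zero.mp this]

-- The criterion involves only `b` and `κ`: two closed symmetric operators whose squares are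
-- diagonalised in the same way have the same domain. This is how `𝔇` and `𝔇̄` are compared.
include hcl in
theorem SquareDiagonal.mem_domain_iff (hb : SquareDiagonal D b κ) {x : H} :
    x ∈ D.domain ↔ Summable fun i => κ i * ‖⟪b i, x⟫_ℂ‖ ^ 2 := by
  have hb' := hb
  choose c hc using hb
  constructor
  · intro hx
    obtain ⟨y, hy⟩ := LinearPMap.mem_domain_iff.mp hx
    exact SquareDiagonal.summable_of_adjoint hsym hb' fun u v huv => hsym _ huv _ hy
  · intro hx
    obtain ⟨y, hy, -⟩ := exists_mem_graph_of_summable hsym hcl hc hx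
    exact LinearPMap.mem_domain_iff.mpr ⟨y, hy⟩

include hcl in
/-- The square of `D`, with its natural domain, is the diagonal operator with entries `κ`. -/
theorem SquareDiagonal.compGraph_iff (hb : SquareDiagonal D b κ) {x z : H} :
    CompGraph D D x z ↔ ∀ i, ⟪b i, z⟫_ℂ = κ i * ⟪b i, x⟫_ℂ := by
  have hb' := hb
  choose c hc using hb
  constructor
  · rintro ⟨y, hxy, hyz⟩ i
    have h1 : ⟪c i, y⟫_ℂ = ⟪b i, z⟫_ℂ := hsym _ (hc i).1 _ hyz
    have h2 : ⟪(κ i : ℂ) • b i, x⟫_ℂ = ⟪c i, y⟫_ℂ := hsym _ (hc i).2 _ hxy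
    rw [← h1, ← h2, inner_smul_left, Complex.conj_ofReal]
  · intro h
    have hnn := SquareDiagonal.nonneg hsym hb'
    have hsx : ∀ w : H, Summable fun i => ‖⟪b i, w⟫_ℂ‖ ^ 2 := fun w => by
      refine (b.summable_inner_mul_inner w w).norm.congr fun i => ?_
      rw [norm_mul, norm_inner_symm, sq]
    -- Because `κ ≤ 1 + κ²`, square summability of the coefficients of `x` and of `z = (κᵢ xᵢ)`
    -- already puts `x` into the domain of `D`.
    have hs : Summable fun i => κ i * ‖⟪b i, x⟫_ℂ‖ ^ 2 := by
      refine Summable.of_nonneg_of_le (fun i => mul_nonneg (hnn i) (sq_nonneg _)) (fun i => ?_)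
        ((hsx x).add (hsx z))
      rw [h i, norm_mul, Complex.norm_real, Real.norm_of_nonneg (hnn i)]
      nlinarith [sq_nonneg (‖⟪b i, x⟫_ℂ‖), sq_nonneg ((κ i - 1) * ‖⟪b i, x⟫_ℂ‖),
        mul_nonneg (hnn i) (sq_nonneg ‖⟪b i, x⟫_ℂ‖)]
    obtain ⟨y, hy, hys⟩ := exists_mem_graph_of_summable hsym hcl hc hs
    refine ⟨y, hy, ?_⟩
    have h1 : HasSum (fun i => ⟪b i, z⟫_ℂ • b i) z := by
      simpa only [b.repr_apply_apply] using b.hasSum_repr z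
    refine hcl.mem_of_tendsto (hys.prodMk_nhds h1) (Filter.Eventually.of_forall fun F => ?_)
    have : (∑ i ∈ F, ⟪b i, x⟫_ℂ • c i, ∑ i ∈ F, ⟪b i, z⟫_ℂ • b i) =
        ∑ i ∈ F, ⟪b i, x⟫_ℂ • (c i, (κ i : ℂ) • b i) := by
      simp only [Prod.smul_mk, Prod.ext_iff, Prod.fst_sum, Prod.snd_sum, true_and, h, smul_smul,
        mul_comm]
    change (∑ i ∈ F, ⟪b i, x⟫_ℂ • c i, ∑ i ∈ F, ⟪b i, z⟫_ℂ • b i) ∈ D.graph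
    rw [this]
    exact Submodule.sum_mem _ fun i _ => Submodule.smul_mem _ _ (hc i).2

end Eigenbasis

end SpectralData

namespace SpectralData

/-! ### The heat semigroup of an operator with an eigenbasis -/

section HeatOfEigenbasis

open InnerProductSpace Filter Topology ComplexOrder

variable {H : Type*} [NormedAddCommGroup H] [InnerProductSpace ℂ H]
  {ι : Type*} {D : H →ₗ.[ℂ] H} {b : HilbertBasis ι ℂ H} {κ : ι → ℝ}

theorem hasSum_norm_inner_sq (b : HilbertBasis ι ℂ H) (x : H) :
    HasSum (fun i => ‖⟪b i, x⟫_ℂ‖ ^ 2) (‖x‖ ^ 2) := by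
  have h := b.hasSum_inner_mul_inner x x
  rw [inner_self_ofReal] at h
  refine Complex.hasSum_ofReal.mp (h.congr_fun fun i => ?_)
  rw [← inner_conj_symm x (b i), Complex.conj_mul']
  push_cast
  rfl

theorem hilbertBasis_ext (b : HilbertBasis ι ℂ H) {x y : H} (h : ∀ i, ⟪b i, x⟫_ℂ = ⟪b i, y⟫_ℂ) :
    x = y := by
  rw [← sub_eq_zero, ← norm_eq_zero, ← sq_eq_zero_iff]
  refine (hasSum_norm_inner_sq b (x - y)).unique ?_
  simp [h, hasSum_zero]

theorem hasSum_inner_single (b : HilbertBasis ι ℂ H) {f : ι → ℂ} {y : H}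
    (h : HasSum (fun i => f i • b i) y) (i : ι) : ⟪b i, y⟫_ℂ = f i := by
  classical
  have h1 := (innerSL ℂ (b i)).hasSum h
  have h2 : HasSum (fun j => innerSL ℂ (b i) (f j • b j)) (f i) := by
    convert! hasSum_ite_eq i (f i) using 2 with j
    rw [innerSL_apply_apply, inner_smul_right, orthonormal_iff_ite.mp b.orthonormal]
    by_cases hj : j = i
    · subst hj; simp
    · rw [if_neg hj, if_neg (Ne.symm hj), mul_zero]
  exact h1.unique h2

variable [CompleteSpace H]

/-- The diagonal operator `∑ exp (- t κᵢ) |bᵢ⟩⟨bᵢ|`. -/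
def heatOp (b : HilbertBasis ι ℂ H) (κ : ι → ℝ) (t : ℝ) : H →L[ℂ] H :=
  ∑' i, (Real.exp (-t * κ i) : ℂ) • rankOne ℂ (b i) (b i)

theorem summable_heatOp {t : ℝ} (hs : Summable fun i => Real.exp (-t * κ i)) :
    Summable fun i => (Real.exp (-t * κ i) : ℂ) • rankOne ℂ (b i) (b i) := by
  refine Summable.of_norm (hs.congr fun i => ?_)
  rw [norm_smul, norm_rankOne, b.orthonormal.1, one_mul, mul_one, Complex.norm_real,
    Real.norm_of_nonneg (Real.exp_nonneg _)]

theorem hasSum_heatOp_apply {t : ℝ} (hs : Summable fun i => Real.exp (-t * κ i)) (x : H) :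
    HasSum (fun i => (Real.exp (-t * κ i) : ℂ) • ⟪b i, x⟫_ℂ • b i) (heatOp b κ t x) := by
  have h0 : HasSum (fun i => (Real.exp (-t * κ i) : ℂ) • rankOne ℂ (b i) (b i)) (heatOp b κ t) :=
    (summable_heatOp hs).hasSum
  have h1 := (ContinuousLinearMap.apply ℂ H x).hasSum h0
  simpa only [ContinuousLinearMap.apply_apply, _root_.smul_apply, rankOne_apply] using h1

theorem inner_heatOp {t : ℝ} (hs : Summable fun i => Real.exp (-t * κ i)) (x : H) (i : ι) :
    ⟪b i, heatOp b κ t x⟫_ℂ = Real.exp (-t * κ i) * ⟪b i, x⟫_ℂ := by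
  have h := hasSum_heatOp_apply (b := b) hs x
  simp only [smul_smul] at h
  exact hasSum_inner_single b h i

theorem heatOp_isPositive {t : ℝ} (hs : Summable fun i => Real.exp (-t * κ i)) :
    (heatOp b κ t).IsPositive := by
  have h : ∀ x y, HasSum (fun i => (Real.exp (-t * κ i) : ℂ) * (⟪x, b i⟫_ℂ * ⟪b i, y⟫_ℂ))
      ⟪x, heatOp b κ t y⟫_ℂ := fun x y => by
    convert! (innerSL ℂ x).hasSum (hasSum_heatOp_apply (b := b) hs y) using 2 with i
    simp only [innerSL_apply_apply, inner_smul_right]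
    ring
  have hsym : ((heatOp b κ t : H →L[ℂ] H) : H →ₗ[ℂ] H).IsSymmetric := by
    intro x y
    change ⟪heatOp b κ t x, y⟫_ℂ = ⟪x, heatOp b κ t y⟫_ℂ
    refine HasSum.unique (f := fun i => (Real.exp (-t * κ i) : ℂ) * (⟪x, b i⟫_ℂ * ⟪b i, y⟫_ℂ))
      ?_ (h x y)
    rw [← inner_conj_symm]
    convert! (Complex.hasSum_conj'.mpr (h y x)) using 2 with i
    simp only [map_mul, inner_conj_symm, Complex.conj_ofReal]
    ring
  refine (ContinuousLinearMap.isPositive_iff _).mpr ⟨hsym, fun x => ?_⟩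
  have h1 : ⟪heatOp b κ t x, x⟫_ℂ = ⟪x, heatOp b κ t x⟫_ℂ := hsym x x
  rw [h1]
  refine (h x x).nonneg fun i => ?_
  rw [← inner_conj_symm x (b i), Complex.conj_mul']
  have : (0 : ℝ) ≤ Real.exp (-t * κ i) * ‖⟪b i, x⟫_ℂ‖ ^ 2 := by positivity
  exact_mod_cast this

theorem isTraceClass_heatOp {t : ℝ} (hs : Summable fun i => Real.exp (-t * κ i)) :
    IsTraceClass (heatOp b κ t) := by
  -- `IsTraceClass` asks for a basis indexed by a subset of `H`, so `b` is reindexed by its own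
  -- range.
  have hsp : ⊤ ≤ (Submodule.span ℂ (Set.range ((↑) : Set.range b → H))).topologicalClosure := by
    rw [Subtype.range_coe]; exact b.dense_span.ge
  refine ⟨Set.range b, HilbertBasis.mk b.orthonormal.toSubtypeRange hsp, ?_⟩
  have habs : CFC.abs (heatOp b κ t) = heatOp b κ t :=
    CFC.abs_of_nonneg _ ((ContinuousLinearMap.nonneg_iff_isPositive _).mpr (heatOp_isPositive hs))
  have hinj : Function.Injective b := b.orthonormal.linearIndependent.injective
  refine (Equiv.summable_iff (Equiv.ofInjective b hinj)).mp (hs.congr fun i => ?_)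
  simp only [HilbertBasis.coe_mk, habs, Function.comp_apply, Equiv.ofInjective_apply]
  rw [inner_heatOp hs, inner_self_ofReal, b.orthonormal.1, one_pow, Complex.ofReal_one, mul_one,
    Complex.ofReal_re]

/-- By Parseval the squared distance to `x` is `∑ |exp(-t κᵢ) - 1|² |xᵢ|²`, and dominated
convergence applies since the first factor is at most `1`. -/
theorem tendsto_heatOp_zero (hκ : ∀ i, 0 ≤ κ i)
    (hs : ∀ t > 0, Summable fun i => Real.exp (-t * κ i)) (x : H) :
    Tendsto (fun t => heatOp b κ t x) (𝓝[>] 0) (𝓝 x) := by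
  rw [tendsto_iff_norm_sub_tendsto_zero]
  have key : Tendsto (fun t => ∑' i, ‖⟪b i, heatOp b κ t x - x⟫_ℂ‖ ^ 2) (𝓝[>] 0)
      (𝓝 (∑' _ : ι, (0 : ℝ))) := by
    refine tendsto_tsum_of_dominated_convergence (hasSum_norm_inner_sq b x).summable
      (fun i => ?_) ?_
    · have h1 : Tendsto (fun t : ℝ => ‖(Real.exp (-t * κ i) - 1 : ℂ) * ⟪b i, x⟫_ℂ‖ ^ 2) (𝓝[>] 0)
          (𝓝 0) := by
        have : ContinuousAt (fun t : ℝ => ‖(Real.exp (-t * κ i) - 1 : ℂ) * ⟪b i, x⟫_ℂ‖ ^ 2) 0 := by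
          fun_prop
        have h2 := this.tendsto.mono_left (nhdsWithin_le_nhds (s := Set.Ioi 0))
        simpa using h2
      refine h1.congr' ?_
      filter_upwards [self_mem_nhdsWithin] with t ht
      rw [inner_sub_right, inner_heatOp (hs t ht), sub_mul, one_mul]
    · filter_upwards [self_mem_nhdsWithin] with t ht i
      have h1 : Real.exp (-t * κ i) ≤ 1 := by
        rw [Real.exp_le_one_iff]
        have : 0 ≤ t * κ i := mul_nonneg (le_of_lt ht) (hκ i)
        linarith
      have h2 := Real.exp_pos (-t * κ i)
      have h3 : ⟪b i, heatOp b κ t x - x⟫_ℂ = ((Real.exp (-t * κ i) - 1 : ℝ) : ℂ) * ⟪b i, x⟫_ℂ := by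
        rw [inner_sub_right, inner_heatOp (hs t ht)]
        push_cast
        ring
      rw [Real.norm_of_nonneg (sq_nonneg _), h3, norm_mul, mul_pow, Complex.norm_real]
      have h4 : ‖Real.exp (-t * κ i) - 1‖ ^ 2 ≤ 1 := by
        rw [Real.norm_eq_abs, sq_abs]
        nlinarith
      nlinarith [sq_nonneg ‖⟪b i, x⟫_ℂ‖]
  simp only [tsum_zero] at key
  have h2 := key.sqrt
  rw [Real.sqrt_zero] at h2
  refine h2.congr fun t => ?_
  rw [(hasSum_norm_inner_sq b _).tsum_eq, Real.sqrt_sq (norm_nonneg _)]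

/-- The series is differentiated term by term on the half-line `(t/2, ∞)`, where the derivatives
have a summable majorant independent of the time. -/
theorem hasDerivAt_heatOp (hκ : ∀ i, 0 ≤ κ i)
    (hs : ∀ t > 0, Summable fun i => Real.exp (-t * κ i)) (x : H) {t : ℝ} (ht : 0 < t) :
    ∃ z, (∀ i, ⟪b i, z⟫_ℂ = κ i * ⟪b i, heatOp b κ t x⟫_ℂ) ∧
      HasDerivAt (fun s => heatOp b κ s x) (-z) t := by
  -- For `s > t/2` the exponential is at most the square of `exp(-t κ / 4)`. One of these two
  -- factors absorbs `κ`, through `κ t / 4 ≤ exp(t κ / 4)`; the other is summable by hypothesis at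
  -- time `t / 4`.
  have hu : Summable fun i => ‖x‖ * (4 / t) * Real.exp (-(t / 4) * κ i) :=
    (hs (t / 4) (by positivity)).mul_left _
  let g : ι → ℝ → H := fun i s => (Real.exp (-s * κ i) : ℂ) • ⟪b i, x⟫_ℂ • b i
  let g' : ι → ℝ → H := fun i s => (-(κ i * Real.exp (-s * κ i) : ℝ) : ℂ) • ⟪b i, x⟫_ℂ • b i
  have hg : ∀ i, ∀ s ∈ Set.Ioi (t / 2), HasDerivAt (g i) (g' i s) s := fun i s _ => by
    have h1 : HasDerivAt (fun s : ℝ => Real.exp (-s * κ i)) (-(κ i * Real.exp (-s * κ i))) s := by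
      have := ((hasDerivAt_id s).neg.mul_const (κ i)).exp
      convert! this using 1
      simp only [Pi.neg_apply, id_eq]
      ring
    have h2 := h1.ofReal_comp.smul_const (⟪b i, x⟫_ℂ • b i)
    simpa [g, g'] using h2
  have hg' : ∀ i, ∀ s ∈ Set.Ioi (t / 2), ‖g' i s‖ ≤
      ‖x‖ * (4 / t) * Real.exp (-(t / 4) * κ i) := fun i s hst => by
    have hst' : t / 2 < s := hst
    have h1 : ‖⟪b i, x⟫_ℂ‖ ≤ ‖x‖ := by
      simpa [b.orthonormal.1] using norm_inner_le_norm (𝕜 := ℂ) (b i) x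
    have h2 : κ i * Real.exp (-s * κ i) ≤ (4 / t) * Real.exp (-(t / 4) * κ i) := by
      have h3 : κ i * (t / 4) ≤ Real.exp (t / 4 * κ i) := by
        have := Real.add_one_le_exp (t / 4 * κ i)
        linarith
      have h4 : Real.exp (-s * κ i) ≤ Real.exp (-(t / 4) * κ i) * Real.exp (-(t / 4) * κ i) := by
        rw [← Real.exp_add, Real.exp_le_exp]
        nlinarith [hκ i]
      have h5 : Real.exp (t / 4 * κ i) * Real.exp (-(t / 4) * κ i) = 1 := by
        rw [← Real.exp_add]; simp
      have h6 := Real.exp_pos (-(t / 4) * κ i)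
      calc κ i * Real.exp (-s * κ i)
          ≤ κ i * (Real.exp (-(t / 4) * κ i) * Real.exp (-(t / 4) * κ i)) :=
            mul_le_mul_of_nonneg_left h4 (hκ i)
        _ = (4 / t) * (κ i * (t / 4)) * (Real.exp (-(t / 4) * κ i) * Real.exp (-(t / 4) * κ i)) := by
            field_simp
        _ ≤ (4 / t) * Real.exp (t / 4 * κ i) *
              (Real.exp (-(t / 4) * κ i) * Real.exp (-(t / 4) * κ i)) := by gcongr
        _ = (4 / t) * (Real.exp (t / 4 * κ i) * Real.exp (-(t / 4) * κ i)) *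
              Real.exp (-(t / 4) * κ i) := by ring
        _ = _ := by rw [h5, mul_one]
    have h7 : 0 ≤ κ i * Real.exp (-s * κ i) := mul_nonneg (hκ i) (Real.exp_nonneg _)
    change ‖(-(κ i * Real.exp (-s * κ i) : ℝ) : ℂ) • ⟪b i, x⟫_ℂ • b i‖ ≤ _
    rw [norm_smul, norm_smul, b.orthonormal.1, mul_one, norm_neg, Complex.norm_real,
      Real.norm_of_nonneg h7]
    calc _ ≤ (4 / t) * Real.exp (-(t / 4) * κ i) * ‖x‖ := by gcongr
      _ = _ := by ring
  have htm : t ∈ Set.Ioi (t / 2) := by simp only [Set.mem_Ioi]; linarith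
  have hd := hasDerivAt_tsum_of_isPreconnected hu isOpen_Ioi isPreconnected_Ioi hg hg' htm
    (hasSum_heatOp_apply (hs t ht) x).summable htm
  refine ⟨-∑' i, g' i t, fun i => ?_, ?_⟩
  · have hsum : Summable fun i => g' i t :=
      Summable.of_norm_bounded hu fun i => hg' i t htm
    have h1 : HasSum (fun i => ((-(κ i * Real.exp (-t * κ i) : ℝ) : ℂ) * ⟪b i, x⟫_ℂ) • b i)
        (∑' i, g' i t) := by
      convert! hsum.hasSum using 2 with i
      simp only [g', smul_smul]
    rw [inner_neg_right, hasSum_inner_single b h1, inner_heatOp (hs t ht)]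
    push_cast
    ring
  · rw [neg_neg]
    refine hd.congr_of_eventuallyEq ?_
    filter_upwards [lt_mem_nhds ht] with s hst
    exact (hasSum_heatOp_apply (hs s hst) x).tsum_eq.symm

/-- With `exists_squareDiagonal`, this makes the trace class condition for a self-adjoint operator
equivalent to an eigenbasis of its square with summable exponentials, a form that passes easily to
tensor products and along unitaries. -/
theorem SquareDiagonal.heatTraceClass (hb : SquareDiagonal D b κ) (hsym : IsSymmGraph D.graph)
    (hcl : IsClosed (D.graph : Set (H × H)))
    (hs : ∀ t > 0, Summable fun i => Real.exp (-t * κ i)) : HeatTraceClass D := by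
  have hκ := SquareDiagonal.nonneg hsym hb
  refine ⟨heatOp b κ, ⟨tendsto_heatOp_zero hκ hs, fun x t ht => ?_⟩,
    fun t ht => isTraceClass_heatOp (hs t ht)⟩
  obtain ⟨z, hz, hd⟩ := hasDerivAt_heatOp (b := b) hκ hs x ht
  exact ⟨z, (SquareDiagonal.compGraph_iff hsym hcl hb).mpr hz, hd⟩

end HeatOfEigenbasis

end SpectralData

namespace SpectralData

/-! ### Hilbert–Schmidt operators -/

section HilbertSchmidt

open InnerProductSpace Filter Topology

variable {H : Type*} [NormedAddCommGroup H] [InnerProductSpace ℂ H] [CompleteSpace H]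

/-- A symmetric operator that is Hilbert–Schmidt in a basis is compact. -/
theorem isCompactOperator_of_summable {ι : Type*} (c : HilbertBasis ι ℂ H) (A : H →L[ℂ] H)
    (hA : (A : H →ₗ[ℂ] H).IsSymmetric) (hs : Summable fun j => ‖A (c j)‖ ^ 2) :
    IsCompactOperator A := by
  classical
  -- By symmetry of `A`, `F s` is `A` followed by the projection onto the span of the `c j`, `j ∈
  -- s`. The tail of the Hilbert–Schmidt sum bounds `‖F s - A‖²`, so `A` is a norm limit of finite
  -- rank operators.
  let F : Finset ι → H →L[ℂ] H := fun s => ∑ j ∈ s, rankOne ℂ (c j) (A (c j))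
  have hF : ∀ s, IsCompactOperator (F s) := fun s => by
    induction s using Finset.induction_on with
    | empty => simpa [F] using isCompactOperator_zero
    | insert j s hj ih =>
      have h1 : F (insert j s) = rankOne ℂ (c j) (A (c j)) + F s := Finset.sum_insert hj
      rw [h1]
      refine IsCompactOperator.add ?_ ih
      rw [rankOne_def']
      have h2 : IsCompactOperator (innerSL ℂ (A (c j))) :=
        isCompactOperator_of_locallyCompactSpace_dom _
      exact h2.clm_comp (ContinuousLinearMap.toSpanSingleton ℂ (c j))
  refine isCompactOperator_of_tendsto (l := atTop) (F := F) ?_ (Eventually.of_forall hF)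
  rw [tendsto_iff_norm_sub_tendsto_zero]
  have h0 := (tendsto_tsum_compl_atTop_zero fun j => ‖A (c j)‖ ^ 2).sqrt
  rw [Real.sqrt_zero] at h0
  refine squeeze_zero (fun _ => norm_nonneg _) (fun s => ?_) h0
  refine ContinuousLinearMap.opNorm_le_bound _ (Real.sqrt_nonneg _) fun x => ?_
  have hcoef : ∀ i, ⟪c i, (F s - A) x⟫_ℂ = if i ∈ s then 0 else -⟪A (c i), x⟫_ℂ := fun i => by
    have h1 : ⟪c i, A x⟫_ℂ = ⟪A (c i), x⟫_ℂ := (hA (c i) x).symm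
    rw [_root_.sub_apply, inner_sub_right, h1]
    simp only [F, _root_.sum_apply, rankOne_apply, inner_sum, inner_smul_right,
      orthonormal_iff_ite.mp c.orthonormal, mul_ite, mul_one, mul_zero, Finset.sum_ite_eq]
    split_ifs <;> simp
  have h2 := hasSum_norm_inner_sq c ((F s - A) x)
  have h3 : Summable fun j : {j // j ∉ s} => ‖A (c j)‖ ^ 2 := hs.subtype _
  have h4 : ‖(F s - A) x‖ ^ 2 ≤ (∑' j : {j // j ∉ s}, ‖A (c j)‖ ^ 2) * ‖x‖ ^ 2 := by
    rw [← h2.tsum_eq, ← tsum_mul_right]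
    have h5 : Function.support (fun i => ‖⟪c i, (F s - A) x⟫_ℂ‖ ^ 2) ⊆ {j | j ∉ s} := by
      intro i hi
      by_contra h
      have h6 := hcoef i
      rw [if_pos (not_not.mp h)] at h6
      exact hi (by simp only [h6, norm_zero, zero_pow two_ne_zero])
    rw [← tsum_subtype_eq_of_support_subset h5]
    refine Summable.tsum_le_tsum (fun j => ?_) (h2.summable.subtype _) (h3.mul_right _)
    rw [hcoef, if_neg j.2, norm_neg, ← mul_pow]
    exact pow_le_pow_left₀ (norm_nonneg _) (norm_inner_le_norm _ _) 2
  have h5 := Real.sqrt_le_sqrt h4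
  rwa [Real.sqrt_sq (norm_nonneg _), Real.sqrt_mul (tsum_nonneg fun _ => sq_nonneg _),
    Real.sqrt_sq (norm_nonneg _)] at h5

omit [CompleteSpace H] in
/-- The Hilbert–Schmidt condition does not depend on the basis. -/
theorem summable_norm_sq_of_summable {ι ι' : Type*} (c : HilbertBasis ι ℂ H)
    (b : HilbertBasis ι' ℂ H) (A : H →L[ℂ] H) (hA : (A : H →ₗ[ℂ] H).IsSymmetric)
    (hs : Summable fun j => ‖A (c j)‖ ^ 2) : Summable fun i => ‖A (b i)‖ ^ 2 := by
  -- The double sum of `|⟪b i, A (c j)⟫|²` is evaluated in both orders: summing over `i` first gives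
  -- the norm in the basis `c`, summing over `j` first the norm in the basis `b`.
  have h1 : Summable fun p : ι × ι' => ‖⟪b p.2, A (c p.1)⟫_ℂ‖ ^ 2 := by
    refine (summable_prod_of_nonneg fun _ => sq_nonneg _).mpr
      ⟨fun j => (hasSum_norm_inner_sq b (A (c j))).summable, hs.congr fun j => ?_⟩
    exact (hasSum_norm_inner_sq b (A (c j))).tsum_eq.symm
  have h2 := ((Equiv.prodComm ι' ι).summable_iff.mpr h1)
  have h3 := ((summable_prod_of_nonneg fun _ => sq_nonneg _).mp h2).2
  refine h3.congr fun i => ?_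
  rw [← (hasSum_norm_inner_sq c (A (b i))).tsum_eq]
  refine tsum_congr fun j => ?_
  have h4 : ⟪c j, A (b i)⟫_ℂ = ⟪A (c j), b i⟫_ℂ := (hA (c j) (b i)).symm
  change ‖⟪b i, A (c j)⟫_ℂ‖ ^ 2 = _
  rw [h4, norm_inner_symm]

/-- A compact symmetric operator has a Hilbert basis of eigenvectors. -/
theorem exists_hilbertBasis_eigenvectors {H : Type v} [NormedAddCommGroup H]
    [InnerProductSpace ℂ H] [CompleteSpace H] (T : H →L[ℂ] H) (hT : IsCompactOperator T)
    (hsym : (T : H →ₗ[ℂ] H).IsSymmetric) :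
    ∃ (ι : Type v) (b : HilbertBasis ι ℂ H) (μ : ι → ℂ), ∀ i, T (b i) = μ i • b i := by
  have hcl : ∀ μ : ℂ, CompleteSpace (Module.End.eigenspace (T : H →ₗ[ℂ] H) μ) := fun μ => by
    have : IsClosed (Module.End.eigenspace (T : H →ₗ[ℂ] H) μ : Set H) := by
      have h : (Module.End.eigenspace (T : H →ₗ[ℂ] H) μ : Set H) = {x | T x = μ • x} := by
        ext x
        exact Module.End.mem_eigenspace_iff
      rw [h]
      exact isClosed_eq T.continuous (continuous_const_smul μ)
    exact this.completeSpace_coe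
  choose w β hβ using fun μ : ℂ =>
    exists_hilbertBasis ℂ (Module.End.eigenspace (T : H →ₗ[ℂ] H) μ)
  have hon := hsym.orthogonalFamily_eigenspaces.orthonormal_sigma_orthonormal
    fun μ => (β μ).orthonormal
  refine ⟨Σ μ, w μ, HilbertBasis.mkOfOrthogonalEqBot hon ?_, fun a => a.1, fun a => ?_⟩
  · rw [eq_bot_iff, ← ContinuousLinearMap.orthogonalComplement_iSup_eigenspaces_eq_bot hT hsym]
    intro x hx
    rw [← Submodule.iInf_orthogonal, Submodule.mem_iInf]
    intro μ y hy
    have hx' : ∀ i, ⟪((β μ i : Module.End.eigenspace (T : H →ₗ[ℂ] H) μ) : H), x⟫_ℂ = 0 :=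
      fun i => hx _ (Submodule.subset_span ⟨⟨μ, i⟩, rfl⟩)
    have h1 := ((Module.End.eigenspace (T : H →ₗ[ℂ] H) μ).subtypeL).hasSum
      ((β μ).hasSum_repr ⟨y, hy⟩)
    have h2 := (innerSL ℂ x).hasSum h1
    have h3 : (innerSL ℂ x) y = 0 := by
      refine h2.unique ?_
      convert! hasSum_zero using 2 with i
      have h4 : ⟪x, ((β μ i : Module.End.eigenspace (T : H →ₗ[ℂ] H) μ) : H)⟫_ℂ = 0 :=
        inner_eq_zero_symm.mp (hx' i)
      simp [h4]
    exact inner_eq_zero_symm.mp h3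
  · rw [HilbertBasis.coe_mkOfOrthogonalEqBot]
    exact Module.End.mem_eigenspace_iff.mp (β a.1 a.2).2

end HilbertSchmidt

/-! ### The eigenbasis of an operator with a trace class heat semigroup -/

section EigenbasisOfHeat

open Filter Topology

variable {H : Type*} [NormedAddCommGroup H] [InnerProductSpace ℂ H] {D : H →ₗ.[ℂ] H}

theorem CompGraph.smul {S T : H →ₗ.[ℂ] H} {x z : H} (c : ℂ) (h : CompGraph S T x z) :
    CompGraph S T (c • x) (c • z) := by
  obtain ⟨y, h1, h2⟩ := h
  exact ⟨c • y, T.graph.smul_mem c h1, S.graph.smul_mem c h2⟩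

theorem CompGraph.sub {S T : H →ₗ.[ℂ] H} {x z x' z' : H} (h : CompGraph S T x z)
    (h' : CompGraph S T x' z') : CompGraph S T (x - x') (z - z') := by
  obtain ⟨y, h1, h2⟩ := h
  obtain ⟨y', h1', h2'⟩ := h'
  exact ⟨y - y', T.graph.sub_mem h1 h1', S.graph.sub_mem h2 h2'⟩

/-- A solution of the heat equation of `D` on the positive half-line. -/
def IsHeatSolution (D : H →ₗ.[ℂ] H) (f : ℝ → H) : Prop :=
  ∀ t > 0, ∃ z, CompGraph D D (f t) z ∧ HasDerivAt f (-z) t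

theorem IsHeatSolution.continuousAt {f : ℝ → H} (hf : IsHeatSolution D f) {t : ℝ} (ht : 0 < t) :
    ContinuousAt f t := by
  obtain ⟨z, -, h⟩ := hf t ht
  exact h.continuousAt

variable (hsym : IsSymmGraph D.graph)
include hsym

theorem inner_compGraph {x z x' z' : H} (h : CompGraph D D x z) (h' : CompGraph D D x' z') :
    ⟪z, x'⟫_ℂ = ⟪x, z'⟫_ℂ := by
  obtain ⟨y, h1, h2⟩ := h
  obtain ⟨y', h1', h2'⟩ := h'
  exact (hsym _ h2 _ h1').trans (hsym _ h1 _ h2')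

theorem inner_compGraph_nonneg {x z : H} (h : CompGraph D D x z) : 0 ≤ (⟪x, z⟫_ℂ).re := by
  obtain ⟨y, h1, h2⟩ := h
  have h3 : ⟪y, y⟫_ℂ = ⟪x, z⟫_ℂ := hsym _ h1 _ h2
  rw [← h3, inner_self_ofReal, Complex.ofReal_re]
  positivity

/-- Energy estimate: the derivative of `‖f‖²` is `-2 Re ⟪f, D² f⟫ = -2 ‖D f‖²`. -/
theorem IsHeatSolution.antitoneOn {f : ℝ → H} (hf : IsHeatSolution D f) :
    AntitoneOn (fun t => ‖f t‖ ^ 2) (Set.Ioi 0) := by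
  have key : ∀ t ∈ Set.Ioi (0 : ℝ), ∃ d ≤ 0, HasDerivAt (fun t => ‖f t‖ ^ 2) d t := by
    intro t ht
    obtain ⟨z, hz, hd⟩ := hf t ht
    have h1 := Complex.reCLM.hasFDerivAt.comp_hasDerivAt t (hd.inner ℂ hd)
    have h2 : (fun t => ‖f t‖ ^ 2) = Complex.reCLM ∘ fun t => ⟪f t, f t⟫_ℂ := by
      ext s
      simp only [Function.comp_apply, inner_self_ofReal, Complex.reCLM_apply, Complex.ofReal_re]
    refine ⟨_, ?_, h2 ▸ h1⟩
    have h3 := inner_compGraph_nonneg hsym hz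
    have h4 : ⟪z, f t⟫_ℂ = ⟪f t, z⟫_ℂ := inner_compGraph hsym hz hz
    simp only [inner_neg_right, inner_neg_left, h4, Complex.reCLM_apply, Complex.add_re,
      Complex.neg_re]
    linarith
  refine antitoneOn_of_deriv_nonpos (convex_Ioi 0) (fun t ht => ?_) (fun t ht => ?_)
    fun t ht => ?_
  · obtain ⟨d, -, hd⟩ := key t ht
    exact hd.continuousAt.continuousWithinAt
  · obtain ⟨d, -, hd⟩ := key t (interior_subset ht)
    exact hd.differentiableAt.differentiableWithinAt
  · obtain ⟨d, hd0, hd⟩ := key t (interior_subset ht)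
    rw [hd.deriv]
    exact hd0

/-- Uniqueness for the heat equation: the norm does not increase and tends to `0` at time `0+`. All
the properties of the semigroup below are drawn from this and from symmetry of `D`. -/
theorem IsHeatSolution.eq_zero {f : ℝ → H} (hf : IsHeatSolution D f)
    (h0 : Tendsto f (𝓝[>] 0) (𝓝 0)) {t : ℝ} (ht : 0 < t) : f t = 0 := by
  have h1 : ‖f t‖ ^ 2 ≤ 0 := by
    have h2 : Tendsto (fun s => ‖f s‖ ^ 2) (𝓝[>] 0) (𝓝 0) := by
      simpa using (h0.norm).pow 2
    refine ge_of_tendsto h2 ?_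
    filter_upwards [Ioo_mem_nhdsGT ht] with s hs
    exact hf.antitoneOn hsym hs.1 ht hs.2.le
  exact norm_eq_zero.mp (pow_eq_zero_iff two_ne_zero |>.mp (le_antisymm h1 (sq_nonneg _)))

omit hsym in
theorem IsHeatSolution.sub {f g : ℝ → H} (hf : IsHeatSolution D f) (hg : IsHeatSolution D g) :
    IsHeatSolution D fun t => f t - g t := fun t ht => by
  obtain ⟨z, hz, hd⟩ := hf t ht
  obtain ⟨z', hz', hd'⟩ := hg t ht
  exact ⟨z - z', hz.sub hz', by rw [neg_sub, ← neg_sub_neg]; exact hd.sub hd'⟩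

variable {T : ℝ → H →L[ℂ] H} (hT : IsHeatSemigroup D T)
include hT

omit hsym in
theorem IsHeatSemigroup.isHeatSolution (x : H) : IsHeatSolution D fun t => T t x := hT.heat x

/-- As functions of `s` both sides solve the heat equation with initial value `T t x`. -/
theorem IsHeatSemigroup.apply_apply {s t : ℝ} (hs : 0 < s) (ht : 0 < t) (x : H) :
    T s (T t x) = T (s + t) x := by
  have h1 : IsHeatSolution D fun r => T (r + t) x := fun r hr => by
    obtain ⟨z, hz, hd⟩ := hT.heat x (r + t) (by positivity)
    exact ⟨z, hz, hd.comp_add_const r t⟩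
  have h2 := ((hT.isHeatSolution (T t x)).sub h1).eq_zero hsym (t := s) ?_ hs
  · exact sub_eq_zero.mp h2
  · have h3 : Tendsto (fun r => T (r + t) x) (𝓝[>] 0) (𝓝 (T t x)) := by
      have h4 : ContinuousAt (fun r => T (r + t) x) 0 := by
        have h5 : ContinuousAt (fun r => T r x) (0 + t) := by
          rw [zero_add]; exact (hT.isHeatSolution x).continuousAt ht
        exact h5.comp (f := fun r : ℝ => r + t) (by fun_prop)
      have h6 := h4.tendsto.mono_left (nhdsWithin_le_nhds (s := Set.Ioi 0))
      simpa using h6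
    simpa using (hT.initial (T t x)).sub h3

/-- The function `s ↦ ⟪T (t - s) x, T s y⟫` has derivative zero by symmetry of `D²`; its limits at
the two ends of `(0, t)` are the two sides. -/
theorem IsHeatSemigroup.inner_apply {t : ℝ} (ht : 0 < t) (x y : H) :
    ⟪T t x, y⟫_ℂ = ⟪x, T t y⟫_ℂ := by
  let f : ℝ → ℂ := fun s => ⟪T (t - s) x, T s y⟫_ℂ
  have hd : ∀ s ∈ Set.Ioo 0 t, HasDerivAt f 0 s := fun s hs => by
    obtain ⟨z, hz, h1⟩ := hT.heat x (t - s) (by linarith [hs.2])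
    obtain ⟨z', hz', h2⟩ := hT.heat y s hs.1
    have h3 := (h1.comp_const_sub t s).inner ℂ h2
    have h4 : ⟪T (t - s) x, -z'⟫_ℂ + ⟪- -z, T s y⟫_ℂ = 0 := by
      rw [neg_neg, inner_neg_right, inner_compGraph hsym hz hz', neg_add_cancel]
    rw [h4] at h3
    exact h3
  -- The value `T 0` is not prescribed, only the limit at `0+`. Comparing `s` with `t - s` turns the
  -- limit at the right end into a second limit `s → 0+`.
  have hconst : ∀ s ∈ Set.Ioo 0 t, f s = f (t - s) := fun s hs =>
    isOpen_Ioo.is_const_of_deriv_eq_zero isPreconnected_Ioo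
      (fun r hr => (hd r hr).differentiableAt.differentiableWithinAt)
      (fun r hr => (hd r hr).deriv) hs ⟨by linarith [hs.2], by linarith [hs.1]⟩
  have hlim : ∀ u v : H, Tendsto (fun s => ⟪T (t - s) u, T s v⟫_ℂ) (𝓝[>] 0) (𝓝 ⟪T t u, v⟫_ℂ) := by
    intro u v
    have h1 : Tendsto (fun s => T (t - s) u) (𝓝[>] 0) (𝓝 (T t u)) := by
      have h4 : ContinuousAt (fun s => T (t - s) u) 0 := by
        have h5 : ContinuousAt (fun r => T r u) (t - 0) := by
          rw [sub_zero]; exact (hT.isHeatSolution u).continuousAt ht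
        exact h5.comp (f := fun r : ℝ => t - r) (by fun_prop)
      have h6 := h4.tendsto.mono_left (nhdsWithin_le_nhds (s := Set.Ioi 0))
      simpa using h6
    exact h1.inner (hT.initial v)
  have h1 := hlim x y
  have h2 : Tendsto (fun s => ⟪T s x, T (t - s) y⟫_ℂ) (𝓝[>] 0) (𝓝 ⟪x, T t y⟫_ℂ) := by
    have h3 := (Complex.continuous_conj.tendsto _).comp (hlim y x)
    simpa only [Function.comp_def, inner_conj_symm] using h3
  refine tendsto_nhds_unique h1 (h2.congr' ?_)
  filter_upwards [Ioo_mem_nhdsGT ht] with s hs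
  have h3 := hconst s hs
  simp only [f, sub_sub_cancel] at h3
  exact h3.symm

theorem IsHeatSemigroup.inner_apply_self {t : ℝ} (ht : 0 < t) (x : H) :
    ⟪x, T t x⟫_ℂ = ((‖T (t / 2) x‖ ^ 2 : ℝ) : ℂ) := by
  have h2 : 0 < t / 2 := by positivity
  rw [← inner_self_ofReal, hT.inner_apply hsym h2, hT.apply_apply hsym h2 h2, add_halves]

/-- An eigenvector of `T h` with positive eigenvalue is an eigenvector of the square root of
`T h`. -/
theorem IsHeatSemigroup.eigenvector_half {h m : ℝ} (hh : 0 < h) (hm : 0 < m) {x : H}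
    (hx : T h x = ((m ^ h : ℝ) : ℂ) • x) : T (h / 2) x = ((m ^ (h / 2) : ℝ) : ℂ) • x := by
  have h2 : 0 < h / 2 := by positivity
  set s : ℝ := m ^ (h / 2)
  have hs : 0 < s := Real.rpow_pos_of_pos hm _
  have hss : m ^ h = s * s := by rw [← Real.rpow_add hm, add_halves]
  -- Since `T (h/2)² x = s² x`, the defect `w` satisfies `T (h/2) w = -s w` with `s > 0`; positivity
  -- of `T (h/2)` then forces `w = 0`.
  set w := T (h / 2) x - (s : ℂ) • x with hw
  have h3 : T (h / 2) w = -((s : ℂ) • w) := by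
    rw [hw, map_sub, map_smul, hT.apply_apply hsym h2 h2, add_halves, hx, hss, smul_sub, smul_smul]
    push_cast
    abel
  have h4 := hT.inner_apply_self hsym h2 w
  rw [h3, inner_neg_right, inner_smul_right, inner_self_ofReal] at h4
  have h5 : -(s * ‖w‖ ^ 2) = ‖T (h / 2 / 2) w‖ ^ 2 := by exact_mod_cast h4
  have h6 : ‖w‖ ^ 2 ≤ 0 := by
    by_contra hc
    have h7 := mul_pos hs (not_le.mp hc)
    nlinarith [sq_nonneg ‖T (h / 2 / 2) w‖]
  exact sub_eq_zero.mp
    (norm_eq_zero.mp (pow_eq_zero_iff two_ne_zero |>.mp (le_antisymm h6 (sq_nonneg _))))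

/-- If `T t x = 0` then `‖T (t/2) x‖² = ⟪x, T t x⟫ = 0`. Halving repeatedly, `T (2⁻ⁿ) x = 0` for all
`n`, while these vectors tend to `x`. -/
theorem IsHeatSemigroup.eq_zero_of_apply_eq_zero {x : H} (hx : T 1 x = 0) : x = 0 := by
  have h1 : ∀ n : ℕ, T ((1 / 2 : ℝ) ^ n) x = 0 := fun n => by
    induction n with
    | zero => simpa using hx
    | succ n ih =>
      have h2 := hT.inner_apply_self hsym (t := (1 / 2 : ℝ) ^ n) (by positivity) x
      rw [ih, inner_zero_right] at h2
      have h3 : ‖T ((1 / 2 : ℝ) ^ n / 2) x‖ ^ 2 = 0 := by exact_mod_cast h2.symm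
      rw [pow_succ, mul_one_div]
      exact norm_eq_zero.mp (pow_eq_zero_iff two_ne_zero |>.mp h3)
  have h2 : Tendsto (fun n : ℕ => (1 / 2 : ℝ) ^ n) atTop (𝓝[>] 0) :=
    tendsto_nhdsWithin_iff.mpr ⟨tendsto_pow_atTop_nhds_zero_of_lt_one (by norm_num) (by norm_num),
      Eventually.of_forall fun n => by simp⟩
  have h3 := (hT.initial x).comp h2
  simp only [Function.comp_def, h1] at h3
  exact tendsto_nhds_unique h3 tendsto_const_nhds

/-- Repeated square roots give `T (2⁻ⁿ) x = m ^ (2⁻ⁿ) x`. The derivative of `T s x` at `s = 1`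
exists by the heat equation, so it may be computed along the times `1 + 2⁻ⁿ`, where `T s x = m ^ s
x`; dividing by `m` yields `D² x = -log m • x`. -/
theorem IsHeatSemigroup.compGraph_of_eigenvector {m : ℝ} (hm : 0 < m) {x : H}
    (hx : T 1 x = (m : ℂ) • x) : CompGraph D D x (((-Real.log m : ℝ) : ℂ) • x) := by
  have h1 : ∀ n : ℕ, T ((1 / 2 : ℝ) ^ n) x = ((m ^ ((1 / 2 : ℝ) ^ n) : ℝ) : ℂ) • x := fun n => by
    induction n with
    | zero => simpa using hx
    | succ n ih =>
      rw [pow_succ, mul_one_div]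
      exact hT.eigenvector_half hsym (by positivity) hm ih
  obtain ⟨z, hz, hd⟩ := hT.heat x 1 one_pos
  have hd2 : HasDerivAt (fun s : ℝ => ((m ^ s : ℝ) : ℂ) • x) (((m * Real.log m : ℝ) : ℂ) • x) 1 := by
    have h3 := (Real.hasStrictDerivAt_const_rpow hm 1).hasDerivAt
    rw [Real.rpow_one] at h3
    exact h3.ofReal_comp.smul_const x
  have hseq : Tendsto (fun n : ℕ => (1 : ℝ) + (1 / 2 : ℝ) ^ n) atTop (𝓝[≠] 1) := by
    refine tendsto_nhdsWithin_iff.mpr ⟨?_, Eventually.of_forall fun n => by simp⟩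
    have := (tendsto_pow_atTop_nhds_zero_of_lt_one (r := (1 / 2 : ℝ)) (by norm_num)
      (by norm_num)).const_add 1
    simpa using this
  have h4 := hd.tendsto_slope.comp hseq
  have h5 := hd2.tendsto_slope.comp hseq
  have h6 : -z = ((m * Real.log m : ℝ) : ℂ) • x := by
    refine tendsto_nhds_unique h4 (h5.congr fun n => ?_)
    have h7 : T (1 + (1 / 2 : ℝ) ^ n) x = ((m ^ (1 + (1 / 2 : ℝ) ^ n) : ℝ) : ℂ) • x := by
      rw [← hT.apply_apply hsym one_pos (by positivity), h1, map_smul, hx, smul_smul,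
        Real.rpow_add hm, Real.rpow_one]
      push_cast
      rw [mul_comm]
    simp only [Function.comp_apply, slope_def_module, h7, hx, Real.rpow_one]
  have h8 : (m : ℂ) ≠ 0 := by exact_mod_cast hm.ne'
  have h9 := hz.smul (m : ℂ)⁻¹
  rw [hx, smul_smul, inv_mul_cancel₀ h8, one_smul, ← neg_neg z, h6, smul_neg, smul_smul] at h9
  convert! h9 using 1
  rw [← neg_smul]
  congr 1
  push_cast
  field_simp

/-- The explicit exponential solves the heat equation with initial value `x`, so uniqueness applies.
-/
theorem IsHeatSemigroup.apply_of_compGraph {k : ℝ} {x : H} (hx : CompGraph D D x ((k : ℂ) • x))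
    {t : ℝ} (ht : 0 < t) : T t x = (Real.exp (-t * k) : ℂ) • x := by
  have h1 : IsHeatSolution D fun s => (Real.exp (-s * k) : ℂ) • x := fun s _ => by
    refine ⟨_, hx.smul _, ?_⟩
    have h1 : HasDerivAt (fun s : ℝ => Real.exp (-s * k)) (-(Real.exp (-s * k) * k)) s := by
      have := ((hasDerivAt_id s).neg.mul_const k).exp
      convert! this using 1
      simp only [Pi.neg_apply, id_eq]
      ring
    convert! h1.ofReal_comp.smul_const x using 1
    rw [smul_smul, ← neg_smul]
    push_cast
    rfl
  refine sub_eq_zero.mp (((hT.isHeatSolution x).sub h1).eq_zero hsym ?_ ht)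
  have h2 : Tendsto (fun s : ℝ => (Real.exp (-s * k) : ℂ) • x) (𝓝[>] 0) (𝓝 x) := by
    have h3 : ContinuousAt (fun s : ℝ => (Real.exp (-s * k) : ℂ) • x) 0 := by fun_prop
    have h4 := h3.tendsto.mono_left (nhdsWithin_le_nhds (s := Set.Ioi 0))
    simpa using h4
  simpa using (hT.initial x).sub h2

end EigenbasisOfHeat

/-! ### Spectral resolution from a trace class heat semigroup -/

section

open Filter Topology

variable {H : Type v} [NormedAddCommGroup H] [InnerProductSpace ℂ H] [CompleteSpace H]
  {D : H →ₗ.[ℂ] H}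

/-- `T t` is positive, so it is its own absolute value, and `⟪b, T t b⟫ = ‖T (t/2) b‖²`: trace class
at time `t` means Hilbert–Schmidt at time `t/2`. -/
theorem IsHeatSemigroup.summable_norm_sq (hsym : IsSymmGraph D.graph) {T : ℝ → H →L[ℂ] H}
    (hT : IsHeatSemigroup D T) {t : ℝ} (ht : 0 < t) (htr : IsTraceClass (T t)) :
    ∃ (w : Set H) (b : HilbertBasis w ℂ H), Summable fun i => ‖T (t / 2) (b i)‖ ^ 2 := by
  obtain ⟨w, b, hb⟩ := htr
  refine ⟨w, b, hb.congr fun i => ?_⟩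
  have hpos : (T t).IsPositive := by
    refine ⟨fun x y => hT.inner_apply hsym ht x y, fun x => ?_⟩
    rw [ContinuousLinearMap.reApplyInnerSelf_apply, hT.inner_apply hsym ht,
      hT.inner_apply_self hsym ht]
    change 0 ≤ (((‖T (t / 2) x‖ ^ 2 : ℝ) : ℂ)).re
    rw [Complex.ofReal_re]
    positivity
  rw [CFC.abs_of_nonneg _ ((ContinuousLinearMap.nonneg_iff_isPositive _).mpr hpos),
    hT.inner_apply_self hsym ht, Complex.ofReal_re]

/-- A self-adjoint operator with trace class heat semigroup has an eigenbasis of its square. -/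
theorem exists_squareDiagonal (hD : IsSelfAdjoint D) (hh : HeatTraceClass D) :
    ∃ (ι : Type v) (b : HilbertBasis ι ℂ H) (κ : ι → ℝ), SquareDiagonal D b κ ∧
      ∀ t > 0, Summable fun i => Real.exp (-t * κ i) := by
  have hsym := isSymmGraph_of_isSelfAdjoint hD
  obtain ⟨T, hT, htr⟩ := hh
  have hTsym : ∀ t > 0, ((T t : H →L[ℂ] H) : H →ₗ[ℂ] H).IsSymmetric := fun t ht x y =>
    hT.inner_apply hsym ht x y
  -- Time `2` is used so that `T 1` is Hilbert–Schmidt and therefore compact.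
  obtain ⟨w, c, hc⟩ := hT.summable_norm_sq hsym two_pos (htr 2 two_pos)
  rw [div_self two_ne_zero] at hc
  obtain ⟨ι, b, μ, hμ⟩ := exists_hilbertBasis_eigenvectors (T 1)
    (isCompactOperator_of_summable c (T 1) (hTsym 1 one_pos) hc) (hTsym 1 one_pos)
  have hm : ∀ i, ∃ m : ℝ, 0 < m ∧ μ i = m := fun i => by
    have h1 := hT.inner_apply_self hsym one_pos (b i)
    rw [hμ, inner_smul_right, inner_self_ofReal, b.orthonormal.1] at h1
    refine ⟨‖T (1 / 2) (b i)‖ ^ 2, lt_of_le_of_ne (sq_nonneg _) fun h0 => ?_, by simpa using h1⟩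
    have h2 : μ i = 0 := by rw [← h0] at h1; simpa using h1
    have h3 := hT.eq_zero_of_apply_eq_zero hsym (x := b i) (by rw [hμ, h2, zero_smul])
    have h4 := b.orthonormal.1 i
    rw [h3, norm_zero] at h4
    exact zero_ne_one h4
  choose m hm hμm using hm
  have hsq : SquareDiagonal D b fun i => -Real.log (m i) := fun i =>
    hT.compGraph_of_eigenvector hsym (hm i) (by rw [hμ, hμm])
  refine ⟨ι, b, _, hsq, fun t ht => ?_⟩
  -- The trace class hypothesis at time `t` supplies its own basis; independence of the
  -- Hilbert–Schmidt norm moves the sum to the eigenbasis, where `‖T (t/2) bᵢ‖² = exp(-t κᵢ)`.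
  obtain ⟨w', c', hc'⟩ := hT.summable_norm_sq hsym ht (htr t ht)
  have h2 : 0 < t / 2 := by positivity
  refine (summable_norm_sq_of_summable c' b _ (hTsym _ h2) hc').congr fun i => ?_
  rw [hT.apply_of_compGraph hsym (hsq i) h2, norm_smul, b.orthonormal.1, mul_one,
    Complex.norm_real, Real.norm_of_nonneg (Real.exp_nonneg _), sq, ← Real.exp_add]
  congr 1
  ring

end

end SpectralData

namespace SpectralData

/-! ### The Hilbert space tensor product -/

section HilbertTensor

variable {H₁ H₂ : Type*} [NormedAddCommGroup H₁] [InnerProductSpace ℂ H₁]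
  [NormedAddCommGroup H₂] [InnerProductSpace ℂ H₂]

theorem inner_htmul (x x' : H₁) (y y' : H₂) :
    ⟪htmul x y, htmul x' y'⟫_ℂ = ⟪x, x'⟫_ℂ * ⟪y, y'⟫_ℂ := by
  rw [htmul, htmul, Completion.inner_coe, TensorProduct.inner_tmul]

theorem norm_htmul (x : H₁) (y : H₂) : ‖htmul x y‖ = ‖x‖ * ‖y‖ := by
  rw [htmul, Completion.norm_coe, TensorProduct.norm_tmul]

/-- The canonical map of the algebraic into the Hilbert space tensor product. -/
def htincl (H₁ H₂ : Type*) [NormedAddCommGroup H₁] [InnerProductSpace ℂ H₁]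
    [NormedAddCommGroup H₂] [InnerProductSpace ℂ H₂] : H₁ ⊗[ℂ] H₂ →ₗ[ℂ] HTensor H₁ H₂ :=
  (Completion.toComplL : H₁ ⊗[ℂ] H₂ →L[ℂ] HTensor H₁ H₂)

@[simp]
theorem htincl_tmul (x : H₁) (y : H₂) : htincl H₁ H₂ (x ⊗ₜ y) = htmul x y := rfl

theorem denseRange_htincl : DenseRange (htincl H₁ H₂) := Completion.denseRange_coe

/-- `(x, y) ↦ x ⊗ y` as a continuous bilinear map. -/
def htmulL (H₁ H₂ : Type*) [NormedAddCommGroup H₁] [InnerProductSpace ℂ H₁]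
    [NormedAddCommGroup H₂] [InnerProductSpace ℂ H₂] : H₁ →L[ℂ] H₂ →L[ℂ] HTensor H₁ H₂ :=
  (LinearMap.mk₂ ℂ htmul htmul_add_left htmul_smul_left htmul_add_right
    htmul_smul_right).mkContinuous₂ 1 fun x y => by
      rw [LinearMap.mk₂_apply, norm_htmul, one_mul]

theorem htmul_neg_left (x : H₁) (y : H₂) : htmul (-x) y = -htmul x y :=
  LinearMap.map_neg₂ (htmulL H₁ H₂).toLinearMap₁₂ x y

theorem htmul_neg_right (x : H₁) (y : H₂) : htmul x (-y) = -htmul x y :=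
  map_neg (htmulL H₁ H₂ x) y

theorem htmul_eq_zero {x : H₁} {y : H₂} (h : htmul x y = 0) : x = 0 ∨ y = 0 := by
  have h1 : ‖x‖ * ‖y‖ = 0 := by rw [← norm_htmul, h, norm_zero]
  simpa using h1

theorem continuous_htmul : Continuous fun p : H₁ × H₂ => htmul p.1 p.2 :=
  (htmulL H₁ H₂).continuous₂

/-- A closed subspace that contains the elementary tensors of two total sets is everything. -/
theorem eq_top_of_htmul_mem {s₁ : Set H₁} {s₂ : Set H₂}
    (h₁ : (Submodule.span ℂ s₁).topologicalClosure = ⊤)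
    (h₂ : (Submodule.span ℂ s₂).topologicalClosure = ⊤) {C : Submodule ℂ (HTensor H₁ H₂)}
    (hC : IsClosed (C : Set (HTensor H₁ H₂))) (h : ∀ x ∈ s₁, ∀ y ∈ s₂, htmul x y ∈ C) :
    C = ⊤ := by
  have e1 : ∀ y ∈ s₂, ∀ x, htmul x y ∈ C := fun y hy x => by
    have hcl : IsClosed ((C.comap ((htmulL H₁ H₂).flip y : H₁ →ₗ[ℂ] _) : Submodule ℂ H₁) : Set H₁) :=
      hC.preimage ((htmulL H₁ H₂).flip y).continuous
    have : (Submodule.span ℂ s₁).topologicalClosure ≤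
        C.comap ((htmulL H₁ H₂).flip y : H₁ →ₗ[ℂ] _) :=
      Submodule.topologicalClosure_minimal _ (Submodule.span_le.mpr fun x hx => h x hx y hy) hcl
    rw [h₁] at this
    exact this (Submodule.mem_top (x := x))
  have e2 : ∀ x y, htmul x y ∈ C := fun x y => by
    have hcl : IsClosed ((C.comap (htmulL H₁ H₂ x : H₂ →ₗ[ℂ] _) : Submodule ℂ H₂) : Set H₂) :=
      hC.preimage (htmulL H₁ H₂ x).continuous
    have : (Submodule.span ℂ s₂).topologicalClosure ≤ C.comap (htmulL H₁ H₂ x : H₂ →ₗ[ℂ] _) :=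
      Submodule.topologicalClosure_minimal _ (Submodule.span_le.mpr fun y hy => e1 y hy x) hcl
    rw [h₂] at this
    exact this (Submodule.mem_top (x := y))
  rw [eq_top_iff]
  intro z _
  refine hC.closure_subset_iff.mpr ?_ (denseRange_htincl z)
  rintro _ ⟨t, rfl⟩
  induction t using TensorProduct.induction_on with
  | zero => rw [map_zero]; exact zero_mem _
  | tmul x y => exact e2 x y
  | add a b ha hb => rw [map_add]; exact add_mem ha hb

theorem dense_span_htmul {s₁ : Set H₁} {s₂ : Set H₂}
    (h₁ : (Submodule.span ℂ s₁).topologicalClosure = ⊤)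
    (h₂ : (Submodule.span ℂ s₂).topologicalClosure = ⊤) :
    (Submodule.span ℂ {z : HTensor H₁ H₂ | ∃ x ∈ s₁, ∃ y ∈ s₂, z = htmul x y}).topologicalClosure =
      ⊤ :=
  eq_top_of_htmul_mem h₁ h₂ (Submodule.isClosed_topologicalClosure _) fun x hx y hy =>
    Submodule.le_topologicalClosure _ (Submodule.subset_span ⟨x, hx, y, hy, rfl⟩)

theorem topologicalClosure_span_of_dense {H : Type*} [NormedAddCommGroup H]
    [InnerProductSpace ℂ H] {s : Set H} (hs : Dense s) :
    (Submodule.span ℂ s).topologicalClosure = ⊤ :=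
  Submodule.dense_iff_topologicalClosure_eq_top.mp (hs.mono Submodule.subset_span)

instance [TopologicalSpace.SeparableSpace H₁] [TopologicalSpace.SeparableSpace H₂] :
    TopologicalSpace.SeparableSpace (HTensor H₁ H₂) := by
  have h1 : TopologicalSpace.IsSeparable
      {z : HTensor H₁ H₂ | ∃ x ∈ Set.univ, ∃ y ∈ Set.univ, z = htmul x y} := by
    have : {z : HTensor H₁ H₂ | ∃ x ∈ Set.univ, ∃ y ∈ Set.univ, z = htmul x y} =
        Set.range fun p : H₁ × H₂ => htmul p.1 p.2 := by
      ext z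
      constructor
      · rintro ⟨x, -, y, -, rfl⟩
        exact ⟨(x, y), rfl⟩
      · rintro ⟨p, rfl⟩
        exact ⟨p.1, trivial, p.2, trivial, rfl⟩
    rw [this]
    exact TopologicalSpace.isSeparable_range continuous_htmul
  have h2 := (h1.span (R := ℂ)).closure
  rw [← Submodule.topologicalClosure_coe,
    dense_span_htmul (topologicalClosure_span_of_dense dense_univ)
      (topologicalClosure_span_of_dense dense_univ)] at h2
  exact TopologicalSpace.isSeparable_univ_iff.mp h2

/-- The product of two Hilbert bases. -/
def htbasis {ι₁ ι₂ : Type*} (b₁ : HilbertBasis ι₁ ℂ H₁) (b₂ : HilbertBasis ι₂ ℂ H₂) :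
    HilbertBasis (ι₁ × ι₂) ℂ (HTensor H₁ H₂) :=
  HilbertBasis.mk (v := fun p : ι₁ × ι₂ => htmul (b₁ p.1) (b₂ p.2)) (by
      classical
      rw [orthonormal_iff_ite]
      rintro ⟨i, j⟩ ⟨i', j'⟩
      rw [inner_htmul, orthonormal_iff_ite.mp b₁.orthonormal, orthonormal_iff_ite.mp b₂.orthonormal]
      by_cases h1 : i = i' <;> by_cases h2 : j = j' <;> simp [h1, h2])
    (by
      refine (eq_top_of_htmul_mem b₁.dense_span b₂.dense_span
        (Submodule.isClosed_topologicalClosure _) ?_).ge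
      rintro _ ⟨i, rfl⟩ _ ⟨j, rfl⟩
      exact Submodule.le_topologicalClosure _ (Submodule.subset_span ⟨(i, j), rfl⟩))

theorem htbasis_apply {ι₁ ι₂ : Type*} (b₁ : HilbertBasis ι₁ ℂ H₁) (b₂ : HilbertBasis ι₂ ℂ H₂)
    (p : ι₁ × ι₂) : htbasis b₁ b₂ p = htmul (b₁ p.1) (b₂ p.2) := by
  rw [htbasis, HilbertBasis.coe_mk]

theorem ext_htmul {K : Type*} [NormedAddCommGroup K] {S T : HTensor H₁ H₂ → K}
    (hS : Continuous S) (hT : Continuous T) (hSa : ∀ z w, S (z + w) = S z + S w)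
    (hTa : ∀ z w, T (z + w) = T z + T w)
    (h : ∀ x y, S (htmul x y) = T (htmul x y)) (z : HTensor H₁ H₂) : S z = T z := by
  refine congrFun (denseRange_htincl.equalizer hS hT (funext fun t => ?_)) z
  simp only [Function.comp_apply]
  induction t using TensorProduct.induction_on with
  | zero =>
    have := h 0 0
    rwa [← htincl_tmul, TensorProduct.zero_tmul] at this
  | tmul x y => exact h x y
  | add a b ha hb => rw [map_add, hSa, hTa, ha, hb]

theorem hmap_mul (S S' : H₁ →L[ℂ] H₁) (T T' : H₂ →L[ℂ] H₂) :
    hmap S T * hmap S' T' = hmap (S * S') (T * T') :=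
  hmap_ext fun x y => by simp only [mul_apply_eq_comp, hmap_htmul]

theorem hmap_one : hmap (1 : H₁ →L[ℂ] H₁) (1 : H₂ →L[ℂ] H₂) = 1 :=
  hmap_ext fun x y => by simp only [hmap_htmul, one_apply_eq_self]

variable [CompleteSpace H₁] [CompleteSpace H₂]

theorem star_hmap (S : H₁ →L[ℂ] H₁) (T : H₂ →L[ℂ] H₂) :
    star (hmap S T) = hmap (star S) (star T) := by
  rw [ContinuousLinearMap.star_eq_adjoint, eq_comm, ContinuousLinearMap.eq_adjoint_iff]
  have h1 : ∀ (x : H₁) (y : H₂) (x' : H₁) (y' : H₂),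
      ⟪hmap (star S) (star T) (htmul x y), htmul x' y'⟫_ℂ =
        ⟪htmul x y, hmap S T (htmul x' y')⟫_ℂ := fun x y x' y' => by
    rw [hmap_htmul, hmap_htmul, inner_htmul, inner_htmul, ContinuousLinearMap.star_eq_adjoint,
      ContinuousLinearMap.star_eq_adjoint, ContinuousLinearMap.adjoint_inner_left,
      ContinuousLinearMap.adjoint_inner_left]
  intro z w
  refine ext_htmul
    (S := fun w => ⟪hmap (star S) (star T) z, w⟫_ℂ)
    (T := fun w => ⟪z, hmap S T w⟫_ℂ) (continuous_const.inner continuous_id)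
    (continuous_const.inner (hmap S T).continuous)
    (fun _ _ => inner_add_right _ _ _) (fun _ _ => by rw [map_add, inner_add_right])
    (fun x' y' => ?_) w
  exact ext_htmul
    (S := fun z => ⟪hmap (star S) (star T) z, htmul x' y'⟫_ℂ)
    (T := fun z => ⟪z, hmap S T (htmul x' y')⟫_ℂ)
    ((hmap (star S) (star T)).continuous.inner continuous_const)
    (continuous_id.inner continuous_const)
    (fun _ _ => by rw [map_add, inner_add_left]) (fun _ _ => inner_add_left _ _ _)
    (fun x y => h1 x y x' y') z

theorem IsGrading.hmap {γ₁ : H₁ →L[ℂ] H₁} {γ₂ : H₂ →L[ℂ] H₂} (h₁ : IsGrading γ₁)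
    (h₂ : IsGrading γ₂) : IsGrading (hmap γ₁ γ₂) where
  selfAdjoint := by rw [IsSelfAdjoint, star_hmap, h₁.selfAdjoint.star_eq, h₂.selfAdjoint.star_eq]
  sq_eq_one := by rw [hmap_mul, h₁.sq_eq_one, h₂.sq_eq_one, hmap_one]

theorem isGrading_one : IsGrading (1 : H₁ →L[ℂ] H₁) := ⟨IsSelfAdjoint.one _, one_mul 1⟩

theorem IsGrading.inner_apply {γ : H₁ →L[ℂ] H₁} (h : IsGrading γ) (x y : H₁) :
    ⟪γ x, y⟫_ℂ = ⟪x, γ y⟫_ℂ :=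
  ContinuousLinearMap.isSelfAdjoint_iff_isSymmetric.mp h.selfAdjoint x y

theorem IsGrading.apply_apply {γ : H₁ →L[ℂ] H₁} (h : IsGrading γ) (x : H₁) : γ (γ x) = x :=
  congrArg (fun T : H₁ →L[ℂ] H₁ => T x) h.sq_eq_one

/-! ### Tensor products of representations -/

variable {A₁ A₂ : Type*} [Ring A₁] [StarRing A₁] [Algebra ℂ A₁] [StarModule ℂ A₁]
  [Ring A₂] [StarRing A₂] [Algebra ℂ A₂] [StarModule ℂ A₂]

/-- The linear map `a₁ ⊗ a₂ ↦ l₁ a₁ ⊗ l₂ a₂`. -/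
def linTensor {A₁ A₂ : Type*} [AddCommGroup A₁] [Module ℂ A₁] [AddCommGroup A₂] [Module ℂ A₂]
    (l₁ : A₁ →ₗ[ℂ] (H₁ →L[ℂ] H₁)) (l₂ : A₂ →ₗ[ℂ] (H₂ →L[ℂ] H₂)) :
    A₁ ⊗[ℂ] A₂ →ₗ[ℂ] (HTensor H₁ H₂ →L[ℂ] HTensor H₁ H₂) :=
  TensorProduct.lift (hmapBilin.compl₁₂ l₁ l₂)

omit [CompleteSpace H₁] [CompleteSpace H₂] in
theorem linTensor_tmul {A₁ A₂ : Type*} [AddCommGroup A₁] [Module ℂ A₁] [AddCommGroup A₂]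
    [Module ℂ A₂] (l₁ : A₁ →ₗ[ℂ] (H₁ →L[ℂ] H₁)) (l₂ : A₂ →ₗ[ℂ] (H₂ →L[ℂ] H₂)) (a₁ : A₁) (a₂ : A₂) :
    linTensor l₁ l₂ (a₁ ⊗ₜ a₂) = hmap (l₁ a₁) (l₂ a₂) := rfl

omit [StarModule ℂ A₁] [StarModule ℂ A₂] in
theorem linTensor_mul (ρ₁ : A₁ →⋆ₐ[ℂ] (H₁ →L[ℂ] H₁)) (ρ₂ : A₂ →⋆ₐ[ℂ] (H₂ →L[ℂ] H₂))
    (s t : A₁ ⊗[ℂ] A₂) : linTensor ρ₁.toAlgHom.toLinearMap ρ₂.toAlgHom.toLinearMap (s * t) =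
      linTensor ρ₁.toAlgHom.toLinearMap ρ₂.toAlgHom.toLinearMap s *
        linTensor ρ₁.toAlgHom.toLinearMap ρ₂.toAlgHom.toLinearMap t := by
  induction s using TensorProduct.induction_on with
  | zero => rw [zero_mul, map_zero, zero_mul]
  | add a b ha hb => rw [add_mul, map_add, map_add, add_mul, ha, hb]
  | tmul a b =>
    induction t using TensorProduct.induction_on with
    | zero => rw [mul_zero, map_zero, mul_zero]
    | add a b ha hb => rw [mul_add, map_add, map_add, mul_add, ha, hb]
    | tmul a' b' =>
      rw [Algebra.TensorProduct.tmul_mul_tmul, linTensor_tmul, linTensor_tmul, linTensor_tmul,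
        hmap_mul]
      exact congrArg₂ hmap (map_mul ρ₁ a a') (map_mul ρ₂ b b')

theorem linTensor_star (ρ₁ : A₁ →⋆ₐ[ℂ] (H₁ →L[ℂ] H₁)) (ρ₂ : A₂ →⋆ₐ[ℂ] (H₂ →L[ℂ] H₂))
    (s : A₁ ⊗[ℂ] A₂) : linTensor ρ₁.toAlgHom.toLinearMap ρ₂.toAlgHom.toLinearMap (star s) =
      star (linTensor ρ₁.toAlgHom.toLinearMap ρ₂.toAlgHom.toLinearMap s) := by
  induction s using TensorProduct.induction_on with
  | zero =>
    rw [star_zero, map_zero]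
    exact (star_zero (HTensor H₁ H₂ →L[ℂ] HTensor H₁ H₂)).symm
  | add a b ha hb =>
    rw [star_add, map_add, map_add, ha, hb]
    exact (star_add (linTensor ρ₁.toAlgHom.toLinearMap ρ₂.toAlgHom.toLinearMap a)
      (linTensor ρ₁.toAlgHom.toLinearMap ρ₂.toAlgHom.toLinearMap b)).symm
  | tmul a b =>
    rw [TensorProduct.star_tmul, linTensor_tmul, linTensor_tmul, star_hmap]
    exact congrArg₂ hmap (map_star ρ₁ a) (map_star ρ₂ b)

omit [StarModule ℂ A₁] [StarModule ℂ A₂] in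
theorem linTensor_one (ρ₁ : A₁ →⋆ₐ[ℂ] (H₁ →L[ℂ] H₁)) (ρ₂ : A₂ →⋆ₐ[ℂ] (H₂ →L[ℂ] H₂)) :
    linTensor ρ₁.toAlgHom.toLinearMap ρ₂.toAlgHom.toLinearMap 1 = 1 := by
  rw [Algebra.TensorProduct.one_def, linTensor_tmul, ← hmap_one]
  exact congrArg₂ hmap (map_one ρ₁) (map_one ρ₂)

/-- The tensor product of two representations. -/
def repTensor (ρ₁ : A₁ →⋆ₐ[ℂ] (H₁ →L[ℂ] H₁)) (ρ₂ : A₂ →⋆ₐ[ℂ] (H₂ →L[ℂ] H₂)) :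
    A₁ ⊗[ℂ] A₂ →⋆ₐ[ℂ] (HTensor H₁ H₂ →L[ℂ] HTensor H₁ H₂) :=
  { AlgHom.ofLinearMap (linTensor ρ₁.toAlgHom.toLinearMap ρ₂.toAlgHom.toLinearMap)
      (linTensor_one ρ₁ ρ₂) (linTensor_mul ρ₁ ρ₂) with
    map_star' := linTensor_star ρ₁ ρ₂ }

@[simp]
theorem repTensor_tmul (ρ₁ : A₁ →⋆ₐ[ℂ] (H₁ →L[ℂ] H₁)) (ρ₂ : A₂ →⋆ₐ[ℂ] (H₂ →L[ℂ] H₂))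
    (a₁ : A₁) (a₂ : A₂) : repTensor ρ₁ ρ₂ (a₁ ⊗ₜ a₂) = hmap (ρ₁ a₁) (ρ₂ a₂) := rfl

/-- The tensor product of faithful representations is faithful on the algebraic tensor product. -/
theorem repTensor_injective {ρ₁ : A₁ →⋆ₐ[ℂ] (H₁ →L[ℂ] H₁)} {ρ₂ : A₂ →⋆ₐ[ℂ] (H₂ →L[ℂ] H₂)}
    (h₁ : Function.Injective ρ₁) (h₂ : Function.Injective ρ₂) :
    Function.Injective (repTensor ρ₁ ρ₂) := by
  classical
  rw [injective_iff_map_eq_zero]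
  intro s hs
  let β := Module.Basis.ofVectorSpace ℂ A₂
  let e := TensorProduct.equivFinsuppOfBasisRight (M := A₁) β
  set f := e s with hf
  have hsf : s = f.sum fun i m => m ⊗ₜ β i := by
    rw [← e.symm_apply_apply s]
    exact TensorProduct.equivFinsuppOfBasisRight_symm_apply β f
  have hf0 : ∀ i, f i = 0 := by
    intro i
    apply h₁
    rw [map_zero]
    ext x
    refine ext_inner_left ℂ fun x' => ?_
    -- For fixed `x`, `x'` the matrix elements of the first leg contract `s = ∑ f i ⊗ β i` to an
    -- element of `A₂` whose image under `ρ₂` has vanishing matrix elements. Faithfulness of `ρ₂`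
    -- and independence of `β` kill the coefficients, and then faithfulness of `ρ₁` applies.
    have key : ∑ i ∈ f.support, ⟪x', ρ₁ (f i) x⟫_ℂ • β i = 0 := by
      apply h₂
      rw [map_zero]
      ext y
      refine ext_inner_left ℂ fun y' => ?_
      have h3 : ⟪htmul x' y', repTensor ρ₁ ρ₂ s (htmul x y)⟫_ℂ = 0 := by
        rw [hs, _root_.zero_apply, inner_zero_right]
      rw [hsf, Finsupp.sum, map_sum, _root_.sum_apply, inner_sum] at h3
      simp only [repTensor_tmul, hmap_htmul, inner_htmul] at h3
      simp only [map_sum, map_smul, _root_.sum_apply, _root_.smul_apply, inner_sum,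
        inner_smul_right, h3, _root_.zero_apply, inner_zero_right]
    by_cases hi : i ∈ f.support
    · have := linearIndependent_iff'.mp β.linearIndependent _ _ key i hi
      rw [this, _root_.zero_apply, inner_zero_right]
    · rw [Finsupp.notMem_support_iff.mp hi, map_zero]
  rw [hsf, Finsupp.sum]
  exact Finset.sum_eq_zero fun i _ => by rw [hf0, TensorProduct.zero_tmul]

end HilbertTensor

end SpectralData

namespace SpectralData

/-! ### Operators determined by a core -/

section Core

variable {H : Type*} [NormedAddCommGroup H] [InnerProductSpace ℂ H]
  {D : H →ₗ.[ℂ] H} {s : Set (H × H)}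

/-- Invariance of a graph under a continuous map need only be tested on a core. The ring
homomorphism `σ` is kept general so that antiunitary operators are covered as well. -/
theorem mem_graph_of_core {σ : ℂ →+* ℂ} (hD : D.graph = (Submodule.span ℂ s).topologicalClosure)
    (L : (H × H) →SL[σ] (H × H)) (h : ∀ p ∈ s, L p ∈ D.graph) {p : H × H} (hp : p ∈ D.graph) :
    L p ∈ D.graph := by
  rw [hD] at hp ⊢
  exact mem_closure_span_of_forall L (fun p hp => hD ▸ h p hp) hp

theorem isCommutator_of_core (hD : D.graph = (Submodule.span ℂ s).topologicalClosure)
    {B T : H →L[ℂ] H} (h : ∀ p ∈ s, (B p.1, B p.2 + T p.1) ∈ D.graph) : IsCommutator D B T :=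
  fun x y hxy => mem_graph_of_core hD
    ((B ∘L ContinuousLinearMap.fst ℂ H H).prod
      (B ∘L ContinuousLinearMap.snd ℂ H H + T ∘L ContinuousLinearMap.fst ℂ H H)) h
    (p := (x, y)) hxy

theorem mem_graph_smul_of_core (hD : D.graph = (Submodule.span ℂ s).topologicalClosure)
    {B : H →L[ℂ] H} {c : ℂ} (h : ∀ p ∈ s, (B p.1, c • B p.2) ∈ D.graph) {x y : H}
    (hxy : (x, y) ∈ D.graph) : (B x, c • B y) ∈ D.graph :=
  mem_graph_of_core hD ((B ∘L ContinuousLinearMap.fst ℂ H H).prod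
    (c • (B ∘L ContinuousLinearMap.snd ℂ H H))) h (p := (x, y)) hxy

theorem IsCommutator.zero : IsCommutator D 0 0 := fun x y _ => by
  simp

theorem IsCommutator.add {B T B' T' : H →L[ℂ] H} (h : IsCommutator D B T)
    (h' : IsCommutator D B' T') : IsCommutator D (B + B') (T + T') := fun x y hxy => by
  have := D.graph.add_mem (h x y hxy) (h' x y hxy)
  rw [Prod.mk_add_mk, add_add_add_comm] at this
  exact this

end Core

/-! ### Sums of the form `D₁ ⊗ B₂ + B₁ ⊗ D₂` -/

section Gen

variable {H₁ H₂ K : Type*} [NormedAddCommGroup H₁] [InnerProductSpace ℂ H₁]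
  [NormedAddCommGroup H₂] [InnerProductSpace ℂ H₂] [NormedAddCommGroup K] [InnerProductSpace ℂ K]
  (t : H₁ →L[ℂ] H₂ →L[ℂ] K) (B₂ : H₂ →L[ℂ] H₂) (B₁ : H₁ →L[ℂ] H₁)

/-- The element `(x ⊗ y, x' ⊗ B₂ y + B₁ x ⊗ y')` of the graph of `D₁ ⊗ B₂ + B₁ ⊗ D₂`. -/
def sumGen (p : H₁ × H₁) (q : H₂ × H₂) : K × K :=
  (t p.1 q.1, t p.2 (B₂ q.1) + t (B₁ p.1) q.2)

/-- For fixed `q` the generator depends linearly and continuously on `p`, in the graph norm of the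
first operator. -/
theorem sumGen_mem_left {C : Submodule ℂ (K × K)} (hC : IsClosed (C : Set (K × K)))
    {s : Set (H₁ × H₁)} {q : H₂ × H₂} (h : ∀ p ∈ s, sumGen t B₂ B₁ p q ∈ C) {p : H₁ × H₁}
    (hp : p ∈ (Submodule.span ℂ s).topologicalClosure) : sumGen t B₂ B₁ p q ∈ C := by
  let L : (H₁ × H₁) →L[ℂ] (K × K) :=
    (t.flip q.1 ∘L ContinuousLinearMap.fst ℂ H₁ H₁).prod
      (t.flip (B₂ q.1) ∘L ContinuousLinearMap.snd ℂ H₁ H₁ +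
        t.flip q.2 ∘L B₁ ∘L ContinuousLinearMap.fst ℂ H₁ H₁)
  have hcl : IsClosed ((C.comap (L : (H₁ × H₁) →ₗ[ℂ] (K × K)) : Submodule ℂ (H₁ × H₁)) :
      Set (H₁ × H₁)) :=
    hC.preimage L.continuous
  exact Submodule.topologicalClosure_minimal _
    (Submodule.span_le (p := C.comap (L : (H₁ × H₁) →ₗ[ℂ] (K × K))) |>.mpr h) hcl hp

theorem sumGen_mem_right {C : Submodule ℂ (K × K)} (hC : IsClosed (C : Set (K × K)))
    {s : Set (H₂ × H₂)} {p : H₁ × H₁} (h : ∀ q ∈ s, sumGen t B₂ B₁ p q ∈ C) {q : H₂ × H₂}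
    (hq : q ∈ (Submodule.span ℂ s).topologicalClosure) : sumGen t B₂ B₁ p q ∈ C := by
  let L : (H₂ × H₂) →L[ℂ] (K × K) :=
    (t p.1 ∘L ContinuousLinearMap.fst ℂ H₂ H₂).prod
      (t p.2 ∘L B₂ ∘L ContinuousLinearMap.fst ℂ H₂ H₂ +
        t (B₁ p.1) ∘L ContinuousLinearMap.snd ℂ H₂ H₂)
  have hcl : IsClosed ((C.comap (L : (H₂ × H₂) →ₗ[ℂ] (K × K)) : Submodule ℂ (H₂ × H₂)) :
      Set (H₂ × H₂)) :=
    hC.preimage L.continuous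
  exact Submodule.topologicalClosure_minimal _
    (Submodule.span_le (p := C.comap (L : (H₂ × H₂) →ₗ[ℂ] (K × K))) |>.mpr h) hcl hq

/-- The generators of the graph of `D₁ ⊗ B₂ + B₁ ⊗ D₂` obtained from two sets of elements of the
graphs of `D₁` and `D₂`. -/
def sumGens (s₁ : Set (H₁ × H₁)) (s₂ : Set (H₂ × H₂)) : Set (K × K) :=
  {r | ∃ p ∈ s₁, ∃ q ∈ s₂, r = sumGen t B₂ B₁ p q}

/-- The closure of the operator `D₁ ⊗ B₂ + B₁ ⊗ D₂` can be computed on cores of `D₁` and `D₂`. -/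
theorem closure_span_sumGens {s₁ : Set (H₁ × H₁)} {s₂ : Set (H₂ × H₂)} {g₁ : Set (H₁ × H₁)}
    {g₂ : Set (H₂ × H₂)} (hs₁ : s₁ ⊆ g₁) (hs₂ : s₂ ⊆ g₂)
    (h₁ : g₁ ⊆ (Submodule.span ℂ s₁).topologicalClosure)
    (h₂ : g₂ ⊆ (Submodule.span ℂ s₂).topologicalClosure) :
    (Submodule.span ℂ (sumGens t B₂ B₁ g₁ g₂)).topologicalClosure =
      (Submodule.span ℂ (sumGens t B₂ B₁ s₁ s₂)).topologicalClosure := by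
  apply le_antisymm
  · refine Submodule.topologicalClosure_minimal _ (Submodule.span_le.mpr ?_)
      (Submodule.isClosed_topologicalClosure _)
    rintro _ ⟨p, hp, q, hq, rfl⟩
    have hcl := Submodule.isClosed_topologicalClosure (Submodule.span ℂ (sumGens t B₂ B₁ s₁ s₂))
    refine sumGen_mem_left t B₂ B₁ hcl (fun p' hp' => ?_) (h₁ hp)
    refine sumGen_mem_right t B₂ B₁ hcl (fun q' hq' => ?_) (h₂ hq)
    exact Submodule.le_topologicalClosure _ (Submodule.subset_span ⟨p', hp', q', hq', rfl⟩)
  · refine Submodule.topologicalClosure_mono (Submodule.span_mono ?_)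
    rintro _ ⟨p, hp, q, hq, rfl⟩
    exact ⟨p, hs₁ hp, q, hs₂ hq, rfl⟩

theorem isSymmGraph_span_sumGens (ht : ∀ x x' y y', ⟪t x y, t x' y'⟫_ℂ = ⟪x, x'⟫_ℂ * ⟪y, y'⟫_ℂ)
    (hB₁ : ∀ x y, ⟪B₁ x, y⟫_ℂ = ⟪x, B₁ y⟫_ℂ) (hB₂ : ∀ x y, ⟪B₂ x, y⟫_ℂ = ⟪x, B₂ y⟫_ℂ)
    {g₁ : Submodule ℂ (H₁ × H₁)} {g₂ : Submodule ℂ (H₂ × H₂)} (h₁ : IsSymmGraph g₁)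
    (h₂ : IsSymmGraph g₂) : IsSymmGraph (Submodule.span ℂ (sumGens t B₂ B₁ g₁ g₂)) := by
  refine isSymmGraph_span ?_
  rintro _ ⟨p, hp, q, hq, rfl⟩ _ ⟨p', hp', q', hq', rfl⟩
  simp only [sumGen, inner_add_left, inner_add_right, ht, hB₁, hB₂, h₁ p hp p' hp',
    h₂ q hq q' hq']

end Gen

/-! ### The closed operator `D₁ ⊗ B₂ + B₁ ⊗ D₂` on the Hilbert space tensor product -/

section TensorSum

variable {H₁ H₂ : Type*} [NormedAddCommGroup H₁] [InnerProductSpace ℂ H₁]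
  [NormedAddCommGroup H₂] [InnerProductSpace ℂ H₂]
  {D₁ : H₁ →ₗ.[ℂ] H₁} {D₂ : H₂ →ₗ.[ℂ] H₂} {B₁ : H₁ →L[ℂ] H₁} {B₂ : H₂ →L[ℂ] H₂}

theorem sumGen_htmulL (p : H₁ × H₁) (q : H₂ × H₂) : sumGen (htmulL H₁ H₂) B₂ B₁ p q =
    (htmul p.1 q.1, htmul p.2 (B₂ q.1) + htmul (B₁ p.1) q.2) := rfl

theorem tensorSum_eq : tensorSum D₁ B₂ B₁ D₂ =
    (Submodule.span ℂ (sumGens (htmulL H₁ H₂) B₂ B₁ D₁.graph D₂.graph)).toLinearPMap.closure := by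
  have : {p : HTensor H₁ H₂ × HTensor H₁ H₂ |
      ∃ x x' y y', (x, x') ∈ D₁.graph ∧ (y, y') ∈ D₂.graph ∧
        p = (htmul x y, htmul x' (B₂ y) + htmul (B₁ x) y')} =
      sumGens (htmulL H₁ H₂) B₂ B₁ D₁.graph D₂.graph := by
    ext r
    constructor
    · rintro ⟨x, x', y, y', h1, h2, rfl⟩
      exact ⟨(x, x'), h1, (y, y'), h2, rfl⟩
    · rintro ⟨p, hp, q, hq, rfl⟩
      exact ⟨p.1, p.2, q.1, q.2, hp, hq, rfl⟩
  rw [tensorSum, this]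

theorem dense_sumGens {s₁ : Set (H₁ × H₁)} {s₂ : Set (H₂ × H₂)}
    (hd₁ : (Submodule.span ℂ (Prod.fst '' s₁)).topologicalClosure = ⊤)
    (hd₂ : (Submodule.span ℂ (Prod.fst '' s₂)).topologicalClosure = ⊤) :
    Dense (Prod.fst '' (Submodule.span ℂ (sumGens (htmulL H₁ H₂) B₂ B₁ s₁ s₂) :
      Set (HTensor H₁ H₂ × HTensor H₁ H₂))) := by
  have h1 : Prod.fst '' (Submodule.span ℂ (sumGens (htmulL H₁ H₂) B₂ B₁ s₁ s₂) :
      Set (HTensor H₁ H₂ × HTensor H₁ H₂)) =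
      ((Submodule.span ℂ (sumGens (htmulL H₁ H₂) B₂ B₁ s₁ s₂)).map
        (LinearMap.fst ℂ (HTensor H₁ H₂) (HTensor H₁ H₂)) : Submodule ℂ (HTensor H₁ H₂)) := rfl
  rw [h1, Submodule.map_span, Submodule.dense_iff_topologicalClosure_eq_top]
  refine eq_top_of_htmul_mem hd₁ hd₂ (Submodule.isClosed_topologicalClosure _) ?_
  rintro _ ⟨p, hp, rfl⟩ _ ⟨q, hq, rfl⟩
  exact Submodule.le_topologicalClosure _ (Submodule.subset_span ⟨_, ⟨p, hp, q, hq, rfl⟩, rfl⟩)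

variable (hB₁ : ∀ x y, ⟪B₁ x, y⟫_ℂ = ⟪x, B₁ y⟫_ℂ) (hB₂ : ∀ x y, ⟪B₂ x, y⟫_ℂ = ⟪x, B₂ y⟫_ℂ)
  (h₁ : IsSymmGraph D₁.graph) (h₂ : IsSymmGraph D₂.graph)
  (hd₁ : Dense (D₁.domain : Set H₁)) (hd₂ : Dense (D₂.domain : Set H₂))

include hB₁ hB₂ h₁ h₂ hd₁ hd₂

/-- The spanning relation is symmetric and densely defined, so it is closable and the default values
hidden in `toLinearPMap` and `closure` do not occur. -/
theorem tensorSum_graph : (tensorSum D₁ B₂ B₁ D₂).graph =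
    (Submodule.span ℂ
      (sumGens (htmulL H₁ H₂) B₂ B₁ D₁.graph D₂.graph)).topologicalClosure := by
  rw [tensorSum_eq]
  refine IsSymmGraph.closure_graph
    (isSymmGraph_span_sumGens (htmulL H₁ H₂) B₂ B₁ inner_htmul hB₁ hB₂ h₁ h₂) (dense_sumGens ?_ ?_)
  · rw [fst_image_graph]
    exact topologicalClosure_span_of_dense hd₁
  · rw [fst_image_graph]
    exact topologicalClosure_span_of_dense hd₂

theorem tensorSum_graph_core {s₁ : Set (H₁ × H₁)} {s₂ : Set (H₂ × H₂)}
    (hs₁ : D₁.graph = (Submodule.span ℂ s₁).topologicalClosure)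
    (hs₂ : D₂.graph = (Submodule.span ℂ s₂).topologicalClosure) :
    (tensorSum D₁ B₂ B₁ D₂).graph =
      (Submodule.span ℂ (sumGens (htmulL H₁ H₂) B₂ B₁ s₁ s₂)).topologicalClosure := by
  rw [tensorSum_graph hB₁ hB₂ h₁ h₂ hd₁ hd₂]
  refine closure_span_sumGens _ _ _ ?_ ?_ (by rw [hs₁]) (by rw [hs₂])
  · rw [hs₁]
    exact Submodule.subset_span.trans (Submodule.le_topologicalClosure _)
  · rw [hs₂]
    exact Submodule.subset_span.trans (Submodule.le_topologicalClosure _)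

theorem isSymmGraph_tensorSum : IsSymmGraph (tensorSum D₁ B₂ B₁ D₂).graph := by
  rw [tensorSum_graph hB₁ hB₂ h₁ h₂ hd₁ hd₂]
  exact (isSymmGraph_span_sumGens (htmulL H₁ H₂) B₂ B₁ inner_htmul hB₁ hB₂ h₁ h₂).topologicalClosure

theorem isClosed_tensorSum : IsClosed ((tensorSum D₁ B₂ B₁ D₂).graph :
    Set (HTensor H₁ H₂ × HTensor H₁ H₂)) := by
  rw [tensorSum_graph hB₁ hB₂ h₁ h₂ hd₁ hd₂]
  exact Submodule.isClosed_topologicalClosure _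

theorem mem_tensorSum {x x' : H₁} {y y' : H₂} (hx : (x, x') ∈ D₁.graph) (hy : (y, y') ∈ D₂.graph) :
    (htmul x y, htmul x' (B₂ y) + htmul (B₁ x) y') ∈ (tensorSum D₁ B₂ B₁ D₂).graph := by
  rw [tensorSum_graph hB₁ hB₂ h₁ h₂ hd₁ hd₂]
  exact Submodule.le_topologicalClosure _
    (Submodule.subset_span ⟨(x, x'), hx, (y, y'), hy, rfl⟩)

/-- A bounded operator `C₁ ⊗ C₂` commutes or anticommutes with `D₁ ⊗ B₂ + B₁ ⊗ D₂` if `C₁` and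
`C₂` do so, with the same sign, with both terms. -/
theorem hmap_mem_tensorSum {C₁ : H₁ →L[ℂ] H₁} {C₂ : H₂ →L[ℂ] H₂} {c c₁ c₂ d₁ d₂ : ℂ}
    (hC₁ : ∀ x y, (x, y) ∈ D₁.graph → (C₁ x, c₁ • C₁ y) ∈ D₁.graph)
    (hC₂ : ∀ x y, (x, y) ∈ D₂.graph → (C₂ x, c₂ • C₂ y) ∈ D₂.graph)
    (hCB₁ : ∀ x, B₁ (C₁ x) = d₁ • C₁ (B₁ x)) (hCB₂ : ∀ x, B₂ (C₂ x) = d₂ • C₂ (B₂ x))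
    (e₁ : c₁ * d₂ = c) (e₂ : d₁ * c₂ = c) {x y : HTensor H₁ H₂}
    (h : (x, y) ∈ (tensorSum D₁ B₂ B₁ D₂).graph) :
    (hmap C₁ C₂ x, c • hmap C₁ C₂ y) ∈ (tensorSum D₁ B₂ B₁ D₂).graph := by
  refine mem_graph_smul_of_core (tensorSum_graph hB₁ hB₂ h₁ h₂ hd₁ hd₂) ?_ h
  rintro _ ⟨p, hp, q, hq, rfl⟩
  have h3 := mem_tensorSum hB₁ hB₂ h₁ h₂ hd₁ hd₂ (hC₁ p.1 p.2 hp) (hC₂ q.1 q.2 hq)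
  have e : htmul (c₁ • C₁ p.2) (B₂ (C₂ q.1)) + htmul (B₁ (C₁ p.1)) (c₂ • C₂ q.2) =
      c • hmap C₁ C₂ (htmul p.2 (B₂ q.1) + htmul (B₁ p.1) q.2) := by
    rw [map_add, hmap_htmul, hmap_htmul, hCB₁, hCB₂, htmul_smul_left, htmul_smul_right,
      htmul_smul_left, htmul_smul_right, smul_smul, smul_smul, e₁, e₂, smul_add]
  rw [e] at h3
  rw [sumGen_htmulL, hmap_htmul]
  exact h3

theorem isCommutator_tensorSum {C₁ T₁ : H₁ →L[ℂ] H₁} {C₂ T₂ : H₂ →L[ℂ] H₂}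
    (hC₁ : IsCommutator D₁ C₁ T₁) (hC₂ : IsCommutator D₂ C₂ T₂)
    (hCB₁ : B₁ * C₁ = C₁ * B₁) (hCB₂ : B₂ * C₂ = C₂ * B₂) :
    IsCommutator (tensorSum D₁ B₂ B₁ D₂) (hmap C₁ C₂)
      (hmap T₁ (B₂ * C₂) + hmap (B₁ * C₁) T₂) := by
  refine isCommutator_of_core (tensorSum_graph hB₁ hB₂ h₁ h₂ hd₁ hd₂) ?_
  rintro _ ⟨p, hp, q, hq, rfl⟩
  have h3 := mem_tensorSum hB₁ hB₂ h₁ h₂ hd₁ hd₂ (hC₁ p.1 p.2 hp) (hC₂ q.1 q.2 hq)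
  have e1 : B₁ (C₁ p.1) = C₁ (B₁ p.1) := congrArg (fun T : H₁ →L[ℂ] H₁ => T p.1) hCB₁
  have e2 : B₂ (C₂ q.1) = C₂ (B₂ q.1) := congrArg (fun T : H₂ →L[ℂ] H₂ => T q.1) hCB₂
  have e : htmul (C₁ p.2 + T₁ p.1) (B₂ (C₂ q.1)) + htmul (B₁ (C₁ p.1)) (C₂ q.2 + T₂ q.1) =
      hmap C₁ C₂ (htmul p.2 (B₂ q.1) + htmul (B₁ p.1) q.2) +
        (hmap T₁ (B₂ * C₂) + hmap (B₁ * C₁) T₂) (htmul p.1 q.1) := by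
    rw [_root_.add_apply, hmap_htmul, hmap_htmul, map_add, hmap_htmul, hmap_htmul,
      mul_apply_eq_comp, mul_apply_eq_comp, htmul_add_left, htmul_add_right, e1, e2]
    abel
  rw [e] at h3
  rw [sumGen_htmulL, hmap_htmul]
  exact h3

theorem exists_isCommutator_linTensor {A₁ A₂ : Type*} [AddCommGroup A₁] [Module ℂ A₁]
    [AddCommGroup A₂] [Module ℂ A₂] (l₁ : A₁ →ₗ[ℂ] (H₁ →L[ℂ] H₁)) (l₂ : A₂ →ₗ[ℂ] (H₂ →L[ℂ] H₂))
    (hl₁ : ∀ a, ∃ T, IsCommutator D₁ (l₁ a) T) (hl₂ : ∀ a, ∃ T, IsCommutator D₂ (l₂ a) T)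
    (hc₁ : ∀ a, B₁ * l₁ a = l₁ a * B₁) (hc₂ : ∀ a, B₂ * l₂ a = l₂ a * B₂) (s : A₁ ⊗[ℂ] A₂) :
    ∃ T, IsCommutator (tensorSum D₁ B₂ B₁ D₂) (linTensor l₁ l₂ s) T := by
  induction s using TensorProduct.induction_on with
  | zero => exact ⟨0, by rw [map_zero]; exact IsCommutator.zero⟩
  | tmul a b =>
    obtain ⟨T₁, hT₁⟩ := hl₁ a
    obtain ⟨T₂, hT₂⟩ := hl₂ b
    exact ⟨_, isCommutator_tensorSum hB₁ hB₂ h₁ h₂ hd₁ hd₂ hT₁ hT₂ (hc₁ a) (hc₂ b)⟩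
  | add a b ha hb =>
    obtain ⟨T, hT⟩ := ha
    obtain ⟨T', hT'⟩ := hb
    exact ⟨T + T', by rw [map_add]; exact hT.add hT'⟩

/-- In the square, the cross terms are `D₁ B₁ x ⊗ B₂ D₂ y` and `B₁ D₁ x ⊗ D₂ B₂ y`, which cancel
since `B₁` anticommutes with `D₁` and `B₂` commutes with `D₂`. -/
theorem compGraph_tensorSum (hBB₁ : ∀ x, B₁ (B₁ x) = x) (hBB₂ : ∀ x, B₂ (B₂ x) = x)
    (hBD₁ : AntiCommutes B₁ D₁) (hBD₂ : Commutes B₂ D₂) {x x'' : H₁} {y y'' : H₂}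
    (hx : CompGraph D₁ D₁ x x'') (hy : CompGraph D₂ D₂ y y'') :
    CompGraph (tensorSum D₁ B₂ B₁ D₂) (tensorSum D₁ B₂ B₁ D₂) (htmul x y)
      (htmul x'' y + htmul x y'') := by
  obtain ⟨x', hx, hx'⟩ := hx
  obtain ⟨y', hy, hy'⟩ := hy
  refine ⟨htmul x' (B₂ y) + htmul (B₁ x) y', mem_tensorSum hB₁ hB₂ h₁ h₂ hd₁ hd₂ hx hy, ?_⟩
  have h3 := (tensorSum D₁ B₂ B₁ D₂).graph.add_mem
    (mem_tensorSum hB₁ hB₂ h₁ h₂ hd₁ hd₂ hx' (hBD₂ y y' hy))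
    (mem_tensorSum hB₁ hB₂ h₁ h₂ hd₁ hd₂ (hBD₁ x x' hx) hy')
  have e : htmul x'' (B₂ (B₂ y)) + htmul (B₁ x') (B₂ y') +
      (htmul (-B₁ x') (B₂ y') + htmul (B₁ (B₁ x)) y'') = htmul x'' y + htmul x y'' := by
    rw [hBB₁, hBB₂, htmul_neg_left]
    abel
  rw [Prod.mk_add_mk, e] at h3
  exact h3

/-- Self-adjointness, domain, square and heat trace of the product operators are all read off from
this basis. -/
theorem squareDiagonal_tensorSum (hBB₁ : ∀ x, B₁ (B₁ x) = x) (hBB₂ : ∀ x, B₂ (B₂ x) = x)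
    (hBD₁ : AntiCommutes B₁ D₁) (hBD₂ : Commutes B₂ D₂) {ι₁ ι₂ : Type*}
    {b₁ : HilbertBasis ι₁ ℂ H₁} {b₂ : HilbertBasis ι₂ ℂ H₂} {κ₁ : ι₁ → ℝ} {κ₂ : ι₂ → ℝ}
    (hb₁ : SquareDiagonal D₁ b₁ κ₁) (hb₂ : SquareDiagonal D₂ b₂ κ₂) :
    SquareDiagonal (tensorSum D₁ B₂ B₁ D₂) (htbasis b₁ b₂) fun p => κ₁ p.1 + κ₂ p.2 := fun p => by
  rw [htbasis_apply, Complex.ofReal_add, add_smul, ← htmul_smul_left, ← htmul_smul_right]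
  exact compGraph_tensorSum hB₁ hB₂ h₁ h₂ hd₁ hd₂ hBB₁ hBB₂ hBD₁ hBD₂ (hb₁ p.1) (hb₂ p.2)

end TensorSum

theorem summable_exp_add {ι₁ ι₂ : Type*} {κ₁ : ι₁ → ℝ} {κ₂ : ι₂ → ℝ}
    (h₁ : ∀ t > 0, Summable fun i => Real.exp (-t * κ₁ i))
    (h₂ : ∀ t > 0, Summable fun i => Real.exp (-t * κ₂ i)) (t : ℝ) (ht : 0 < t) :
    Summable fun p : ι₁ × ι₂ => Real.exp (-t * (κ₁ p.1 + κ₂ p.2)) := by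
  refine ((h₁ t ht).mul_of_nonneg (h₂ t ht) (fun _ => Real.exp_nonneg _)
    fun _ => Real.exp_nonneg _).congr fun p => ?_
  rw [mul_add, Real.exp_add]

end SpectralData

namespace SpectralData

/-! ### Products of `N = (1,1)` spectral data -/

section AntiComm

variable {H : Type*} [NormedAddCommGroup H] [InnerProductSpace ℂ H] [CompleteSpace H]
  {ι : Type*} {D D' : H →ₗ.[ℂ] H} {b : HilbertBasis ι ℂ H} {κ : ι → ℝ}

/-- The domains of `D` and `D'` agree, and so do their squares with domains. If `D D' x` is defined,
then `D' x` lies in the common domain, so `D'² x = D² x` is defined, hence `D' D x` is. Its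
coefficients are found by moving both operators onto `bᵢ`, where anticommutation is assumed. -/
theorem compGraph_neg_of_basis (hD : IsSelfAdjoint D) (hD' : IsSelfAdjoint D')
    (hb : SquareDiagonal D b κ) (hb' : SquareDiagonal D' b κ)
    (h : ∀ i, ∃ c, CompGraph D D' (b i) c ∧ CompGraph D' D (b i) (-c)) {x z : H}
    (hx : CompGraph D D' x z) : CompGraph D' D x (-z) := by
  have hs := isSymmGraph_of_isSelfAdjoint hD
  have hs' := isSymmGraph_of_isSelfAdjoint hD'
  have hcl := isClosed_graph_of_isSelfAdjoint hD
  have hcl' := isClosed_graph_of_isSelfAdjoint hD'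
  have hdom : ∀ {y}, y ∈ D.domain ↔ y ∈ D'.domain := fun {y} => by
    rw [SquareDiagonal.mem_domain_iff hs hcl hb, SquareDiagonal.mem_domain_iff hs' hcl' hb']
  obtain ⟨y, hxy, hyz⟩ := hx
  obtain ⟨w, hw⟩ := LinearPMap.mem_domain_iff.mp (hdom.mp (LinearPMap.mem_domain_of_mem_graph hyz))
  have hw' : CompGraph D' D' x w := ⟨y, hxy, hw⟩
  obtain ⟨y', hxy', hyw'⟩ := (SquareDiagonal.compGraph_iff hs hcl hb).mpr
    ((SquareDiagonal.compGraph_iff hs' hcl' hb').mp hw')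
  obtain ⟨z', hz'⟩ :=
    LinearPMap.mem_domain_iff.mp (hdom.mp (LinearPMap.mem_domain_of_mem_graph hyw'))
  have e : z' = -z := by
    refine hilbertBasis_ext b fun i => ?_
    obtain ⟨c, ⟨v, hv, hvc⟩, ⟨u, hu, huc⟩⟩ := h i
    have e1 : ⟪b i, z'⟫_ℂ = ⟪c, x⟫_ℂ := (hs' _ hv _ hz').symm.trans (hs _ hvc _ hxy').symm
    have e2 : ⟪b i, z⟫_ℂ = ⟪-c, x⟫_ℂ := (hs _ hu _ hyz).symm.trans (hs' _ huc _ hxy).symm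
    rw [inner_neg_right, e1, e2, inner_neg_left, neg_neg]
  exact ⟨y', hxy', e ▸ hz'⟩

theorem compGraph_anticomm_iff_of_basis (hD : IsSelfAdjoint D) (hD' : IsSelfAdjoint D')
    (hb : SquareDiagonal D b κ) (hb' : SquareDiagonal D' b κ)
    (h : ∀ i, ∃ c, CompGraph D D' (b i) c ∧ CompGraph D' D (b i) (-c)) (x z : H) :
    CompGraph D D' x z ↔ CompGraph D' D x (-z) := by
  refine ⟨compGraph_neg_of_basis hD hD' hb hb' h, fun hx => ?_⟩
  have := compGraph_neg_of_basis hD' hD hb' hb (fun i => by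
    obtain ⟨c, h1, h2⟩ := h i
    exact ⟨-c, h2, by rwa [neg_neg]⟩) hx
  rwa [neg_neg] at this

/-- `D' bᵢ` lies in the domain of `D'`, because `D'² bᵢ` is defined, and this is also the domain of
`D`. -/
theorem exists_compGraph_basis (hD : IsSelfAdjoint D) (hD' : IsSelfAdjoint D')
    (hb : SquareDiagonal D b κ) (hb' : SquareDiagonal D' b κ)
    (h : ∀ x z, CompGraph D D' x z ↔ CompGraph D' D x (-z)) (i : ι) :
    ∃ c, CompGraph D D' (b i) c ∧ CompGraph D' D (b i) (-c) := by
  obtain ⟨y, hy, hy'⟩ := hb' i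
  have hdom : y ∈ D.domain := by
    rw [SquareDiagonal.mem_domain_iff (isSymmGraph_of_isSelfAdjoint hD)
      (isClosed_graph_of_isSelfAdjoint hD) hb, ← SquareDiagonal.mem_domain_iff
      (isSymmGraph_of_isSelfAdjoint hD') (isClosed_graph_of_isSelfAdjoint hD') hb']
    exact LinearPMap.mem_domain_of_mem_graph hy'
  obtain ⟨c, hc⟩ := LinearPMap.mem_domain_iff.mp hdom
  have hc' : CompGraph D D' (b i) c := ⟨y, hy, hc⟩
  exact ⟨c, hc', (h _ _).mp hc'⟩

end AntiComm

section Prod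

variable {H₁ H₂ : Type*} [NormedAddCommGroup H₁] [InnerProductSpace ℂ H₁]
  [NormedAddCommGroup H₂] [InnerProductSpace ℂ H₂]

theorem hmap_mul_linTensor {A₁ A₂ : Type*} [AddCommGroup A₁] [Module ℂ A₁] [AddCommGroup A₂]
    [Module ℂ A₂] (l₁ : A₁ →ₗ[ℂ] (H₁ →L[ℂ] H₁)) (l₂ : A₂ →ₗ[ℂ] (H₂ →L[ℂ] H₂))
    {C₁ : H₁ →L[ℂ] H₁} {C₂ : H₂ →L[ℂ] H₂} (h₁ : ∀ a, C₁ * l₁ a = l₁ a * C₁)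
    (h₂ : ∀ a, C₂ * l₂ a = l₂ a * C₂) (s : A₁ ⊗[ℂ] A₂) :
    hmap C₁ C₂ * linTensor l₁ l₂ s = linTensor l₁ l₂ s * hmap C₁ C₂ := by
  induction s using TensorProduct.induction_on with
  | zero => rw [map_zero, mul_zero, zero_mul]
  | tmul a b => rw [linTensor_tmul, hmap_mul, hmap_mul, h₁, h₂]
  | add a b ha hb => rw [map_add, mul_add, add_mul, ha, hb]

theorem commutes_one {D : H₁ →ₗ.[ℂ] H₁} : Commutes 1 D := fun _ _ h => h

end Prod

variable {A₁ A₂ K₁ K₂ : Type u} [Ring A₁] [StarRing A₁] [Algebra ℂ A₁]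
  [Ring A₂] [StarRing A₂] [Algebra ℂ A₂]
  [NormedAddCommGroup K₁] [InnerProductSpace ℂ K₁] [CompleteSpace K₁]
  [NormedAddCommGroup K₂] [InnerProductSpace ℂ K₂] [CompleteSpace K₂]
  {S₁ : Sextuple A₁ K₁} {S₂ : Sextuple A₂ K₂}

theorem Sextuple.IsN11.exists_basis {S : Sextuple A₁ K₁} (hS : S.IsN11) :
    ∃ (ι : Type u) (b : HilbertBasis ι ℂ K₁) (κ : ι → ℝ), SquareDiagonal S.D b κ ∧
      SquareDiagonal S.Dbar b κ ∧ ∀ t > 0, Summable fun i => Real.exp (-t * κ i) := by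
  obtain ⟨ι, b, κ, h1, h2⟩ := exists_squareDiagonal hS.selfAdjoint hS.trace_class
  exact ⟨ι, b, κ, h1, fun i => (hS.sq_eq _ _).mp (h1 i), h2⟩

/-- Each order of composition gives four terms. They are opposite in pairs: the terms with both
operators in one factor by anticommutation there (and `⋆₁ γ₁ = γ₁ ⋆₁`), the mixed ones because `D₂
⋆₂ = -⋆₂ D₂` and `D₁ γ₁ = -γ₁ D₁`, while `⋆₁` commutes with `D̄₁`. -/
theorem compGraph_prod (h₁ : S₁.IsN11) (h₂ : S₂.IsN11) {x w : K₁} {y v : K₂}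
    (hx : CompGraph S₁.D S₁.Dbar x w) (hx' : CompGraph S₁.Dbar S₁.D x (-w))
    (hy : CompGraph S₂.D S₂.Dbar y v) (hy' : CompGraph S₂.Dbar S₂.D y (-v)) :
    ∃ c, CompGraph (S₁.prodD S₂ .standard) (S₁.prodDbar S₂ .standard) (htmul x y) c ∧
      CompGraph (S₁.prodDbar S₂ .standard) (S₁.prodD S₂ .standard) (htmul x y) (-c) := by
  obtain ⟨xb, hxb, hxw⟩ := hx
  obtain ⟨x', hx', hxw'⟩ := hx'
  obtain ⟨yb, hyb, hyv⟩ := hy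
  obtain ⟨y', hy', hyv'⟩ := hy'
  have mem : ∀ {x x' : K₁} {y y' : K₂}, (x, x') ∈ S₁.D.graph → (y, y') ∈ S₂.D.graph →
      (htmul x y, htmul x' y + htmul (S₁.hodge x) y') ∈ (S₁.prodD S₂ .standard).graph :=
    fun {x x' y y'} h h' => mem_tensorSum (B₂ := 1) h₁.hodge_grading.inner_apply (fun _ _ => rfl)
      (isSymmGraph_of_isSelfAdjoint h₁.selfAdjoint) (isSymmGraph_of_isSelfAdjoint h₂.selfAdjoint)
      h₁.selfAdjoint.dense_domain h₂.selfAdjoint.dense_domain h h'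
  have memb : ∀ {x x' : K₁} {y y' : K₂}, (x, x') ∈ S₁.Dbar.graph → (y, y') ∈ S₂.Dbar.graph →
      (htmul x y, htmul x' (S₂.hodge y) + htmul (S₁.γ x) y') ∈ (S₁.prodDbar S₂ .standard).graph :=
    fun {x x' y y'} h h' => mem_tensorSum h₁.grading.inner_apply h₂.hodge_grading.inner_apply
      (isSymmGraph_of_isSelfAdjoint h₁.selfAdjoint_bar)
      (isSymmGraph_of_isSelfAdjoint h₂.selfAdjoint_bar)
      h₁.selfAdjoint_bar.dense_domain h₂.selfAdjoint_bar.dense_domain h h'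
  have comm : S₁.hodge (S₁.γ x) = S₁.γ (S₁.hodge x) :=
    congrArg (fun T : K₁ →L[ℂ] K₁ => T x) h₁.hodge_γ
  refine ⟨(htmul w (S₂.hodge y) + htmul (S₁.hodge xb) (-S₂.hodge y')) +
    (htmul (-S₁.γ x') yb + htmul (S₁.hodge (S₁.γ x)) v), ?_, ?_⟩
  · exact ⟨_, memb hxb hyb, (S₁.prodD S₂ .standard).graph.add_mem
      (mem hxw (h₂.hodge_D _ _ hy')) (mem (h₁.γ_D _ _ hx') hyv)⟩
  · refine ⟨_, mem hx' hy', ?_⟩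
    have h3 := (S₁.prodDbar S₂ .standard).graph.add_mem (memb hxw' hyb)
      (memb (h₁.hodge_Dbar _ _ hxb) hyv')
    have e : htmul (-w) (S₂.hodge y) + htmul (S₁.γ x') yb +
        (htmul (S₁.hodge xb) (S₂.hodge y') + htmul (S₁.γ (S₁.hodge x)) (-v)) =
        -((htmul w (S₂.hodge y) + htmul (S₁.hodge xb) (-S₂.hodge y')) +
          (htmul (-S₁.γ x') yb + htmul (S₁.hodge (S₁.γ x)) v)) := by
      rw [comm, htmul_neg_left, htmul_neg_left, htmul_neg_right, htmul_neg_right]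
      abel
    rw [Prod.mk_add_mk, e] at h3
    exact h3

theorem antiCommutes_hmap {K₁ K₂ : Type*} [NormedAddCommGroup K₁] [InnerProductSpace ℂ K₁]
    [NormedAddCommGroup K₂] [InnerProductSpace ℂ K₂] {C₁ : K₁ →L[ℂ] K₁} {C₂ : K₂ →L[ℂ] K₂}
    {D : HTensor K₁ K₂ →ₗ.[ℂ] HTensor K₁ K₂}
    (h : ∀ {x y}, (x, y) ∈ D.graph → (hmap C₁ C₂ x, (-1 : ℂ) • hmap C₁ C₂ y) ∈ D.graph) :
    AntiCommutes (hmap C₁ C₂) D := fun x y hxy => by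
  have := h hxy
  rwa [neg_one_smul] at this

theorem commutes_hmap {K₁ K₂ : Type*} [NormedAddCommGroup K₁] [InnerProductSpace ℂ K₁]
    [NormedAddCommGroup K₂] [InnerProductSpace ℂ K₂] {C₁ : K₁ →L[ℂ] K₁} {C₂ : K₂ →L[ℂ] K₂}
    {D : HTensor K₁ K₂ →ₗ.[ℂ] HTensor K₁ K₂}
    (h : ∀ {x y}, (x, y) ∈ D.graph → (hmap C₁ C₂ x, (1 : ℂ) • hmap C₁ C₂ y) ∈ D.graph) :
    Commutes (hmap C₁ C₂) D := fun x y hxy => by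
  have := h hxy
  rwa [one_smul] at this

theorem AntiCommutes.neg_one {K : Type*} [NormedAddCommGroup K] [InnerProductSpace ℂ K]
    {C : K →L[ℂ] K} {D : K →ₗ.[ℂ] K} (h : AntiCommutes C D) (x y : K) (hxy : (x, y) ∈ D.graph) :
    (C x, (-1 : ℂ) • C y) ∈ D.graph := by
  rw [neg_one_smul]
  exact h x y hxy

theorem Commutes.one {K : Type*} [NormedAddCommGroup K] [InnerProductSpace ℂ K]
    {C : K →L[ℂ] K} {D : K →ₗ.[ℂ] K} (h : Commutes C D) (x y : K) (hxy : (x, y) ∈ D.graph) :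
    (C x, (1 : ℂ) • C y) ∈ D.graph := by
  rw [one_smul]
  exact h x y hxy

/-- The standard product of `N = (1,1)` spectral data is a set of `N = (1,1)` spectral data. -/
theorem Sextuple.IsN11.prod [StarModule ℂ A₁] [StarModule ℂ A₂] (h₁ : S₁.IsN11) (h₂ : S₂.IsN11) :
    (Sextuple.prod .standard S₁ S₂).IsN11 := by
  obtain ⟨ι₁, b₁, κ₁, hb₁, hbb₁, hs₁⟩ := h₁.exists_basis
  obtain ⟨ι₂, b₂, κ₂, hb₂, hbb₂, hs₂⟩ := h₂.exists_basis
  have sy₁ := isSymmGraph_of_isSelfAdjoint h₁.selfAdjoint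
  have sy₂ := isSymmGraph_of_isSelfAdjoint h₂.selfAdjoint
  have syb₁ := isSymmGraph_of_isSelfAdjoint h₁.selfAdjoint_bar
  have syb₂ := isSymmGraph_of_isSelfAdjoint h₂.selfAdjoint_bar
  have de₁ := h₁.selfAdjoint.dense_domain
  have de₂ := h₂.selfAdjoint.dense_domain
  have deb₁ := h₁.selfAdjoint_bar.dense_domain
  have deb₂ := h₂.selfAdjoint_bar.dense_domain
  have one : ∀ x y : K₂, ⟪(1 : K₂ →L[ℂ] K₂) x, y⟫_ℂ = ⟪x, (1 : K₂ →L[ℂ] K₂) y⟫_ℂ :=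
    fun _ _ => rfl
  have hg₁ := h₁.hodge_grading.inner_apply
  have hg₂ := h₂.hodge_grading.inner_apply
  have gg₁ := h₁.grading.inner_apply
  have sym := isSymmGraph_tensorSum hg₁ one sy₁ sy₂ de₁ de₂
  have cl := isClosed_tensorSum hg₁ one sy₁ sy₂ de₁ de₂
  have symb := isSymmGraph_tensorSum gg₁ hg₂ syb₁ syb₂ deb₁ deb₂
  have clb := isClosed_tensorSum gg₁ hg₂ syb₁ syb₂ deb₁ deb₂
  -- The two operators satisfy the sign conditions for different reasons: `⋆₁` anticommutes with
  -- `D₁` and is paired with `1`, whereas `γ₁` anticommutes with `D̄₁` and is paired with `⋆₂`,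
  -- which commutes with `D̄₂`. They end up with the same eigenbasis and the same values.
  have sq := squareDiagonal_tensorSum hg₁ one sy₁ sy₂ de₁ de₂ h₁.hodge_grading.apply_apply
    (fun _ => rfl) h₁.hodge_D commutes_one hb₁ hb₂
  have sqb := squareDiagonal_tensorSum gg₁ hg₂ syb₁ syb₂ deb₁ deb₂ h₁.grading.apply_apply
    h₂.hodge_grading.apply_apply h₁.γ_Dbar h₂.hodge_Dbar hbb₁ hbb₂
  have sa := SquareDiagonal.isSelfAdjoint sym cl sq
  have sab := SquareDiagonal.isSelfAdjoint symb clb sqb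
  have hγ₁ : ∀ x, S₁.hodge (S₁.γ x) = (1 : ℂ) • S₁.γ (S₁.hodge x) := fun x =>
    (congrArg (fun T : K₁ →L[ℂ] K₁ => T x) h₁.hodge_γ).trans (one_smul _ _).symm
  have γh₁ : ∀ x, S₁.γ (S₁.hodge x) = (1 : ℂ) • S₁.hodge (S₁.γ x) := fun x =>
    (congrArg (fun T : K₁ →L[ℂ] K₁ => T x) h₁.hodge_γ.symm).trans (one_smul _ _).symm
  have hγ₂ : ∀ x, S₂.hodge (S₂.γ x) = (1 : ℂ) • S₂.γ (S₂.hodge x) := fun x =>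
    (congrArg (fun T : K₂ →L[ℂ] K₂ => T x) h₂.hodge_γ).trans (one_smul _ _).symm
  have triv : ∀ {K : Type u} [NormedAddCommGroup K] [InnerProductSpace ℂ K] (x : K),
    x = (1 : ℂ) • x := fun x => (one_smul _ _).symm
  obtain ⟨ρ₁, hρ₁, inj₁⟩ := h₁.representation
  obtain ⟨ρ₂, hρ₂, inj₂⟩ := h₂.representation
  have := h₁.separable
  have := h₂.separable
  exact
  { separable := inferInstance
    representation := by
      refine ⟨repTensor ρ₁ ρ₂, fun a => ?_, repTensor_injective inj₁ inj₂⟩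
      have e₁ : ρ₁.toAlgHom.toLinearMap = S₁.rep := LinearMap.ext hρ₁
      have e₂ : ρ₂.toAlgHom.toLinearMap = S₂.rep := LinearMap.ext hρ₂
      change linTensor ρ₁.toAlgHom.toLinearMap ρ₂.toAlgHom.toLinearMap a =
        linTensor S₁.rep S₂.rep a
      rw [e₁, e₂]
    selfAdjoint := sa
    selfAdjoint_bar := sab
    sq_eq := fun x z => (SquareDiagonal.compGraph_iff sym cl sq).trans
      (SquareDiagonal.compGraph_iff symb clb sqb).symm
    anticomm := compGraph_anticomm_iff_of_basis sa sab sq sqb fun p => by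
      obtain ⟨w, hw, hw'⟩ := exists_compGraph_basis h₁.selfAdjoint h₁.selfAdjoint_bar hb₁ hbb₁
        h₁.anticomm p.1
      obtain ⟨v, hv, hv'⟩ := exists_compGraph_basis h₂.selfAdjoint h₂.selfAdjoint_bar hb₂ hbb₂
        h₂.anticomm p.2
      rw [htbasis_apply]
      exact compGraph_prod h₁ h₂ hw hw' hv hv'
    bounded_commutator := exists_isCommutator_linTensor hg₁ one sy₁ sy₂ de₁ de₂ _ _
      h₁.bounded_commutator h₂.bounded_commutator h₁.hodge_rep fun _ => rfl
    bounded_commutator_bar := exists_isCommutator_linTensor gg₁ hg₂ syb₁ syb₂ deb₁ deb₂ _ _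
      h₁.bounded_commutator_bar h₂.bounded_commutator_bar h₁.γ_rep h₂.hodge_rep
    trace_class := SquareDiagonal.heatTraceClass sq sym cl (summable_exp_add hs₁ hs₂)
    grading := h₁.grading.hmap h₂.grading
    γ_rep := hmap_mul_linTensor _ _ h₁.γ_rep h₂.γ_rep
    γ_D := antiCommutes_hmap (hmap_mem_tensorSum hg₁ one sy₁ sy₂ de₁ de₂ h₁.γ_D.neg_one
      h₂.γ_D.neg_one hγ₁ (fun _ => triv _) (mul_one _) (one_mul _))
    γ_Dbar := antiCommutes_hmap (hmap_mem_tensorSum gg₁ hg₂ syb₁ syb₂ deb₁ deb₂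
      h₁.γ_Dbar.neg_one h₂.γ_Dbar.neg_one (fun _ => triv _) hγ₂ (mul_one _) (one_mul _))
    hodge_grading := h₁.hodge_grading.hmap h₂.hodge_grading
    hodge_γ := by
      change hmap _ _ * hmap _ _ = hmap _ _ * hmap _ _
      rw [hmap_mul, hmap_mul, h₁.hodge_γ, h₂.hodge_γ]
    hodge_rep := hmap_mul_linTensor _ _ h₁.hodge_rep h₂.hodge_rep
    hodge_D := antiCommutes_hmap (hmap_mem_tensorSum hg₁ one sy₁ sy₂ de₁ de₂ h₁.hodge_D.neg_one
      h₂.hodge_D.neg_one (fun _ => triv _) (fun _ => triv _) (mul_one _) (one_mul _))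
    hodge_Dbar := commutes_hmap (hmap_mem_tensorSum gg₁ hg₂ syb₁ syb₂ deb₁ deb₂
      h₁.hodge_Dbar.one h₂.hodge_Dbar.one γh₁ (fun _ => triv _) (mul_one _) (one_mul _)) }

/-! ### Transport along a unitary -/

section Transport

variable {K L : Type*} [NormedAddCommGroup K] [InnerProductSpace ℂ K]
  [NormedAddCommGroup L] [InnerProductSpace ℂ L] {U : K ≃ₗᵢ[ℂ] L}

theorem compGraph_transport {D D' : K →ₗ.[ℂ] K} {F F' : L →ₗ.[ℂ] L}
    (h : ∀ x y, (x, y) ∈ D.graph ↔ (U x, U y) ∈ F.graph)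
    (h' : ∀ x y, (x, y) ∈ D'.graph ↔ (U x, U y) ∈ F'.graph) (x z : K) :
    CompGraph D D' x z ↔ CompGraph F F' (U x) (U z) := by
  constructor
  · rintro ⟨y, h1, h2⟩
    exact ⟨U y, (h' _ _).mp h1, (h _ _).mp h2⟩
  · rintro ⟨y, h1, h2⟩
    rw [← U.apply_symm_apply y] at h1 h2
    exact ⟨U.symm y, (h' _ _).mpr h1, (h _ _).mpr h2⟩

theorem isSelfAdjoint_transport [CompleteSpace K] [CompleteSpace L] {D : K →ₗ.[ℂ] K} {F : L →ₗ.[ℂ] L}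
    (h : ∀ x y, (x, y) ∈ D.graph ↔ (U x, U y) ∈ F.graph) (hF : IsSelfAdjoint F) :
    IsSelfAdjoint D := by
  rw [isSelfAdjoint_iff_graph] at hF ⊢
  have hdom : ∀ x, x ∈ D.domain ↔ U x ∈ F.domain := fun x => by
    rw [LinearPMap.mem_domain_iff, LinearPMap.mem_domain_iff]
    constructor
    · rintro ⟨y, hy⟩
      exact ⟨U y, (h _ _).mp hy⟩
    · rintro ⟨y, hy⟩
      rw [← U.apply_symm_apply y] at hy
      exact ⟨U.symm y, (h _ _).mpr hy⟩
  refine ⟨?_, fun x y => ?_⟩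
  · have : (D.domain : Set K) = U.toHomeomorph ⁻¹' (F.domain : Set L) := Set.ext hdom
    rw [this]
    exact hF.1.preimage U.toHomeomorph.isOpenMap
  · rw [h, hF.2]
    constructor
    · intro h1 u v huv
      have := h1 _ _ ((h _ _).mp huv)
      rwa [U.inner_map_map, U.inner_map_map] at this
    · intro h1 u v huv
      rw [← U.apply_symm_apply u, ← U.apply_symm_apply v] at huv ⊢
      rw [U.inner_map_map, U.inner_map_map]
      exact h1 _ _ ((h _ _).mpr huv)

/-- Rather than the semigroup, the eigenbasis of `F²` is pulled back along `U`. -/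
theorem heatTraceClass_transport {K L : Type v} [NormedAddCommGroup K] [InnerProductSpace ℂ K]
    [CompleteSpace K] [NormedAddCommGroup L] [InnerProductSpace ℂ L] [CompleteSpace L]
    {U : K ≃ₗᵢ[ℂ] L} {D : K →ₗ.[ℂ] K} {F : L →ₗ.[ℂ] L}
    (h : ∀ x y, (x, y) ∈ D.graph ↔ (U x, U y) ∈ F.graph) (hF : IsSelfAdjoint F)
    (hh : HeatTraceClass F) : HeatTraceClass D := by
  obtain ⟨ι, b, κ, hb, hs⟩ := exists_squareDiagonal hF hh
  have hD := isSelfAdjoint_transport h hF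
  have e : ∀ i, U (HilbertBasis.ofRepr (U.trans b.repr) i) = b i := fun i => by
    classical
    rw [← HilbertBasis.repr_symm_single, ← HilbertBasis.repr_symm_single]
    exact U.apply_symm_apply _
  refine SquareDiagonal.heatTraceClass (b := HilbertBasis.ofRepr (U.trans b.repr)) (κ := κ)
    (fun i => ?_) (isSymmGraph_of_isSelfAdjoint hD) (isClosed_graph_of_isSelfAdjoint hD) hs
  rw [compGraph_transport h h, map_smul, e]
  exact hb i

theorem isCommutator_transport {D : K →ₗ.[ℂ] K} {F : L →ₗ.[ℂ] L}
    (h : ∀ x y, (x, y) ∈ D.graph ↔ (U x, U y) ∈ F.graph) {B : K →L[ℂ] K} {C T : L →L[ℂ] L}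
    (hB : ∀ x, U (B x) = C (U x)) (hT : IsCommutator F C T) : ∃ T', IsCommutator D B T' := by
  refine ⟨(U.symm.toContinuousLinearEquiv : L →L[ℂ] K) ∘L T ∘L
    (U.toContinuousLinearEquiv : K →L[ℂ] L), fun x y hxy => ?_⟩
  rw [h, map_add, hB, hB]
  have e : U (((U.symm.toContinuousLinearEquiv : L →L[ℂ] K) ∘L T ∘L
    (U.toContinuousLinearEquiv : K →L[ℂ] L)) x) = T (U x) := U.apply_symm_apply _
  rw [e]
  exact hT _ _ ((h _ _).mp hxy)

theorem isGrading_transport [CompleteSpace K] [CompleteSpace L] {B : K →L[ℂ] K} {C : L →L[ℂ] L}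
    (hB : ∀ x, U (B x) = C (U x))
    (hC : IsGrading C) : IsGrading B where
  selfAdjoint := by
    rw [ContinuousLinearMap.isSelfAdjoint_iff_isSymmetric]
    intro x y
    change ⟪B x, y⟫_ℂ = ⟪x, B y⟫_ℂ
    rw [← U.inner_map_map, ← U.inner_map_map x, hB, hB, hC.inner_apply]
  sq_eq_one := by
    ext x
    apply U.injective
    change U (B (B x)) = U x
    rw [hB, hB, hC.apply_apply]

theorem mul_comm_transport {B B' : K →L[ℂ] K} {C C' : L →L[ℂ] L} (hB : ∀ x, U (B x) = C (U x))
    (hB' : ∀ x, U (B' x) = C' (U x)) (h : C * C' = C' * C) : B * B' = B' * B := by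
  ext x
  apply U.injective
  change U (B (B' x)) = U (B' (B x))
  rw [hB, hB', hB', hB]
  exact congrArg (fun T : L →L[ℂ] L => T (U x)) h

theorem antiCommutes_transport {D : K →ₗ.[ℂ] K} {F : L →ₗ.[ℂ] L}
    (h : ∀ x y, (x, y) ∈ D.graph ↔ (U x, U y) ∈ F.graph) {B : K →L[ℂ] K} {C : L →L[ℂ] L}
    (hB : ∀ x, U (B x) = C (U x)) (hC : AntiCommutes C F) : AntiCommutes B D := fun x y hxy => by
  rw [h, map_neg, hB, hB]
  exact hC _ _ ((h _ _).mp hxy)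

theorem commutes_transport {D : K →ₗ.[ℂ] K} {F : L →ₗ.[ℂ] L}
    (h : ∀ x y, (x, y) ∈ D.graph ↔ (U x, U y) ∈ F.graph) {B : K →L[ℂ] K} {C : L →L[ℂ] L}
    (hB : ∀ x, U (B x) = C (U x)) (hC : Commutes C F) : Commutes B D := fun x y hxy => by
  rw [h, hB, hB]
  exact hC _ _ ((h _ _).mp hxy)

end Transport

/-- `N = (1,1)` spectral data can be transported along a unitary. -/
theorem Sextuple.Transports.isN11 {A K L : Type u} [Ring A] [StarRing A] [Algebra ℂ A]
    [NormedAddCommGroup K] [InnerProductSpace ℂ K] [CompleteSpace K]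
    [NormedAddCommGroup L] [InnerProductSpace ℂ L] [CompleteSpace L]
    {U : K ≃ₗᵢ[ℂ] L} {S : Sextuple A K} {T : Sextuple A L} (h : Sextuple.Transports U S T)
    (hT : T.IsN11) : S.IsN11 where
  separable := by
    have := hT.separable
    exact U.symm.surjective.denseRange.separableSpace U.symm.continuous
  representation := by
    obtain ⟨ρ, hρ, inj⟩ := hT.representation
    have hU : ∀ a x, U (S.rep a x) = ρ a (U x) := fun a x => by rw [h.rep, hρ]
    have h1 : S.rep 1 = 1 := by
      ext x
      apply U.injective
      rw [hU, map_one]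
      rfl
    have hmul : ∀ a b, S.rep (a * b) = S.rep a * S.rep b := fun a b => by
      ext x
      apply U.injective
      rw [hU, map_mul]
      change ρ a (ρ b (U x)) = U (S.rep a (S.rep b x))
      rw [hU, hU]
    refine ⟨{ AlgHom.ofLinearMap S.rep h1 hmul with
      map_star' := fun a => ?_ }, fun a => rfl, fun a b hab => ?_⟩
    · change S.rep (star a) = star (S.rep a)
      rw [ContinuousLinearMap.star_eq_adjoint, ContinuousLinearMap.eq_adjoint_iff]
      intro x y
      rw [← U.inner_map_map, ← U.inner_map_map x, hU, hU, map_star,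
        ContinuousLinearMap.star_eq_adjoint, ContinuousLinearMap.adjoint_inner_left]
    · have hab : S.rep a = S.rep b := hab
      apply inj
      ext x
      rw [← U.apply_symm_apply x, ← hU, ← hU, hab]
  selfAdjoint := isSelfAdjoint_transport h.D hT.selfAdjoint
  selfAdjoint_bar := isSelfAdjoint_transport h.Dbar hT.selfAdjoint_bar
  sq_eq x z := by
    rw [compGraph_transport h.D h.D, compGraph_transport h.Dbar h.Dbar, hT.sq_eq]
  anticomm x z := by
    rw [compGraph_transport h.D h.Dbar, compGraph_transport h.Dbar h.D, hT.anticomm, map_neg]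
  bounded_commutator a := by
    obtain ⟨T', hT'⟩ := hT.bounded_commutator a
    exact isCommutator_transport h.D (h.rep a) hT'
  bounded_commutator_bar a := by
    obtain ⟨T', hT'⟩ := hT.bounded_commutator_bar a
    exact isCommutator_transport h.Dbar (h.rep a) hT'
  trace_class := heatTraceClass_transport h.D hT.selfAdjoint hT.trace_class
  grading := isGrading_transport h.γ hT.grading
  γ_rep a := mul_comm_transport h.γ (h.rep a) (hT.γ_rep a)
  γ_D := antiCommutes_transport h.D h.γ hT.γ_D
  γ_Dbar := antiCommutes_transport h.Dbar h.γ hT.γ_Dbar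
  hodge_grading := isGrading_transport h.hodge hT.hodge_grading
  hodge_γ := mul_comm_transport h.hodge h.γ hT.hodge_γ
  hodge_rep a := mul_comm_transport h.hodge (h.rep a) (hT.hodge_rep a)
  hodge_D := antiCommutes_transport h.D h.hodge hT.hodge_D
  hodge_Dbar := commutes_transport h.Dbar h.hodge hT.hodge_Dbar

end SpectralData

namespace SpectralData

/-! ### The completion of `E ⊗_A E` -/

section Completion

variable {A H : Type u} [Ring A] [StarRing A] [Algebra ℂ A] [StarModule ℂ A]
  [NormedAddCommGroup H] [InnerProductSpace ℂ H] [CompleteSpace H]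

namespace ModuleData

variable (X : ModuleData A H)

/-- Dual basis lemma: a finitely generated projective module is a direct summand of some `Aⁿ`. The
coordinates are `ℂ`-linear because scalars act through `A`. -/
theorem exists_coordinates : ∃ (n : ℕ) (e : Fin n → X.E) (φ : Fin n → X.E →ₗ[ℂ] A),
    (∀ k a ξ, φ k (X.left a ξ) = a * φ k ξ) ∧ ∀ ξ, ξ = ∑ k, X.left (φ k ξ) (e k) := by
  let _ : Module A X.E := repModule X.rep X.E X.rep_mem
  have := X.finite_projective.1
  have := X.finite_projective.2
  obtain ⟨n, f, g, -, -, hfg⟩ := Module.Finite.exists_comp_eq_id_of_projective A X.E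
  have hc : ∀ (c : ℂ) (ξ : X.E), (algebraMap ℂ A c) • ξ = c • ξ := fun c ξ => Subtype.ext (by
    change X.rep (algebraMap ℂ A c) (ξ : H) = c • (ξ : H)
    rw [AlgHomClass.commutes, Algebra.algebraMap_eq_smul_one]
    rfl)
  refine ⟨n, fun k => f (Pi.single k 1), fun k =>
    { toFun := fun ξ => g ξ k
      map_add' := fun ξ η => by rw [map_add]; rfl
      map_smul' := fun c ξ => by
        rw [← hc, map_smul, Pi.smul_apply, smul_eq_mul, RingHom.id_apply, Algebra.smul_def] },
    fun k a ξ => ?_, fun ξ => ?_⟩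
  · change g (a • ξ) k = a * g ξ k
    rw [map_smul, Pi.smul_apply, smul_eq_mul]
  · have h1 : f (g ξ) = ξ := LinearMap.congr_fun hfg ξ
    conv_lhs => rw [← h1, pi_eq_sum_univ' (g ξ), map_sum]
    refine Finset.sum_congr rfl fun k _ => ?_
    rw [map_smul]
    congr 2

end ModuleData

namespace HermitianData

variable (X : HermitianData A H)

/-- Self-duality represents each coordinate functional by a vector. -/
theorem exists_dual_basis : ∃ (n : ℕ) (e f : Fin n → X.E),
    ∀ ξ, ξ = ∑ k, X.left (X.herm ξ (f k)) (e k) := by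
  obtain ⟨n, e, φ, h1, h2⟩ := X.exists_coordinates
  choose f hf using fun k => (X.herm_dual (φ k) (h1 k)).exists
  refine ⟨n, e, f, fun ξ => ?_⟩
  simp only [← hf]
  exact h2 ξ

/-- The contraction `ξ ⊗ η ↦ ⟨f, J ξ⟩ η`. -/
def contraction (f : X.E) : X.EE →ₗ[ℂ] X.E :=
  nclift (LinearMap.mk₂ ℂ (fun ξ η => X.left (X.herm f (X.JE ξ)) η)
    (fun ξ ξ' η => Subtype.ext (by
      change X.rep _ (η : H) = X.rep _ (η : H) + X.rep _ (η : H)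
      rw [map_add, map_add, map_add]
      rfl))
    (fun c ξ η => Subtype.ext (by
      change X.rep _ (η : H) = c • X.rep _ (η : H)
      rw [LinearMap.map_smulₛₗ, LinearMap.map_smulₛₗ, Complex.conj_conj, map_smul]
      rfl))
    (fun ξ η η' => map_add _ _ _) (fun c ξ η => map_smul _ _ _))
    (fun a ξ η => Subtype.ext (by
      change X.rep (X.herm f (X.JE (X.right a ξ))) (η : H) =
        X.rep (X.herm f (X.JE ξ)) (X.rep a (η : H))
      rw [JE_right, X.herm_right, star_star, map_mul]
      rfl))

theorem contraction_nctmul (f ξ η : X.E) :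
    X.contraction f (nctmul X.right X.left ξ η) = X.left (X.herm f (X.JE ξ)) η := rfl

theorem form_contraction (f η : X.E) (z : X.EE) :
    X.form (nctmul X.right X.left (X.JEsymm f) η) z = ⟪(η : H), (X.contraction f z : H)⟫_ℂ := by
  induction z using nctensor_induction with
  | tmul ξ η' => rw [form_nctmul, JE_JEsymm, contraction_nctmul]; rfl
  | add x y hx hy =>
    rw [LinearMap.map_add (X.form _), map_add, hx, hy, Submodule.coe_add, inner_add_right]

/-- Expanding `J ξ` in the frame and applying `J*` writes `ξ` with coefficients acting from the
right; balancing moves them onto the second leg, where they form the contractions. -/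
theorem eq_sum_contraction {n : ℕ} {e f : Fin n → X.E}
    (h : ∀ ξ, ξ = ∑ k, X.left (X.herm ξ (f k)) (e k)) (z : X.EE) :
    z = ∑ k, nctmul X.right X.left (X.JEsymm (e k)) (X.contraction (f k) z) := by
  induction z using nctensor_induction with
  | tmul ξ η =>
    have h1 : ξ = ∑ k, X.right (X.herm (f k) (X.JE ξ)) (X.JEsymm (e k)) := by
      conv_lhs => rw [← X.JEsymm_JE ξ, h (X.JE ξ), map_sum]
      refine Finset.sum_congr rfl fun k _ => ?_
      rw [right_eq, X.herm_symm]
      apply Subtype.ext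
      change X.J.symm (X.rep _ (e k : H)) = X.J (X.rep _ (X.J.symm (X.J.symm (e k : H))))
      rw [X.J_symm_eq (e k : H), map_zsmul, X.J.symm_apply_apply, map_zsmul, map_zsmul, X.J_symm_eq]
    conv_lhs => rw [h1]
    have h2 : ∀ s : Fin n → X.E, nctmul X.right X.left (∑ k, s k) η =
        ∑ k, nctmul X.right X.left (s k) η := fun s =>
      map_sum ((ncmk X.right X.left).flip η) s Finset.univ
    rw [h2]
    exact Finset.sum_congr rfl fun k _ => by rw [nctmul_balanced, contraction_nctmul]
  | add x y hx hy =>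
    conv_lhs => rw [hx, hy]
    rw [← Finset.sum_add_distrib]
    exact Finset.sum_congr rfl fun k _ => by rw [map_add, nctmul_add_right]

/-- Pairing with `J* f ⊗ η` for `η` in the dense `E` shows that all contractions of `z` vanish, and
the contractions along a frame determine `z`. Thus the form is nondegenerate and `E ⊗_A E` embeds in
its completion. -/
theorem eq_zero_of_form {z : X.EE} (hz : ∀ w, X.form w z = 0) : z = 0 := by
  obtain ⟨n, e, f, h⟩ := X.exists_dual_basis
  have h1 : ∀ g, X.contraction g z = 0 := fun g => by
    apply Subtype.ext
    refine X.dense_E.eq_zero_of_inner_right ℂ fun η hη => ?_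
    rw [← X.form_contraction g ⟨η, hη⟩ z, hz]
  rw [X.eq_sum_contraction h z]
  refine Finset.sum_eq_zero fun k _ => ?_
  rw [h1]
  exact map_zero (ncmk X.right X.left (X.JEsymm (e k)))

theorem inner_incl (z w : X.EE) : ⟪X.incl z, X.incl w⟫_ℂ = X.form z w :=
  Completion.inner_coe (E := X.Pre) z w

theorem denseRange_incl : DenseRange X.incl := Completion.denseRange_coe (α := X.Pre)

theorem incl_injective : Function.Injective X.incl := by
  rw [injective_iff_map_eq_zero]
  intro z hz
  refine X.eq_zero_of_form fun w => ?_
  rw [← inner_incl, hz, inner_zero_right]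

/-- The graph of an operator on `E ⊗_A E`, in the completion. -/
def preGraph (T : X.EE →ₗ[ℂ] X.EE) : Submodule ℂ (X.HTilde × X.HTilde) :=
  LinearMap.range (X.incl.prod (X.incl ∘ₗ T))

theorem preGraph_toLinearPMap (T : X.EE →ₗ[ℂ] X.EE) :
    (X.preGraph T).toLinearPMap.graph = X.preGraph T := by
  refine Submodule.toLinearPMap_graph_eq _ ?_
  rintro _ ⟨z, rfl⟩ h
  have : z = 0 := X.incl_injective (h.trans (map_zero X.incl).symm)
  rw [this, map_zero]
  rfl

theorem closureOp_graph {T : X.EE →ₗ[ℂ] X.EE}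
    (h : ∃ F : X.HTilde →ₗ.[ℂ] X.HTilde, (X.preGraph T).topologicalClosure = F.graph) :
    (X.closureOp T).graph = (X.preGraph T).topologicalClosure := by
  have hc : (X.preGraph T).toLinearPMap.IsClosable := by
    rwa [LinearPMap.IsClosable, preGraph_toLinearPMap]
  have h1 := hc.graph_closure_eq_closure_graph
  rw [preGraph_toLinearPMap] at h1
  exact h1.symm

/-- Without closability `closureOp T` would by default be the operator itself; being self-adjoint it
would be closed, hence closable, a contradiction. -/
theorem closureOp_graph_of_isSelfAdjoint {T : X.EE →ₗ[ℂ] X.EE} (h : IsSelfAdjoint (X.closureOp T)) :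
    (X.closureOp T).graph = (X.preGraph T).topologicalClosure := by
  by_cases hc : (X.preGraph T).toLinearPMap.IsClosable
  · exact X.closureOp_graph (by rwa [LinearPMap.IsClosable, preGraph_toLinearPMap] at hc)
  · have h1 : X.closureOp T = (X.preGraph T).toLinearPMap := LinearPMap.closure_def' hc
    exact absurd (LinearPMap.IsClosed.isClosable (h1 ▸ h.isClosed)) hc

theorem boundedExtension_incl {T : X.EE →ₗ[ℂ] X.EE} {S : X.HTilde →L[ℂ] X.HTilde}
    (h : ∀ z, S (X.incl z) = X.incl (T z)) : X.boundedExtension T = S := by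
  have h1 : ∃ S : X.HTilde →L[ℂ] X.HTilde, ∀ z, S (X.incl z) = X.incl (T z) := ⟨S, h⟩
  rw [boundedExtension, dif_pos h1]
  refine ContinuousLinearMap.coeFn_injective
    (X.denseRange_incl.equalizer (map_continuous _) (map_continuous _) (funext fun z => ?_))
  exact (h1.choose_spec z).trans (h z).symm

/-- The default value `0` can square to the identity only on the zero space, where there is nothing
to prove. -/
theorem boundedExtension_incl_of_isGrading {T : X.EE →ₗ[ℂ] X.EE}
    (hT : IsGrading (X.boundedExtension T)) (z : X.EE) :
    X.boundedExtension T (X.incl z) = X.incl (T z) := by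
  by_cases h : ∃ S : X.HTilde →L[ℂ] X.HTilde, ∀ z, S (X.incl z) = X.incl (T z)
  · obtain ⟨S, hS⟩ := h
    rw [X.boundedExtension_incl hS, hS]
  · have h0 : X.boundedExtension T = 0 := dif_neg h
    have h1 : ∀ x : X.HTilde, x = 0 := fun x => by
      rw [← hT.apply_apply x, h0]
      rfl
    exact (h1 _).trans (h1 _).symm

theorem repTilde_incl {ρ : A →ₗ[ℂ] (X.HTilde →L[ℂ] X.HTilde)}
    (h : ∀ a z, ρ a (X.incl z) = X.incl (X.eeLeft a z)) : X.repTilde = ρ := by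
  have h1 : ∃ ρ : A →ₗ[ℂ] (X.HTilde →L[ℂ] X.HTilde),
    ∀ a z, ρ a (X.incl z) = X.incl (X.eeLeft a z) := ⟨ρ, h⟩
  rw [repTilde, dif_pos h1]
  refine LinearMap.ext fun a => ContinuousLinearMap.coeFn_injective
    (X.denseRange_incl.equalizer (map_continuous _) (map_continuous _) (funext fun z => ?_))
  exact (h1.choose_spec a z).trans (h a z).symm

/-- As for gradings, the default value `0` is unital only on the zero space. -/
theorem repTilde_incl_of_one (h1 : X.repTilde 1 = 1) (a : A) (z : X.EE) :
    X.repTilde a (X.incl z) = X.incl (X.eeLeft a z) := by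
  by_cases h : ∃ ρ : A →ₗ[ℂ] (X.HTilde →L[ℂ] X.HTilde),
    ∀ a z, ρ a (X.incl z) = X.incl (X.eeLeft a z)
  · obtain ⟨ρ, hρ⟩ := h
    rw [X.repTilde_incl hρ, hρ]
  · have h0 : X.repTilde = 0 := dif_neg h
    have h2 : ∀ x : X.HTilde, x = 0 := fun x => by
      have : x = X.repTilde 1 x := by rw [h1]; rfl
      rw [this, h0]
      rfl
    exact (h2 _).trans (h2 _).symm

end HermitianData

/-! ### Identification of the completion with a given Hilbert space -/

section Identification

variable (X : HermitianData A H) {K : Type*} [NormedAddCommGroup K] [InnerProductSpace ℂ K]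
  [CompleteSpace K] (Θ : X.EE →ₗ[ℂ] K) (hΘ : ∀ z w, ⟪Θ z, Θ w⟫_ℂ = X.form z w)
  (hd : DenseRange Θ)

include hΘ hd

theorem exists_unitary : ∃ U : X.HTilde ≃ₗᵢ[ℂ] K, ∀ z, U (X.incl z) = Θ z := by
  have hn : ∀ z, ‖Θ (LinearEquiv.refl ℂ X.EE z)‖ = ‖X.incl z‖ := fun z => by
    have h1 := (hΘ z z).trans (X.inner_incl z z).symm
    rw [inner_self_ofReal, inner_self_ofReal, Complex.ofReal_inj] at h1
    exact (sq_eq_sq₀ (norm_nonneg _) (norm_nonneg _)).mp h1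
  exact ⟨(LinearEquiv.refl ℂ X.EE).extendOfIsometry X.incl Θ X.denseRange_incl hd hn,
    LinearEquiv.extendOfIsometry_eq _ _ _ _ _ hn⟩

end Identification

/-! ### Transport of the extended operators along the identification -/

section Unitary

variable {X : HermitianData A H} {K : Type*} [NormedAddCommGroup K] [InnerProductSpace ℂ K]
  {Θ : X.EE →ₗ[ℂ] K} {U : X.HTilde ≃ₗᵢ[ℂ] K} (hU : ∀ z, U (X.incl z) = Θ z)

include hU

theorem map_preGraph_closure (T : X.EE →ₗ[ℂ] X.EE) (x y : X.HTilde) :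
    (x, y) ∈ (X.preGraph T).topologicalClosure ↔
      (U x, U y) ∈ (LinearMap.range (Θ.prod (Θ ∘ₗ T))).topologicalClosure := by
  let V : X.HTilde × X.HTilde ≃ₜ K × K := U.toHomeomorph.prodCongr U.toHomeomorph
  have h1 : V ⁻¹' (LinearMap.range (Θ.prod (Θ ∘ₗ T)) : Set (K × K)) = X.preGraph T := by
    ext p
    constructor
    · rintro ⟨z, hz⟩
      refine ⟨z, Prod.ext ?_ ?_⟩
      · exact U.injective ((hU z).trans (congrArg Prod.fst hz))
      · exact U.injective ((hU (T z)).trans (congrArg Prod.snd hz))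
    · rintro ⟨z, rfl⟩
      exact ⟨z, Prod.ext (hU z).symm (hU (T z)).symm⟩
  have h2 := V.preimage_closure (LinearMap.range (Θ.prod (Θ ∘ₗ T)) : Set (K × K))
  rw [h1] at h2
  exact (Set.ext_iff.mp h2 (x, y)).symm

/-- Closability need not be known beforehand: the closed relation is carried by `U` to the graph of
the operator `F`, hence is single-valued. -/
theorem closureOp_transport {T : X.EE →ₗ[ℂ] X.EE} {F : K →ₗ.[ℂ] K}
    (hF : F.graph = (LinearMap.range (Θ.prod (Θ ∘ₗ T))).topologicalClosure) (x y : X.HTilde) :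
    (x, y) ∈ (X.closureOp T).graph ↔ (U x, U y) ∈ F.graph := by
  rw [X.closureOp_graph, hF, map_preGraph_closure hU]
  refine ⟨(X.preGraph T).topologicalClosure.toLinearPMap,
    (Submodule.toLinearPMap_graph_eq _ ?_).symm⟩
  rintro ⟨x, y⟩ hp hx
  have hx : x = 0 := hx
  rw [map_preGraph_closure hU, ← hF] at hp
  have h0 := LinearPMap.graph_fst_eq_zero_snd F hp (by rw [hx, map_zero])
  exact (map_eq_zero_iff U U.injective).mp h0

theorem boundedExtension_transport {T : X.EE →ₗ[ℂ] X.EE} {S : K →L[ℂ] K}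
    (hS : ∀ z, S (Θ z) = Θ (T z)) (x : X.HTilde) : U (X.boundedExtension T x) = S (U x) := by
  have h := X.boundedExtension_incl (T := T)
    (S := (U.symm.toContinuousLinearEquiv : K →L[ℂ] X.HTilde) ∘L S ∘L
      (U.toContinuousLinearEquiv : X.HTilde →L[ℂ] K)) fun z => by
    apply U.injective
    rw [hU, ← hS, ← hU]
    exact U.apply_symm_apply _
  rw [h]
  exact U.apply_symm_apply _

theorem repTilde_transport {ρ : A →ₗ[ℂ] (K →L[ℂ] K)}
    (hρ : ∀ a z, ρ a (Θ z) = Θ (X.eeLeft a z)) (a : A) (x : X.HTilde) :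
    U (X.repTilde a x) = ρ a (U x) := by
  have h := X.repTilde_incl
    (ρ := { toFun := fun a => (U.symm.toContinuousLinearEquiv : K →L[ℂ] X.HTilde) ∘L ρ a ∘L
              (U.toContinuousLinearEquiv : X.HTilde →L[ℂ] K)
            map_add' := fun a b => by rw [map_add]; ext; simp
            map_smul' := fun c a => by rw [map_smul]; ext; simp }) fun a z => by
    apply U.injective
    rw [hU, ← hρ, ← hU]
    exact U.apply_symm_apply _
  rw [h]
  exact U.apply_symm_apply _

end Unitary

/-- To identify `Φ X` with a sextuple on a Hilbert space `K` it suffices to identify `E ⊗_A E`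
isometrically with a dense subspace of `K`. -/
theorem transports_of_isometry (X : ExtInput A H) {K : Type u} [NormedAddCommGroup K]
    [InnerProductSpace ℂ K] {S : Sextuple A K} {Θ : X.EE →ₗ[ℂ] K} {U : X.HTilde ≃ₗᵢ[ℂ] K}
    (hU : ∀ z, U (X.incl z) = Θ z)
    (hrep : ∀ a z, S.rep a (Θ z) = Θ (X.eeLeft a z))
    (hD : S.D.graph = (LinearMap.range (Θ.prod (Θ ∘ₗ X.dirac))).topologicalClosure)
    (hDbar : S.Dbar.graph = (LinearMap.range (Θ.prod (Θ ∘ₗ X.diracBar))).topologicalClosure)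
    (hγ : ∀ z, S.γ (Θ z) = Θ (X.eeγ z)) (hhodge : ∀ z, S.hodge (Θ z) = Θ (X.eeHodge z)) :
    Sextuple.Transports U (Phi X) S where
  rep := repTilde_transport hU hrep
  D := closureOp_transport hU hD
  Dbar := closureOp_transport hU hDbar
  γ := boundedExtension_transport hU hγ
  hodge := boundedExtension_transport hU hhodge

/-! ### Consequences of the relations of `N = (1,1)` spectral data -/

section N11

variable {X : ExtInput A H} (h : (Phi X).IsN11)

include h

theorem Phi_rep_incl (a : A) (z : X.EE) : (Phi X).rep a (X.incl z) = X.incl (X.eeLeft a z) := by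
  obtain ⟨ρ, hρ, -⟩ := h.representation
  exact X.repTilde_incl_of_one ((hρ 1).symm.trans (map_one ρ)) a z

theorem Phi_γ_incl (z : X.EE) : (Phi X).γ (X.incl z) = X.incl (X.eeγ z) :=
  X.boundedExtension_incl_of_isGrading h.grading z

theorem Phi_hodge_incl (z : X.EE) : (Phi X).hodge (X.incl z) = X.incl (X.eeHodge z) :=
  X.boundedExtension_incl_of_isGrading h.hodge_grading z

theorem Phi_D_graph : (Phi X).D.graph = (X.preGraph X.dirac).topologicalClosure :=
  X.closureOp_graph_of_isSelfAdjoint h.selfAdjoint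

theorem Phi_Dbar_graph : (Phi X).Dbar.graph = (X.preGraph X.diracBar).topologicalClosure :=
  X.closureOp_graph_of_isSelfAdjoint h.selfAdjoint_bar

/-- The Hermitian structure is invariant under the grading. -/
theorem herm_γE (ξ η : X.E) : X.herm (X.γE ξ) (X.γE η) = X.herm ξ η := by
  -- Self-adjointness and involutivity of the extended `γ ⊗ γ` say that it preserves the form.
  have key : ∀ ξ ξ' η η' : X.E, ⟪(X.γE η : H), X.rep (X.herm (X.JE (X.γE ξ)) (X.JE (X.γE ξ')))
      (X.γE η' : H)⟫_ℂ = ⟪(η : H), X.rep (X.herm (X.JE ξ) (X.JE ξ')) (η' : H)⟫_ℂ := by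
    intro ξ ξ' η η'
    rw [← X.form_nctmul, ← X.form_nctmul, ← X.inner_incl, ← X.inner_incl]
    have e : ∀ ξ η : X.E, X.incl (nctmul X.right X.left (X.γE ξ) (X.γE η)) =
        (Phi X).γ (X.incl (nctmul X.right X.left ξ η)) := fun ξ η =>
      (Phi_γ_incl h (nctmul X.right X.left ξ η)).symm
    rw [e, e, h.grading.inner_apply, h.grading.apply_apply]
  -- Since `γ` commutes with `A` and is unitary on `H`, it can be removed from the second leg;
  -- density of `E` and faithfulness then give an identity in `A`. Passing `γ` through `J` costs a
  -- sign in both arguments.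
  have key2 : ∀ ξ ξ' : X.E, X.herm (X.JE (X.γE ξ)) (X.JE (X.γE ξ')) =
      X.herm (X.JE ξ) (X.JE ξ') := by
    intro ξ ξ'
    apply X.faithful
    refine ContinuousLinearMap.coeFn_injective (Continuous.ext_on X.dense_E
      (map_continuous _) (map_continuous _) fun η' hη' => ?_)
    rw [← sub_eq_zero]
    refine X.dense_E.eq_zero_of_inner_right ℂ fun η hη => ?_
    rw [inner_sub_right, sub_eq_zero, ← key ξ ξ' ⟨η, hη⟩ ⟨η', hη'⟩]
    change ⟪η, _⟫_ℂ = ⟪X.γ η, X.rep _ (X.γ η')⟫_ℂ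
    have hc : ∀ a x, X.rep a (X.γ x) = X.γ (X.rep a x) := fun a x =>
      (congrArg (fun T : H →L[ℂ] H => T x) (X.γ_rep a)).symm
    rw [hc, X.grading.inner_apply, X.grading.apply_apply]
  obtain ⟨ξ, rfl⟩ : ∃ ξ', X.JE ξ' = ξ := ⟨X.JEsymm ξ, X.JE_JEsymm ξ⟩
  obtain ⟨η, rfl⟩ : ∃ η', X.JE η' = η := ⟨X.JEsymm η, X.JE_JEsymm η⟩
  rw [← key2, HermitianData.γE_JE, HermitianData.γE_JE]
  have hk : ∀ k : Fin 4, epsGamma k = 1 ∨ epsGamma k = -1 := by intro k; fin_cases k <;> simp [epsGamma]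
  rcases hk X.ko with hk | hk
  · rw [hk, one_smul, one_smul]
  · rw [hk, neg_one_smul, neg_one_smul, map_neg, map_neg, LinearMap.neg_apply, neg_neg]

end N11

end Completion

end SpectralData

namespace SpectralData

/-! ### Explicit formulas for `𝔇` and `𝔇̄` -/

section Formulas

theorem exists_sum_nctmul {A M N : Type*} [AddCommGroup M] [Module ℂ M] [AddCommGroup N]
    [Module ℂ N] {r : A → M →ₗ[ℂ] M} {l : A → N →ₗ[ℂ] N} (z : NCTensor r l) :
    ∃ (n : ℕ) (x : Fin n → M) (y : Fin n → N), z = ∑ i, nctmul r l (x i) (y i) := by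
  obtain ⟨t, rfl⟩ := ncq_surjective z
  obtain ⟨n, x, y, rfl⟩ := TensorProduct.exists_sum_tmul_eq t
  exact ⟨n, x, y, map_sum _ _ _⟩

variable {A H : Type u} [Ring A] [StarRing A] [Algebra ℂ A] [StarModule ℂ A]
  [NormedAddCommGroup H] [InnerProductSpace ℂ H] [CompleteSpace H]

theorem epsGamma_eq (k : Fin 4) : epsGamma k = 1 ∨ epsGamma k = -1 := by
  fin_cases k <;> simp [epsGamma]

/-- Conjugation by `γ` fixes `A` and changes the sign of `D`, hence the sign of each `[D, a]`. -/
theorem N1Data.γ_omega (X : N1Data A H) {ω : H →L[ℂ] H} (hω : ω ∈ X.Omega) :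
    X.γ * ω = -(ω * X.γ) := by
  have hd : ∀ a, X.γ * X.d a = -(X.d a * X.γ) := fun a => by
    refine ContinuousLinearMap.coeFn_injective (Continuous.ext_on X.selfAdjoint.dense_domain
      (map_continuous _) (map_continuous _) fun x hx => ?_)
    obtain ⟨y, hy⟩ := LinearPMap.mem_domain_iff.mp hx
    have h1 := X.γ_D _ _ (X.d_spec a x y hy)
    have h2 := X.d_spec a _ _ (X.γ_D x y hy)
    have hc : ∀ x, X.γ (X.rep a x) = X.rep a (X.γ x) := fun x =>
      congrArg (fun T : H →L[ℂ] H => T x) (X.γ_rep a)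
    have h3 := X.D.graph.sub_mem h1 h2
    rw [Prod.mk_sub_mk, hc, sub_self] at h3
    have h4 := LinearPMap.graph_fst_eq_zero_snd X.D h3 rfl
    rw [map_add, hc, map_neg, neg_add, add_sub_add_left_eq_sub, sub_eq_zero] at h4
    change X.γ (X.d a x) = -(X.d a (X.γ x))
    rw [← h4, neg_neg]
  induction hω using Submodule.span_induction with
  | mem ω h =>
    obtain ⟨a, b, rfl⟩ := h
    rw [← mul_assoc, X.γ_rep, mul_assoc, hd, mul_neg, mul_assoc]
  | zero => rw [mul_zero, zero_mul, neg_zero]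
  | add x y _ _ hx hy => rw [mul_add, add_mul, hx, hy, neg_add]
  | smul c x _ hx => rw [mul_smul_comm, smul_mul_assoc, hx, smul_neg]

namespace HermitianData

variable (X : HermitianData A H)

theorem γE_omegaAct (ω : X.Omega) (ξ : X.E) :
    X.γE (X.omegaAct ω ξ) = -X.omegaAct ω (X.γE ξ) :=
  Subtype.ext (congrArg (fun T : H →L[ℂ] H => T ξ) (X.γ_omega ω.2))

theorem γE_γE (ξ : X.E) : X.γE (X.γE ξ) = ξ := Subtype.ext (X.γ_γ ξ)

end HermitianData

namespace ExtInput

variable (X : ExtInput A H)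

theorem nablaTilde_nctmul (ξ η : X.E) : X.nablaTilde (nctmul X.right X.left ξ η) =
    nctmul X.eoRight X.left (X.nablaBar ξ) η + X.insert ξ (X.nabla η) := rfl

theorem nablaTilde_eq {ξ η : X.E} {ι κ : Type*} [Fintype ι] [Fintype κ] {ω : ι → X.Omega}
    {ζ : ι → X.E} {ω' : κ → X.Omega} {ζ' : κ → X.E}
    (h : X.nabla (X.JEsymm ξ) = ∑ i, nctmul _ _ (ω i) (ζ i))
    (h' : X.nabla η = ∑ j, nctmul _ _ (ω' j) (ζ' j)) :
    X.nablaTilde (nctmul X.right X.left ξ η) =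
      -∑ i, nctmul X.eoRight X.left
        (nctmul X.right X.omegaLeft (X.JE (ζ i)) (X.omegaStar (ω i))) η +
      ∑ j, nctmul X.eoRight X.left (nctmul X.right X.omegaLeft ξ (ω' j)) (ζ' j) := by
  have h1 : X.nablaBar ξ =
      -∑ i, nctmul X.right X.omegaLeft (X.JE (ζ i)) (X.omegaStar (ω i)) := by
    change -X.flip (X.nabla (X.JEsymm ξ)) = _
    rw [h, map_sum]
    rfl
  rw [nablaTilde_nctmul, h1, h', map_sum]
  congr 1
  change (ncmk X.eoRight X.left).flip η _ = _
  rw [map_neg, map_sum]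
  rfl

/-- Any representatives of `∇ J* ξ` and `∇ η` may be used. Arbitrary finite index types are allowed
so that the two-part sums of a product connection can be substituted. -/
theorem dirac_eq {ξ η : X.E} {ι κ : Type*} [Fintype ι] [Fintype κ] {ω : ι → X.Omega}
    {ζ : ι → X.E} {ω' : κ → X.Omega} {ζ' : κ → X.E}
    (h : X.nabla (X.JEsymm ξ) = ∑ i, nctmul _ _ (ω i) (ζ i))
    (h' : X.nabla η = ∑ j, nctmul _ _ (ω' j) (ζ' j)) :
    X.dirac (nctmul X.right X.left ξ η) =
      -∑ i, nctmul X.right X.left (X.JE (ζ i)) (X.omegaAct (X.omegaStar (ω i)) η) +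
      ∑ j, nctmul X.right X.left ξ (X.omegaAct (ω' j) (ζ' j)) := by
  change X.c (X.nablaTilde _) = _
  rw [X.nablaTilde_eq h h', map_add, map_neg, map_sum, map_sum]
  rfl

/-- In the first sum, the star of the flip `Ψ` and the star in the right action `J ω* J*` cancel, so
`ω` itself acts under `J`; in the second sum the star survives. -/
theorem diracBar_eq {ξ η : X.E} {ι κ : Type*} [Fintype ι] [Fintype κ] {ω : ι → X.Omega}
    {ζ : ι → X.E} {ω' : κ → X.Omega} {ζ' : κ → X.E}
    (h : X.nabla (X.JEsymm ξ) = ∑ i, nctmul _ _ (ω i) (ζ i))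
    (h' : X.nabla η = ∑ j, nctmul _ _ (ω' j) (ζ' j)) :
    X.diracBar (nctmul X.right X.left ξ η) =
      -∑ i, nctmul X.right X.left (X.JE (X.omegaAct (ω i) (ζ i))) (X.γE η) +
      ∑ j, nctmul X.right X.left (X.JE (X.omegaAct (X.omegaStar (ω' j)) (X.JEsymm ξ)))
        (X.γE (ζ' j)) := by
  change X.cBar (X.nablaTilde _) = _
  rw [X.nablaTilde_eq h h', map_add, map_neg, map_sum, map_sum]
  congr 1
  refine congrArg Neg.neg (Finset.sum_congr rfl fun i _ => ?_)
  change nctmul X.right X.left (X.JE (X.omegaAct (X.omegaStar (X.omegaStar (ω i)))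
    (X.JEsymm (X.JE (ζ i))))) (X.γE η) = _
  have : X.omegaStar (X.omegaStar (ω i)) = ω i := Subtype.ext (star_star _)
  rw [X.JEsymm_JE, this]

end ExtInput

end Formulas

/-! ### Tensor decompositions -/

section Decomposition

variable {A₁ A₂ A H₁ H₂ H : Type u}
  [Ring A₁] [StarRing A₁] [Algebra ℂ A₁] [StarModule ℂ A₁]
  [NormedAddCommGroup H₁] [InnerProductSpace ℂ H₁] [CompleteSpace H₁]
  [Ring A₂] [StarRing A₂] [Algebra ℂ A₂] [StarModule ℂ A₂]
  [NormedAddCommGroup H₂] [InnerProductSpace ℂ H₂] [CompleteSpace H₂]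
  [Ring A] [StarRing A] [Algebra ℂ A] [StarModule ℂ A]
  [NormedAddCommGroup H] [InnerProductSpace ℂ H] [CompleteSpace H]

/-- The operator by which `J` of the second factor has to be twisted in a product with first factor
of `KO`-dimension `2 k`. -/
def twist (k : Fin 4) (X : HermitianData A H) : X.E →ₗ[ℂ] X.E :=
  if epsGamma k = 1 then LinearMap.id else X.γE

/-- The properties of the module `E`, as a tensor product of `E₁` and `E₂`, of a Kasparov
product. -/
structure TensorDecomposition (X₁ : ExtInput A₁ H₁) (X₂ : ExtInput A₂ H₂) (X : ExtInput A H) where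
  /-- The identification of the algebra with the tensor product. -/
  τ : A₁ ⊗[ℂ] A₂ →ₗ[ℂ] A
  /-- The identification of the module with the tensor product. -/
  ε : X₁.E ⊗[ℂ] X₂.E ≃ₗ[ℂ] X.E
  τ_surjective : Function.Surjective τ
  left : ∀ a b x y, X.left (τ (a ⊗ₜ b)) (ε (x ⊗ₜ y)) = ε (X₁.left a x ⊗ₜ X₂.left b y)
  star_τ : ∀ a b, star (τ (a ⊗ₜ b)) = τ (star a ⊗ₜ star b)
  JE : ∀ x y, X.JE (ε (x ⊗ₜ y)) = ε (X₁.JE x ⊗ₜ X₂.JE (twist X₁.ko X₂.toHermitianData y))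
  γE : ∀ x y, X.γE (ε (x ⊗ₜ y)) = ε (X₁.γE x ⊗ₜ X₂.γE y)
  herm : ∀ x y x' y', X.herm (ε (x ⊗ₜ y)) (ε (x' ⊗ₜ y')) = τ (X₁.herm x x' ⊗ₜ X₂.herm y y')
  inner : ∀ x y x' y', ⟪(ε (x ⊗ₜ y) : H), (ε (x' ⊗ₜ y') : H)⟫_ℂ =
    ⟪(x : H₁), (x' : H₁)⟫_ℂ * ⟪(y : H₂), (y' : H₂)⟫_ℂ
  nabla : ∀ x y, ∀ (m n : ℕ) (ω : Fin m → X₁.Omega) (ξ : Fin m → X₁.E) (ω' : Fin n → X₂.Omega)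
      (η : Fin n → X₂.E),
      X₁.nabla x = ∑ i, nctmul _ _ (ω i) (ξ i) → X₂.nabla y = ∑ j, nctmul _ _ (ω' j) (η j) →
      ∃ (w : Fin m → X.Omega) (w' : Fin n → X.Omega),
        (∀ i x y, X.omegaAct (w i) (ε (x ⊗ₜ y)) = ε (X₁.omegaAct (ω i) x ⊗ₜ y) ∧
          X.omegaAct (X.omegaStar (w i)) (ε (x ⊗ₜ y)) =
            ε (X₁.omegaAct (X₁.omegaStar (ω i)) x ⊗ₜ y)) ∧
        (∀ j x y, X.omegaAct (w' j) (ε (x ⊗ₜ y)) = ε (X₁.γE x ⊗ₜ X₂.omegaAct (ω' j) y) ∧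
          X.omegaAct (X.omegaStar (w' j)) (ε (x ⊗ₜ y)) =
            ε (X₁.γE x ⊗ₜ X₂.omegaAct (X₂.omegaStar (ω' j)) y)) ∧
        X.nabla (ε (x ⊗ₜ y)) = ∑ i, nctmul _ _ (w i) (ε (ξ i ⊗ₜ y)) +
          ∑ j, nctmul _ _ (w' j) (ε (x ⊗ₜ η j))

/-! ### The twist of the second factor by its grading -/

section Twist

variable (k : Fin 4) (X : HermitianData A H)

theorem twist_twist (ξ : X.E) : twist k X (twist k X ξ) = ξ := by
  unfold twist
  split_ifs
  · rfl
  · exact X.γE_γE ξ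

theorem twist_left (a : A) (ξ : X.E) : twist k X (X.left a ξ) = X.left a (twist k X ξ) := by
  unfold twist
  split_ifs
  · rfl
  · exact X.γE_left a ξ

theorem twist_omegaAct (ω : X.Omega) (ξ : X.E) :
    twist k X (X.omegaAct ω ξ) = epsGamma k • X.omegaAct ω (twist k X ξ) := by
  unfold twist
  split_ifs with h
  · rw [h, one_smul]
    rfl
  · rw [(epsGamma_eq k).resolve_left h, neg_one_smul, X.γE_omegaAct]

theorem twist_omegaAct_twist (ω : X.Omega) (ξ : X.E) :
    twist k X (X.omegaAct ω (twist k X ξ)) = epsGamma k • X.omegaAct ω ξ := by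
  rw [twist_omegaAct, twist_twist]

theorem nabla_twist (X : ExtInput A H) {ξ : X.E} {n : ℕ} {ω : Fin n → X.Omega} {ζ : Fin n → X.E}
    (h : X.nabla ξ = ∑ j, nctmul _ _ (ω j) (ζ j)) :
    X.nabla (twist k X.toHermitianData ξ) =
      ∑ j, nctmul _ _ (ω j) (twist k X.toHermitianData (ζ j)) := by
  unfold twist
  split_ifs
  · exact h
  · rw [X.nabla_γ, h, map_sum]
    rfl

/-- Given invariance under `γ`, the Hermitian structure does not see whether `J` or `J γ` is used;
the commutation sign of `J` and `γ` occurs twice. -/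
theorem herm_JE_twist (hγ : ∀ ξ η, X.herm (X.γE ξ) (X.γE η) = X.herm ξ η) (ξ η : X.E) :
    X.herm (X.JE (twist k X ξ)) (X.JE (twist k X η)) = X.herm (X.JE ξ) (X.JE η) := by
  unfold twist
  split_ifs
  · rfl
  · rw [← hγ, X.γE_JE, X.γE_JE, X.γE_γE, X.γE_γE]
    rcases epsGamma_eq X.ko with hk | hk
    · rw [hk, one_smul, one_smul]
    · rw [hk, neg_one_smul, neg_one_smul, map_neg, map_neg, LinearMap.neg_apply, neg_neg]

end Twist

namespace TensorDecomposition

variable {X₁ : ExtInput A₁ H₁} {X₂ : ExtInput A₂ H₂} {X : ExtInput A H}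
  (d : TensorDecomposition X₁ X₂ X)

theorem JEsymm (x : X₁.E) (y : X₂.E) : X.JEsymm (d.ε (x ⊗ₜ y)) =
    d.ε (X₁.JEsymm x ⊗ₜ twist X₁.ko X₂.toHermitianData (X₂.JEsymm y)) := by
  have h := d.JE (X₁.JEsymm x) (twist X₁.ko X₂.toHermitianData (X₂.JEsymm y))
  rw [twist_twist, X₁.JE_JEsymm, X₂.JE_JEsymm] at h
  rw [← h, X.JEsymm_JE]

/-- The twist enters once through `J*` and once through `J`, and commutes with the algebra in
between, so it cancels. -/
theorem right (a : A₁) (b : A₂) (x : X₁.E) (y : X₂.E) :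
    X.right (d.τ (a ⊗ₜ b)) (d.ε (x ⊗ₜ y)) = d.ε (X₁.right a x ⊗ₜ X₂.right b y) := by
  rw [X.right_eq, d.star_τ, d.JEsymm, d.left, d.JE, X₁.right_eq, X₂.right_eq, twist_left,
    twist_twist]

/-- The map `(ξ, η) ↦ (ξ₁ ⊗ η₁) ⊗ (ξ₂ ⊗ η₂)`, for `ξ = ξ₁ ⊗ ξ₂` and `η = η₁ ⊗ η₂`. -/
def swapPre : X.E →ₗ[ℂ] X.E →ₗ[ℂ] X₁.EE ⊗[ℂ] X₂.EE :=
  ((TensorProduct.mk ℂ (X₁.E ⊗[ℂ] X₂.E) (X₁.E ⊗[ℂ] X₂.E)).compr₂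
    (TensorProduct.map (ncq X₁.right X₁.left) (ncq X₂.right X₂.left) ∘ₗ
      (TensorProduct.tensorTensorTensorComm ℂ X₁.E X₂.E X₁.E X₂.E).toLinearMap)).compl₁₂
    d.ε.symm.toLinearMap d.ε.symm.toLinearMap

theorem swapPre_apply (x x' : X₁.E) (y y' : X₂.E) :
    d.swapPre (d.ε (x ⊗ₜ y)) (d.ε (x' ⊗ₜ y')) =
      nctmul X₁.right X₁.left x x' ⊗ₜ nctmul X₂.right X₂.left y y' := by
  simp only [swapPre, LinearMap.compl₁₂_apply, LinearMap.compr₂_apply, LinearEquiv.coe_coe,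
    LinearEquiv.symm_apply_apply, TensorProduct.mk_apply, LinearMap.comp_apply,
    TensorProduct.tensorTensorTensorComm_tmul, TensorProduct.map_tmul]
  rfl

theorem E_induction {p : X.E → Prop} (ξ : X.E) (tmul : ∀ x y, p (d.ε (x ⊗ₜ y)))
    (add : ∀ ξ η, p ξ → p η → p (ξ + η)) : p ξ := by
  obtain ⟨t, rfl⟩ := d.ε.surjective ξ
  induction t using TensorProduct.induction_on with
  | zero => simpa using tmul 0 0
  | tmul x y => exact tmul x y
  | add a b ha hb => rw [map_add]; exact add _ _ ha hb

theorem A_induction {p : A → Prop} (a : A) (tmul : ∀ x y, p (d.τ (x ⊗ₜ y)))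
    (add : ∀ a b, p a → p b → p (a + b)) : p a := by
  obtain ⟨t, rfl⟩ := d.τ_surjective a
  induction t using TensorProduct.induction_on with
  | zero => simpa using tmul 0 0
  | tmul x y => exact tmul x y
  | add a b ha hb => rw [map_add]; exact add _ _ ha hb

theorem left_add (a b : A) (ξ : X.E) : X.left (a + b) ξ = X.left a ξ + X.left b ξ :=
  Subtype.ext (by
    change X.rep (a + b) (ξ : H) = X.rep a (ξ : H) + X.rep b (ξ : H)
    rw [map_add]
    rfl)

theorem right_add (a b : A) (ξ : X.E) : X.right (a + b) ξ = X.right a ξ + X.right b ξ := by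
  rw [X.right_eq, star_add, left_add, map_add]
  rfl

theorem swapPre_balanced (a : A) (ξ η : X.E) :
    d.swapPre (X.right a ξ) η = d.swapPre ξ (X.left a η) := by
  induction a using d.A_induction with
  | add a b ha hb => rw [right_add, left_add, map_add, map_add, LinearMap.add_apply, ha, hb]
  | tmul a b =>
    induction ξ using d.E_induction with
    | add ξ ξ' h h' => simp only [map_add, LinearMap.add_apply, h, h']
    | tmul x y =>
      induction η using d.E_induction with
      | add ξ ξ' h h' => simp only [map_add, h, h']
      | tmul x' y' =>
        rw [d.right, d.left, swapPre_apply, swapPre_apply, nctmul_balanced, nctmul_balanced]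

/-- The canonical map `E ⊗_A E → (E₁ ⊗_{A₁} E₁) ⊗ (E₂ ⊗_{A₂} E₂)`. -/
def swap : X.EE →ₗ[ℂ] X₁.EE ⊗[ℂ] X₂.EE := nclift d.swapPre d.swapPre_balanced

theorem swap_nctmul (x x' : X₁.E) (y y' : X₂.E) :
    d.swap (nctmul X.right X.left (d.ε (x ⊗ₜ y)) (d.ε (x' ⊗ₜ y'))) =
      nctmul X₁.right X₁.left x x' ⊗ₜ nctmul X₂.right X₂.left y y' :=
  d.swapPre_apply x x' y y'

theorem EE_induction {p : X.EE → Prop} (z : X.EE)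
    (tmul : ∀ x y x' y', p (nctmul X.right X.left (d.ε (x ⊗ₜ y)) (d.ε (x' ⊗ₜ y'))))
    (add : ∀ z w, p z → p w → p (z + w)) : p z := by
  induction z using nctensor_induction with
  | add z w hz hw => exact add z w hz hw
  | tmul ξ η =>
    induction ξ using d.E_induction with
    | add ξ ξ' h h' => rw [nctmul_add_left]; exact add _ _ h h'
    | tmul x y =>
      induction η using d.E_induction with
      | add ξ ξ' h h' => rw [nctmul_add_right]; exact add _ _ h h'
      | tmul x' y' => exact tmul x y x' y'

theorem swap_surjective : Function.Surjective d.swap := by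
  intro t
  rw [← LinearMap.mem_range]
  induction t using TensorProduct.induction_on with
  | zero => exact zero_mem _
  | add a b ha hb => exact add_mem ha hb
  | tmul z w =>
    induction z using nctensor_induction with
    | add a b ha hb => rw [TensorProduct.add_tmul]; exact add_mem ha hb
    | tmul x x' =>
      induction w using nctensor_induction with
      | add a b ha hb => rw [TensorProduct.tmul_add]; exact add_mem ha hb
      | tmul y y' => exact ⟨_, d.swap_nctmul x x' y y'⟩

theorem swap_eeγ (z : X.EE) :
    d.swap (X.eeγ z) = TensorProduct.map X₁.eeγ X₂.eeγ (d.swap z) := by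
  induction z using d.EE_induction with
  | add z w hz hw => rw [map_add, map_add, map_add, map_add, hz, hw]
  | tmul x y x' y' =>
    change d.swap (nctmul X.right X.left (X.γE _) (X.γE _)) = _
    rw [d.γE, d.γE, swap_nctmul, swap_nctmul]
    rfl

theorem swap_eeHodge (z : X.EE) :
    d.swap (X.eeHodge z) = TensorProduct.map X₁.eeHodge X₂.eeHodge (d.swap z) := by
  induction z using d.EE_induction with
  | add z w hz hw => rw [map_add, map_add, map_add, map_add, hz, hw]
  | tmul x y x' y' =>
    change d.swap (nctmul X.right X.left (d.ε (x ⊗ₜ y)) (X.γE _)) = _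
    rw [d.γE, swap_nctmul, swap_nctmul]
    rfl

theorem swap_eeLeft (a : A₁) (b : A₂) (z : X.EE) : d.swap (X.eeLeft (d.τ (a ⊗ₜ b)) z) =
    TensorProduct.map (X₁.eeLeft a) (X₂.eeLeft b) (d.swap z) := by
  induction z using d.EE_induction with
  | add z w hz hw => rw [map_add, map_add, map_add, map_add, hz, hw]
  | tmul x y x' y' =>
    change d.swap (nctmul X.right X.left (X.left _ _) (d.ε (x' ⊗ₜ y'))) = _
    rw [d.left, swap_nctmul, swap_nctmul]
    rfl

theorem nabla_eq {x : X₁.E} {y : X₂.E} {m n : ℕ} {ω : Fin m → X₁.Omega} {ξ : Fin m → X₁.E}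
    {ω' : Fin n → X₂.Omega} {η : Fin n → X₂.E}
    (h₁ : X₁.nabla x = ∑ i, nctmul _ _ (ω i) (ξ i))
    (h₂ : X₂.nabla y = ∑ j, nctmul _ _ (ω' j) (η j)) :
    ∃ w : Fin m ⊕ Fin n → X.Omega,
      (∀ i x y, X.omegaAct (w (.inl i)) (d.ε (x ⊗ₜ y)) = d.ε (X₁.omegaAct (ω i) x ⊗ₜ y)) ∧
      (∀ i x y, X.omegaAct (X.omegaStar (w (.inl i))) (d.ε (x ⊗ₜ y)) =
          d.ε (X₁.omegaAct (X₁.omegaStar (ω i)) x ⊗ₜ y)) ∧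
      (∀ j x y, X.omegaAct (w (.inr j)) (d.ε (x ⊗ₜ y)) =
          d.ε (X₁.γE x ⊗ₜ X₂.omegaAct (ω' j) y)) ∧
      (∀ j x y, X.omegaAct (X.omegaStar (w (.inr j))) (d.ε (x ⊗ₜ y)) =
            d.ε (X₁.γE x ⊗ₜ X₂.omegaAct (X₂.omegaStar (ω' j)) y)) ∧
      X.nabla (d.ε (x ⊗ₜ y)) = ∑ i, nctmul _ _ (w i)
        (Sum.elim (fun i => d.ε (ξ i ⊗ₜ y)) (fun j => d.ε (x ⊗ₜ η j)) i) := by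
  obtain ⟨w, w', h1, h2, h3⟩ := d.nabla x y m n ω ξ ω' η h₁ h₂
  refine ⟨Sum.elim w w', fun i x y => (h1 i x y).1, fun i x y => (h1 i x y).2,
    fun i x y => (h2 i x y).1, fun i x y => (h2 i x y).2, ?_⟩
  rw [h3, Fintype.sum_sum_type]
  rfl

/-- Both halves of the tensored connection act from the left on the second leg. There `ω₁ ⊗ 1`
contributes to `𝔇₁ ⊗ 1`, and `γ₁ ⊗ ω₂`, or its adjoint `γ₁ ⊗ ω₂*`, puts `γ₁` on the second leg of
the first factor, which is its Hodge operator. On the first leg the twists in `J` and `J*` cancel.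
-/
theorem swap_dirac (z : X.EE) : d.swap (X.dirac z) =
    TensorProduct.map X₁.dirac LinearMap.id (d.swap z) +
      TensorProduct.map X₁.eeHodge X₂.dirac (d.swap z) := by
  induction z using d.EE_induction with
  | add z w hz hw => simp only [map_add, hz, hw]; abel
  | tmul x y x' y' =>
    obtain ⟨m, ω, ζ, h1⟩ := exists_sum_nctmul (X₁.nabla (X₁.JEsymm x))
    obtain ⟨n, ω', ζ', h2⟩ := exists_sum_nctmul (X₂.nabla (X₂.JEsymm y))
    obtain ⟨p, ν, χ, h3⟩ := exists_sum_nctmul (X₁.nabla x')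
    obtain ⟨q, ν', χ', h4⟩ := exists_sum_nctmul (X₂.nabla y')
    obtain ⟨w, -, hw1, -, hw2, hw⟩ := d.nabla_eq h1 (nabla_twist X₁.ko X₂ h2)
    obtain ⟨v, hv1, -, hv2, -, hv⟩ := d.nabla_eq h3 h4
    rw [← d.JEsymm] at hw
    have e1 : X₁.eeHodge (nctmul X₁.right X₁.left x x') =
      nctmul X₁.right X₁.left x (X₁.γE x') := rfl
    rw [X.dirac_eq hw hv, d.swap_nctmul, TensorProduct.map_tmul, TensorProduct.map_tmul,
      X₁.dirac_eq h1 h3, X₂.dirac_eq h2 h4, e1]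
    simp only [Fintype.sum_sum_type, Sum.elim_inl, Sum.elim_inr, hw1, hw2, hv1, hv2, d.JE,
      twist_twist, X₂.JE_JEsymm, X₁.JE_JEsymm, map_add, map_neg, map_sum, swap_nctmul,
      TensorProduct.add_tmul, TensorProduct.tmul_add, TensorProduct.neg_tmul,
      TensorProduct.tmul_neg, TensorProduct.sum_tmul, TensorProduct.tmul_sum, LinearMap.id_apply]
    abel

theorem JE_γE_JEsymm (x : X₁.E) :
    X₁.JE (X₁.γE (X₁.JEsymm x)) = epsGamma X₁.ko • X₁.γE x := by
  have h := X₁.γE_JE (X₁.JEsymm x)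
  rw [X₁.JE_JEsymm] at h
  rw [h, smul_smul]
  rcases epsGamma_eq X₁.ko with hk | hk <;> rw [hk] <;> simp

/-- Two signs cancel: the one from `J₁ γ₁ J₁*`, and the one from carrying a one-form of the second
factor between two twists. Both equal `epsGamma X₁.ko`, which is why the twist depends on the first
factor. -/
theorem JE_eps_tmul (x : X₁.E) (y : X₂.E) (ω : X₂.Omega) :
    X₁.JE (X₁.γE (X₁.JEsymm x)) ⊗ₜ[ℂ] X₂.JE (twist X₁.ko X₂.toHermitianData
      (X₂.omegaAct ω (twist X₁.ko X₂.toHermitianData y))) =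
    X₁.γE x ⊗ₜ[ℂ] X₂.JE (X₂.omegaAct ω y) := by
  rw [JE_γE_JEsymm, twist_omegaAct_twist]
  rcases epsGamma_eq X₁.ko with hk | hk
  · rw [hk, one_smul, one_smul]
  · rw [hk, neg_one_smul, neg_one_smul, map_neg, TensorProduct.neg_tmul, TensorProduct.tmul_neg,
      neg_neg]

/-- Here one-forms act from the right on the first leg and `γ₁ ⊗ γ₂` acts on the second. A form `ω₁
⊗ 1` leaves the spare `γ₂` on the second leg, the Hodge operator of the second factor; a form `γ₁ ⊗
ω₂` leaves `γ₁` on both legs of the first factor, its grading. The signs are settled by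
`JE_eps_tmul`. -/
theorem swap_diracBar (z : X.EE) : d.swap (X.diracBar z) =
    TensorProduct.map X₁.diracBar X₂.eeHodge (d.swap z) +
      TensorProduct.map X₁.eeγ X₂.diracBar (d.swap z) := by
  induction z using d.EE_induction with
  | add z w hz hw => simp only [map_add, hz, hw]; abel
  | tmul x y x' y' =>
    obtain ⟨m, ω, ζ, h1⟩ := exists_sum_nctmul (X₁.nabla (X₁.JEsymm x))
    obtain ⟨n, ω', ζ', h2⟩ := exists_sum_nctmul (X₂.nabla (X₂.JEsymm y))
    obtain ⟨p, ν, χ, h3⟩ := exists_sum_nctmul (X₁.nabla x')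
    obtain ⟨q, ν', χ', h4⟩ := exists_sum_nctmul (X₂.nabla y')
    obtain ⟨w, hw1, -, hw2, -, hw⟩ := d.nabla_eq h1 (nabla_twist X₁.ko X₂ h2)
    obtain ⟨v, -, hv1, -, hv2, hv⟩ := d.nabla_eq h3 h4
    rw [← d.JEsymm] at hw
    have e1 : X₂.eeHodge (nctmul X₂.right X₂.left y y') =
      nctmul X₂.right X₂.left y (X₂.γE y') := rfl
    have e2 : X₁.eeγ (nctmul X₁.right X₁.left x x') =
      nctmul X₁.right X₁.left (X₁.γE x) (X₁.γE x') := rfl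
    rw [X.diracBar_eq hw hv, d.swap_nctmul, TensorProduct.map_tmul, TensorProduct.map_tmul,
      X₁.diracBar_eq h1 h3, X₂.diracBar_eq h2 h4, e1, e2]
    simp only [Fintype.sum_sum_type, Sum.elim_inl, Sum.elim_inr, hw1, hw2, d.JEsymm, hv1, hv2,
      d.JE, d.γE, JE_eps_tmul, twist_twist, X₂.JE_JEsymm, map_add, map_neg, map_sum, swap_nctmul,
      TensorProduct.add_tmul, TensorProduct.tmul_add, TensorProduct.neg_tmul,
      TensorProduct.tmul_neg, TensorProduct.sum_tmul, TensorProduct.tmul_sum]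
    abel

/-- The form involves `⟨J ξ, J ξ'⟩` with the twisted `J` on the second factor, which is why
invariance of its Hermitian structure under the grading is needed. -/
theorem form_tmul (hγ : ∀ ξ η, X₂.herm (X₂.γE ξ) (X₂.γE η) = X₂.herm ξ η)
    (x x' u u' : X₁.E) (y y' v v' : X₂.E) :
    X.form (nctmul X.right X.left (d.ε (x ⊗ₜ y)) (d.ε (x' ⊗ₜ y')))
        (nctmul X.right X.left (d.ε (u ⊗ₜ v)) (d.ε (u' ⊗ₜ v'))) =
      X₁.form (nctmul X₁.right X₁.left x x') (nctmul X₁.right X₁.left u u') *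
        X₂.form (nctmul X₂.right X₂.left y y') (nctmul X₂.right X₂.left v v') := by
  rw [X.form_nctmul, X₁.form_nctmul, X₂.form_nctmul, d.JE, d.JE, d.herm,
    herm_JE_twist X₁.ko X₂.toHermitianData hγ]
  have h := d.left (X₁.herm (X₁.JE x) (X₁.JE u)) (X₂.herm (X₂.JE y) (X₂.JE v)) u' v'
  exact (congrArg (fun ξ : X.E => ⟪(d.ε (x' ⊗ₜ y') : H), (ξ : H)⟫_ℂ) h).trans (d.inner _ _ _ _)

/-- The map from `E ⊗_A E` to the tensor product of the completions of `E₁ ⊗_{A₁} E₁` and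
`E₂ ⊗_{A₂} E₂`. -/
def toHTensor : X.EE →ₗ[ℂ] HTensor X₁.HTilde X₂.HTilde :=
  htincl X₁.HTilde X₂.HTilde ∘ₗ TensorProduct.map X₁.incl X₂.incl ∘ₗ d.swap

theorem toHTensor_of_swap {z : X.EE} {a : X₁.EE} {b : X₂.EE} (h : d.swap z = a ⊗ₜ b) :
    d.toHTensor z = htmul (X₁.incl a) (X₂.incl b) := by
  rw [toHTensor, LinearMap.comp_apply, LinearMap.comp_apply, h]
  rfl

theorem inner_toHTensor (hγ : ∀ ξ η, X₂.herm (X₂.γE ξ) (X₂.γE η) = X₂.herm ξ η) (z w : X.EE) :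
    ⟪d.toHTensor z, d.toHTensor w⟫_ℂ = X.form z w := by
  induction z using d.EE_induction with
  | add a b ha hb =>
    rw [map_add, X.form_add_left, ← ha, ← hb]
    exact inner_add_left _ _ _
  | tmul x y x' y' =>
    induction w using d.EE_induction with
    | add a b ha hb =>
      rw [map_add, LinearMap.map_add (X.form _), ← ha, ← hb]
      exact inner_add_right _ _ _
    | tmul u v u' v' =>
      rw [d.form_tmul hγ, d.toHTensor_of_swap (d.swap_nctmul x x' y y'),
        d.toHTensor_of_swap (d.swap_nctmul u u' v v')]
      refine (inner_htmul (H₁ := X₁.HTilde) (H₂ := X₂.HTilde) _ _ _ _).trans ?_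
      rw [X₁.inner_incl, X₂.inner_incl]

theorem denseRange_toHTensor : DenseRange d.toHTensor := by
  have h := eq_top_of_htmul_mem (H₁ := X₁.HTilde) (H₂ := X₂.HTilde)
    (topologicalClosure_span_of_dense X₁.denseRange_incl)
    (topologicalClosure_span_of_dense X₂.denseRange_incl)
    (Submodule.isClosed_topologicalClosure (LinearMap.range d.toHTensor)) (by
      rintro _ ⟨a, rfl⟩ _ ⟨b, rfl⟩
      obtain ⟨z, hz⟩ := d.swap_surjective (a ⊗ₜ b)
      exact Submodule.le_topologicalClosure _ ⟨z, d.toHTensor_of_swap hz⟩)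
  have h2 := Submodule.dense_iff_topologicalClosure_eq_top.mpr h
  exact h2

end TensorDecomposition

end Decomposition

end SpectralData

namespace SpectralData

/-! ### Tensor products of antiunitary operators -/

section Antiunitary

variable {H₁ H₂ : Type*} [NormedAddCommGroup H₁] [InnerProductSpace ℂ H₁]
  [NormedAddCommGroup H₂] [InnerProductSpace ℂ H₂]

/-- Polarization: norms are preserved, and antilinearity interchanges the two terms with coefficient
`± i`, which swaps the arguments. -/
theorem inner_map_antiunitary {H : Type*} [NormedAddCommGroup H] [InnerProductSpace ℂ H]
    (J : H ≃ₗᵢ⋆[ℂ] H) (x y : H) : ⟪J x, J y⟫_ℂ = ⟪y, x⟫_ℂ := by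
  have hI : ∀ z : H, J (Complex.I • z) = -(Complex.I • J z) := fun z => by
    rw [J.map_smulₛₗ, Complex.conj_I, neg_smul]
  rw [inner_eq_sum_norm_sq_div_four, inner_eq_sum_norm_sq_div_four (𝕜 := ℂ) y x]
  have e1 : ‖J x - RCLike.I (K := ℂ) • J y‖ = ‖x + Complex.I • y‖ := by
    rw [← J.norm_map (x + Complex.I • y), map_add, hI, ← sub_eq_add_neg]
    rfl
  have e2 : ‖J x + RCLike.I (K := ℂ) • J y‖ = ‖x - Complex.I • y‖ := by
    rw [← J.norm_map (x - Complex.I • y), map_sub, hI, sub_neg_eq_add]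
    rfl
  have e3 : ‖x + Complex.I • y‖ = ‖y - RCLike.I (K := ℂ) • x‖ := by
    have : x + Complex.I • y = Complex.I • (y - Complex.I • x) := by
      rw [smul_sub, smul_smul, Complex.I_mul_I, neg_one_smul, sub_neg_eq_add, add_comm]
    rw [this, norm_smul, Complex.norm_I, one_mul]
    rfl
  have e4 : ‖x - Complex.I • y‖ = ‖y + RCLike.I (K := ℂ) • x‖ := by
    have : x - Complex.I • y = -(Complex.I • (y + Complex.I • x)) := by
      rw [smul_add, smul_smul, Complex.I_mul_I, neg_one_smul, neg_add, neg_neg, sub_eq_add_neg,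
        add_comm]
    rw [this, norm_neg, norm_smul, Complex.norm_I, one_mul]
    rfl
  rw [e1, e2, e3, e4, ← map_add, ← map_sub, J.norm_map, J.norm_map, add_comm x y, norm_sub_rev x y]

theorem norm_congr_antiunitary (J₁ : H₁ ≃ₗᵢ⋆[ℂ] H₁) (J₂ : H₂ ≃ₗᵢ⋆[ℂ] H₂) (z : H₁ ⊗[ℂ] H₂) :
    ‖TensorProduct.congr J₁.toLinearEquiv J₂.toLinearEquiv z‖ = ‖z‖ := by
  have key : ∀ z w : H₁ ⊗[ℂ] H₂, ⟪TensorProduct.congr J₁.toLinearEquiv J₂.toLinearEquiv z,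
      TensorProduct.congr J₁.toLinearEquiv J₂.toLinearEquiv w⟫_ℂ = ⟪w, z⟫_ℂ := by
    intro z w
    induction z using TensorProduct.induction_on with
    | zero => rw [map_zero, inner_zero_left, inner_zero_right]
    | add a b ha hb => rw [map_add, inner_add_left, inner_add_right, ha, hb]
    | tmul x y =>
      induction w using TensorProduct.induction_on with
      | zero => rw [map_zero, inner_zero_left, inner_zero_right]
      | add a b ha hb => rw [map_add, inner_add_left, inner_add_right, ha, hb]
      | tmul x' y' =>
        rw [TensorProduct.congr_tmul, TensorProduct.congr_tmul, TensorProduct.inner_tmul,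
          TensorProduct.inner_tmul]
        exact congrArg₂ _ (inner_map_antiunitary J₁ x x') (inner_map_antiunitary J₂ y y')
  have h := key z z
  rw [norm_eq_sqrt_re_inner (𝕜 := ℂ), norm_eq_sqrt_re_inner (𝕜 := ℂ) z, h]

/-- The antiunitary `J₁ ⊗ J₂`. -/
def htJ (J₁ : H₁ ≃ₗᵢ⋆[ℂ] H₁) (J₂ : H₂ ≃ₗᵢ⋆[ℂ] H₂) : HTensor H₁ H₂ ≃ₗᵢ⋆[ℂ] HTensor H₁ H₂ :=
  (TensorProduct.congr J₁.toLinearEquiv J₂.toLinearEquiv).extendOfIsometry (htincl H₁ H₂)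
    (htincl H₁ H₂) denseRange_htincl denseRange_htincl fun z => by
      have h : ∀ z : H₁ ⊗[ℂ] H₂, ‖htincl H₁ H₂ z‖ = ‖z‖ := fun z => Completion.norm_coe z
      rw [h, h, norm_congr_antiunitary]

theorem htJ_htmul (J₁ : H₁ ≃ₗᵢ⋆[ℂ] H₁) (J₂ : H₂ ≃ₗᵢ⋆[ℂ] H₂) (x : H₁) (y : H₂) :
    htJ J₁ J₂ (htmul x y) = htmul (J₁ x) (J₂ y) :=
  LinearEquiv.extendOfIsometry_eq _ _ _ _ _ _ (x ⊗ₜ[ℂ] y)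

end Antiunitary

/-! ### The tensor product of `N = 1` spectral data -/

section N1

variable {A₁ A₂ A H₁ H₂ H : Type u}
  [Ring A₁] [StarRing A₁] [Algebra ℂ A₁] [StarModule ℂ A₁]
  [NormedAddCommGroup H₁] [InnerProductSpace ℂ H₁] [CompleteSpace H₁]
  [Ring A₂] [StarRing A₂] [Algebra ℂ A₂] [StarModule ℂ A₂]
  [NormedAddCommGroup H₂] [InnerProductSpace ℂ H₂] [CompleteSpace H₂]
  [Ring A] [StarRing A] [Algebra ℂ A] [StarModule ℂ A]
  [NormedAddCommGroup H] [InnerProductSpace ℂ H] [CompleteSpace H]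

section Concrete

variable (X₁ : N1Data A₁ H₁) (X₂ : N1Data A₂ H₂)

theorem isSymmGraph_D (X : N1Data A H) : IsSymmGraph X.D.graph :=
  isSymmGraph_of_isSelfAdjoint X.selfAdjoint

omit [CompleteSpace H] in
theorem symm_one (x y : H) : ⟪(1 : H →L[ℂ] H) x, y⟫_ℂ = ⟪x, (1 : H →L[ℂ] H) y⟫_ℂ := rfl

theorem isCommutator_prodN1 {C₁ T₁ : H₁ →L[ℂ] H₁} {C₂ T₂ : H₂ →L[ℂ] H₂}
    (hC₁ : IsCommutator X₁.D C₁ T₁) (hC₂ : IsCommutator X₂.D C₂ T₂)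
    (hγ : X₁.γ * C₁ = C₁ * X₁.γ) : IsCommutator (tensorSum X₁.D 1 X₁.γ X₂.D) (hmap C₁ C₂)
      (hmap T₁ C₂ + hmap (X₁.γ * C₁) T₂) := by
  have h := isCommutator_tensorSum X₁.grading.inner_apply symm_one (isSymmGraph_D X₁)
    (isSymmGraph_D X₂) X₁.selfAdjoint.dense_domain X₂.selfAdjoint.dense_domain hC₁ hC₂ hγ
    ((one_mul _).trans (mul_one _).symm)
  rwa [one_mul] at h

/-- The Kasparov product of `N = 1` spectral data, without the real structure. -/
def prodN1 : N1Data (A₁ ⊗[ℂ] A₂) (HTensor H₁ H₂) where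
  rep := repTensor X₁.rep X₂.rep
  D := tensorSum X₁.D 1 X₁.γ X₂.D
  γ := hmap X₁.γ X₂.γ
  separable := by
    have := X₁.separable
    have := X₂.separable
    infer_instance
  faithful := repTensor_injective X₁.faithful X₂.faithful
  selfAdjoint := by
    obtain ⟨ι₁, b₁, κ₁, hb₁, -⟩ := exists_squareDiagonal X₁.selfAdjoint X₁.theta_summable
    obtain ⟨ι₂, b₂, κ₂, hb₂, -⟩ := exists_squareDiagonal X₂.selfAdjoint X₂.theta_summable
    have h₁ := isSymmGraph_D X₁
    have h₂ := isSymmGraph_D X₂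
    have d₁ := X₁.selfAdjoint.dense_domain
    have d₂ := X₂.selfAdjoint.dense_domain
    have g := X₁.grading.inner_apply
    exact SquareDiagonal.isSelfAdjoint (isSymmGraph_tensorSum g symm_one h₁ h₂ d₁ d₂)
      (isClosed_tensorSum g symm_one h₁ h₂ d₁ d₂)
      (squareDiagonal_tensorSum g symm_one h₁ h₂ d₁ d₂ X₁.grading.apply_apply (fun _ => rfl)
        X₁.γ_D commutes_one hb₁ hb₂)
  bounded_commutator := exists_isCommutator_linTensor X₁.grading.inner_apply symm_one
    (isSymmGraph_D X₁) (isSymmGraph_D X₂) X₁.selfAdjoint.dense_domain X₂.selfAdjoint.dense_domain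
    X₁.rep.toAlgHom.toLinearMap X₂.rep.toAlgHom.toLinearMap X₁.bounded_commutator
    X₂.bounded_commutator X₁.γ_rep fun _ => rfl
  theta_summable := by
    obtain ⟨ι₁, b₁, κ₁, hb₁, hs₁⟩ := exists_squareDiagonal X₁.selfAdjoint X₁.theta_summable
    obtain ⟨ι₂, b₂, κ₂, hb₂, hs₂⟩ := exists_squareDiagonal X₂.selfAdjoint X₂.theta_summable
    have h₁ := isSymmGraph_D X₁
    have h₂ := isSymmGraph_D X₂
    have d₁ := X₁.selfAdjoint.dense_domain
    have d₂ := X₂.selfAdjoint.dense_domain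
    have g := X₁.grading.inner_apply
    exact SquareDiagonal.heatTraceClass
      (squareDiagonal_tensorSum g symm_one h₁ h₂ d₁ d₂ X₁.grading.apply_apply (fun _ => rfl)
        X₁.γ_D commutes_one hb₁ hb₂) (isSymmGraph_tensorSum g symm_one h₁ h₂ d₁ d₂)
      (isClosed_tensorSum g symm_one h₁ h₂ d₁ d₂) (summable_exp_add hs₁ hs₂)
  grading := X₁.grading.hmap X₂.grading
  γ_rep := hmap_mul_linTensor X₁.rep.toAlgHom.toLinearMap X₂.rep.toAlgHom.toLinearMap X₁.γ_rep
    X₂.γ_rep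
  γ_D := antiCommutes_hmap (hmap_mem_tensorSum X₁.grading.inner_apply symm_one
    (isSymmGraph_D X₁) (isSymmGraph_D X₂) X₁.selfAdjoint.dense_domain X₂.selfAdjoint.dense_domain
    X₁.γ_D.neg_one X₂.γ_D.neg_one (fun _ => (one_smul _ _).symm) (fun _ => (one_smul _ _).symm)
    (mul_one _) (one_mul _))

end Concrete

/-- The properties of the tensor product `X` of the spectral data `X₁` and `X₂`. -/
structure TensorN1 (X₁ : N1Data A₁ H₁) (X₂ : N1Data A₂ H₂) (X : N1Data A H) where
  /-- The map `(x, y) ↦ x ⊗ y`. -/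
  t : H₁ →L[ℂ] H₂ →L[ℂ] H
  /-- The map `(S, T) ↦ S ⊗ T`. -/
  m : (H₁ →L[ℂ] H₁) →ₗ[ℂ] (H₂ →L[ℂ] H₂) →ₗ[ℂ] (H →L[ℂ] H)
  /-- The identification of the algebra with the tensor product. -/
  τ : A₁ ⊗[ℂ] A₂ ≃ₗ[ℂ] A
  inner : ∀ x x' y y', ⟪t x y, t x' y'⟫_ℂ = ⟪x, x'⟫_ℂ * ⟪y, y'⟫_ℂ
  total : ∀ {s₁ : Set H₁} {s₂ : Set H₂}, (Submodule.span ℂ s₁).topologicalClosure = ⊤ →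
    (Submodule.span ℂ s₂).topologicalClosure = ⊤ →
    (Submodule.span ℂ {z : H | ∃ x ∈ s₁, ∃ y ∈ s₂, z = t x y}).topologicalClosure = ⊤
  m_t : ∀ S T x y, m S T (t x y) = t (S x) (T y)
  τ_mul : ∀ a b a' b', τ (a ⊗ₜ b) * τ (a' ⊗ₜ b') = τ ((a * a') ⊗ₜ (b * b'))
  τ_star : ∀ a b, star (τ (a ⊗ₜ b)) = τ (star a ⊗ₜ star b)
  rep : ∀ a b, X.rep (τ (a ⊗ₜ b)) = m (X₁.rep a) (X₂.rep b)
  γ : X.γ = m X₁.γ X₂.γ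
  d : ∀ a b, X.d (τ (a ⊗ₜ b)) = m (X₁.d a) (X₂.rep b) + m (X₁.γ * X₁.rep a) (X₂.d b)

/-- The data of the Kasparov product. -/
def tensorN1 {X₁ : N1Data A₁ H₁} {X₂ : N1Data A₂ H₂} {X : N1Data (A₁ ⊗[ℂ] A₂) (HTensor H₁ H₂)}
    (hrep : ∀ a₁ a₂, X.rep (a₁ ⊗ₜ[ℂ] a₂) = hmap (X₁.rep a₁) (X₂.rep a₂))
    (hD : X.D = tensorSum X₁.D 1 X₁.γ X₂.D) (hγ : X.γ = hmap X₁.γ X₂.γ) : TensorN1 X₁ X₂ X where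
  t := htmulL H₁ H₂
  m := hmapBilin
  τ := LinearEquiv.refl ℂ _
  inner := inner_htmul
  total := dense_span_htmul
  m_t := hmap_htmul
  τ_mul a b a' b' := Algebra.TensorProduct.tmul_mul_tmul a a' b b'
  τ_star := TensorProduct.star_tmul
  rep := hrep
  γ := hγ
  d a b := X.commutator_unique (X.d_spec _) (by
    change IsCommutator X.D (X.rep (a ⊗ₜ b)) _
    rw [hrep, hD]
    exact isCommutator_prodN1 X₁ X₂ (X₁.d_spec a) (X₂.d_spec b) (X₁.γ_rep a))

end N1

end SpectralData

namespace SpectralData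

/-! ### The tensor product of real structures -/

section TwistedReal

variable {A H : Type u} [Ring A] [StarRing A] [Algebra ℂ A] [StarModule ℂ A]
  [NormedAddCommGroup H] [InnerProductSpace ℂ H] [CompleteSpace H]

/-- A grading as a unitary operator. -/
def IsGrading.isometryEquiv {γ : H →L[ℂ] H} (h : IsGrading γ) : H ≃ₗᵢ[ℂ] H :=
  (LinearEquiv.ofInvolutive γ.toLinearMap h.apply_apply).isometryOfInner fun x y => by
    change ⟪γ x, γ y⟫_ℂ = _
    rw [h.inner_apply, h.apply_apply]

variable (k : Fin 4) (X : RealN1Data A H)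

theorem N1Data.d_add (X : N1Data A H) (a b : A) : X.d (a + b) = X.d a + X.d b :=
  X.commutator_unique (X.d_spec _) (by
    rw [map_add]
    exact (X.d_spec a).add (X.d_spec b))

namespace RealN1Data

/-- The operator `J` or `J γ` of the second factor of a product with first factor of
`KO`-dimension `2 k`. -/
def twistJ : H ≃ₗᵢ⋆[ℂ] H :=
  if epsGamma k = 1 then X.J else X.grading.isometryEquiv.trans X.J

theorem twistJ_apply (x : H) : X.twistJ k x = X.J (if epsGamma k = 1 then x else X.γ x) := by
  unfold twistJ
  split_ifs <;> rfl

theorem twistJ_symm_apply (x : H) :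
    (X.twistJ k).symm x = if epsGamma k = 1 then X.J.symm x else X.γ (X.J.symm x) := by
  rw [LinearIsometryEquiv.symm_apply_eq, twistJ_apply]
  split_ifs
  · rw [X.J.apply_symm_apply]
  · rw [X.grading.apply_apply, X.J.apply_symm_apply]

theorem J_γ' (x : H) : X.γ (X.J x) = epsGamma X.ko • X.J (X.γ x) := by
  rw [X.J_γ, smul_smul]
  rcases epsGamma_eq X.ko with h | h <;> rw [h] <;> simp

/-- In the twisted case `J γ J γ = ε'' J²`, where `ε''` is the sign of the factor carrying `J`, not
of the other one. -/
theorem twistJ_twistJ (x : H) : X.twistJ k (X.twistJ k x) =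
    ((if epsGamma k = 1 then 1 else epsGamma X.ko) * eps X.ko) • x := by
  rw [twistJ_apply, twistJ_apply]
  split_ifs
  · rw [X.J_J, one_mul]
  · rw [X.J_γ', X.grading.apply_apply, map_zsmul, X.J_J, smul_smul]

theorem twistJ_γ (x : H) : X.twistJ k (X.γ x) = epsGamma X.ko • X.γ (X.twistJ k x) := by
  rw [twistJ_apply, twistJ_apply]
  split_ifs <;> exact X.J_γ _

/-- `J γ` anticommutes with `D`. This sign compensates that of `J₁ γ₁ = -γ₁ J₁` in the term `γ₁ ⊗
D₂` of the product. -/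
theorem twistJ_D {x y : H} (h : (x, y) ∈ X.D.graph) :
    (X.twistJ k x, epsGamma k • X.twistJ k y) ∈ X.D.graph := by
  rw [twistJ_apply, twistJ_apply]
  split_ifs with hk
  · rw [hk, one_smul]
    exact X.J_D _ _ h
  · rw [(epsGamma_eq k).resolve_left hk, neg_one_smul, ← map_neg]
    exact X.J_D _ _ (X.γ_D _ _ h)

theorem twistJ_rep (a : A) (x : H) :
    X.twistJ k (X.rep a ((X.twistJ k).symm x)) = X.J (X.rep a (X.J.symm x)) := by
  rw [twistJ_symm_apply, twistJ_apply]
  split_ifs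
  · rfl
  · have : X.γ (X.rep a (X.γ (X.J.symm x))) = X.rep a (X.γ (X.γ (X.J.symm x))) :=
      congrArg (fun T : H →L[ℂ] H => T (X.γ (X.J.symm x))) (X.γ_rep a)
    rw [this, X.grading.apply_apply]

/-- `γ` crosses `J*` and `J` once each, so the sign appears squared. -/
theorem J_rep_γ (a : A) (x : H) :
    X.J (X.rep a (X.J.symm (X.γ x))) = X.γ (X.J (X.rep a (X.J.symm x))) := by
  have h1 : X.J.symm (X.γ x) = epsGamma X.ko • X.γ (X.J.symm x) := by
    rw [LinearIsometryEquiv.symm_apply_eq, map_zsmul, X.J_γ, smul_smul, X.J.apply_symm_apply]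
    rcases epsGamma_eq X.ko with h | h <;> rw [h] <;> simp
  have h2 : X.rep a (X.γ (X.J.symm x)) = X.γ (X.rep a (X.J.symm x)) :=
    (congrArg (fun T : H →L[ℂ] H => T (X.J.symm x)) (X.γ_rep a)).symm
  rw [h1, map_zsmul, map_zsmul, h2, X.J_γ, smul_smul]
  rcases epsGamma_eq X.ko with h | h <;> rw [h] <;> simp

end RealN1Data

end TwistedReal

/-! ### The real structure of the product and its order conditions -/

section RealProduct

variable {A₁ A₂ A H₁ H₂ H : Type u}
  [Ring A₁] [StarRing A₁] [Algebra ℂ A₁] [StarModule ℂ A₁]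
  [NormedAddCommGroup H₁] [InnerProductSpace ℂ H₁] [CompleteSpace H₁]
  [Ring A₂] [StarRing A₂] [Algebra ℂ A₂] [StarModule ℂ A₂]
  [NormedAddCommGroup H₂] [InnerProductSpace ℂ H₂] [CompleteSpace H₂]
  [Ring A] [StarRing A] [Algebra ℂ A] [StarModule ℂ A]
  [NormedAddCommGroup H] [InnerProductSpace ℂ H] [CompleteSpace H]

namespace TensorN1

section Basic

variable {X₁ : N1Data A₁ H₁} {X₂ : N1Data A₂ H₂} {X : N1Data A H} (M : TensorN1 X₁ X₂ X)

include M

theorem ext {K : Type*} [AddCommGroup K] [TopologicalSpace K] [T2Space K] {S T : H → K}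
    (hS : Continuous S) (hT : Continuous T)
    (hSa : ∀ z w, S (z + w) = S z + S w) (hTa : ∀ z w, T (z + w) = T z + T w)
    (h : ∀ x y, S (M.t x y) = T (M.t x y)) (z : H) : S z = T z := by
  have h0 : (Submodule.span ℂ (Set.univ : Set H₁)).topologicalClosure = ⊤ := by
    rw [Submodule.span_univ, ← Submodule.dense_iff_topologicalClosure_eq_top]
    exact dense_univ
  have h0' : (Submodule.span ℂ (Set.univ : Set H₂)).topologicalClosure = ⊤ := by
    rw [Submodule.span_univ, ← Submodule.dense_iff_topologicalClosure_eq_top]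
    exact dense_univ
  have hd := Submodule.dense_iff_topologicalClosure_eq_top.mpr (M.total h0 h0')
  refine congrFun (Continuous.ext_on hd hS hT fun z hz => ?_) z
  induction hz using Submodule.closure_induction with
  | zero => simpa using h 0 0
  | add z w _ _ hz hw => rw [hSa, hTa, hz, hw]
  | smul_mem c z hz =>
    obtain ⟨x, -, y, -, rfl⟩ := hz
    simpa using h (c • x) y

theorem ext_op {S T : H →L[ℂ] H} (h : ∀ x y, S (M.t x y) = T (M.t x y)) : S = T :=
  ContinuousLinearMap.ext
    (M.ext S.continuous T.continuous (map_add S) (map_add T) h)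

theorem m_mul (S S' : H₁ →L[ℂ] H₁) (T T' : H₂ →L[ℂ] H₂) :
    M.m S T * M.m S' T' = M.m (S * S') (T * T') :=
  M.ext_op fun x y => by
    change M.m S T (M.m S' T' (M.t x y)) = _
    rw [M.m_t, M.m_t, M.m_t]
    rfl

theorem star_m (S : H₁ →L[ℂ] H₁) (T : H₂ →L[ℂ] H₂) :
    star (M.m S T) = M.m (star S) (star T) := by
  rw [ContinuousLinearMap.star_eq_adjoint, eq_comm, ContinuousLinearMap.eq_adjoint_iff]
  intro z w
  have h : ∀ x y, ⟪M.m (star S) (star T) (M.t x y), w⟫_ℂ = ⟪M.t x y, M.m S T w⟫_ℂ := by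
    intro x y
    refine M.ext (S := fun w => ⟪M.m (star S) (star T) (M.t x y), w⟫_ℂ)
      (T := fun w => ⟪M.t x y, M.m S T w⟫_ℂ) (by fun_prop) (by fun_prop)
      (fun z w => inner_add_right _ _ _) (fun z w => by rw [map_add, inner_add_right])
      (fun x' y' => ?_) w
    rw [M.m_t, M.m_t, M.inner, M.inner, ContinuousLinearMap.star_eq_adjoint,
      ContinuousLinearMap.star_eq_adjoint, ContinuousLinearMap.adjoint_inner_left,
      ContinuousLinearMap.adjoint_inner_left]
  exact M.ext (S := fun z => ⟪M.m (star S) (star T) z, w⟫_ℂ) (T := fun z => ⟪z, M.m S T w⟫_ℂ)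
    (by fun_prop) (by fun_prop) (fun z w => by rw [map_add, inner_add_left])
    (fun z w => inner_add_left _ _ _) h z

theorem A_induction {p : A → Prop} (a : A) (tmul : ∀ x y, p (M.τ (x ⊗ₜ y)))
    (add : ∀ a b, p a → p b → p (a + b)) : p a := by
  obtain ⟨t, rfl⟩ := M.τ.surjective a
  induction t using TensorProduct.induction_on with
  | zero => simpa using tmul 0 0
  | tmul x y => exact tmul x y
  | add a b ha hb => rw [map_add]; exact add _ _ ha hb

theorem rep_t (a : A₁) (b : A₂) (x : H₁) (y : H₂) :
    X.rep (M.τ (a ⊗ₜ b)) (M.t x y) = M.t (X₁.rep a x) (X₂.rep b y) := by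
  rw [M.rep, M.m_t]

theorem d_t (a : A₁) (b : A₂) (x : H₁) (y : H₂) : X.d (M.τ (a ⊗ₜ b)) (M.t x y) =
    M.t (X₁.d a x) (X₂.rep b y) + M.t (X₁.γ (X₁.rep a x)) (X₂.d b y) := by
  rw [M.d, _root_.add_apply, M.m_t, M.m_t]
  rfl

theorem t_zsmul (m n : ℤ) (x : H₁) (y : H₂) : M.t (m • x) (n • y) = (m * n) • M.t x y := by
  rw [map_zsmul, map_zsmul, mul_comm, mul_smul]
  rfl

theorem γ_t (x : H₁) (y : H₂) : X.γ (M.t x y) = M.t (X₁.γ x) (X₂.γ y) := by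
  rw [M.γ, M.m_t]

end Basic

section Real

variable {X₁ : RealN1Data A₁ H₁} {X₂ : RealN1Data A₂ H₂} {X : N1Data A H}
  (M : TensorN1 X₁.toN1Data X₂.toN1Data X)

/-- A check of the sixteen pairs: with the twist chosen according to the first factor, the sign
table is compatible with addition of `KO`-dimensions. -/
theorem eps_add (k l : Fin 4) :
    eps k * ((if epsGamma k = 1 then 1 else epsGamma l) * eps l) = eps (k + l) := by
  fin_cases k <;> fin_cases l <;> rfl

theorem epsGamma_add (k l : Fin 4) : epsGamma k * epsGamma l = epsGamma (k + l) := by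
  fin_cases k <;> fin_cases l <;> rfl

/-- The tensor product of real structures. -/
def real (J : H ≃ₗᵢ⋆[ℂ] H) (hJ : ∀ x y, J (M.t x y) = M.t (X₁.J x) (X₂.twistJ X₁.ko y))
    (hD : ∀ x y, (x, y) ∈ X.D.graph → (J x, J y) ∈ X.D.graph) : RealN1Data A H :=
  have hJs : ∀ x y, J.symm (M.t x y) = M.t (X₁.J.symm x) ((X₂.twistJ X₁.ko).symm y) :=
    fun x y => by
      rw [LinearIsometryEquiv.symm_apply_eq, hJ, X₁.J.apply_symm_apply,
        LinearIsometryEquiv.apply_symm_apply]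
  -- On elementary tensors the twist disappears from `J a J*`, which becomes the tensor product of
  -- the operators of the factors. Both order conditions thereby reduce to those of the factors.
  have hR : ∀ a b x y, J (X.rep (M.τ (a ⊗ₜ b)) (J.symm (M.t x y))) =
      M.t (X₁.J (X₁.rep a (X₁.J.symm x))) (X₂.J (X₂.rep b (X₂.J.symm y))) := fun a b x y => by
    rw [hJs, M.rep_t, hJ, X₂.twistJ_rep]
  { X with
    J := J
    ko := X₁.ko + X₂.ko
    J_J := M.ext (by fun_prop) (by fun_prop) (fun z w => by rw [map_add, map_add])
      (fun z w => smul_add _ _ _) fun x y => by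
        rw [hJ, hJ, X₁.J_J, X₂.twistJ_twistJ, ← eps_add, M.t_zsmul]
    J_D := hD
    J_γ := M.ext (by fun_prop) (by fun_prop) (fun z w => by rw [map_add, map_add])
      (fun z w => by rw [map_add, map_add, smul_add]) fun x y => by
        rw [M.γ_t, hJ, hJ, M.γ_t, X₁.J_γ, X₂.twistJ_γ, ← epsGamma_add, M.t_zsmul]
    order_zero := fun a b => by
      induction a using M.A_induction with
      | add a a' ha ha' =>
        intro x
        simp only [map_add, _root_.add_apply, ha, ha']
      | tmul a a' =>
        induction b using M.A_induction with
        | add b b' hb hb' =>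
          intro x
          simp only [map_add, _root_.add_apply, hb, hb']
        | tmul b b' =>
          refine M.ext (by fun_prop) (by fun_prop) (fun z w => by simp only [map_add])
            (fun z w => by simp only [map_add]) fun x y => ?_
          rw [M.rep_t, hR, hR, M.rep_t, X₁.order_zero, X₂.order_zero]
    order_one := fun a b => by
      induction a using M.A_induction with
      | add a a' ha ha' =>
        intro x
        simp only [map_add, _root_.add_apply, ha, ha']
      | tmul a a' =>
        induction b using M.A_induction with
        | add b b' hb hb' =>
          intro x
          rw [X.d_add]
          simp only [map_add, _root_.add_apply, hb, hb']
        | tmul b b' =>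
          refine M.ext (by fun_prop) (by fun_prop) (fun z w => by simp only [map_add])
            (fun z w => by simp only [map_add]) fun x y => ?_
          rw [M.d_t, hR, M.d_t, map_add, map_add, map_add, hR, hR, X₁.order_one, X₂.order_one,
            X₂.order_zero, X₁.J_rep_γ, X₁.order_zero] }

end Real

end TensorN1

omit [CompleteSpace H] in
theorem mem_graph_antiunitary_of_core {D : H →ₗ.[ℂ] H} {s : Set (H × H)}
    (hD : D.graph = (Submodule.span ℂ s).topologicalClosure) (J : H ≃ₗᵢ⋆[ℂ] H)
    (h : ∀ p ∈ s, (J p.1, J p.2) ∈ D.graph) {x y : H} (hxy : (x, y) ∈ D.graph) :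
    (J x, J y) ∈ D.graph :=
  mem_graph_of_core hD (σ := starRingEnd ℂ)
    { toFun := fun p => (J p.1, J p.2)
      map_add' := fun _ _ => Prod.ext (map_add J _ _) (map_add J _ _)
      map_smul' := fun _ _ => Prod.ext (J.map_smulₛₗ _ _) (J.map_smulₛₗ _ _)
      cont := (J.continuous.comp continuous_fst).prodMk (J.continuous.comp continuous_snd) }
    h (p := (x, y)) hxy

/-- Tested on generators: in `γ₁ x ⊗ D₂ y` the sign of `J₁ γ₁ = ± γ₁ J₁` cancels the sign between
the twisted `J₂` and `D₂`. -/
theorem htJ_mem_tensorSum (X₁ : RealN1Data A₁ H₁) (X₂ : RealN1Data A₂ H₂) (z w : HTensor H₁ H₂)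
    (h : (z, w) ∈ (tensorSum X₁.D 1 X₁.γ X₂.D).graph) :
    (htJ X₁.J (X₂.twistJ X₁.ko) z, htJ X₁.J (X₂.twistJ X₁.ko) w) ∈
      (tensorSum X₁.D 1 X₁.γ X₂.D).graph := by
  have hs₁ := isSymmGraph_D X₁.toN1Data
  have hs₂ := isSymmGraph_D X₂.toN1Data
  have hd₁ := X₁.selfAdjoint.dense_domain
  have hd₂ := X₂.selfAdjoint.dense_domain
  have hγ := X₁.grading.inner_apply
  refine mem_graph_antiunitary_of_core (tensorSum_graph hγ symm_one hs₁ hs₂ hd₁ hd₂)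
    (htJ X₁.J (X₂.twistJ X₁.ko)) ?_ h
  rintro _ ⟨⟨x, x'⟩, hx, ⟨y, y'⟩, hy, rfl⟩
  have h1 := mem_tensorSum hγ symm_one hs₁ hs₂ hd₁ hd₂ (X₁.J_D x x' hx) (X₂.twistJ_D X₁.ko hy)
  have h2 : htmul (X₁.γ (X₁.J x)) (epsGamma X₁.ko • X₂.twistJ X₁.ko y') =
      htmul (X₁.J (X₁.γ x)) (X₂.twistJ X₁.ko y') := by
    rw [X₁.J_γ]
    rcases epsGamma_eq X₁.ko with hk | hk <;> rw [hk]
    · rw [one_smul, one_smul]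
    · rw [neg_one_smul, neg_one_smul, htmul_neg_left, htmul_neg_right]
  rw [h2] at h1
  rw [sumGen_htmulL, map_add, htJ_htmul, htJ_htmul, htJ_htmul]
  exact h1

end RealProduct

end SpectralData

namespace SpectralData

/-! ### The tensor product of Hermitian modules -/

theorem finite_projective_of_coordinates {R M ι : Type*} [Ring R] [AddCommGroup M] [Module R M]
    [Fintype ι] (e : ι → M) (φ : ι → M →ₗ[R] R) (h : ∀ x, x = ∑ k, φ k x • e k) :
    Module.Finite R M ∧ Module.Projective R M := by
  have hc : Fintype.linearCombination R e ∘ₗ LinearMap.pi φ = LinearMap.id :=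
    LinearMap.ext fun x => (h x).symm
  exact ⟨Module.Finite.of_surjective (Fintype.linearCombination R e)
    fun x => ⟨_, LinearMap.congr_fun hc x⟩, Module.Projective.of_split _ _ hc⟩

section HermitianProduct

variable {A₁ A₂ A H₁ H₂ H : Type u}
  [Ring A₁] [StarRing A₁] [Algebra ℂ A₁] [StarModule ℂ A₁]
  [NormedAddCommGroup H₁] [InnerProductSpace ℂ H₁] [CompleteSpace H₁]
  [Ring A₂] [StarRing A₂] [Algebra ℂ A₂] [StarModule ℂ A₂]
  [NormedAddCommGroup H₂] [InnerProductSpace ℂ H₂] [CompleteSpace H₂]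
  [Ring A] [StarRing A] [Algebra ℂ A] [StarModule ℂ A]
  [NormedAddCommGroup H] [InnerProductSpace ℂ H] [CompleteSpace H]

/-- The submodule `E₁ ⊗ E₂` of the tensor product `X` of real spectral data. -/
structure TensorModule (X₁ : HermitianData A₁ H₁) (X₂ : HermitianData A₂ H₂) (X : RealN1Data A H)
    extends TensorN1 X₁.toN1Data X₂.toN1Data X.toN1Data where
  /-- The dense submodule. -/
  E : Submodule ℂ H
  /-- The identification of the module with the tensor product. -/
  ε : X₁.E ⊗[ℂ] X₂.E ≃ₗ[ℂ] E
  coe_ε : ∀ x y, (ε (x ⊗ₜ y) : H) = t (x : H₁) (y : H₂)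
  J : ∀ x y, X.J (t x y) = t (X₁.J x) (X₂.twistJ X₁.ko y)

namespace TensorN1

variable {X₁ : N1Data A₁ H₁} {X₂ : N1Data A₂ H₂} {X : N1Data A H} (M : TensorN1 X₁ X₂ X)
  (E₁ : Submodule ℂ H₁) (E₂ : Submodule ℂ H₂)

/-- The map `H₁ ⊗ H₂ → H`. -/
def tensorMap : H₁ ⊗[ℂ] H₂ →ₗ[ℂ] H :=
  TensorProduct.lift (LinearMap.mk₂ ℂ (fun x y => M.t x y)
    (fun _ _ _ => by rw [map_add, _root_.add_apply])
    (fun _ _ _ => by rw [map_smul, _root_.smul_apply])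
    (fun _ _ _ => by rw [map_add])
    (fun _ _ _ => by rw [map_smul]))

theorem tensorMap_tmul (x : H₁) (y : H₂) : M.tensorMap (x ⊗ₜ y) = M.t x y := rfl

theorem inner_tensorMap (z w : H₁ ⊗[ℂ] H₂) : ⟪M.tensorMap z, M.tensorMap w⟫_ℂ = ⟪z, w⟫_ℂ := by
  induction z using TensorProduct.induction_on with
  | zero => rw [map_zero, inner_zero_left, inner_zero_left]
  | add a b ha hb => rw [map_add, inner_add_left, inner_add_left, ha, hb]
  | tmul x y =>
    induction w using TensorProduct.induction_on with
    | zero => rw [map_zero, inner_zero_right, inner_zero_right]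
    | add a b ha hb => rw [map_add, inner_add_right, inner_add_right, ha, hb]
    | tmul x' y' => rw [tensorMap_tmul, tensorMap_tmul, M.inner, TensorProduct.inner_tmul]

theorem tensorMap_injective : Function.Injective M.tensorMap := by
  refine (injective_iff_map_eq_zero M.tensorMap).mpr fun z hz => ?_
  have h := M.inner_tensorMap z z
  rw [hz, inner_zero_left] at h
  exact (inner_self_eq_zero (𝕜 := ℂ) (E := H₁ ⊗[ℂ] H₂)).mp h.symm

/-- The map `E₁ ⊗ E₂ → H`. -/
def moduleMap : E₁ ⊗[ℂ] E₂ →ₗ[ℂ] H :=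
  M.tensorMap ∘ₗ TensorProduct.map E₁.subtype E₂.subtype

/-- `H₁ ⊗ H₂ → H` is isometric, and vector spaces are flat, so `E₁ ⊗ E₂` embeds in `H₁ ⊗ H₂`. -/
theorem moduleMap_injective : Function.Injective (M.moduleMap E₁ E₂) :=
  M.tensorMap_injective.comp
    (TensorProduct.map_injective_of_flat_flat _ _ E₁.subtype_injective E₂.subtype_injective)

theorem range_moduleMap : LinearMap.range (M.moduleMap E₁ E₂) =
    Submodule.span ℂ {z | ∃ x ∈ E₁, ∃ y ∈ E₂, z = M.t x y} := by
  apply le_antisymm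
  · rintro _ ⟨z, rfl⟩
    induction z using TensorProduct.induction_on with
    | zero => rw [map_zero]; exact zero_mem _
    | add a b ha hb => rw [map_add]; exact add_mem ha hb
    | tmul x y => exact Submodule.subset_span ⟨x, x.2, y, y.2, rfl⟩
  · rw [Submodule.span_le]
    rintro _ ⟨x, hx, y, hy, rfl⟩
    exact ⟨⟨x, hx⟩ ⊗ₜ ⟨y, hy⟩, rfl⟩

/-- The identification of a submodule of `H` with `E₁ ⊗ E₂`. -/
def moduleEquiv {E : Submodule ℂ H}
    (hE : E = Submodule.span ℂ {z | ∃ x ∈ E₁, ∃ y ∈ E₂, z = M.t x y}) :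
    E₁ ⊗[ℂ] E₂ ≃ₗ[ℂ] E :=
  (LinearEquiv.ofInjective (M.moduleMap E₁ E₂) (M.moduleMap_injective E₁ E₂)).trans
    (LinearEquiv.ofEq _ _ ((M.range_moduleMap E₁ E₂).trans hE.symm))

end TensorN1

namespace TensorModule

variable {X₁ : HermitianData A₁ H₁} {X₂ : HermitianData A₂ H₂} {X : RealN1Data A H}
  (M : TensorModule X₁ X₂ X)

theorem mem_tmul (x : X₁.E) (y : X₂.E) : M.t (x : H₁) (y : H₂) ∈ M.E :=
  M.coe_ε x y ▸ (M.ε (x ⊗ₜ y)).2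

theorem E_induction {p : M.E → Prop} (ξ : M.E) (tmul : ∀ x y, p (M.ε (x ⊗ₜ y)))
    (add : ∀ ξ η, p ξ → p η → p (ξ + η)) : p ξ := by
  obtain ⟨t, rfl⟩ := M.ε.surjective ξ
  induction t using TensorProduct.induction_on with
  | zero => simpa using tmul 0 0
  | tmul x y => exact tmul x y
  | add a b ha hb => rw [map_add]; exact add _ _ ha hb

theorem mem_induction {p : H → Prop} {x : H} (hx : x ∈ M.E)
    (tmul : ∀ (x : X₁.E) (y : X₂.E), p (M.t (x : H₁) (y : H₂)))
    (add : ∀ x y, p x → p y → p (x + y)) : p x :=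
  M.E_induction (p := fun ξ => p ξ) ⟨x, hx⟩ (fun x y => (M.coe_ε x y).symm ▸ tmul x y)
    fun _ _ h h' => add _ _ h h'

theorem dense_E : Dense (M.E : Set H) := by
  rw [Submodule.dense_iff_topologicalClosure_eq_top, eq_top_iff,
    ← M.total (topologicalClosure_span_of_dense X₁.dense_E)
      (topologicalClosure_span_of_dense X₂.dense_E)]
  refine Submodule.topologicalClosure_mono (Submodule.span_le.mpr ?_)
  rintro _ ⟨x, hx, y, hy, rfl⟩
  exact M.mem_tmul ⟨x, hx⟩ ⟨y, hy⟩

theorem rep_mem (a : A) (x : H) (hx : x ∈ M.E) : X.rep a x ∈ M.E := by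
  induction a using M.A_induction with
  | add a b ha hb => rw [map_add]; exact add_mem ha hb
  | tmul a b =>
    refine M.mem_induction hx (p := fun x => X.rep (M.τ (a ⊗ₜ b)) x ∈ M.E) (fun x y => ?_)
      fun x y hx hy => ?_
    · rw [M.rep_t]
      exact M.mem_tmul (X₁.left a x) (X₂.left b y)
    · rw [map_add]
      exact add_mem hx hy

theorem twistJ_mem (k : Fin 4) (y : X₂.E) : X₂.twistJ k (y : H₂) ∈ X₂.E := by
  rw [X₂.twistJ_apply]
  split_ifs
  · exact X₂.J_mem _ y.2
  · exact X₂.J_mem _ (X₂.γ_mem _ y.2)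

theorem J_mem (x : H) (hx : x ∈ M.E) : X.J x ∈ M.E := by
  refine M.mem_induction hx (p := fun x => X.J x ∈ M.E) (fun x y => ?_)
    fun x y hx hy => ?_
  · rw [M.J]
    exact M.mem_tmul (X₁.JE x) ⟨_, twistJ_mem X₁.ko y⟩
  · rw [map_add]
    exact add_mem hx hy

theorem γ_mem (x : H) (hx : x ∈ M.E) : X.γ x ∈ M.E := by
  refine M.mem_induction hx (p := fun x => X.γ x ∈ M.E) (fun x y => ?_)
    fun x y hx hy => ?_
  · rw [M.γ_t]
    exact M.mem_tmul (X₁.γE x) (X₂.γE y)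
  · rw [map_add]
    exact add_mem hx hy

theorem d_mem_E (a : A) (x : H) (hx : x ∈ M.E) : X.d a x ∈ M.E := by
  induction a using M.A_induction with
  | add a b ha hb => rw [X.d_add]; exact add_mem ha hb
  | tmul a b =>
    refine M.mem_induction hx (p := fun x => X.d (M.τ (a ⊗ₜ b)) x ∈ M.E) (fun x y => ?_)
      fun x y hx hy => ?_
    · rw [M.d_t]
      exact add_mem (M.mem_tmul ⟨_, X₁.d_mem_E a x x.2⟩ (X₂.left b y))
        (M.mem_tmul (X₁.γE (X₁.left a x)) ⟨_, X₂.d_mem_E b y y.2⟩)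
    · rw [map_add]
      exact add_mem hx hy

/-- The Hermitian structure of the tensor product. -/
def herm : M.E →ₗ[ℂ] M.E →ₗ⋆[ℂ] A :=
  LinearMap.mk₂'ₛₗ (RingHom.id ℂ) (starRingEnd ℂ)
    (fun ξ η => M.τ (TensorProduct.map₂ X₁.herm X₂.herm (M.ε.symm ξ) (M.ε.symm η)))
    (fun _ _ _ => by simp only [map_add, LinearMap.add_apply])
    (fun _ _ _ => by simp only [map_smul, LinearMap.smul_apply, RingHom.id_apply])
    (fun _ _ _ => by simp only [map_add])
    (fun _ _ _ => by simp only [map_smul, LinearMap.map_smulₛₗ])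

theorem herm_tmul (x x' : X₁.E) (y y' : X₂.E) : M.herm (M.ε (x ⊗ₜ y)) (M.ε (x' ⊗ₜ y')) =
    M.τ (X₁.herm x x' ⊗ₜ X₂.herm y y') := by
  change M.τ (TensorProduct.map₂ X₁.herm X₂.herm (M.ε.symm _) (M.ε.symm _)) = _
  rw [LinearEquiv.symm_apply_apply, LinearEquiv.symm_apply_apply]
  rfl

/-- The left action on the tensor product of modules. -/
def left (a : A) : M.E →ₗ[ℂ] M.E where
  toFun x := ⟨X.rep a x, M.rep_mem a x x.2⟩
  map_add' x y := Subtype.ext (map_add (X.rep a) (x : H) y)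
  map_smul' c x := Subtype.ext (map_smul (X.rep a) c (x : H))

theorem left_add (a b : A) (ξ : M.E) : M.left (a + b) ξ = M.left a ξ + M.left b ξ :=
  Subtype.ext (by
    change X.rep (a + b) (ξ : H) = X.rep a (ξ : H) + X.rep b (ξ : H)
    rw [map_add]
    rfl)

theorem left_tmul (a : A₁) (b : A₂) (x : X₁.E) (y : X₂.E) :
    M.left (M.τ (a ⊗ₜ b)) (M.ε (x ⊗ₜ y)) = M.ε (X₁.left a x ⊗ₜ X₂.left b y) :=
  Subtype.ext (by
    change X.rep _ (M.ε (x ⊗ₜ y) : H) = _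
    rw [M.coe_ε, M.coe_ε, M.rep_t]
    rfl)

theorem herm_left (a : A) (ξ η : M.E) : M.herm (M.left a ξ) η = a * M.herm ξ η := by
  induction a using M.A_induction with
  | add a b ha hb => rw [left_add, map_add, LinearMap.add_apply, ha, hb, add_mul]
  | tmul a b =>
    induction ξ using M.E_induction with
    | add ξ ξ' h h' => simp only [map_add, LinearMap.add_apply, h, h', mul_add]
    | tmul x y =>
      induction η using M.E_induction with
      | add ξ ξ' h h' => simp only [map_add, h, h', mul_add]
      | tmul x' y' =>
        rw [M.left_tmul, M.herm_tmul, M.herm_tmul, M.τ_mul, X₁.herm_left, X₂.herm_left]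

theorem herm_symm (ξ η : M.E) : star (M.herm ξ η) = M.herm η ξ := by
  induction ξ using M.E_induction with
  | add ξ ξ' h h' => simp only [map_add, LinearMap.add_apply, h, h', star_add]
  | tmul x y =>
    induction η using M.E_induction with
    | add ξ ξ' h h' => simp only [map_add, LinearMap.add_apply, h, h', star_add]
    | tmul x' y' => rw [M.herm_tmul, M.herm_tmul, M.τ_star, X₁.herm_symm, X₂.herm_symm]

/-- Products of the two dual bases work. Finite generation, projectivity and self-duality of `E₁ ⊗
E₂` all follow from this expansion. -/
theorem exists_dual_basis : ∃ (ι : Type) (_ : Fintype ι) (e f : ι → M.E),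
    ∀ ξ, ξ = ∑ k, M.left (M.herm ξ (f k)) (e k) := by
  obtain ⟨m, e₁, f₁, h₁⟩ := X₁.exists_dual_basis
  obtain ⟨n, e₂, f₂, h₂⟩ := X₂.exists_dual_basis
  refine ⟨Fin m × Fin n, inferInstance, fun k => M.ε (e₁ k.1 ⊗ₜ e₂ k.2),
    fun k => M.ε (f₁ k.1 ⊗ₜ f₂ k.2), fun ξ => ?_⟩
  induction ξ using M.E_induction with
  | add ξ η h h' =>
    simp only [map_add, LinearMap.add_apply, left_add, Finset.sum_add_distrib, ← h, ← h']
  | tmul x y =>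
    simp only [herm_tmul, left_tmul]
    conv_lhs => rw [h₁ x, h₂ y, TensorProduct.sum_tmul]
    simp only [TensorProduct.tmul_sum, map_sum, Fintype.sum_prod_type]

theorem finite_projective :
    letI : Module A M.E := repModule X.rep M.E M.rep_mem
    Module.Finite A M.E ∧ Module.Projective A M.E := by
  let _ : Module A M.E := repModule X.rep M.E M.rep_mem
  obtain ⟨ι, _, e, f, h⟩ := M.exists_dual_basis
  exact finite_projective_of_coordinates e (fun k =>
    { toFun := fun ξ => M.herm ξ (f k)
      map_add' := fun _ _ => by rw [map_add, LinearMap.add_apply]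
      map_smul' := fun a ξ => M.herm_left a ξ (f k) }) h

/-- The sum `∑ ⟪zₖ, T zₗ⟫`, for `T = ⟨ξ, ξ⟩_A`, as a square of a norm. -/
theorem inner_herm {ι κ : Type*} [Fintype ι] [Fintype κ] (x : ι → X₁.E) (y : ι → X₂.E)
    (u : κ → X₁.E) (v : κ → X₂.E) :
    ⟪∑ k, M.t (u k : H₁) (v k : H₂), X.rep (M.herm (∑ i, M.ε (x i ⊗ₜ y i))
      (∑ i, M.ε (x i ⊗ₜ y i))) (∑ k, M.t (u k : H₁) (v k : H₂))⟫_ℂ =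
    ⟪∑ i, ∑ k, htmul (X₁.incl (nctmul X₁.right X₁.left (X₁.JEsymm (x i)) (u k)))
        (X₂.incl (nctmul X₂.right X₂.left (X₂.JEsymm (y i)) (v k))),
      ∑ i, ∑ k, htmul (X₁.incl (nctmul X₁.right X₁.left (X₁.JEsymm (x i)) (u k)))
        (X₂.incl (nctmul X₂.right X₂.left (X₂.JEsymm (y i)) (v k)))⟫_ℂ := by
  have h : ∀ i j k l, ⟪M.t (u k : H₁) (v k : H₂),
      X.rep (M.herm (M.ε (x i ⊗ₜ y i)) (M.ε (x j ⊗ₜ y j))) (M.t (u l : H₁) (v l : H₂))⟫_ℂ =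
      ⟪htmul (X₁.incl (nctmul X₁.right X₁.left (X₁.JEsymm (x i)) (u k)))
        (X₂.incl (nctmul X₂.right X₂.left (X₂.JEsymm (y i)) (v k))),
      htmul (X₁.incl (nctmul X₁.right X₁.left (X₁.JEsymm (x j)) (u l)))
        (X₂.incl (nctmul X₂.right X₂.left (X₂.JEsymm (y j)) (v l)))⟫_ℂ := by
    intro i j k l
    refine Eq.trans ?_ (inner_htmul (H₁ := X₁.HTilde) (H₂ := X₂.HTilde) _ _ _ _).symm
    rw [X₁.inner_incl, X₂.inner_incl, X₁.form_nctmul, X₂.form_nctmul, X₁.JE_JEsymm, X₁.JE_JEsymm,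
      X₂.JE_JEsymm, X₂.JE_JEsymm, M.herm_tmul, M.rep_t, M.inner]
  simp only [map_sum, LinearMap.sum_apply, _root_.sum_apply, inner_sum, sum_inner, h]
  exact Finset.sum_comm

/-- For a sum of elementary tensors positivity is not visible factor by factor. On the dense
subspace `E`, `⟪z, ⟨ξ, ξ⟩ z⟫` equals the squared norm of a vector in the tensor product of the
completions of the `Eᵢ ⊗ Eᵢ`, so it rests on positivity of a tensor product of inner products. -/
theorem herm_nonneg (ξ : M.E) : (X.rep (M.herm ξ ξ)).IsPositive := by
  rw [ContinuousLinearMap.isPositive_def']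
  refine ⟨?_, fun z => ?_⟩
  · rw [IsSelfAdjoint, ← map_star, M.herm_symm]
  · have hcl : IsClosed {z : H | 0 ≤ (X.rep (M.herm ξ ξ)).reApplyInnerSelf z} :=
      isClosed_le continuous_const (ContinuousLinearMap.reApplyInnerSelf_continuous _)
    refine hcl.closure_subset_iff.mpr ?_ (M.dense_E z)
    intro z hz
    obtain ⟨s, rfl⟩ := M.ε.surjective ξ
    obtain ⟨w, hw⟩ := M.ε.surjective ⟨z, hz⟩
    obtain ⟨m, x, y, rfl⟩ := TensorProduct.exists_sum_tmul_eq s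
    obtain ⟨n, u, v, rfl⟩ := TensorProduct.exists_sum_tmul_eq w
    have hz : z = ∑ k, M.t (u k : H₁) (v k : H₂) := by
      have := congrArg (fun ξ : M.E => (ξ : H)) hw
      simp only [map_sum, AddSubmonoidClass.coe_finsetSum, M.coe_ε] at this
      exact this.symm
    have h := M.inner_herm x y u v
    rw [← map_sum] at h
    rw [Set.mem_ofPred_eq, ContinuousLinearMap.reApplyInnerSelf, ← inner_re_symm, hz, h]
    exact inner_self_nonneg (𝕜 := ℂ) (E := HTensor X₁.HTilde X₂.HTilde)

theorem herm_right (a : A) (ξ η : M.E) : M.herm ξ (M.left a η) = M.herm ξ η * star a := by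
  rw [← M.herm_symm, M.herm_left, star_mul, M.herm_symm]

/-- A dual basis reconstructs `η` from the elements `⟨η, fₖ⟩`, which are adjoints of `⟨fₖ, η⟩`. -/
theorem eq_of_herm {η η' : M.E} (h : ∀ ξ, M.herm ξ η = M.herm ξ η') : η = η' := by
  obtain ⟨ι, _, e, f, hef⟩ := M.exists_dual_basis
  rw [hef η, hef η']
  refine Finset.sum_congr rfl fun k _ => ?_
  rw [← M.herm_symm, h, M.herm_symm]

theorem herm_dual (φ : M.E →ₗ[ℂ] A) (hφ : ∀ a ξ, φ (M.left a ξ) = a * φ ξ) :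
    ∃! η, ∀ ξ, φ ξ = M.herm ξ η := by
  obtain ⟨ι, _, e, f, h⟩ := M.exists_dual_basis
  -- The representing vector is `∑ φ(eₖ)* fₖ`: apply `φ` to `ξ = ∑ ⟨ξ, fₖ⟩ eₖ`.
  have key : ∀ ξ, φ ξ = M.herm ξ (∑ k, M.left (star (φ (e k))) (f k)) := fun ξ => by
    conv_lhs => rw [h ξ]
    simp only [map_sum, hφ, M.herm_right, star_star]
  exact ⟨_, key, fun η hη => M.eq_of_herm fun ξ => (hη ξ).symm.trans (key ξ)⟩

/-- The tensor product of Hermitian modules. -/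
def hermitian : HermitianData A H where
  toRealN1Data := X
  E := M.E
  dense_E := M.dense_E
  rep_mem := M.rep_mem
  J_mem := M.J_mem
  γ_mem := M.γ_mem
  d_mem_E := M.d_mem_E
  finite_projective := M.finite_projective
  herm := M.herm
  herm_left := M.herm_left
  herm_symm := M.herm_symm
  herm_nonneg := M.herm_nonneg
  herm_dual := M.herm_dual

end TensorModule

end HermitianProduct

end SpectralData

namespace SpectralData

/-! ### The product connection -/

section ProductConnection

variable {A₁ A₂ A H₁ H₂ H : Type u}
  [Ring A₁] [StarRing A₁] [Algebra ℂ A₁] [StarModule ℂ A₁]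
  [NormedAddCommGroup H₁] [InnerProductSpace ℂ H₁] [CompleteSpace H₁]
  [Ring A₂] [StarRing A₂] [Algebra ℂ A₂] [StarModule ℂ A₂]
  [NormedAddCommGroup H₂] [InnerProductSpace ℂ H₂] [CompleteSpace H₂]
  [Ring A] [StarRing A] [Algebra ℂ A] [StarModule ℂ A]
  [NormedAddCommGroup H] [InnerProductSpace ℂ H] [CompleteSpace H]

theorem N1Data.d_one (X : N1Data A H) : X.d 1 = 0 := by
  have h := X.d_mul 1 1
  rw [mul_one, map_one, mul_one, one_mul, left_eq_add] at h
  exact h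

namespace TensorN1

variable {X₁ : N1Data A₁ H₁} {X₂ : N1Data A₂ H₂} {X : N1Data A H} (M : TensorN1 X₁ X₂ X)

/-- Since `d 1 = 0`, the form `a db ⊗ 1` is `(a ⊗ 1) d(b ⊗ 1)`. In the same way `d(1 ⊗ b) = γ₁ ⊗
db`, which is where the grading in the second kind of one-form comes from. -/
theorem m_one_mem {ω : H₁ →L[ℂ] H₁} (hω : ω ∈ X₁.Omega) : M.m ω 1 ∈ X.Omega := by
  induction hω using Submodule.span_induction with
  | mem ω h =>
    obtain ⟨a, b, rfl⟩ := h
    refine Submodule.subset_span ⟨M.τ (a ⊗ₜ 1), M.τ (b ⊗ₜ 1), ?_⟩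
    rw [M.rep, M.d, X₂.d_one, map_zero, add_zero, M.m_mul, map_one X₂.rep, one_mul]
  | zero => rw [map_zero]; exact zero_mem _
  | add S T _ _ hS hT => rw [map_add]; exact add_mem hS hT
  | smul c S _ hS => rw [map_smul]; exact Submodule.smul_mem _ _ hS

theorem m_γ_mem {ω : H₂ →L[ℂ] H₂} (hω : ω ∈ X₂.Omega) : M.m X₁.γ ω ∈ X.Omega := by
  induction hω using Submodule.span_induction with
  | mem ω h =>
    obtain ⟨a, b, rfl⟩ := h
    refine Submodule.subset_span ⟨M.τ (1 ⊗ₜ a), M.τ (1 ⊗ₜ b), ?_⟩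
    rw [M.rep, M.d, X₁.d_one, LinearMap.map_zero₂, zero_add, M.m_mul, map_one, one_mul, mul_one]
  | zero => rw [map_zero]; exact zero_mem _
  | add S T _ _ hS hT => rw [map_add]; exact add_mem hS hT
  | smul c S _ hS => rw [map_smul]; exact Submodule.smul_mem _ _ hS

/-- The one-form `ω ⊗ 1`. -/
def omegaFst : X₁.Omega →ₗ[ℂ] X.Omega where
  toFun ω := ⟨M.m ω 1, M.m_one_mem ω.2⟩
  map_add' _ _ := Subtype.ext (LinearMap.map_add₂ M.m _ _ _)
  map_smul' _ _ := Subtype.ext (LinearMap.map_smul₂ M.m _ _ _)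

/-- The one-form `γ ⊗ ω`. -/
def omegaSnd : X₂.Omega →ₗ[ℂ] X.Omega where
  toFun ω := ⟨M.m X₁.γ ω, M.m_γ_mem ω.2⟩
  map_add' _ _ := Subtype.ext (map_add (M.m X₁.γ) _ _)
  map_smul' _ _ := Subtype.ext (map_smul (M.m X₁.γ) _ _)

theorem omegaFst_right (a : A₁) (ω : X₁.Omega) :
    M.omegaFst (X₁.omegaRight a ω) = X.omegaRight (M.τ (a ⊗ₜ 1)) (M.omegaFst ω) :=
  Subtype.ext (by
    change M.m (ω * X₁.rep a) 1 = M.m ω 1 * X.rep _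
    rw [M.rep, M.m_mul, map_one X₂.rep, one_mul])

theorem omegaSnd_right (a : A₂) (ω : X₂.Omega) :
    M.omegaSnd (X₂.omegaRight a ω) = X.omegaRight (M.τ (1 ⊗ₜ a)) (M.omegaSnd ω) :=
  Subtype.ext (by
    change M.m X₁.γ (ω * X₂.rep a) = M.m X₁.γ ω * X.rep _
    rw [M.rep, M.m_mul, map_one, mul_one])

/-- The element `b` of the other factor passes through `ω ⊗ 1`, so it can be moved across `⊗_A` onto
the module. -/
theorem omegaFst_left (a : A₁) (b : A₂) (ω : X₁.Omega) :
    X.omegaLeft (M.τ (a ⊗ₜ b)) (M.omegaFst ω) =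
      X.omegaRight (M.τ (1 ⊗ₜ b)) (M.omegaFst (X₁.omegaLeft a ω)) :=
  Subtype.ext (by
    change X.rep _ * M.m ω 1 = M.m (X₁.rep a * ω) 1 * X.rep _
    rw [M.rep, M.rep, M.m_mul, M.m_mul, map_one, mul_one, mul_one, one_mul])

theorem omegaSnd_left (a : A₁) (b : A₂) (ω : X₂.Omega) :
    X.omegaLeft (M.τ (a ⊗ₜ b)) (M.omegaSnd ω) =
      X.omegaRight (M.τ (a ⊗ₜ 1)) (M.omegaSnd (X₂.omegaLeft b ω)) :=
  Subtype.ext (by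
    change X.rep _ * M.m X₁.γ ω = M.m X₁.γ (X₂.rep b * ω) * X.rep _
    rw [M.rep, M.rep, M.m_mul, M.m_mul, map_one, mul_one, X₁.γ_rep])

theorem d_mem_eq (a : A₁) (b : A₂) :
    (⟨X.d (M.τ (a ⊗ₜ b)), X.d_mem _⟩ : X.Omega) =
      X.omegaRight (M.τ (1 ⊗ₜ b)) (M.omegaFst ⟨X₁.d a, X₁.d_mem a⟩) +
        X.omegaRight (M.τ (a ⊗ₜ 1)) (M.omegaSnd ⟨X₂.d b, X₂.d_mem b⟩) :=
  Subtype.ext (by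
    change X.d _ = M.m (X₁.d a) 1 * X.rep _ + M.m X₁.γ (X₂.d b) * X.rep _
    rw [M.rep, M.rep, M.m_mul, M.m_mul, map_one, map_one, mul_one, mul_one, one_mul, M.d])

end TensorN1

/-- The properties of the tensor product `X` of the Hermitian modules `X₁` and `X₂`. -/
structure TensorHermitian (X₁ : HermitianData A₁ H₁) (X₂ : HermitianData A₂ H₂)
    (X : HermitianData A H) extends TensorN1 X₁.toN1Data X₂.toN1Data X.toN1Data where
  /-- The identification of the module with the tensor product. -/
  ε : X₁.E ⊗[ℂ] X₂.E ≃ₗ[ℂ] X.E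
  coe_ε : ∀ x y, (ε (x ⊗ₜ y) : H) = t (x : H₁) (y : H₂)
  J_tmul : ∀ x y, X.J (t x y) = t (X₁.J x) (X₂.twistJ X₁.ko y)
  herm_tmul : ∀ x x' y y', X.herm (ε (x ⊗ₜ y)) (ε (x' ⊗ₜ y')) =
    τ (X₁.herm x x' ⊗ₜ X₂.herm y y')

/-- The tensor product of Hermitian modules is a tensor product. -/
def TensorModule.tensorHermitian {X₁ : HermitianData A₁ H₁} {X₂ : HermitianData A₂ H₂}
    {X : RealN1Data A H} (M : TensorModule X₁ X₂ X) : TensorHermitian X₁ X₂ M.hermitian where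
  toTensorN1 := M.toTensorN1
  ε := M.ε
  coe_ε := M.coe_ε
  J_tmul := M.J
  herm_tmul x x' y y' := M.herm_tmul x x' y y'

theorem HermitianData.left_add {X : HermitianData A H} (a b : A) (ξ : X.E) :
    X.left (a + b) ξ = X.left a ξ + X.left b ξ :=
  Subtype.ext (by
    change X.rep (a + b) (ξ : H) = X.rep a (ξ : H) + X.rep b (ξ : H)
    rw [map_add]
    rfl)

theorem HermitianData.pairing_add {X : HermitianData A H} (η η' : X.E) (s : X.OmegaE) :
    X.pairing (η + η') s = X.pairing η s + X.pairing η' s := by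
  induction s using nctensor_induction with
  | add s s' h h' => simp only [map_add, h, h']; abel
  | tmul ω ξ =>
    change (ω : H →L[ℂ] H) * X.rep (X.herm ξ (η + η')) = ω * X.rep (X.herm ξ η) +
      ω * X.rep (X.herm ξ η')
    rw [map_add, map_add, mul_add]

namespace TensorHermitian

variable {X₁ : ExtInput A₁ H₁} {X₂ : ExtInput A₂ H₂} {X : HermitianData A H}
  (M : TensorHermitian X₁.toHermitianData X₂.toHermitianData X)

theorem E_induction {p : X.E → Prop} (ξ : X.E) (tmul : ∀ x y, p (M.ε (x ⊗ₜ y)))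
    (add : ∀ ξ η, p ξ → p η → p (ξ + η)) : p ξ := by
  obtain ⟨t, rfl⟩ := M.ε.surjective ξ
  induction t using TensorProduct.induction_on with
  | zero => simpa using tmul 0 0
  | tmul x y => exact tmul x y
  | add a b ha hb => rw [map_add]; exact add _ _ ha hb

theorem left_tmul (a : A₁) (b : A₂) (x : X₁.E) (y : X₂.E) :
    X.left (M.τ (a ⊗ₜ b)) (M.ε (x ⊗ₜ y)) = M.ε (X₁.left a x ⊗ₜ X₂.left b y) :=
  Subtype.ext (by
    change X.rep _ (M.ε (x ⊗ₜ y) : H) = _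
    rw [M.coe_ε, M.coe_ε, M.rep_t]
    rfl)

theorem γE_tmul (x : X₁.E) (y : X₂.E) :
    X.γE (M.ε (x ⊗ₜ y)) = M.ε (X₁.γE x ⊗ₜ X₂.γE y) :=
  Subtype.ext (by
    change X.γ (M.ε (x ⊗ₜ y) : H) = _
    rw [M.coe_ε, M.coe_ε, M.γ_t]
    rfl)

theorem left_tmul_one (a : A₁) (x : X₁.E) (y : X₂.E) :
    X.left (M.τ (a ⊗ₜ 1)) (M.ε (x ⊗ₜ y)) = M.ε (X₁.left a x ⊗ₜ y) := by
  have : X₂.left 1 y = y := Subtype.ext (by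
    change X₂.rep 1 (y : H₂) = y
    rw [map_one]
    rfl)
  rw [left_tmul, this]

theorem left_one_tmul (b : A₂) (x : X₁.E) (y : X₂.E) :
    X.left (M.τ (1 ⊗ₜ b)) (M.ε (x ⊗ₜ y)) = M.ε (x ⊗ₜ X₂.left b y) := by
  have : X₁.left 1 x = x := Subtype.ext (by
    change X₁.rep 1 (x : H₁) = x
    rw [map_one]
    rfl)
  rw [left_tmul, this]

/-- The map `(ω ⊗ ξ, y) ↦ (ω ⊗ 1) ⊗ (ξ ⊗ y)`. -/
def nablaFst : X₁.OmegaE →ₗ[ℂ] X₂.E →ₗ[ℂ] X.OmegaE :=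
  nclift (LinearMap.mk₂ ℂ
    (fun (ω : X₁.Omega) (ξ : X₁.E) => (ncmk X.omegaRight X.left
      (M.omegaFst ω)).comp (M.ε.toLinearMap.comp (TensorProduct.mk ℂ _ _ ξ)))
    (fun _ _ _ => by rw [map_add, map_add, LinearMap.add_comp])
    (fun _ _ _ => by rw [map_smul, map_smul, LinearMap.smul_comp])
    (fun _ _ _ => by rw [map_add, LinearMap.comp_add, LinearMap.comp_add])
    (fun _ _ _ => by rw [map_smul, LinearMap.comp_smul, LinearMap.comp_smul]))
    (fun a ω ξ => LinearMap.ext fun y => by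
      change nctmul X.omegaRight X.left (M.omegaFst _) (M.ε (ξ ⊗ₜ y)) =
        nctmul X.omegaRight X.left (M.omegaFst ω) (M.ε (X₁.left a ξ ⊗ₜ y))
      rw [M.omegaFst_right, ← M.left_tmul_one]
      exact nctmul_balanced _ _ _)

theorem nablaFst_nctmul (ω : X₁.Omega) (ξ : X₁.E) (y : X₂.E) :
    M.nablaFst (nctmul X₁.omegaRight X₁.left ω ξ) y =
      nctmul X.omegaRight X.left (M.omegaFst ω) (M.ε (ξ ⊗ₜ y)) := rfl

/-- The map `(ω ⊗ η, x) ↦ (γ ⊗ ω) ⊗ (x ⊗ η)`. -/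
def nablaSnd : X₂.OmegaE →ₗ[ℂ] X₁.E →ₗ[ℂ] X.OmegaE :=
  nclift (LinearMap.mk₂ ℂ
    (fun (ω : X₂.Omega) (η : X₂.E) => (ncmk X.omegaRight X.left
      (M.omegaSnd ω)).comp (M.ε.toLinearMap.comp ((TensorProduct.mk ℂ X₁.E X₂.E).flip η)))
    (fun _ _ _ => by rw [map_add, map_add, LinearMap.add_comp])
    (fun _ _ _ => by rw [map_smul, map_smul, LinearMap.smul_comp])
    (fun _ _ _ => by rw [map_add, LinearMap.comp_add, LinearMap.comp_add])
    (fun _ _ _ => by rw [map_smul, LinearMap.comp_smul, LinearMap.comp_smul]))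
    (fun a ω η => LinearMap.ext fun x => by
      change nctmul X.omegaRight X.left (M.omegaSnd _) (M.ε (x ⊗ₜ η)) =
        nctmul X.omegaRight X.left (M.omegaSnd ω) (M.ε (x ⊗ₜ X₂.left a η))
      rw [M.omegaSnd_right, ← M.left_one_tmul]
      exact nctmul_balanced _ _ _)

theorem nablaSnd_nctmul (ω : X₂.Omega) (x : X₁.E) (η : X₂.E) :
    M.nablaSnd (nctmul X₂.omegaRight X₂.left ω η) x =
      nctmul X.omegaRight X.left (M.omegaSnd ω) (M.ε (x ⊗ₜ η)) := rfl

/-- The product connection. -/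
def nabla : X.E →ₗ[ℂ] X.OmegaE :=
  (TensorProduct.lift (M.nablaFst ∘ₗ X₁.nabla + (M.nablaSnd ∘ₗ X₂.nabla).flip)).comp
    M.ε.symm.toLinearMap

theorem nabla_tmul (x : X₁.E) (y : X₂.E) :
    M.nabla (M.ε (x ⊗ₜ y)) = M.nablaFst (X₁.nabla x) y + M.nablaSnd (X₂.nabla y) x := by
  rw [nabla, LinearMap.comp_apply, LinearEquiv.coe_coe, LinearEquiv.symm_apply_apply]
  rfl

theorem nablaFst_left (a : A₁) (b : A₂) (s : X₁.OmegaE) (y : X₂.E) :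
    M.nablaFst (X₁.oeLeft a s) (X₂.left b y) =
      X.oeLeft (M.τ (a ⊗ₜ b)) (M.nablaFst s y) := by
  induction s using nctensor_induction with
  | add s s' h h' => simp only [map_add, LinearMap.add_apply, h, h']
  | tmul ω ξ =>
    change nctmul X.omegaRight X.left (M.omegaFst (X₁.omegaLeft a ω))
      (M.ε (ξ ⊗ₜ X₂.left b y)) = nctmul X.omegaRight X.left
        (X.omegaLeft (M.τ (a ⊗ₜ b)) (M.omegaFst ω)) (M.ε (ξ ⊗ₜ y))
    rw [M.omegaFst_left, ← M.left_one_tmul]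
    exact (nctmul_balanced _ _ _).symm

theorem nablaSnd_left (a : A₁) (b : A₂) (s : X₂.OmegaE) (x : X₁.E) :
    M.nablaSnd (X₂.oeLeft b s) (X₁.left a x) =
      X.oeLeft (M.τ (a ⊗ₜ b)) (M.nablaSnd s x) := by
  induction s using nctensor_induction with
  | add s s' h h' => simp only [map_add, LinearMap.add_apply, h, h']
  | tmul ω η =>
    change nctmul X.omegaRight X.left (M.omegaSnd (X₂.omegaLeft b ω))
      (M.ε (X₁.left a x ⊗ₜ η)) = nctmul X.omegaRight X.left
        (X.omegaLeft (M.τ (a ⊗ₜ b)) (M.omegaSnd ω)) (M.ε (x ⊗ₜ η))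
    rw [M.omegaSnd_left, ← M.left_tmul_one]
    exact (nctmul_balanced _ _ _).symm

/-- The two summands of `d(a ⊗ b) = da ⊗ b + γ₁ a ⊗ db` are the Leibniz terms of the two factors,
once the undifferentiated element is moved across `⊗_A`. -/
theorem leibniz (a : A) (ξ : X.E) : M.nabla (X.left a ξ) =
    X.oeLeft a (M.nabla ξ) + nctmul X.omegaRight X.left
      (⟨X.d a, X.d_mem a⟩ : X.Omega) ξ := by
  induction a using M.A_induction with
  | add a b ha hb =>
    have h1 : X.oeLeft (a + b) (M.nabla ξ) =
        X.oeLeft a (M.nabla ξ) + X.oeLeft b (M.nabla ξ) := by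
      induction M.nabla ξ using nctensor_induction with
      | add s s' h h' => simp only [map_add, h, h']; abel
      | tmul ω η =>
        have : X.omegaLeft (a + b) ω = X.omegaLeft a ω + X.omegaLeft b ω := Subtype.ext (by
          change X.rep (a + b) * (ω : H →L[ℂ] H) = X.rep a * ω + X.rep b * ω
          rw [map_add, add_mul])
        change nctmul X.omegaRight X.left (X.omegaLeft (a + b) ω) η = _
        rw [this, nctmul_add_left]
        rfl
    have h2 : (⟨X.d (a + b), X.d_mem (a + b)⟩ : X.Omega) =
        ⟨X.d a, X.d_mem a⟩ + ⟨X.d b, X.d_mem b⟩ := Subtype.ext (X.d_add a b)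
    rw [HermitianData.left_add, map_add, ha, hb, h1, h2, nctmul_add_left]
    abel
  | tmul a b =>
    induction ξ using M.E_induction with
    | add ξ ξ' h h' => simp only [map_add, h, h', nctmul_add_right]; abel
    | tmul x y =>
      rw [M.left_tmul, M.nabla_tmul, M.nabla_tmul, X₁.leibniz, X₂.leibniz, M.d_mem_eq, map_add,
        map_add, map_add, LinearMap.add_apply, LinearMap.add_apply, M.nablaFst_left,
        M.nablaSnd_left, nablaFst_nctmul, nablaSnd_nctmul, nctmul_add_left, nctmul_balanced,
        nctmul_balanced, M.left_tmul_one, M.left_one_tmul]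
      abel


theorem pairing_nablaFst (x' : X₁.E) (y y' : X₂.E) (s : X₁.OmegaE) :
    X.pairing (M.ε (x' ⊗ₜ y')) (M.nablaFst s y) =
      M.m (X₁.pairing x' s) (X₂.rep (X₂.herm y y')) := by
  induction s using nctensor_induction with
  | add s s' h h' => simp only [map_add, LinearMap.add_apply, h, h']
  | tmul ω ξ =>
    change M.m ω 1 * X.rep (X.herm (M.ε (ξ ⊗ₜ y)) (M.ε (x' ⊗ₜ y'))) =
      M.m (ω * X₁.rep (X₁.herm ξ x')) _
    rw [M.herm_tmul, M.rep, M.m_mul, one_mul]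

theorem pairing_nablaSnd (x x' : X₁.E) (y' : X₂.E) (s : X₂.OmegaE) :
    X.pairing (M.ε (x' ⊗ₜ y')) (M.nablaSnd s x) =
      M.m (X₁.γ * X₁.rep (X₁.herm x x')) (X₂.pairing y' s) := by
  induction s using nctensor_induction with
  | add s s' h h' => simp only [map_add, LinearMap.add_apply, h, h']
  | tmul ω η =>
    change M.m X₁.γ ω * X.rep (X.herm (M.ε (x ⊗ₜ η)) (M.ε (x' ⊗ₜ y'))) =
      M.m _ (ω * X₂.rep (X₂.herm η y'))
    rw [M.herm_tmul, M.rep, M.m_mul]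

/-- The parts with `ω₁ ⊗ 1` and with `γ₁ ⊗ ω₂` separately reproduce the compatibility of one factor.
In the second part `γ₁` is self-adjoint and commutes with `A₁`, so it survives the adjoint
unchanged. -/
theorem compatible (ξ η : X.E) : X.pairing η (M.nabla ξ) -
    star (X.pairing ξ (M.nabla η)) = X.d (X.herm ξ η) := by
  induction ξ using M.E_induction with
  | add ξ ξ' h h' =>
    rw [map_add, map_add, map_add, LinearMap.add_apply, X.d_add, ← h, ← h',
      HermitianData.pairing_add, star_add]
    abel
  | tmul x y =>
    induction η using M.E_induction with
    | add η η' h h' =>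
      rw [map_add, map_add, map_add, star_add, X.d_add, ← h, ← h',
        HermitianData.pairing_add]
      abel
    | tmul x' y' =>
      rw [M.nabla_tmul, M.nabla_tmul, map_add, map_add, pairing_nablaFst, pairing_nablaSnd,
        pairing_nablaFst, pairing_nablaSnd, M.herm_tmul, M.d, ← X₁.compatible, ← X₂.compatible,
        star_add, M.star_m, M.star_m, star_mul, ← map_star X₁.rep, ← map_star X₂.rep, X₁.herm_symm,
        X₂.herm_symm, X₁.grading.selfAdjoint.star_eq, ← X₁.γ_rep, map_sub, map_sub,
        LinearMap.sub_apply]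
      abel

theorem nabla_γ (ξ : X.E) : M.nabla (X.γE ξ) = X.oeγ (M.nabla ξ) := by
  induction ξ using M.E_induction with
  | add ξ ξ' h h' => rw [map_add, map_add, map_add, map_add, h, h']
  | tmul x y =>
    have h1 : ∀ s : X₁.OmegaE, M.nablaFst (X₁.oeγ s) (X₂.γE y) =
        X.oeγ (M.nablaFst s y) := fun s => by
      induction s using nctensor_induction with
      | add s s' h h' => simp only [map_add, LinearMap.add_apply, h, h']
      | tmul ω ξ =>
        change nctmul _ _ (M.omegaFst ω) (M.ε (X₁.γE ξ ⊗ₜ X₂.γE y)) =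
          nctmul X.omegaRight X.left (M.omegaFst ω)
            (X.γE (M.ε (ξ ⊗ₜ y)))
        rw [M.γE_tmul]
    have h2 : ∀ s : X₂.OmegaE, M.nablaSnd (X₂.oeγ s) (X₁.γE x) =
        X.oeγ (M.nablaSnd s x) := fun s => by
      induction s using nctensor_induction with
      | add s s' h h' => simp only [map_add, LinearMap.add_apply, h, h']
      | tmul ω η =>
        change nctmul _ _ (M.omegaSnd ω) (M.ε (X₁.γE x ⊗ₜ X₂.γE η)) =
          nctmul X.omegaRight X.left (M.omegaSnd ω)
            (X.γE (M.ε (x ⊗ₜ η)))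
        rw [M.γE_tmul]
    rw [M.γE_tmul, M.nabla_tmul, M.nabla_tmul, X₁.nabla_γ, X₂.nabla_γ, h1, h2, map_add]

/-- The tensor product of the inputs of the extension procedure. -/
def extInput : ExtInput A H where
  toHermitianData := X
  nabla := M.nabla
  leibniz := M.leibniz
  compatible := M.compatible
  nabla_γ := M.nabla_γ

end TensorHermitian

end ProductConnection

end SpectralData

namespace SpectralData

/-! ### Existence and structure of the Kasparov product -/

section Kasparov

variable {A₁ A₂ A H₁ H₂ H : Type u}
  [Ring A₁] [StarRing A₁] [Algebra ℂ A₁] [StarModule ℂ A₁]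
  [NormedAddCommGroup H₁] [InnerProductSpace ℂ H₁] [CompleteSpace H₁]
  [Ring A₂] [StarRing A₂] [Algebra ℂ A₂] [StarModule ℂ A₂]
  [NormedAddCommGroup H₂] [InnerProductSpace ℂ H₂] [CompleteSpace H₂]
  [Ring A] [StarRing A] [Algebra ℂ A] [StarModule ℂ A]
  [NormedAddCommGroup H] [InnerProductSpace ℂ H] [CompleteSpace H]

namespace TensorHermitian

variable {X₁ : ExtInput A₁ H₁} {X₂ : ExtInput A₂ H₂}

theorem nabla_eq_sum {X : HermitianData A H}
    (M : TensorHermitian X₁.toHermitianData X₂.toHermitianData X) {x : X₁.E} {y : X₂.E} {m n : ℕ}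
    {ω : Fin m → X₁.Omega} {ξ : Fin m → X₁.E} {ω' : Fin n → X₂.Omega} {η : Fin n → X₂.E}
    (h₁ : X₁.nabla x = ∑ i, nctmul _ _ (ω i) (ξ i))
    (h₂ : X₂.nabla y = ∑ j, nctmul _ _ (ω' j) (η j)) :
    M.nabla (M.ε (x ⊗ₜ y)) = ∑ i, nctmul _ _ (M.omegaFst (ω i)) (M.ε (ξ i ⊗ₜ y)) +
      ∑ j, nctmul _ _ (M.omegaSnd (ω' j)) (M.ε (x ⊗ₜ η j)) := by
  rw [M.nabla_tmul, h₁, h₂, map_sum, map_sum, LinearMap.sum_apply, LinearMap.sum_apply]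
  rfl

theorem coe_twist (k : Fin 4) (X : HermitianData A H) (y : X.E) :
    (X.JE (twist k X y) : H) = X.twistJ k (y : H) := by
  rw [X.twistJ_apply]
  unfold twist
  split_ifs <;> rfl

/-- A tensor product of Hermitian modules with the product connection is decomposed. -/
def decomposition {X : ExtInput A H}
    (M : TensorHermitian X₁.toHermitianData X₂.toHermitianData X.toHermitianData)
    (hnabla : ∀ x y, ∀ (m n : ℕ) (ω : Fin m → X₁.Omega) (ξ : Fin m → X₁.E) (ω' : Fin n → X₂.Omega)
      (η : Fin n → X₂.E),
      X₁.nabla x = ∑ i, nctmul _ _ (ω i) (ξ i) → X₂.nabla y = ∑ j, nctmul _ _ (ω' j) (η j) →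
      X.nabla (M.ε (x ⊗ₜ y)) = ∑ i, nctmul _ _ (M.omegaFst (ω i)) (M.ε (ξ i ⊗ₜ y)) +
        ∑ j, nctmul _ _ (M.omegaSnd (ω' j)) (M.ε (x ⊗ₜ η j))) : TensorDecomposition X₁ X₂ X where
  τ := M.τ.toLinearMap
  ε := M.ε
  τ_surjective := M.τ.surjective
  left := M.left_tmul
  star_τ := M.τ_star
  JE x y := Subtype.ext (by
    change X.J (M.ε (x ⊗ₜ y) : H) = _
    rw [M.coe_ε, M.coe_ε, M.J_tmul, coe_twist]
    rfl)
  γE := M.γE_tmul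
  herm x y x' y' := M.herm_tmul x x' y y'
  inner x y x' y' := by rw [M.coe_ε, M.coe_ε, M.inner]
  nabla x y m n ω ξ ω' η h₁ h₂ := by
    refine ⟨fun i => M.omegaFst (ω i), fun j => M.omegaSnd (ω' j), fun i x y => ⟨?_, ?_⟩,
      fun j x y => ⟨?_, ?_⟩, hnabla x y m n ω ξ ω' η h₁ h₂⟩
    · apply Subtype.ext
      change M.m (ω i) 1 (M.ε (x ⊗ₜ y) : H) = _
      rw [M.coe_ε, M.coe_ε, M.m_t]
      rfl
    · apply Subtype.ext
      change star (M.m (ω i) 1) (M.ε (x ⊗ₜ y) : H) = _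
      rw [M.coe_ε, M.coe_ε, M.star_m, M.m_t, star_one]
      rfl
    · apply Subtype.ext
      change M.m X₁.γ (ω' j) (M.ε (x ⊗ₜ y) : H) = _
      rw [M.coe_ε, M.coe_ε, M.m_t]
      rfl
    · apply Subtype.ext
      change star (M.m X₁.γ (ω' j)) (M.ε (x ⊗ₜ y) : H) = _
      rw [M.coe_ε, M.coe_ε, M.star_m, M.m_t, X₁.grading.selfAdjoint.star_eq]
      rfl

end TensorHermitian

variable (X₁ : ExtInput A₁ H₁) (X₂ : ExtInput A₂ H₂)

/-- The tensor product of real spectral data. -/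
def prodReal : RealN1Data (A₁ ⊗[ℂ] A₂) (HTensor H₁ H₂) :=
  (tensorN1 (X := prodN1 X₁.toN1Data X₂.toN1Data) (fun _ _ => rfl) rfl rfl).real
    (X₁ := X₁.toRealN1Data) (X₂ := X₂.toRealN1Data)
    (htJ X₁.J (X₂.twistJ X₁.ko)) (htJ_htmul X₁.J (X₂.twistJ X₁.ko))
    (htJ_mem_tensorSum X₁.toRealN1Data X₂.toRealN1Data)

/-- The tensor product of the modules `E₁` and `E₂`. -/
def prodModule : TensorModule X₁.toHermitianData X₂.toHermitianData (prodReal X₁ X₂) where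
  toTensorN1 := tensorN1 (X := prodN1 X₁.toN1Data X₂.toN1Data) (fun _ _ => rfl) rfl rfl
  E := Submodule.span ℂ {z | ∃ x ∈ X₁.E, ∃ y ∈ X₂.E, z = htmul x y}
  ε := (tensorN1 (X := prodN1 X₁.toN1Data X₂.toN1Data)
    (fun _ _ => rfl) rfl rfl).moduleEquiv X₁.E X₂.E rfl
  coe_ε _ _ := rfl
  J := htJ_htmul X₁.J (X₂.twistJ X₁.ko)

/-- The Kasparov product exists. -/
theorem exists_isProduct :
    ∃ X : ExtInput (A₁ ⊗[ℂ] A₂) (HTensor H₁ H₂), IsProduct X₁ X₂ X := by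
  let M := (prodModule X₁ X₂).tensorHermitian
  have hε : ∀ (x : X₁.E) (y : X₂.E) (e : (prodModule X₁ X₂).hermitian.E),
      (e : HTensor H₁ H₂) = htmul (x : H₁) (y : H₂) → e = M.ε (x ⊗ₜ y) :=
    fun x y e he => Subtype.ext (he.trans (M.coe_ε x y).symm)
  refine ⟨M.extInput, ?_⟩
  constructor
  · exact fun _ _ => rfl
  · rfl
  · rfl
  · rfl
  · exact fun x y => (htJ_htmul X₁.J (X₂.twistJ X₁.ko) x y).trans
      (congrArg _ (X₂.twistJ_apply X₁.ko y))
  · rfl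
  · intro x x' y y' e e' he he'
    rw [hε x y e he, hε x' y' e' he']
    exact M.herm_tmul x x' y y'
  · intro x y e he m n ω ξ ω' η h₁ h₂
    refine ⟨fun i => M.omegaFst (ω i), fun j => M.omegaSnd (ω' j), fun i => M.ε (ξ i ⊗ₜ y),
      fun j => M.ε (x ⊗ₜ η j), fun i => ⟨rfl, M.coe_ε _ _⟩, fun j => ⟨rfl, M.coe_ε _ _⟩, ?_⟩
    rw [hε x y e he]
    exact M.nabla_eq_sum h₁ h₂

end Kasparov

/-! ### Every Kasparov product decomposes as a tensor product -/

section IsProduct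

variable {A₁ A₂ H₁ H₂ : Type u}
  [Ring A₁] [StarRing A₁] [Algebra ℂ A₁] [StarModule ℂ A₁]
  [NormedAddCommGroup H₁] [InnerProductSpace ℂ H₁] [CompleteSpace H₁]
  [Ring A₂] [StarRing A₂] [Algebra ℂ A₂] [StarModule ℂ A₂]
  [NormedAddCommGroup H₂] [InnerProductSpace ℂ H₂] [CompleteSpace H₂]
  {X₁ : ExtInput A₁ H₁} {X₂ : ExtInput A₂ H₂} {X : ExtInput (A₁ ⊗[ℂ] A₂) (HTensor H₁ H₂)}

/-- The module of a Kasparov product is the tensor product of the modules. -/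
def IsProduct.tensorHermitian (h : IsProduct X₁ X₂ X) :
    TensorHermitian X₁.toHermitianData X₂.toHermitianData X.toHermitianData where
  toTensorN1 := tensorN1 h.rep h.D h.γ
  ε := (tensorN1 h.rep h.D h.γ).moduleEquiv X₁.E X₂.E h.E
  coe_ε _ _ := rfl
  J_tmul x y := (h.J x y).trans (congrArg _ (X₂.twistJ_apply X₁.ko y).symm)
  herm_tmul x x' y y' := h.herm x x' y y' _ _ rfl rfl

/-- The decomposition of a Kasparov product. -/
def IsProduct.decomposition (h : IsProduct X₁ X₂ X) : TensorDecomposition X₁ X₂ X :=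
  h.tensorHermitian.decomposition fun x y m n ω ξ ω' η h₁ h₂ => by
    obtain ⟨w, w', u, v, hw, hw', hn⟩ := h.nabla x y _ (h.tensorHermitian.coe_ε x y) m n ω ξ ω' η
      h₁ h₂
    have e1 : ∀ i, w i = h.tensorHermitian.omegaFst (ω i) := fun i => Subtype.ext (hw i).1
    have e2 : ∀ i, u i = h.tensorHermitian.ε (ξ i ⊗ₜ y) := fun i =>
      Subtype.ext ((hw i).2.trans (h.tensorHermitian.coe_ε _ _).symm)
    have e3 : ∀ j, w' j = h.tensorHermitian.omegaSnd (ω' j) := fun j => Subtype.ext (hw' j).1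
    have e4 : ∀ j, v j = h.tensorHermitian.ε (x ⊗ₜ η j) := fun j =>
      Subtype.ext ((hw' j).2.trans (h.tensorHermitian.coe_ε _ _).symm)
    rw [hn]
    exact congrArg₂ _ (Finset.sum_congr rfl fun i _ => congrArg₂ _ (e1 i) (e2 i))
      (Finset.sum_congr rfl fun j _ => congrArg₂ _ (e3 j) (e4 j))

end IsProduct

end SpectralData

namespace SpectralData

/-! ### `Φ` of a Kasparov product -/

section Multiplicativity

variable {A₁ A₂ A H₁ H₂ H : Type u}
  [Ring A₁] [StarRing A₁] [Algebra ℂ A₁] [StarModule ℂ A₁]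
  [NormedAddCommGroup H₁] [InnerProductSpace ℂ H₁] [CompleteSpace H₁]
  [Ring A₂] [StarRing A₂] [Algebra ℂ A₂] [StarModule ℂ A₂]
  [NormedAddCommGroup H₂] [InnerProductSpace ℂ H₂] [CompleteSpace H₂]
  [Ring A] [StarRing A] [Algebra ℂ A] [StarModule ℂ A]
  [NormedAddCommGroup H] [InnerProductSpace ℂ H] [CompleteSpace H]
  {X₁ : ExtInput A₁ H₁} {X₂ : ExtInput A₂ H₂} {X : ExtInput A H}

theorem HermitianData.eeLeft_add {A H : Type u} [Ring A] [StarRing A] [Algebra ℂ A]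
    [StarModule ℂ A] [NormedAddCommGroup H] [InnerProductSpace ℂ H] [CompleteSpace H]
    (X : HermitianData A H) (a b : A) (z : X.EE) :
    X.eeLeft (a + b) z = X.eeLeft a z + X.eeLeft b z := by
  induction z using nctensor_induction with
  | tmul ξ η =>
    change nctmul X.right X.left (X.left (a + b) ξ) η =
      nctmul X.right X.left (X.left a ξ) η + nctmul X.right X.left (X.left b ξ) η
    rw [X.left_add, nctmul_add_left]
  | add z w hz hw => rw [map_add, map_add, map_add, hz, hw]; abel

theorem HermitianData.eeLeft_zero {A H : Type u} [Ring A] [StarRing A] [Algebra ℂ A]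
    [StarModule ℂ A] [NormedAddCommGroup H] [InnerProductSpace ℂ H] [CompleteSpace H]
    (X : HermitianData A H) (z : X.EE) : X.eeLeft 0 z = 0 := by
  simpa using X.eeLeft_add 0 0 z

namespace TensorDecomposition

variable (d : TensorDecomposition X₁ X₂ X)

theorem toHTensor_map {T : X.EE →ₗ[ℂ] X.EE} {T₁ : X₁.EE →ₗ[ℂ] X₁.EE} {T₂ : X₂.EE →ₗ[ℂ] X₂.EE}
    (hT : ∀ z, d.swap (T z) = TensorProduct.map T₁ T₂ (d.swap z))
    {S₁ : X₁.HTilde →L[ℂ] X₁.HTilde} {S₂ : X₂.HTilde →L[ℂ] X₂.HTilde}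
    (h₁ : ∀ z, S₁ (X₁.incl z) = X₁.incl (T₁ z)) (h₂ : ∀ z, S₂ (X₂.incl z) = X₂.incl (T₂ z))
    (z : X.EE) : hmap S₁ S₂ (d.toHTensor z) = d.toHTensor (T z) := by
  induction z using d.EE_induction with
  | add z w hz hw => rw [map_add, map_add, map_add, map_add, hz, hw]
  | tmul x y x' y' =>
    have h3 := hT (nctmul X.right X.left (d.ε (x ⊗ₜ y)) (d.ε (x' ⊗ₜ y')))
    rw [d.swap_nctmul, TensorProduct.map_tmul] at h3
    rw [d.toHTensor_of_swap h3, d.toHTensor_of_swap (d.swap_nctmul x x' y y'), hmap_htmul, h₁, h₂]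

/-- Every pair of elements of `E₁ ⊗ E₁` and `E₂ ⊗ E₂` comes from an element of `E ⊗ E`, and
conversely such elements are sums of these. The two relations therefore agree before any closure is
taken. -/
theorem span_sumGens_preGraph {T : X.EE →ₗ[ℂ] X.EE} {T₁ Γ₁ : X₁.EE →ₗ[ℂ] X₁.EE}
    {T₂ Γ₂ : X₂.EE →ₗ[ℂ] X₂.EE}
    (hT : ∀ z, d.swap (T z) = TensorProduct.map T₁ Γ₂ (d.swap z) +
      TensorProduct.map Γ₁ T₂ (d.swap z))
    {B₁ : X₁.HTilde →L[ℂ] X₁.HTilde} {B₂ : X₂.HTilde →L[ℂ] X₂.HTilde}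
    (h₁ : ∀ z, B₁ (X₁.incl z) = X₁.incl (Γ₁ z)) (h₂ : ∀ z, B₂ (X₂.incl z) = X₂.incl (Γ₂ z)) :
    Submodule.span ℂ (sumGens (htmulL X₁.HTilde X₂.HTilde) B₂ B₁ (X₁.preGraph T₁)
      (X₂.preGraph T₂)) = LinearMap.range (d.toHTensor.prod (d.toHTensor ∘ₗ T)) := by
  have key : ∀ {z : X.EE} {a : X₁.EE} {b : X₂.EE}, d.swap z = a ⊗ₜ b →
      (d.toHTensor.prod (d.toHTensor ∘ₗ T)) z = sumGen (htmulL X₁.HTilde X₂.HTilde) B₂ B₁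
        (X₁.incl a, X₁.incl (T₁ a)) (X₂.incl b, X₂.incl (T₂ b)) := by
    intro z a b hz
    refine Prod.ext (d.toHTensor_of_swap hz) ?_
    have h3 := hT z
    rw [hz, TensorProduct.map_tmul, TensorProduct.map_tmul] at h3
    have h4 : d.toHTensor (T z) = htincl X₁.HTilde X₂.HTilde
        (X₁.incl (T₁ a) ⊗ₜ X₂.incl (Γ₂ b)) + htincl X₁.HTilde X₂.HTilde
        (X₁.incl (Γ₁ a) ⊗ₜ X₂.incl (T₂ b)) := by
      rw [toHTensor, LinearMap.comp_apply, LinearMap.comp_apply, h3, map_add, map_add]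
      rfl
    refine h4.trans ?_
    rw [← h₁, ← h₂]
    rfl
  apply le_antisymm
  · rw [Submodule.span_le]
    rintro _ ⟨_, ⟨a, rfl⟩, _, ⟨b, rfl⟩, rfl⟩
    obtain ⟨z, hz⟩ := d.swap_surjective (a ⊗ₜ b)
    exact ⟨z, key hz⟩
  · rintro _ ⟨z, rfl⟩
    induction z using d.EE_induction with
    | add z w hz hw => rw [map_add]; exact add_mem hz hw
    | tmul x y x' y' =>
      rw [key (d.swap_nctmul x x' y y')]
      exact Submodule.subset_span ⟨_, ⟨_, rfl⟩, _, ⟨_, rfl⟩, rfl⟩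

end TensorDecomposition

/-- The tensor sum of the closed operators is generated by the cores `Eᵢ ⊗ Eᵢ`, so taking closures
before or after the product makes no difference. -/
theorem tensorSum_graph_preGraph {D₁ : X₁.EE →ₗ[ℂ] X₁.EE} {D₂ : X₂.EE →ₗ[ℂ] X₂.EE}
    {F₁ : X₁.HTilde →ₗ.[ℂ] X₁.HTilde} {F₂ : X₂.HTilde →ₗ.[ℂ] X₂.HTilde}
    (hF₁ : IsSelfAdjoint F₁) (hF₂ : IsSelfAdjoint F₂)
    (hg₁ : F₁.graph = (X₁.preGraph D₁).topologicalClosure)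
    (hg₂ : F₂.graph = (X₂.preGraph D₂).topologicalClosure)
    {B₁ : X₁.HTilde →L[ℂ] X₁.HTilde} {B₂ : X₂.HTilde →L[ℂ] X₂.HTilde}
    (hB₁ : IsGrading B₁) (hB₂ : IsGrading B₂) :
    (tensorSum F₁ B₂ B₁ F₂).graph = (Submodule.span ℂ
      (sumGens (htmulL X₁.HTilde X₂.HTilde) B₂ B₁ (X₁.preGraph D₁)
        (X₂.preGraph D₂))).topologicalClosure :=
  tensorSum_graph_core hB₁.inner_apply hB₂.inner_apply (isSymmGraph_of_isSelfAdjoint hF₁)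
    (isSymmGraph_of_isSelfAdjoint hF₂) hF₁.dense_domain hF₂.dense_domain
    (hg₁.trans (by rw [Submodule.span_eq])) (hg₂.trans (by rw [Submodule.span_eq]))

end Multiplicativity

section Product

variable {A₁ A₂ H₁ H₂ : Type u}
  [Ring A₁] [StarRing A₁] [Algebra ℂ A₁] [StarModule ℂ A₁]
  [NormedAddCommGroup H₁] [InnerProductSpace ℂ H₁] [CompleteSpace H₁]
  [Ring A₂] [StarRing A₂] [Algebra ℂ A₂] [StarModule ℂ A₂]
  [NormedAddCommGroup H₂] [InnerProductSpace ℂ H₂] [CompleteSpace H₂]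
  {X₁ : ExtInput A₁ H₁} {X₂ : ExtInput A₂ H₂} {X : ExtInput (A₁ ⊗[ℂ] A₂) (HTensor H₁ H₂)}

/-- `Φ` of a Kasparov product equals the standard product. -/
theorem IsProduct.phiEqProd_standard (h : IsProduct X₁ X₂ X) (h₁ : (Phi X₁).IsN11)
    (h₂ : (Phi X₂).IsN11) : PhiEqProd .standard X₁ X₂ X := by
  let d := h.decomposition
  obtain ⟨U, hU⟩ := exists_unitary X.toHermitianData d.toHTensor
    (d.inner_toHTensor (herm_γE h₂)) d.denseRange_toHTensor
  refine ⟨U, ?_, transports_of_isometry X hU ?_ ?_ ?_ ?_ ?_⟩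
  · intro ξ₁ η₁ ξ₂ η₂ ξ η hξ hη
    have e1 : ξ = d.ε (ξ₁ ⊗ₜ ξ₂) := Subtype.ext hξ
    have e2 : η = d.ε (η₁ ⊗ₜ η₂) := Subtype.ext hη
    rw [hU, e1, e2]
    exact d.toHTensor_of_swap (d.swap_nctmul _ _ _ _)
  · intro a z
    induction a using TensorProduct.induction_on with
    | zero => rw [map_zero, X.eeLeft_zero, map_zero]; rfl
    | add a b ha hb =>
      rw [map_add, X.eeLeft_add, map_add, ← ha, ← hb]; rfl
    | tmul a b =>
      exact d.toHTensor_map (d.swap_eeLeft a b) (Phi_rep_incl h₁ a) (Phi_rep_incl h₂ b) z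
  · refine (tensorSum_graph_preGraph h₁.selfAdjoint h₂.selfAdjoint (Phi_D_graph h₁)
      (Phi_D_graph h₂) h₁.hodge_grading isGrading_one).trans ?_
    rw [d.span_sumGens_preGraph d.swap_dirac (Phi_hodge_incl h₁) fun _ => rfl]
  · refine (tensorSum_graph_preGraph h₁.selfAdjoint_bar h₂.selfAdjoint_bar (Phi_Dbar_graph h₁)
      (Phi_Dbar_graph h₂) h₁.grading h₂.hodge_grading).trans ?_
    rw [d.span_sumGens_preGraph d.swap_diracBar (Phi_γ_incl h₁) (Phi_hodge_incl h₂)]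
  · exact d.toHTensor_map d.swap_eeγ (Phi_γ_incl h₁) (Phi_γ_incl h₂)
  · exact d.toHTensor_map d.swap_eeHodge (Phi_hodge_incl h₁) (Phi_hodge_incl h₂)

theorem PhiEqProd.isN11 (h : PhiEqProd .standard X₁ X₂ X) (h₁ : (Phi X₁).IsN11)
    (h₂ : (Phi X₂).IsN11) : (Phi X).IsN11 := by
  obtain ⟨U, -, hU⟩ := h
  exact hU.isN11 (h₁.prod h₂)

end Product

end SpectralData

namespace SpectralData

/-! ### The other product rules -/

section ZeroOperator

variable {H : Type*} [NormedAddCommGroup H] [InnerProductSpace ℂ H] [CompleteSpace H]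
  {D D' : H →ₗ.[ℂ] H} {C : H →L[ℂ] H}

theorem AntiCommutes.eq_zero (ha : AntiCommutes C D) (hc : Commutes C D) (hC : IsGrading C)
    {x y : H} (h : (x, y) ∈ D.graph) : y = 0 := by
  have h1 : C y = -C y := D.mem_graph_snd_inj' (hc x y h) (ha x y h) rfl
  have h2 : (2 : ℂ) • C y = 0 := by rw [two_smul]; nth_rewrite 1 [h1]; exact neg_add_cancel _
  rw [← hC.apply_apply y, (smul_eq_zero.mp h2).resolve_left two_ne_zero, map_zero]

/-- If `D'` vanishes, then `D² bᵢ = D'² bᵢ = 0`, so `‖D bᵢ‖² = 0`, and `⟪bᵢ, D x⟫ = ⟪D bᵢ, x⟫ = 0`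
for every `i`. -/
theorem eq_zero_of_sq_eq {ι : Type*} {b : HilbertBasis ι ℂ H} {κ : ι → ℝ}
    (hD : IsSelfAdjoint D) (hb : SquareDiagonal D b κ)
    (hb' : SquareDiagonal D' b κ) (h0 : ∀ x y, (x, y) ∈ D'.graph → y = 0) {x y : H}
    (h : (x, y) ∈ D.graph) : y = 0 := by
  refine hilbertBasis_ext b fun i => ?_
  obtain ⟨z, hz, hz'⟩ := hb' i
  obtain ⟨w, hw, hw'⟩ := hb i
  rw [h0 _ _ hz'] at hw'
  have h1 := isSymmGraph_of_isSelfAdjoint hD _ hw _ hw'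
  have h2 : w = 0 := by simpa using h1
  have h3 := isSymmGraph_of_isSelfAdjoint hD _ hw _ h
  rw [h2, inner_zero_left] at h3
  rw [inner_zero_right, ← h3]

end ZeroOperator

/-! ### Recovering the coefficients of a tensor sum -/

section TensorSum

variable {H₁ H₂ : Type*} [NormedAddCommGroup H₁] [InnerProductSpace ℂ H₁] [CompleteSpace H₁]
  [NormedAddCommGroup H₂] [InnerProductSpace ℂ H₂] [CompleteSpace H₂]
  {F₁ : H₁ →ₗ.[ℂ] H₁} {F₂ : H₂ →ₗ.[ℂ] H₂} {B₁ B₁' : H₁ →L[ℂ] H₁} {B₂ B₂' C : H₂ →L[ℂ] H₂}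

theorem eq_of_eq_on_domain {F : H₁ →ₗ.[ℂ] H₁} (hF : IsSelfAdjoint F)
    (h : ∀ x y, (x, y) ∈ F.graph → B₁ x = B₁' x) : B₁ = B₁' := by
  ext x
  refine congrFun (Continuous.ext_on hF.dense_domain B₁.continuous B₁'.continuous fun x hx => ?_) x
  obtain ⟨y, hy⟩ := LinearPMap.mem_domain_iff.mp hx
  exact h x y hy

/-- The operator `F₁ ⊗ B₂ + B₁ ⊗ F₂` determines `B₂` if `F₁ ≠ 0` and `B₁` if `F₂ ≠ 0`. -/
theorem eq_of_tensorSum_eq (hF₁ : IsSelfAdjoint F₁) (hF₂ : IsSelfAdjoint F₂)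
    (hB₁ : IsGrading B₁) (hB₂ : IsGrading B₂) (hB₁' : IsGrading B₁') (hB₂' : IsGrading B₂')
    (hC : IsGrading C) (hCF : AntiCommutes C F₂) (hCB : C * B₂ = B₂ * C)
    (hCB' : C * B₂' = B₂' * C)
    (h : (tensorSum F₁ B₂ B₁ F₂).graph = (tensorSum F₁ B₂' B₁' F₂).graph) :
    ((∃ x x', (x, x') ∈ F₁.graph ∧ x' ≠ 0) → B₂ = B₂') ∧
      ((∃ y y', (y, y') ∈ F₂.graph ∧ y' ≠ 0) → B₁ = B₁') := by
  have e : ∀ {x x' y y'}, (x, x') ∈ F₁.graph → (y, y') ∈ F₂.graph →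
      htmul x' (B₂ y) + htmul (B₁ x) y' = htmul x' (B₂' y) + htmul (B₁' x) y' := by
    intro x x' y y' hx hy
    have m := mem_tensorSum hB₁.inner_apply hB₂.inner_apply (isSymmGraph_of_isSelfAdjoint hF₁)
      (isSymmGraph_of_isSelfAdjoint hF₂) hF₁.dense_domain hF₂.dense_domain hx hy
    rw [h] at m
    exact LinearPMap.mem_graph_snd_inj' _ m (mem_tensorSum hB₁'.inner_apply hB₂'.inner_apply
      (isSymmGraph_of_isSelfAdjoint hF₁) (isSymmGraph_of_isSelfAdjoint hF₂) hF₁.dense_domain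
      hF₂.dense_domain hx hy) rfl
  have hc : ∀ y, B₂ (C y) = C (B₂ y) := fun y => (congrArg (fun T : H₂ →L[ℂ] H₂ => T y) hCB).symm
  have hc' : ∀ y, B₂' (C y) = C (B₂' y) :=
    fun y => (congrArg (fun T : H₂ →L[ℂ] H₂ => T y) hCB').symm
  -- Evaluating at `C y` and applying `1 ⊗ C` preserves the first term and changes the sign of the
  -- second, since `C` commutes with `B₂`, `B₂'` and anticommutes with `F₂`. Sum and difference of
  -- the two identities separate the terms.
  have key : ∀ {x x' y y'}, (x, x') ∈ F₁.graph → (y, y') ∈ F₂.graph →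
      htmul x' (B₂ y - B₂' y) = 0 ∧ htmul (B₁ x - B₁' x) y' = 0 := by
    intro x x' y y' hx hy
    have e1 := e hx hy
    have e2 := congrArg (hmap 1 C) (e hx (hCF y y' hy))
    have one : ∀ z : H₁, (1 : H₁ →L[ℂ] H₁) z = z := fun _ => rfl
    simp only [map_add, hmap_htmul, one, hc, hc', map_neg, hC.apply_apply,
      htmul_neg_right] at e2
    have l : ∀ (a : H₁) (p q : H₂), htmul a (p - q) = htmul a p - htmul a q := fun a p q => by
      rw [sub_eq_add_neg, htmul_add_right, htmul_neg_right, sub_eq_add_neg]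
    have r : ∀ (a b : H₁) (p : H₂), htmul (a - b) p = htmul a p - htmul b p := fun a b p => by
      rw [sub_eq_add_neg, htmul_add_left, htmul_neg_left, sub_eq_add_neg]
    rw [l, r]
    generalize htmul x' (B₂ y) = a at *
    generalize htmul x' (B₂' y) = b at *
    generalize htmul (B₁ x) y' = c at *
    generalize htmul (B₁' x) y' = d at *
    have h1 : (2 : ℂ) • (a - b) = 0 := by
      rw [two_smul]
      calc a - b + (a - b) = (a + c - (b + d)) + (a + -c - (b + -d)) := by abel
        _ = 0 := by rw [e1, e2]; abel
    have h2 : a - b = 0 := (smul_eq_zero.mp h1).resolve_left two_ne_zero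
    refine ⟨h2, ?_⟩
    calc c - d = (a + c - (b + d)) - (a - b) := by abel
      _ = 0 := by rw [e1, h2]; abel
  constructor
  · rintro ⟨x, x', hx, hne⟩
    exact eq_of_eq_on_domain hF₂ fun y y' hy =>
      sub_eq_zero.mp ((htmul_eq_zero (key hx hy).1).resolve_left hne)
  · rintro ⟨y, y', hy, hne⟩
    exact eq_of_eq_on_domain hF₁ fun x x' hx =>
      sub_eq_zero.mp ((htmul_eq_zero (key hx hy).2).resolve_right hne)

end TensorSum

/-! ### Exclusion of the other rules for nonzero operators -/

section Rules

variable {A₁ A₂ K₁ K₂ : Type u} [Ring A₁] [StarRing A₁] [Algebra ℂ A₁]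
  [Ring A₂] [StarRing A₂] [Algebra ℂ A₂]
  [NormedAddCommGroup K₁] [InnerProductSpace ℂ K₁] [CompleteSpace K₁]
  [NormedAddCommGroup K₂] [InnerProductSpace ℂ K₂] [CompleteSpace K₂]
  {S₁ : Sextuple A₁ K₁} {S₂ : Sextuple A₂ K₂}

theorem Sextuple.IsN11.Dbar_ne_zero (h₁ : S₁.IsN11)
    (h : ∃ x y, (x, y) ∈ S₁.D.graph ∧ y ≠ 0) : ∃ x y, (x, y) ∈ S₁.Dbar.graph ∧ y ≠ 0 := by
  by_contra! h0
  obtain ⟨x, y, hxy, hy⟩ := h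
  obtain ⟨ι, b, κ, hb, hb', -⟩ := h₁.exists_basis
  exact hy (eq_zero_of_sq_eq h₁.selfAdjoint hb hb' h0 hxy)

/-- For nonzero operators, only the standard rule gives the standard product. -/
theorem Sextuple.IsN11.eq_standard (h₁ : S₁.IsN11) (h₂ : S₂.IsN11)
    (n₁ : ∃ x y, (x, y) ∈ S₁.D.graph ∧ y ≠ 0) (n₂ : ∃ x y, (x, y) ∈ S₂.D.graph ∧ y ≠ 0)
    {k : ProductRule} (hD : (S₁.prodD S₂ .standard).graph = (S₁.prodD S₂ k).graph)
    (hDbar : (S₁.prodDbar S₂ .standard).graph = (S₁.prodDbar S₂ k).graph) : k = .standard := by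
  have n₁' := h₁.Dbar_ne_zero n₁
  have n₂' := h₂.Dbar_ne_zero n₂
  have g1 : S₂.γ * 1 = 1 * S₂.γ := by rw [mul_one, one_mul]
  cases k with
  | standard => rfl
  -- Comparing `𝔇̄` gives `⋆₂ = γ₂`, but `⋆₂` commutes and `γ₂` anticommutes with `𝔇̄₂ ≠ 0`.
  | rule1 =>
    have e := (eq_of_tensorSum_eq h₁.selfAdjoint_bar h₂.selfAdjoint_bar h₁.grading
      h₂.hodge_grading h₁.hodge_grading h₂.grading h₂.grading h₂.γ_Dbar h₂.hodge_γ.symm rfl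
      hDbar).1 n₁'
    obtain ⟨y, y', hy, hne⟩ := n₂'
    exact absurd (h₂.γ_Dbar.eq_zero (e ▸ h₂.hodge_Dbar) h₂.grading hy) hne
  -- For this rule and the next, comparing `𝔇` gives `1 = ⋆₂`, which contradicts that `⋆₂`
  -- anticommutes with `𝔇₂ ≠ 0`.
  | rule2 =>
    have e := (eq_of_tensorSum_eq h₁.selfAdjoint h₂.selfAdjoint h₁.hodge_grading isGrading_one
      isGrading_one h₂.hodge_grading h₂.grading h₂.γ_D g1 h₂.hodge_γ.symm hD).1 n₁
    obtain ⟨y, y', hy, hne⟩ := n₂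
    exact absurd (h₂.hodge_D.eq_zero (e ▸ fun _ _ h => h) h₂.hodge_grading hy) hne
  | rule3 =>
    have e := (eq_of_tensorSum_eq h₁.selfAdjoint h₂.selfAdjoint h₁.hodge_grading isGrading_one
      isGrading_one h₂.hodge_grading h₂.grading h₂.γ_D g1 h₂.hodge_γ.symm hD).1 n₁
    obtain ⟨y, y', hy, hne⟩ := n₂
    exact absurd (h₂.hodge_D.eq_zero (e ▸ fun _ _ h => h) h₂.hodge_grading hy) hne
  -- Comparing `𝔇` gives `⋆₁ = γ₁`; the former commutes and the latter anticommutes with `𝔇̄₁ ≠ 0`.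
  | rule4 =>
    have e := (eq_of_tensorSum_eq h₁.selfAdjoint h₂.selfAdjoint h₁.hodge_grading isGrading_one
      h₁.grading isGrading_one h₂.grading h₂.γ_D g1 g1 hD).2 n₂
    obtain ⟨x, x', hx, hne⟩ := n₁'
    exact absurd (h₁.γ_Dbar.eq_zero (e ▸ h₁.hodge_Dbar) h₁.grading hx) hne
  -- Comparing `𝔇` gives `1 = γ₂`, which contradicts that `γ₂` anticommutes with `𝔇₂ ≠ 0`.
  | rule5 =>
    have e := (eq_of_tensorSum_eq h₁.selfAdjoint h₂.selfAdjoint h₁.hodge_grading isGrading_one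
      isGrading_one h₂.grading h₂.grading h₂.γ_D g1 rfl hD).1 n₁
    obtain ⟨y, y', hy, hne⟩ := n₂
    exact absurd (h₂.γ_D.eq_zero (e ▸ fun _ _ h => h) h₂.grading hy) hne

end Rules

section Product

variable {A₁ A₂ H₁ H₂ : Type u}
  [Ring A₁] [StarRing A₁] [Algebra ℂ A₁] [StarModule ℂ A₁]
  [NormedAddCommGroup H₁] [InnerProductSpace ℂ H₁] [CompleteSpace H₁]
  [Ring A₂] [StarRing A₂] [Algebra ℂ A₂] [StarModule ℂ A₂]
  [NormedAddCommGroup H₂] [InnerProductSpace ℂ H₂] [CompleteSpace H₂]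
  {X₁ : ExtInput A₁ H₁} {X₂ : ExtInput A₂ H₂} {X : ExtInput (A₁ ⊗[ℂ] A₂) (HTensor H₁ H₂)}

/-- The condition fixes the unitary on a total set. Two rules that both hold therefore hold through
the same unitary, and their operators coincide. -/
theorem IsProduct.canonical_unique (h : IsProduct X₁ X₂ X)
    {U V : X.HTilde ≃ₗᵢ[ℂ] HTensor X₁.HTilde X₂.HTilde} (hU : IsCanonical X₁ X₂ X U)
    (hV : IsCanonical X₁ X₂ X V) (w : X.HTilde) : U w = V w := by
  refine congrFun (X.denseRange_incl.equalizer U.continuous V.continuous (funext fun z => ?_)) w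
  change U (X.incl z) = V (X.incl z)
  induction z using h.decomposition.EE_induction with
  | add z w hz hw => rw [map_add, map_add, map_add, hz, hw]
  | tmul x y x' y' => exact (hU x x' y y' _ _ rfl rfl).trans (hV x x' y y' _ _ rfl rfl).symm

theorem IsProduct.rule_eq_standard (h : IsProduct X₁ X₂ X) (h₁ : (Phi X₁).IsN11)
    (h₂ : (Phi X₂).IsN11) (n₁ : ∃ x y, (x, y) ∈ (Phi X₁).D.graph ∧ y ≠ 0)
    (n₂ : ∃ x y, (x, y) ∈ (Phi X₂).D.graph ∧ y ≠ 0) {k : ProductRule}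
    (hk : PhiEqProd k X₁ X₂ X) : k = .standard := by
  obtain ⟨U, hU, hUT⟩ := h.phiEqProd_standard h₁ h₂
  obtain ⟨V, hV, hVT⟩ := hk
  have hUV := h.canonical_unique hU hV
  refine h₁.eq_standard h₂ n₁ n₂ ?_ ?_
  · ext ⟨x, y⟩
    obtain ⟨x, rfl⟩ := U.surjective x
    obtain ⟨y, rfl⟩ := U.surjective y
    refine (hUT.D x y).symm.trans ?_
    rw [hUV, hUV]
    exact hVT.D x y
  · ext ⟨x, y⟩
    obtain ⟨x, rfl⟩ := U.surjective x
    obtain ⟨y, rfl⟩ := U.surjective y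
    refine (hUT.Dbar x y).symm.trans ?_
    rw [hUV, hUV]
    exact hVT.Dbar x y

end Product

end SpectralData

namespace SpectralData

/-! ### Operators on finite dimensional spaces -/

section FiniteDimensional

variable {K : Type u} [NormedAddCommGroup K] [InnerProductSpace ℂ K]

theorem mem_graph_toPMap_top {T : K →ₗ[ℂ] K} {x y : K} :
    (x, y) ∈ (T.toPMap ⊤).graph ↔ T x = y := by
  rw [LinearPMap.mem_graph_iff]
  exact ⟨by rintro ⟨z, rfl, rfl⟩; rfl, fun h => ⟨⟨x, trivial⟩, rfl, h⟩⟩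

theorem compGraph_toPMap_top {S T : K →ₗ[ℂ] K} {x z : K} :
    CompGraph (S.toPMap ⊤) (T.toPMap ⊤) x z ↔ S (T x) = z := by
  simp only [CompGraph, mem_graph_toPMap_top]
  exact ⟨by rintro ⟨y, rfl, h⟩; exact h, fun h => ⟨_, rfl, h⟩⟩

theorem isSymmGraph_toPMap_top {T : K →ₗ[ℂ] K} (hT : T.IsSymmetric) :
    IsSymmGraph (T.toPMap ⊤).graph := by
  rintro ⟨x, y⟩ hx ⟨x', y'⟩ hx'
  rw [mem_graph_toPMap_top] at hx hx'
  subst hx hx'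
  exact hT x x'

variable [CompleteSpace K]

theorem isSelfAdjoint_toPMap_top {T : K →ₗ[ℂ] K} (hT : T.IsSymmetric) :
    IsSelfAdjoint (T.toPMap ⊤) := by
  refine isSelfAdjoint_iff_graph.mpr ⟨dense_univ, fun x y => ?_⟩
  simp only [mem_graph_toPMap_top]
  constructor
  · rintro rfl u _ rfl
    exact hT u x
  · exact fun h => ext_inner_left ℂ fun u => (hT u x).symm.trans (h u _ rfl)

theorem heatTraceClass_toPMap_top [FiniteDimensional ℂ K] {T : K →ₗ[ℂ] K} (hT : T.IsSymmetric) :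
    HeatTraceClass (T.toPMap ⊤) := by
  let e := hT.eigenvectorBasis rfl
  have he : ∀ i, e.toHilbertBasis i = e i := fun i => by simp
  refine SquareDiagonal.heatTraceClass (b := e.toHilbertBasis)
    (κ := fun i => hT.eigenvalues rfl i ^ 2) (fun i => ?_) (isSymmGraph_toPMap_top hT)
    (isClosed_graph_of_isSelfAdjoint (isSelfAdjoint_toPMap_top hT)) fun t _ =>
    Summable.of_finite
  rw [compGraph_toPMap_top, he, hT.apply_eigenvectorBasis, map_smul, hT.apply_eigenvectorBasis,
    smul_smul]
  push_cast
  rw [sq]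
  rfl

end FiniteDimensional

/-! ### Families of matrices with the Hilbert-Schmidt inner product -/

section HilbertSchmidt

open scoped Matrix ComplexOrder

/-- The space of families of matrices. -/
def HS (ι : Type u) (κ : Type v) : Type (max u v) := κ → Matrix ι ι ℂ

namespace HS

variable {ι : Type u} {κ : Type v}

instance : AddCommGroup (HS ι κ) := inferInstanceAs (AddCommGroup (κ → Matrix ι ι ℂ))

instance : Module ℂ (HS ι κ) := inferInstanceAs (Module ℂ (κ → Matrix ι ι ℂ))

theorem add_apply (x y : HS ι κ) (s : κ) : (x + y) s = x s + y s := rfl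

theorem neg_apply (x : HS ι κ) (s : κ) : (-x) s = -x s := rfl

theorem smul_apply (c : ℂ) (x : HS ι κ) (s : κ) : (c • x) s = c • x s := rfl

theorem sum_apply {α : Type*} (t : Finset α) (x : α → HS ι κ) (s : κ) :
    (∑ i ∈ t, x i) s = ∑ i ∈ t, x i s := Finset.sum_apply s t x

variable [Fintype ι]

/-- The operator `(x s) ↦ (c s • [M, x (f s)])`. -/
def ad (M : Matrix ι ι ℂ) (f : κ → κ) (c : κ → ℤ) : HS ι κ →ₗ[ℂ] HS ι κ where
  toFun x s := c s • (M * x (f s) - x (f s) * M)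
  map_add' x y := funext fun s => by
    change c s • (M * (x (f s) + y (f s)) - (x (f s) + y (f s)) * M) =
      c s • (M * x (f s) - x (f s) * M) + c s • (M * y (f s) - y (f s) * M)
    rw [← smul_add, Matrix.mul_add, Matrix.add_mul]
    congr 1
    abel
  map_smul' k x := funext fun s => by
    rw [smul_apply, Matrix.mul_smul, Matrix.smul_mul, ← smul_sub, smul_comm]; rfl

theorem ad_apply (M : Matrix ι ι ℂ) (f : κ → κ) (c : κ → ℤ) (x : HS ι κ) (s : κ) :
    ad M f c x s = c s • (M * x (f s) - x (f s) * M) := rfl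

variable [Fintype κ]

theorem trace_self_nonneg (x : Matrix ι ι ℂ) : 0 ≤ (xᴴ * x).trace :=
  (Matrix.posSemidef_conjTranspose_mul_self x).trace_nonneg

/-- The Hilbert-Schmidt inner product. -/
@[reducible]
def core : InnerProductSpace.Core ℂ (HS ι κ) where
  inner x y := ∑ s, ((x s)ᴴ * y s).trace
  conj_inner_symm x y := by
    simp only [map_sum, starRingEnd_apply, ← Matrix.trace_conjTranspose,
      Matrix.conjTranspose_mul, Matrix.conjTranspose_conjTranspose]
  re_inner_nonneg x := by
    change 0 ≤ (∑ s, ((x s)ᴴ * x s).trace).re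
    exact (Complex.le_def.mp (Finset.sum_nonneg fun s _ => trace_self_nonneg (x s))).1
  add_left x y z := by
    rw [← Finset.sum_add_distrib]
    refine Finset.sum_congr rfl fun s _ => ?_
    rw [← Matrix.trace_add, ← Matrix.add_mul, ← Matrix.conjTranspose_add]
    rfl
  smul_left x y c := by
    rw [Finset.mul_sum]
    refine Finset.sum_congr rfl fun s _ => ?_
    change ((c • x s)ᴴ * y s).trace = _
    rw [Matrix.conjTranspose_smul, Matrix.smul_mul, Matrix.trace_smul]
    rfl
  definite x hx := by
    have h := (Finset.sum_eq_zero_iff_of_nonneg fun s _ => trace_self_nonneg (x s)).mp hx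
    exact funext fun s => Matrix.trace_conjTranspose_mul_self_eq_zero_iff.mp
      (h s (Finset.mem_univ s))

instance : NormedAddCommGroup (HS ι κ) :=
  @InnerProductSpace.Core.toNormedAddCommGroup ℂ (HS ι κ) _ _ _ core

instance : InnerProductSpace ℂ (HS ι κ) := InnerProductSpace.ofCore core.toCore

instance : FiniteDimensional ℂ (HS ι κ) :=
  inferInstanceAs (FiniteDimensional ℂ (κ → Matrix ι ι ℂ))

instance : CompleteSpace (HS ι κ) := FiniteDimensional.complete ℂ _

theorem inner_eq (x y : HS ι κ) : ⟪x, y⟫_ℂ = ∑ s, ((x s)ᴴ * y s).trace := rfl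

/-- The operator `(x s) ↦ (c s • a * x (f s))`. -/
def L (a : Matrix ι ι ℂ) (f : κ → κ) (c : κ → ℤ) : HS ι κ →L[ℂ] HS ι κ :=
  LinearMap.toContinuousLinearMap
    { toFun := fun x s => c s • (a * x (f s))
      map_add' := fun x y => funext fun s => by
        rw [add_apply, Matrix.mul_add, smul_add]; rfl
      map_smul' := fun k x => funext fun s => by
        rw [smul_apply, Matrix.mul_smul, smul_comm]; rfl }

theorem L_apply (a : Matrix ι ι ℂ) (f : κ → κ) (c : κ → ℤ) (x : HS ι κ) (s : κ) :
    L a f c x s = c s • (a * x (f s)) := rfl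

theorem inner_L {f : κ → κ} (hf : ∀ s, f (f s) = s) {c : κ → ℤ} (hc : ∀ s, c (f s) = c s)
    (a : Matrix ι ι ℂ) (x y : HS ι κ) : ⟪L a f c x, y⟫_ℂ = ⟪x, L aᴴ f c y⟫_ℂ := by
  rw [inner_eq, inner_eq, ← Equiv.sum_comp (Function.Involutive.toPerm f hf)]
  refine Finset.sum_congr rfl fun s _ => ?_
  change ((L a f c x (f s))ᴴ * y (f s)).trace = _
  rw [L_apply, L_apply, hf, hc, Matrix.conjTranspose_zsmul, Matrix.conjTranspose_mul,
    smul_mul_assoc, mul_smul_comm, Matrix.mul_assoc]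

/-- Commutators with a Hermitian matrix are symmetric for the trace form by cyclicity; the
permutation of the indices is absorbed by reindexing along the involution `f`. -/
theorem isSymmetric_ad {M : Matrix ι ι ℂ} (hM : Mᴴ = M) {f : κ → κ} (hf : ∀ s, f (f s) = s)
    {c : κ → ℤ} (hc : ∀ s, c (f s) = c s) : (ad M f c).IsSymmetric := by
  intro x y
  change ⟪ad M f c x, y⟫_ℂ = ⟪x, ad M f c y⟫_ℂ
  rw [inner_eq, inner_eq, ← Equiv.sum_comp (Function.Involutive.toPerm f hf)]
  refine Finset.sum_congr rfl fun s _ => ?_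
  change ((ad M f c x (f s))ᴴ * y (f s)).trace = _
  rw [ad_apply, ad_apply, hf, hc, Matrix.conjTranspose_zsmul, Matrix.conjTranspose_sub,
    Matrix.conjTranspose_mul, Matrix.conjTranspose_mul, hM, smul_mul_assoc, mul_smul_comm,
    Matrix.trace_smul, Matrix.trace_smul, Matrix.sub_mul, Matrix.mul_sub, Matrix.trace_sub,
    Matrix.trace_sub, Matrix.mul_assoc, Matrix.mul_assoc, Matrix.trace_mul_comm M, Matrix.mul_assoc]

theorem star_L {f : κ → κ} (hf : ∀ s, f (f s) = s) {c : κ → ℤ} (hc : ∀ s, c (f s) = c s)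
    (a : Matrix ι ι ℂ) : star (L a f c : HS ι κ →L[ℂ] HS ι κ) = L aᴴ f c := by
  rw [ContinuousLinearMap.star_eq_adjoint, eq_comm, ContinuousLinearMap.eq_adjoint_iff]
  intro x y
  rw [inner_L hf hc, Matrix.conjTranspose_conjTranspose]

/-- `[M, ·]` is a derivation, so its commutator with left multiplication by `a` is left
multiplication by `[M, a]`. -/
theorem isCommutator_ad (M a : Matrix ι ι ℂ) (f : κ → κ) (c : κ → ℤ) :
    IsCommutator ((ad M f c).toPMap ⊤) (L a id 1) (L (M * a - a * M) f c) := by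
  intro x y h
  rw [mem_graph_toPMap_top] at h ⊢
  subst h
  funext s
  simp only [add_apply, L_apply, ad_apply, Pi.one_apply, one_smul, id]
  rw [mul_smul_comm, ← smul_add]
  congr 1
  noncomm_ring

variable [DecidableEq ι]

theorem isGrading_L {c : κ → ℤ} (hc : ∀ s, c s * c s = 1) :
    IsGrading (L 1 id c : HS ι κ →L[ℂ] HS ι κ) where
  selfAdjoint := by
    have := star_L (κ := κ) (f := id) (fun _ => rfl) (c := c) (fun _ => rfl) (1 : Matrix ι ι ℂ)
    rwa [Matrix.conjTranspose_one] at this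
  sq_eq_one := by
    ext x
    funext s
    change c s • (1 * (c s • (1 * x s))) = x s
    rw [one_mul, one_mul, smul_smul, hc, one_smul]

theorem antiCommutes_L {M : Matrix ι ι ℂ} {f : κ → κ} {c e : κ → ℤ} (h : ∀ s, e (f s) = -e s) :
    AntiCommutes (L 1 id e) ((ad M f c).toPMap ⊤ : HS ι κ →ₗ.[ℂ] HS ι κ) := by
  intro x y hx
  rw [mem_graph_toPMap_top] at hx ⊢
  subst hx
  funext s
  simp only [neg_apply, L_apply, ad_apply, one_mul, id, h, mul_smul_comm, smul_mul_assoc,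
    ← smul_sub]
  rw [smul_comm, neg_smul]

theorem commutes_L {M : Matrix ι ι ℂ} {f : κ → κ} {c e : κ → ℤ} (h : ∀ s, e (f s) = e s) :
    Commutes (L 1 id e) ((ad M f c).toPMap ⊤ : HS ι κ →ₗ.[ℂ] HS ι κ) := by
  intro x y hx
  rw [mem_graph_toPMap_top] at hx ⊢
  subst hx
  funext s
  simp only [L_apply, ad_apply, one_mul, id, h, mul_smul_comm, smul_mul_assoc, ← smul_sub]
  rw [smul_comm]

theorem L_comm (c : κ → ℤ) (a : Matrix ι ι ℂ) :
    (L 1 id c : HS ι κ →L[ℂ] HS ι κ) * L a id 1 = L a id 1 * L 1 id c := by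
  ext x
  funext s
  change c s • (1 * ((1 : κ → ℤ) s • (a * x s))) = (1 : κ → ℤ) s • (a * (c s • (1 * x s)))
  rw [one_mul, one_mul, Pi.one_apply, one_smul, one_smul, mul_smul_comm]

variable (ι κ)

/-- Left multiplication. -/
def rep : Matrix ι ι ℂ →⋆ₐ[ℂ] (HS ι κ →L[ℂ] HS ι κ) where
  toFun a := L a id 1
  map_one' := by ext x; funext s; simp [L_apply]
  map_mul' a b := by
    ext x; funext s
    change (1 : κ → ℤ) s • (a * b * x s) = (1 : κ → ℤ) s • (a * ((1 : κ → ℤ) s • (b * x s)))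
    simp [mul_assoc]
  map_zero' := by ext x; funext s; simp [L_apply]; rfl
  map_add' a b := by
    ext x; funext s
    change (1 : κ → ℤ) s • ((a + b) * x s) =
      (1 : κ → ℤ) s • (a * x s) + (1 : κ → ℤ) s • (b * x s)
    simp [add_mul]
  commutes' c := by
    ext x; funext s
    change (1 : κ → ℤ) s • (algebraMap ℂ (Matrix ι ι ℂ) c * x s) = c • x s
    rw [Algebra.algebraMap_eq_smul_one]
    simp
  map_star' a := (star_L (fun _ => rfl) (fun _ => rfl) a).symm

variable {ι κ}

theorem rep_apply_apply (a : Matrix ι ι ℂ) (x : HS ι κ) (s : κ) : rep ι κ a x s = a * x s :=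
  one_smul ℤ _

theorem rep_injective [Nonempty κ] : Function.Injective (rep ι κ) := by
  intro a b h
  obtain ⟨s⟩ := ‹Nonempty κ›
  have h1 := congrArg (fun T : HS ι κ →L[ℂ] HS ι κ => T (fun _ => 1) s) h
  exact (mul_one a).symm.trans (((rep_apply_apply a _ s).symm.trans
    (h1.trans (rep_apply_apply b _ s))).trans (mul_one b))

end HS

end HilbertSchmidt

end SpectralData

namespace SpectralData

/-! ### Grassmann connections -/

section Grassmann

variable {A H : Type u} [Ring A] [StarRing A] [Algebra ℂ A] [StarModule ℂ A]
  [NormedAddCommGroup H] [InnerProductSpace ℂ H] [CompleteSpace H]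

theorem N1Data.d_smul (X : N1Data A H) (c : ℂ) (a : A) : X.d (c • a) = c • X.d a :=
  X.commutator_unique (X.d_spec _) fun x y h => by
    have h1 : X.rep a y + X.d a x - X.rep a y = X.d a x := add_sub_cancel_left _ _
    have h2 := X.D.graph.smul_mem c (X.d_spec a x y h)
    rw [Prod.smul_mk, smul_add] at h2
    rw [map_smul]
    exact h2

namespace HermitianData

variable (X : HermitianData A H)

/-- The exterior derivative, as a linear map to the one-forms. -/
def dOmega : A →ₗ[ℂ] X.Omega where
  toFun a := ⟨X.d a, X.d_mem a⟩
  map_add' a b := Subtype.ext (X.d_add a b)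
  map_smul' c a := Subtype.ext (X.d_smul c a)

theorem dOmega_mul (a b : A) :
    X.dOmega (a * b) = X.omegaRight b (X.dOmega a) + X.omegaLeft a (X.dOmega b) :=
  Subtype.ext (X.d_mul a b)

variable {κ : Type*} [Fintype κ] (e : κ → X.E)

/-- The Grassmann connection `ξ ↦ ∑ d⟨ξ, eₛ⟩ ⊗ eₛ` of a frame. -/
def grassmannNabla : X.E →ₗ[ℂ] X.OmegaE where
  toFun ξ := ∑ s, nctmul _ _ (X.dOmega (X.herm ξ (e s))) (e s)
  map_add' ξ η := by
    simp only [map_add, LinearMap.add_apply, nctmul_add_left, Finset.sum_add_distrib]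
  map_smul' c ξ := by
    simp only [map_smul, LinearMap.smul_apply, nctmul_smul_left, Finset.smul_sum,
      RingHom.id_apply]

theorem grassmannNabla_apply (ξ : X.E) : X.grassmannNabla e ξ =
    ∑ s, nctmul _ _ (X.dOmega (X.herm ξ (e s))) (e s) := rfl

theorem pairing_grassmannNabla (ξ η : X.E) : X.pairing η (X.grassmannNabla e ξ) =
    ∑ s, X.d (X.herm ξ (e s)) * X.rep (X.herm (e s) η) := by
  rw [grassmannNabla_apply, map_sum]
  rfl

/-- A Hermitian module with a frame of homogeneous elements, with its Grassmann connection. -/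
def grassmann (he : ∀ ξ, ∑ s, X.left (X.herm ξ (e s)) (e s) = ξ) (ε : κ → ℤ)
    (hε : ∀ s, X.γE (e s) = ε s • e s) (hγ : ∀ ξ η, X.herm (X.γE ξ) η = X.herm ξ (X.γE η)) :
    ExtInput A H where
  toHermitianData := X
  nabla := X.grassmannNabla e
  leibniz a ξ := by
    -- The Leibniz term is expanded in the frame, and the coefficients `⟨ξ, eₛ⟩` are moved onto the
    -- one-form, to match `d(a ⟨ξ, eₛ⟩)` term by term.
    have h : nctmul X.omegaRight X.left (X.dOmega a) ξ =
        ∑ s, nctmul _ _ (X.omegaRight (X.herm ξ (e s)) (X.dOmega a)) (e s) := by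
      conv_lhs => rw [← he ξ]
      simp only [nctmul_balanced]
      exact map_sum (ncmk X.omegaRight X.left (X.dOmega a)) _ _
    change _ = _ + nctmul X.omegaRight X.left (X.dOmega a) ξ
    rw [grassmannNabla_apply, grassmannNabla_apply, map_sum, h, ← Finset.sum_add_distrib]
    refine Finset.sum_congr rfl fun s _ => ?_
    rw [X.herm_left, dOmega_mul, nctmul_add_left, add_comm]
    rfl
  compatible ξ η := by
    -- Applying the Leibniz rule for `d` to this product formula is exactly compatibility of the
    -- Grassmann connection.
    have h : X.herm ξ η = ∑ s, X.herm ξ (e s) * X.herm (e s) η := by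
      conv_lhs => rw [← he ξ, map_sum, LinearMap.sum_apply]
      exact Finset.sum_congr rfl fun s _ => X.herm_left _ _ _
    have hd : X.d (X.herm ξ η) = ∑ s, X.d (X.herm ξ (e s) * X.herm (e s) η) := by
      rw [h]
      exact congrArg Subtype.val (map_sum X.dOmega _ _) |>.trans (AddSubmonoidClass.coe_finsetSum _ _)
    rw [hd, pairing_grassmannNabla, pairing_grassmannNabla, star_sum, ← Finset.sum_sub_distrib]
    refine Finset.sum_congr rfl fun s _ => ?_
    rw [star_mul, X.star_d, ← map_star, X.herm_symm, X.herm_symm, X.d_mul, mul_neg, sub_neg_eq_add]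
  nabla_γ ξ := by
    rw [grassmannNabla_apply, grassmannNabla_apply, map_sum]
    refine Finset.sum_congr rfl fun s _ => ?_
    change _ = nctmul _ _ (X.dOmega (X.herm ξ (e s))) (X.γE (e s))
    -- `γ` is moved onto the frame vector inside the Hermitian structure; homogeneity turns it into
    -- the sign `ε s`, which can be carried to the module leg.
    rw [hγ, hε, map_zsmul, map_zsmul]
    exact (LinearMap.map_smul_of_tower (ncmk X.omegaRight X.left |>.flip (e s)) (ε s) _).trans
      (LinearMap.map_smul_of_tower (ncmk X.omegaRight X.left _) (ε s) _).symm

end HermitianData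

end Grassmann

/-! ### Inner derivations of matrix algebras -/

section Matrices

open scoped Matrix

/-- The sign of a Boolean. -/
def sgn (s : Bool) : ℤ := if s then 1 else -1

theorem sgn_mul_self (s : Bool) : sgn s * sgn s = 1 := by cases s <;> rfl

theorem sgn_not (s : Bool) : sgn (!s) = -sgn s := by cases s <;> rfl

namespace HS

variable {ι : Type u} [Fintype ι]

/-- The antiunitary operator `(x s) ↦ (± (x s)*)`. -/
def conj : HS ι Bool ≃ₗᵢ⋆[ℂ] HS ι Bool where
  toFun x s := sgn s • (x s)ᴴ
  invFun x s := sgn s • (x s)ᴴ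
  map_add' x y := funext fun s => by
    rw [add_apply, Matrix.conjTranspose_add, smul_add]; rfl
  map_smul' c x := funext fun s => by
    rw [smul_apply, Matrix.conjTranspose_smul, smul_comm]; rfl
  left_inv x := funext fun s => by
    change sgn s • (sgn s • (x s)ᴴ)ᴴ = x s
    rw [Matrix.conjTranspose_zsmul, smul_smul, sgn_mul_self, one_smul,
      Matrix.conjTranspose_conjTranspose]
  right_inv x := funext fun s => by
    change sgn s • (sgn s • (x s)ᴴ)ᴴ = x s
    rw [Matrix.conjTranspose_zsmul, smul_smul, sgn_mul_self, one_smul,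
      Matrix.conjTranspose_conjTranspose]
  norm_map' x := by
    refine (sq_eq_sq₀ (norm_nonneg _) (norm_nonneg _)).mp ?_
    rw [← @inner_self_eq_norm_sq ℂ, ← @inner_self_eq_norm_sq ℂ, inner_eq, inner_eq]
    refine congrArg _ (Finset.sum_congr rfl fun s _ => ?_)
    change ((sgn s • (x s)ᴴ)ᴴ * (sgn s • (x s)ᴴ)).trace = _
    rw [Matrix.conjTranspose_zsmul, smul_mul_assoc, mul_smul_comm, smul_smul, sgn_mul_self,
      one_smul, Matrix.conjTranspose_conjTranspose, Matrix.trace_mul_comm]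

theorem conj_apply (x : HS ι Bool) (s : Bool) : conj x s = sgn s • (x s)ᴴ := rfl

theorem conj_symm_apply (x : HS ι Bool) (s : Bool) : conj.symm x s = sgn s • (x s)ᴴ := rfl

theorem conj_L (a : Matrix ι ι ℂ) (f : Bool → Bool) (x : HS ι Bool) (s : Bool) :
    conj (L a f 1 (conj.symm x)) s = (sgn s * sgn (f s)) • (x (f s) * aᴴ) := by
  rw [conj_apply, L_apply, conj_symm_apply, Pi.one_apply, one_smul, Matrix.conjTranspose_mul,
    Matrix.conjTranspose_zsmul, Matrix.conjTranspose_conjTranspose, smul_mul_assoc, smul_smul]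

/-- The matrix valued inner product `∑ x s (y s)*`. -/
def herm : HS ι Bool →ₗ[ℂ] HS ι Bool →ₗ⋆[ℂ] Matrix ι ι ℂ :=
  LinearMap.mk₂'ₛₗ (RingHom.id ℂ) (starRingEnd ℂ)
    (fun ξ η => ∑ s, ξ s * (η s)ᴴ)
    (fun ξ ξ' η => by
      rw [← Finset.sum_add_distrib]
      exact Finset.sum_congr rfl fun s _ => by rw [add_apply, Matrix.add_mul])
    (fun c ξ η => by
      rw [Finset.smul_sum]
      exact Finset.sum_congr rfl fun s _ => by rw [smul_apply, Matrix.smul_mul]; rfl)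
    (fun ξ η η' => by
      rw [← Finset.sum_add_distrib]
      exact Finset.sum_congr rfl fun s _ => by
        rw [add_apply, Matrix.conjTranspose_add, Matrix.mul_add])
    (fun c ξ η => by
      rw [Finset.smul_sum]
      exact Finset.sum_congr rfl fun s _ => by
        rw [smul_apply, Matrix.conjTranspose_smul, Matrix.mul_smul, starRingEnd_apply])

theorem herm_apply (x y : HS ι Bool) : herm x y = ∑ s, x s * (y s)ᴴ := rfl

theorem herm_symm (x y : HS ι Bool) : star (herm x y) = herm y x := by
  rw [herm_apply, herm_apply, star_sum]
  refine Finset.sum_congr rfl fun s _ => ?_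
  rw [Matrix.star_eq_conjTranspose, Matrix.conjTranspose_mul, Matrix.conjTranspose_conjTranspose]

variable [DecidableEq ι] {κ : Type v} [DecidableEq κ]

theorem herm_rep (a : Matrix ι ι ℂ) (x y : HS ι Bool) :
    herm (rep ι Bool a x) y = a * herm x y := by
  rw [herm_apply, herm_apply, Finset.mul_sum]
  exact Finset.sum_congr rfl fun s _ => by rw [rep_apply_apply, mul_assoc]

theorem rep_herm_nonneg (x : HS ι Bool) : (rep ι Bool (herm x x)).IsPositive := by
  rw [herm_apply, map_sum]
  refine (ContinuousLinearMap.nonneg_iff_isPositive _).mp (Finset.sum_nonneg fun s _ => ?_)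
  rw [map_mul, ← Matrix.star_eq_conjTranspose, map_star]
  exact mul_star_self_nonneg _

/-- The family with the entry `1` at `s`. -/
def unit (s : κ) : HS ι κ := fun t => if t = s then 1 else 0

theorem mul_unit [Fintype κ] (x : κ → Matrix ι ι ℂ) (t : κ) :
    ∑ s, x s * (unit s : HS ι κ) t = x t := by
  simp [unit]

theorem herm_unit (s : Bool) (x : HS ι Bool) : herm (unit s) x = (x s)ᴴ := by
  simp [herm_apply, unit]

theorem conj_unit_mul (x : Bool → Matrix ι ι ℂ) (t : Bool) :
    ∑ s, conj (unit s : HS ι Bool) t * x s = sgn t • x t := by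
  have : ∀ s, conj (unit s : HS ι Bool) t * x s = if t = s then sgn t • x t else 0 := by
    intro s
    rw [conj_apply, unit]
    split_ifs with h
    · rw [Matrix.conjTranspose_one, smul_mul_assoc, one_mul, h]
    · rw [Matrix.conjTranspose_zero, smul_zero, zero_mul]
  simp only [this, Finset.sum_ite_eq, Finset.mem_univ, if_true]

end HS

variable {ι : Type u} [Fintype ι] (M : Matrix ι ι ℂ) (hM : Mᴴ = M)

/-- The commutator `[M, a]`. -/
def br (a : Matrix ι ι ℂ) : Matrix ι ι ℂ := M * a - a * M

include hM in
theorem conjTranspose_br (a : Matrix ι ι ℂ) : (br M a)ᴴ = -br M aᴴ := by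
  rw [br, br, Matrix.conjTranspose_sub, Matrix.conjTranspose_mul, Matrix.conjTranspose_mul, hM,
    neg_sub]

theorem br_zsmul (k : ℤ) (a : Matrix ι ι ℂ) : br M (k • a) = k • br M a := by
  rw [br, br, mul_smul_comm, smul_mul_assoc, smul_sub]

theorem br_neg (a : Matrix ι ι ℂ) : br M (-a) = -br M a := by
  rw [br, br, mul_neg, neg_mul, neg_sub_neg, neg_sub]

theorem br_mul (a b : Matrix ι ι ℂ) : br M (a * b) = br M a * b + a * br M b := by
  rw [br, br, br]; noncomm_ring

variable [DecidableEq ι]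

/-- The `N = 1` spectral data of the inner derivation `[M, ·]`. -/
def innerN1 : N1Data (Matrix ι ι ℂ) (HS ι Bool) where
  rep := HS.rep ι Bool
  D := (HS.ad M not 1).toPMap ⊤
  γ := HS.L 1 id sgn
  separable := by
    have : ProperSpace (HS ι Bool) := FiniteDimensional.proper ℂ _
    infer_instance
  faithful := HS.rep_injective
  selfAdjoint := isSelfAdjoint_toPMap_top (HS.isSymmetric_ad hM Bool.not_not fun _ => rfl)
  bounded_commutator a := ⟨_, HS.isCommutator_ad M a not 1⟩
  theta_summable := heatTraceClass_toPMap_top (HS.isSymmetric_ad hM Bool.not_not fun _ => rfl)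
  grading := HS.isGrading_L sgn_mul_self
  γ_rep := HS.L_comm sgn
  γ_D := HS.antiCommutes_L sgn_not

theorem innerN1_d (a : Matrix ι ι ℂ) : (innerN1 M hM).d a = HS.L (br M a) not 1 :=
  (innerN1 M hM).commutator_unique ((innerN1 M hM).d_spec a) (HS.isCommutator_ad M a not 1)

/-- The real structure on the spectral data of an inner derivation. -/
def innerReal : RealN1Data (Matrix ι ι ℂ) (HS ι Bool) where
  toN1Data := innerN1 M hM
  J := HS.conj
  ko := 0
  J_J x := by
    change HS.conj (HS.conj.symm x) = (1 : ℤ) • x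
    rw [HS.conj.apply_symm_apply, one_smul]
  -- Taking adjoints turns `[M, x]` into `-[M, x*]`. The sign in `conj` changes under the exchange
  -- of the two copies and compensates this, so `J` commutes with `D`.
  J_D x y h := by
    have h1 := mem_graph_toPMap_top.mp h
    subst h1
    refine mem_graph_toPMap_top.mpr (funext fun s => ?_)
    rw [HS.ad_apply, HS.conj_apply, HS.conj_apply, HS.ad_apply, sgn_not, Pi.one_apply, one_smul,
      one_smul, Matrix.conjTranspose_sub, Matrix.conjTranspose_mul, Matrix.conjTranspose_mul, hM,
      mul_smul_comm, smul_mul_assoc, neg_smul, neg_smul, smul_sub]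
    exact neg_sub_neg _ _
  J_γ x := by
    change _ = (1 : ℤ) • _
    rw [one_smul]
    funext s
    change sgn s • (sgn s • (1 * x s))ᴴ = sgn s • (1 * (sgn s • (x s)ᴴ))
    rw [one_mul, one_mul, Matrix.conjTranspose_zsmul]
  order_zero a b x := funext fun s => by
    refine (HS.conj_L a id _ s).trans ?_
    change (sgn s * sgn s) • ((HS.rep ι Bool b x) s * aᴴ) =
      HS.rep ι Bool b (HS.conj (HS.L a id 1 (HS.conj.symm x))) s
    rw [HS.rep_apply_apply, HS.rep_apply_apply, HS.conj_L, mul_smul_comm, mul_assoc]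
    rfl
  order_one a b x := funext fun s => by
    rw [innerN1_d]
    refine (HS.conj_L a id _ s).trans ?_
    change (sgn s * sgn s) • ((HS.L (br M b) not 1 x) s * aᴴ) =
      HS.L (br M b) not 1 (HS.conj (HS.L a id 1 (HS.conj.symm x))) s
    rw [HS.L_apply, HS.L_apply, HS.conj_L, sgn_mul_self, id, sgn_mul_self, one_smul, one_smul,
      smul_mul_assoc, mul_assoc]

/-- The free module of the spectral data of an inner derivation. -/
def innerModule : ModuleData (Matrix ι ι ℂ) (HS ι Bool) where
  toRealN1Data := innerReal M hM
  E := ⊤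
  dense_E := dense_univ
  rep_mem _ _ _ := trivial
  J_mem _ _ := trivial
  γ_mem _ _ := trivial
  d_mem_E _ _ _ := trivial
  finite_projective := by
    let : Module (Matrix ι ι ℂ) (⊤ : Submodule ℂ (HS ι Bool)) :=
      repModule (HS.rep ι Bool) ⊤ fun _ _ _ => trivial
    refine finite_projective_of_coordinates (fun s : Bool => ⟨HS.unit s, trivial⟩)
      (fun s => { toFun := fun x => (x : HS ι Bool) s
                  map_add' := fun _ _ => rfl
                  map_smul' := fun a x => HS.rep_apply_apply a _ s }) fun x => ?_
    apply Subtype.ext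
    funext t
    rw [AddSubmonoidClass.coe_finsetSum, HS.sum_apply]
    refine (HS.mul_unit _ t).symm.trans (Finset.sum_congr rfl fun s _ => ?_)
    exact (HS.rep_apply_apply _ _ t).symm

theorem innerModule_left (a : Matrix ι ι ℂ) (ξ : (innerModule M hM).E) (s : Bool) :
    ((innerModule M hM).left a ξ : HS ι Bool) s = a * (ξ : HS ι Bool) s :=
  HS.rep_apply_apply a _ s

/-- The element of the free module with the entry `1` at `s`. -/
def innerUnit (s : Bool) : (innerModule M hM).E := ⟨HS.unit s, trivial⟩

theorem sum_left_innerUnit (ξ : (innerModule M hM).E) :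
    ∑ s, (innerModule M hM).left ((ξ : HS ι Bool) s) (innerUnit M hM s) = ξ := by
  apply Subtype.ext
  funext t
  rw [AddSubmonoidClass.coe_finsetSum, HS.sum_apply]
  refine Eq.trans (Finset.sum_congr rfl fun s _ => ?_) (HS.mul_unit _ t)
  exact innerModule_left M hM _ _ t

/-- The standard Hermitian structure on the free module. -/
def innerHermitian : HermitianData (Matrix ι ι ℂ) (HS ι Bool) where
  toModuleData := innerModule M hM
  herm := LinearMap.mk₂'ₛₗ (RingHom.id ℂ) (starRingEnd ℂ)
    (fun ξ η : (innerModule M hM).E => HS.herm (ξ : HS ι Bool) (η : HS ι Bool))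
    (fun ξ ξ' η => LinearMap.map_add₂ HS.herm (ξ : HS ι Bool) ξ' η)
    (fun c ξ η => LinearMap.map_smul₂ HS.herm c (ξ : HS ι Bool) η)
    (fun ξ η η' => map_add (HS.herm (ξ : HS ι Bool)) (η : HS ι Bool) η')
    (fun c ξ η => LinearMap.map_smulₛₗ (HS.herm (ξ : HS ι Bool)) c (η : HS ι Bool))
  herm_left a ξ η := HS.herm_rep a _ _
  herm_symm ξ η := HS.herm_symm _ _
  herm_nonneg ξ := HS.rep_herm_nonneg _
  herm_dual φ hφ := by
    have h : ∀ ξ : (innerModule M hM).E,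
        φ ξ = ∑ s, (ξ : HS ι Bool) s * φ (innerUnit M hM s) := fun ξ => by
      conv_lhs => rw [← sum_left_innerUnit M hM ξ, map_sum]
      exact Finset.sum_congr rfl fun s _ => hφ _ _
    refine ⟨⟨fun s => (φ (innerUnit M hM s))ᴴ, trivial⟩, fun ξ => ?_, fun η hη => ?_⟩
    · refine (h ξ).trans ?_
      change _ = ∑ s, (ξ : HS ι Bool) s * ((φ (innerUnit M hM s))ᴴ)ᴴ
      refine Finset.sum_congr rfl fun s _ => ?_
      exact congrArg _ (Matrix.conjTranspose_conjTranspose _).symm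
    · apply Subtype.ext
      funext s
      have h1 := (hη (innerUnit M hM s)).trans (HS.herm_unit s _)
      exact (Matrix.conjTranspose_conjTranspose _).symm.trans (congrArg _ h1.symm)

theorem innerHermitian_herm (ξ η : (innerHermitian M hM).E) :
    (innerHermitian M hM).herm ξ η = ∑ s, (ξ : HS ι Bool) s * ((η : HS ι Bool) s)ᴴ := rfl

theorem herm_innerUnit (s : Bool) (η : (innerHermitian M hM).E) :
    (innerHermitian M hM).herm (innerUnit M hM s) η = ((η : HS ι Bool) s)ᴴ :=
  HS.herm_unit s _

theorem γE_innerUnit (s : Bool) :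
    (innerHermitian M hM).γE (innerUnit M hM s) = sgn s • innerUnit M hM s := by
  apply Subtype.ext
  funext t
  change sgn t • (1 * (HS.unit s : HS ι Bool) t) = sgn s • (HS.unit s : HS ι Bool) t
  rw [HS.unit]
  split_ifs with h
  · rw [one_mul, h]
  · rw [one_mul, smul_zero, smul_zero]

theorem herm_right_innerUnit (ξ : (innerHermitian M hM).E) (s : Bool) :
    (innerHermitian M hM).herm ξ (innerUnit M hM s) = (ξ : HS ι Bool) s :=
  ((innerHermitian M hM).herm_symm (innerUnit M hM s) ξ).symm.trans
    ((congrArg star (herm_innerUnit M hM s ξ)).trans (Matrix.conjTranspose_conjTranspose _))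

theorem herm_innerγ (ξ η : (innerHermitian M hM).E) :
    (innerHermitian M hM).herm ((innerHermitian M hM).γE ξ) η =
      (innerHermitian M hM).herm ξ ((innerHermitian M hM).γE η) := by
  rw [innerHermitian_herm, innerHermitian_herm]
  refine Finset.sum_congr rfl fun s _ => ?_
  change (sgn s • (1 * (ξ : HS ι Bool) s)) * ((η : HS ι Bool) s)ᴴ =
    (ξ : HS ι Bool) s * (sgn s • (1 * (η : HS ι Bool) s))ᴴ
  rw [one_mul, one_mul, Matrix.conjTranspose_zsmul, smul_mul_assoc, mul_smul_comm]

/-- The flat connection on the free module over the spectral data of an inner derivation. -/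
def innerInput : ExtInput (Matrix ι ι ℂ) (HS ι Bool) :=
  (innerHermitian M hM).grassmann (innerUnit M hM) (fun ξ => by
    simp only [herm_right_innerUnit]
    exact sum_left_innerUnit M hM ξ) sgn (γE_innerUnit M hM) (herm_innerγ M hM)

end Matrices

end SpectralData

namespace SpectralData

/-! ### The extension of an inner derivation -/

section InnerExtension

open scoped Matrix

/-- The product of families of matrices. -/
def HS.mulFamily {ι : Type u} [Fintype ι] {κ κ' : Type v} [Fintype κ] [Fintype κ'] :
    HS ι κ →ₗ[ℂ] HS ι κ' →ₗ[ℂ] HS ι (κ × κ') :=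
  LinearMap.mk₂ ℂ (fun x y p => x p.1 * y p.2)
    (fun x x' y => funext fun p => by
      change (x p.1 + x' p.1) * y p.2 = x p.1 * y p.2 + x' p.1 * y p.2
      rw [Matrix.add_mul])
    (fun c x y => funext fun p => by
      change (c • x p.1) * y p.2 = c • (x p.1 * y p.2)
      rw [Matrix.smul_mul])
    (fun x y y' => funext fun p => by
      change x p.1 * (y p.2 + y' p.2) = x p.1 * y p.2 + x p.1 * y' p.2
      rw [Matrix.mul_add])
    (fun c x y => funext fun p => by
      change x p.1 * (c • y p.2) = c • (x p.1 * y p.2)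
      rw [Matrix.mul_smul])

variable {ι : Type u} [Fintype ι] [DecidableEq ι] (M : Matrix ι ι ℂ) (hM : Mᴴ = M)

theorem innerInput_right (a : Matrix ι ι ℂ) (ξ : (innerInput M hM).E) (s : Bool) :
    ((innerInput M hM).right a ξ : HS ι Bool) s = (ξ : HS ι Bool) s * a := by
  refine (HS.conj_L aᴴ id (ξ : HS ι Bool) s).trans ?_
  rw [id, sgn_mul_self, one_smul, Matrix.conjTranspose_conjTranspose]

theorem innerInput_left (a : Matrix ι ι ℂ) (ξ : (innerInput M hM).E) (s : Bool) :
    ((innerInput M hM).left a ξ : HS ι Bool) s = a * (ξ : HS ι Bool) s :=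
  innerModule_left M hM a ξ s

/-- The identification of `E ⊗_A E` with a space of families of matrices. -/
def innerTheta : (innerInput M hM).EE →ₗ[ℂ] HS ι (Bool × Bool) :=
  nclift (HS.mulFamily.compl₁₂ (innerInput M hM).E.subtype (innerInput M hM).E.subtype)
    fun a ξ η => funext fun p => by
      change ((innerInput M hM).right a ξ : HS ι Bool) p.1 * (η : HS ι Bool) p.2 =
        (ξ : HS ι Bool) p.1 * ((innerInput M hM).left a η : HS ι Bool) p.2
      rw [innerInput_right, innerInput_left, mul_assoc]

theorem innerTheta_nctmul (ξ η : (innerInput M hM).E) (p : Bool × Bool) :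
    innerTheta M hM (nctmul _ _ ξ η) p = (ξ : HS ι Bool) p.1 * (η : HS ι Bool) p.2 := rfl

/-- Summing `(ξₛ ηₜ)* ξ'ₛ η'ₜ` over `s` produces `ηₜ* ⟨J ξ, J ξ'⟩ η'ₜ`, and the trace then gives the
form. -/
theorem inner_innerTheta (z w : (innerInput M hM).EE) :
    ⟪innerTheta M hM z, innerTheta M hM w⟫_ℂ = (innerInput M hM).form z w := by
  induction z using nctensor_induction with
  | add z z' hz hz' => rw [map_add, inner_add_left, hz, hz', HermitianData.form_add_left]
  | tmul ξ η =>
    induction w using nctensor_induction with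
    | add w w' hw hw' => rw [map_add, inner_add_right, hw, hw', map_add]
    | tmul ξ' η' =>
      refine Eq.trans ?_ (HermitianData.form_nctmul _ ξ η ξ' η').symm
      rw [HS.inner_eq, Fintype.sum_prod_type_right]
      refine Eq.trans ?_ (HS.inner_eq _ _).symm
      refine Finset.sum_congr rfl fun t _ => ?_
      rw [← Matrix.trace_sum]
      refine congrArg Matrix.trace ?_
      refine Eq.trans ?_ (congrArg (fun T => ((η : HS ι Bool) t)ᴴ * T)
        (HS.rep_apply_apply _ _ t)).symm
      have h : (innerInput M hM).herm ((innerInput M hM).JE ξ) ((innerInput M hM).JE ξ') =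
          ∑ s, ((ξ : HS ι Bool) s)ᴴ * (ξ' : HS ι Bool) s := by
        refine (innerHermitian_herm M hM _ _).trans ?_
        refine Finset.sum_congr rfl fun s _ => ?_
        change (sgn s • ((ξ : HS ι Bool) s)ᴴ) * (sgn s • ((ξ' : HS ι Bool) s)ᴴ)ᴴ = _
        rw [Matrix.conjTranspose_zsmul, Matrix.conjTranspose_conjTranspose, smul_mul_assoc,
          mul_smul_comm, smul_smul, sgn_mul_self, one_smul]
      rw [h, Finset.sum_mul, Finset.mul_sum]
      refine Finset.sum_congr rfl fun s _ => ?_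
      rw [innerTheta_nctmul, innerTheta_nctmul, Matrix.conjTranspose_mul]
      simp only [mul_assoc]

theorem innerTheta_surjective : Function.Surjective (innerTheta M hM) := by
  intro x
  -- The preimage places the row `x (s, ·)` on the second leg of the `s`-th unit vector.
  refine ⟨∑ s, nctmul _ _ (innerUnit M hM s) (⟨fun t => x (s, t), trivial⟩ : (innerInput M hM).E),
    funext fun p => ?_⟩
  rw [map_sum, HS.sum_apply]
  change ∑ s, (if p.1 = s then 1 else 0) * x (s, p.2) = x p
  simp

theorem innerInput_nabla (ξ : (innerInput M hM).E) : (innerInput M hM).nabla ξ =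
    ∑ s, nctmul _ _ ((innerHermitian M hM).dOmega ((ξ : HS ι Bool) s)) (innerUnit M hM s) := by
  refine ((innerHermitian M hM).grassmannNabla_apply _ ξ).trans ?_
  refine Finset.sum_congr rfl fun s _ => ?_
  exact congrArg (fun a => nctmul (innerHermitian M hM).omegaRight (innerHermitian M hM).left
    ((innerHermitian M hM).dOmega a) (innerUnit M hM s)) (herm_right_innerUnit M hM ξ s)

theorem omegaAct_dOmega (a : Matrix ι ι ℂ) (ξ : (innerHermitian M hM).E) (s : Bool) :
    ((innerHermitian M hM).omegaAct ((innerHermitian M hM).dOmega a) ξ : HS ι Bool) s =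
      br M a * (ξ : HS ι Bool) (!s) := by
  change (innerN1 M hM).d a (ξ : HS ι Bool) s = _
  rw [innerN1_d, HS.L_apply, Pi.one_apply, one_smul]

theorem omegaStar_dOmega (a : Matrix ι ι ℂ) :
    (innerHermitian M hM).omegaStar ((innerHermitian M hM).dOmega a) =
      (innerHermitian M hM).dOmega (-aᴴ) := by
  rw [map_neg]
  exact Subtype.ext ((innerN1 M hM).star_d a)

theorem omegaAct_omegaStar_dOmega (a : Matrix ι ι ℂ) (ξ : (innerHermitian M hM).E) (s : Bool) :
    ((innerHermitian M hM).omegaAct ((innerHermitian M hM).omegaStar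
      ((innerHermitian M hM).dOmega a)) ξ : HS ι Bool) s = br M (-aᴴ) * (ξ : HS ι Bool) (!s) := by
  rw [omegaStar_dOmega, omegaAct_dOmega]

/-- This sum and the next one evaluate the contributions of `∇̄ ξ` and `∇ η` to `𝔇`; the two after
them do the same for `𝔇̄`. Sums against the unit vectors collapse to one entry. -/
theorem sum_conj_unit_mul_br (x y : HS ι Bool) (s t : Bool) :
    ∑ r, HS.conj (HS.unit r : HS ι Bool) s * (br M (-(HS.conj.symm x r)ᴴ) * y t) =
      -(br M (x s) * y t) := by
  rw [HS.conj_unit_mul, HS.conj_symm_apply, Matrix.conjTranspose_zsmul,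
    Matrix.conjTranspose_conjTranspose, br_neg, br_zsmul, ← smul_neg, smul_mul_assoc, smul_smul,
    sgn_mul_self, one_smul, neg_mul]

theorem sum_mul_br_mul_unit (x y : HS ι Bool) (s t : Bool) :
    ∑ r, x s * (br M (y r) * (HS.unit r : HS ι Bool) t) = x s * br M (y t) := by
  rw [← Finset.mul_sum, HS.mul_unit (fun r => br M (y r))]

include hM in
theorem sum_conj_br_mul_unit (x y : HS ι Bool) (s t : Bool) :
    ∑ r, sgn s • (br M (HS.conj.symm x r) * (HS.unit r : HS ι Bool) (!s))ᴴ *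
      (sgn t • (1 * y t)) = sgn t • (br M (x (!s)) * y t) := by
  rw [← Finset.sum_mul, ← Finset.smul_sum, ← Matrix.conjTranspose_sum,
    HS.mul_unit (fun r => br M (HS.conj.symm x r)), HS.conj_symm_apply, br_zsmul,
    Matrix.conjTranspose_zsmul, conjTranspose_br M hM, Matrix.conjTranspose_conjTranspose,
    sgn_not, neg_smul, smul_neg, smul_neg, smul_neg, neg_neg, smul_smul, sgn_mul_self, one_smul, one_mul,
    mul_smul_comm]

include hM in
theorem sum_conj_br_mul_conj (x y : HS ι Bool) (s t : Bool) :
    ∑ r, sgn s • (br M (-(y r)ᴴ) * HS.conj.symm x (!s))ᴴ *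
      (sgn t • (1 * (HS.unit r : HS ι Bool) t)) = -(sgn t • (x (!s) * br M (y t))) := by
  have h : ∀ r, sgn s • (br M (-(y r)ᴴ) * HS.conj.symm x (!s))ᴴ = -(x (!s) * br M (y r)) := by
    intro r
    rw [HS.conj_symm_apply, Matrix.conjTranspose_mul, Matrix.conjTranspose_zsmul,
      Matrix.conjTranspose_conjTranspose, conjTranspose_br M hM, Matrix.conjTranspose_neg,
      Matrix.conjTranspose_conjTranspose, br_neg, neg_neg, sgn_not, smul_mul_assoc, smul_smul,
      mul_neg, sgn_mul_self, neg_one_smul]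
  simp only [h, one_mul, mul_smul_comm]
  rw [← Finset.smul_sum, HS.mul_unit (fun r => -(x (!s) * br M (y r))), smul_neg]

/-- The two halves contribute `[M, ξ] η` and `ξ [M, η]`, and the derivation property combines them
into `[M, ξ η]`, with the second index exchanged by the odd operator `D`. -/
theorem innerTheta_dirac (z : (innerInput M hM).EE) : innerTheta M hM ((innerInput M hM).dirac z) =
    HS.ad M (fun p => (p.1, !p.2)) 1 (innerTheta M hM z) := by
  induction z using nctensor_induction with
  | add z w hz hw => rw [map_add, map_add, map_add, map_add, hz, hw]
  | tmul ξ η =>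
    rw [(innerInput M hM).dirac_eq (innerInput_nabla M hM _) (innerInput_nabla M hM _), map_add,
      map_neg, map_sum, map_sum]
    funext p
    rw [HS.add_apply, HS.neg_apply, HS.sum_apply, HS.sum_apply, HS.ad_apply, innerTheta_nctmul]
    have a₁ : ∀ r, innerTheta M hM (nctmul (innerInput M hM).right (innerInput M hM).left
        ((innerInput M hM).JE (innerUnit M hM r)) ((innerInput M hM).omegaAct
          ((innerInput M hM).omegaStar ((innerHermitian M hM).dOmega
            (((innerInput M hM).JEsymm ξ : HS ι Bool) r))) η)) p =
        HS.conj (HS.unit r : HS ι Bool) p.1 *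
          (br M (-(HS.conj.symm (ξ : HS ι Bool) r)ᴴ) * (η : HS ι Bool) (!p.2)) := fun r =>
      congrArg (HS.conj (HS.unit r : HS ι Bool) p.1 * ·)
        (omegaAct_omegaStar_dOmega M hM (HS.conj.symm (ξ : HS ι Bool) r) η p.2)
    have a₂ : ∀ r, innerTheta M hM (nctmul (innerInput M hM).right (innerInput M hM).left ξ
        ((innerInput M hM).omegaAct ((innerHermitian M hM).dOmega ((η : HS ι Bool) r))
          (innerUnit M hM r))) p =
        (ξ : HS ι Bool) p.1 * (br M ((η : HS ι Bool) r) * (HS.unit r : HS ι Bool) (!p.2)) :=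
      fun r => congrArg ((ξ : HS ι Bool) p.1 * ·)
        (omegaAct_dOmega M hM ((η : HS ι Bool) r) (innerUnit M hM r) p.2)
    rw [Finset.sum_congr rfl fun r _ => a₁ r, Finset.sum_congr rfl fun r _ => a₂ r,
      sum_conj_unit_mul_br, sum_mul_br_mul_unit]
    rw [neg_neg, Pi.one_apply, one_smul]
    exact (br_mul M _ _).symm

/-- As for `𝔇`, but one-forms act on the first leg and hence exchange the first index; the grading
on the second leg contributes the sign of the second index. -/
theorem innerTheta_diracBar (z : (innerInput M hM).EE) :
    innerTheta M hM ((innerInput M hM).diracBar z) =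
      HS.ad M (fun p => (!p.1, p.2)) (fun p => -sgn p.2) (innerTheta M hM z) := by
  induction z using nctensor_induction with
  | add z w hz hw => rw [map_add, map_add, map_add, map_add, hz, hw]
  | tmul ξ η =>
    rw [(innerInput M hM).diracBar_eq (innerInput_nabla M hM _) (innerInput_nabla M hM _), map_add,
      map_neg, map_sum, map_sum]
    funext p
    rw [HS.add_apply, HS.neg_apply, HS.sum_apply, HS.sum_apply, HS.ad_apply, innerTheta_nctmul]
    have a₁ : ∀ r, innerTheta M hM (nctmul (innerInput M hM).right (innerInput M hM).left
        ((innerInput M hM).JE ((innerInput M hM).omegaAct ((innerHermitian M hM).dOmega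
            (((innerInput M hM).JEsymm ξ : HS ι Bool) r)) (innerUnit M hM r)))
          ((innerInput M hM).γE η)) p =
        sgn p.1 • (br M (HS.conj.symm (ξ : HS ι Bool) r) * (HS.unit r : HS ι Bool) (!p.1))ᴴ *
          (sgn p.2 • (1 * (η : HS ι Bool) p.2)) := fun r =>
      congrArg (fun a : Matrix ι ι ℂ => sgn p.1 • aᴴ * (sgn p.2 • (1 * (η : HS ι Bool) p.2)))
        (omegaAct_dOmega M hM (HS.conj.symm (ξ : HS ι Bool) r) (innerUnit M hM r) p.1)
    have a₂ : ∀ r, innerTheta M hM (nctmul (innerInput M hM).right (innerInput M hM).left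
        ((innerInput M hM).JE ((innerInput M hM).omegaAct ((innerInput M hM).omegaStar
          ((innerHermitian M hM).dOmega ((η : HS ι Bool) r))) ((innerInput M hM).JEsymm ξ)))
          ((innerInput M hM).γE (innerUnit M hM r))) p =
        sgn p.1 • (br M (-((η : HS ι Bool) r)ᴴ) * HS.conj.symm (ξ : HS ι Bool) (!p.1))ᴴ *
          (sgn p.2 • (1 * (HS.unit r : HS ι Bool) p.2)) := fun r =>
      congrArg (fun a : Matrix ι ι ℂ => sgn p.1 • aᴴ * (sgn p.2 • (1 * (HS.unit r : HS ι Bool) p.2)))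
        (omegaAct_omegaStar_dOmega M hM ((η : HS ι Bool) r) ((innerInput M hM).JEsymm ξ) p.1)
    rw [Finset.sum_congr rfl fun r _ => a₁ r, Finset.sum_congr rfl fun r _ => a₂ r,
      sum_conj_br_mul_unit M hM, sum_conj_br_mul_conj M hM]
    rw [← neg_add, ← smul_add, neg_smul]
    exact congrArg (fun a => -(sgn p.2 • a)) (br_mul M _ _).symm

/-- The sextuple of an inner derivation. -/
def innerSextuple : Sextuple (Matrix ι ι ℂ) (HS ι (Bool × Bool)) where
  rep := (HS.rep ι (Bool × Bool)).toAlgHom.toLinearMap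
  D := (HS.ad M (fun p => (p.1, !p.2)) 1).toPMap ⊤
  Dbar := (HS.ad M (fun p => (!p.1, p.2)) fun p => -sgn p.2).toPMap ⊤
  γ := HS.L 1 id fun p => sgn p.1 * sgn p.2
  hodge := HS.L 1 id fun p => sgn p.2

include hM in
theorem innerSextuple_isN11 : (innerSextuple M).IsN11 where
  separable := by
    have : ProperSpace (HS ι (Bool × Bool)) := FiniteDimensional.proper ℂ _
    infer_instance
  representation := ⟨HS.rep ι (Bool × Bool), fun _ => rfl, HS.rep_injective⟩
  selfAdjoint := isSelfAdjoint_toPMap_top (HS.isSymmetric_ad hM (by simp) (by simp))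
  selfAdjoint_bar := isSelfAdjoint_toPMap_top (HS.isSymmetric_ad hM (by simp) (by simp))
  sq_eq x z := by
    refine compGraph_toPMap_top.trans (Iff.trans (Eq.congr_left ?_) compGraph_toPMap_top.symm)
    funext p
    simp only [HS.ad_apply, Bool.not_not, Pi.one_apply, one_smul, mul_smul_comm, smul_mul_assoc,
      ← smul_sub, smul_smul, neg_mul_neg, sgn_mul_self]
  anticomm x z := by
    refine compGraph_toPMap_top.trans (Iff.trans ?_ compGraph_toPMap_top.symm)
    rw [eq_comm, ← neg_inj, eq_comm (a := -z)]
    refine Eq.congr_left ?_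
    funext p
    simp only [HS.neg_apply, HS.ad_apply, Pi.one_apply, one_smul, mul_smul_comm, smul_mul_assoc,
      ← smul_sub, sgn_not, neg_neg, neg_smul]
  bounded_commutator a := ⟨_, HS.isCommutator_ad M a _ _⟩
  bounded_commutator_bar a := ⟨_, HS.isCommutator_ad M a _ _⟩
  trace_class := heatTraceClass_toPMap_top (HS.isSymmetric_ad hM (by simp) (by simp))
  grading := HS.isGrading_L fun p => by
    rw [mul_mul_mul_comm, sgn_mul_self, sgn_mul_self, one_mul]
  γ_rep := HS.L_comm _
  γ_D := HS.antiCommutes_L fun p => by rw [sgn_not, mul_neg]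
  γ_Dbar := HS.antiCommutes_L fun p => by rw [sgn_not, neg_mul]
  hodge_grading := HS.isGrading_L fun p => sgn_mul_self p.2
  hodge_γ := by
    ext x
    funext p
    change sgn p.2 • (1 * ((sgn p.1 * sgn p.2) • (1 * x p))) =
      (sgn p.1 * sgn p.2) • (1 * (sgn p.2 • (1 * x p)))
    rw [one_mul, one_mul, one_mul, smul_comm]
  hodge_rep := HS.L_comm _
  hodge_D := HS.antiCommutes_L fun p => sgn_not p.2
  hodge_Dbar := HS.commutes_L fun _ => rfl

theorem graph_toPMap_top_of_surjective {E K : Type*} [AddCommGroup E] [Module ℂ E]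
    [NormedAddCommGroup K] [InnerProductSpace ℂ K] [FiniteDimensional ℂ K] {Θ : E →ₗ[ℂ] K}
    (hΘ : Function.Surjective Θ) {T : K →ₗ[ℂ] K} {S : E →ₗ[ℂ] E} (h : ∀ z, Θ (S z) = T (Θ z)) :
    (T.toPMap ⊤).graph = (LinearMap.range (Θ.prod (Θ ∘ₗ S))).topologicalClosure := by
  rw [(Submodule.closed_of_finiteDimensional _).submodule_topologicalClosure_eq]
  ext ⟨x, y⟩
  rw [mem_graph_toPMap_top, LinearMap.mem_range]
  constructor
  · rintro rfl
    obtain ⟨z, rfl⟩ := hΘ x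
    exact ⟨z, Prod.ext rfl (h z)⟩
  · rintro ⟨z, hz⟩
    cases hz
    exact (h z).symm

/-- The extension of an inner derivation. -/
theorem exists_transports_innerSextuple :
    ∃ U, Sextuple.Transports U (Phi (innerInput M hM)) (innerSextuple M) := by
  obtain ⟨U, hU⟩ := exists_unitary (innerInput M hM).toHermitianData (innerTheta M hM)
    (inner_innerTheta M hM) (innerTheta_surjective M hM).denseRange
  refine ⟨U, transports_of_isometry _ hU (fun a z => ?_)
    (graph_toPMap_top_of_surjective (innerTheta_surjective M hM) (innerTheta_dirac M hM))
    (graph_toPMap_top_of_surjective (innerTheta_surjective M hM) (innerTheta_diracBar M hM))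
    (fun z => ?_) fun z => ?_⟩
  · induction z using nctensor_induction with
    | add z w hz hw => rw [map_add, map_add, map_add, map_add, hz, hw]
    | tmul ξ η =>
      funext p
      refine (HS.rep_apply_apply a _ p).trans ?_
      refine Eq.trans ?_ (congrArg (· * (η : HS ι Bool) p.2) (innerInput_left M hM a ξ p.1)).symm
      exact (mul_assoc _ _ _).symm
  · induction z using nctensor_induction with
    | add z w hz hw => rw [map_add, map_add, map_add, map_add, hz, hw]
    | tmul ξ η =>
      funext p
      change (sgn p.1 * sgn p.2) • (1 * ((ξ : HS ι Bool) p.1 * (η : HS ι Bool) p.2)) =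
        (sgn p.1 • (1 * (ξ : HS ι Bool) p.1)) * (sgn p.2 • (1 * (η : HS ι Bool) p.2))
      rw [one_mul, one_mul, one_mul, smul_mul_smul_comm]
  · induction z using nctensor_induction with
    | add z w hz hw => rw [map_add, map_add, map_add, map_add, hz, hw]
    | tmul ξ η =>
      funext p
      change sgn p.2 • (1 * ((ξ : HS ι Bool) p.1 * (η : HS ι Bool) p.2)) =
        (ξ : HS ι Bool) p.1 * (sgn p.2 • (1 * (η : HS ι Bool) p.2))
      rw [one_mul, one_mul, mul_smul_comm]

theorem innerInput_isN11 : (Phi (innerInput M hM)).IsN11 := by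
  obtain ⟨U, hU⟩ := exists_transports_innerSextuple M hM
  exact hU.isN11 (innerSextuple_isN11 M hM)

theorem innerInput_D_ne_zero {a : Matrix ι ι ℂ} (ha : M * a ≠ a * M) :
    ∃ x y, (x, y) ∈ (Phi (innerInput M hM)).D.graph ∧ y ≠ 0 := by
  obtain ⟨U, hU⟩ := exists_transports_innerSextuple M hM
  -- On a constant family `𝔇` is entrywise the commutator with `M`.
  let x : HS ι (Bool × Bool) := fun _ => a
  refine ⟨U.symm x, U.symm (HS.ad M (fun p => (p.1, !p.2)) 1 x), ?_, fun h => ?_⟩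
  · rw [hU.D, U.apply_symm_apply, U.apply_symm_apply]
    exact mem_graph_toPMap_top.mpr rfl
  · have h1 := congrFun (U.symm.map_eq_zero_iff.mp h) (true, true)
    refine ha (sub_eq_zero.mp (Eq.trans ?_ h1))
    exact (one_smul ℤ _).symm

end InnerExtension

/-- There are nontrivial inputs whose extension is a set of `N = (1,1)` spectral data. -/
theorem exists_isN11_ne_zero : ∃ (A H : Type u) (_ : Ring A) (_ : StarRing A) (_ : Algebra ℂ A)
    (_ : StarModule ℂ A) (_ : NormedAddCommGroup H) (_ : InnerProductSpace ℂ H)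
    (_ : CompleteSpace H) (X : ExtInput A H), (Phi X).IsN11 ∧
      ∃ x y, (x, y) ∈ (Phi X).D.graph ∧ y ≠ 0 := by
  -- The projection `diag(1, 0)` does not commute with the all-ones matrix: the off-diagonal entries
  -- of the two products are `1` and `0`. The lift places the example in the required universe.
  let M : Matrix (ULift.{u} Bool) (ULift.{u} Bool) ℂ :=
    Matrix.diagonal fun i => if i.down then 1 else 0
  have hM : M.conjTranspose = M := by
    rw [Matrix.diagonal_conjTranspose]
    congr 1
    funext i
    simp only [Pi.star_apply]
    split_ifs <;> simp
  let a : Matrix (ULift.{u} Bool) (ULift.{u} Bool) ℂ := fun _ _ => 1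
  refine ⟨_, _, inferInstance, inferInstance, inferInstance, inferInstance, inferInstance,
    inferInstance, inferInstance, innerInput M hM, innerInput_isN11 M hM,
    innerInput_D_ne_zero M hM (a := a) fun h => ?_⟩
  have h1 := congrFun (congrFun h ⟨true⟩) ⟨false⟩
  rw [Matrix.diagonal_mul, Matrix.mul_diagonal] at h1
  simp [a] at h1

end SpectralData

end

/-! ### The main theorem -/

theorem mainTheorem1 :
    (∀ (A₁ H₁ A₂ H₂ : Type u)
      [Ring A₁] [StarRing A₁] [Algebra ℂ A₁] [StarModule ℂ A₁]
      [NormedAddCommGroup H₁] [InnerProductSpace ℂ H₁] [CompleteSpace H₁]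
      [Ring A₂] [StarRing A₂] [Algebra ℂ A₂] [StarModule ℂ A₂]
      [NormedAddCommGroup H₂] [InnerProductSpace ℂ H₂] [CompleteSpace H₂]
      (X₁ : SpectralData.ExtInput A₁ H₁) (X₂ : SpectralData.ExtInput A₂ H₂),
      (SpectralData.Phi X₁).IsN11 → (SpectralData.Phi X₂).IsN11 →
      (∃ X : SpectralData.ExtInput (A₁ ⊗[ℂ] A₂) (SpectralData.HTensor H₁ H₂),
        SpectralData.IsProduct X₁ X₂ X) ∧
      ∀ X : SpectralData.ExtInput (A₁ ⊗[ℂ] A₂) (SpectralData.HTensor H₁ H₂),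
        SpectralData.IsProduct X₁ X₂ X →
        (SpectralData.Phi X).IsN11 ∧
        SpectralData.PhiEqProd .standard X₁ X₂ X ∧
        ((∃ x y, (x, y) ∈ (SpectralData.Phi X₁).D.graph ∧ y ≠ 0) →
          (∃ x y, (x, y) ∈ (SpectralData.Phi X₂).D.graph ∧ y ≠ 0) →
          ∀ k : SpectralData.ProductRule, k ≠ .standard →
            ¬ SpectralData.PhiEqProd k X₁ X₂ X)) ∧
    (∃! k : SpectralData.ProductRule, SpectralData.Multiplicative.{u} k) := by
  refine ⟨?_, .standard, ?_, fun k hk => ?_⟩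
  · intro A₁ H₁ A₂ H₂ _ _ _ _ _ _ _ _ _ _ _ _ _ _ X₁ X₂ h₁ h₂
    refine ⟨SpectralData.exists_isProduct X₁ X₂, fun X hX => ?_⟩
    have h := hX.phiEqProd_standard h₁ h₂
    exact ⟨h.isN11 h₁ h₂, h, fun n₁ n₂ k hk hk' => hk (hX.rule_eq_standard h₁ h₂ n₁ n₂ hk')⟩
  · intro A₁ H₁ A₂ H₂ _ _ _ _ _ _ _ _ _ _ _ _ _ _ X₁ X₂ h₁ h₂ X hX
    exact hX.phiEqProd_standard h₁ h₂
  · obtain ⟨A, H, _, _, _, _, _, _, _, X, hX, hD⟩ := SpectralData.exists_isN11_ne_zero.{u}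
    -- A multiplicative rule holds in particular for the product of the nontrivial example with
    -- itself, where only the standard rule is possible.
    obtain ⟨Y, hY⟩ := SpectralData.exists_isProduct X X
    exact hY.rule_eq_standard hX hX hD hD (hk A H A H X X hX hX Y hY)
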